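/- **Setting.** Fix $\kappa>0$, $g\ge 0$, $h\in(0,+\infty]$ and put $\Omega(\xi)=(\kappa|\xi|^3+g|\xi|)^{1/2}\tanh(h|\xi|)^{1/2}$ (with $\tanh(\infty)=1$), $E=\mathrm{diag}(1,-1)$, $D=-\mathrm i\partial_x$. Functions on $\mathbb T=\mathbb R/2\pi\mathbb Z$ have zero average, $u(x)=\sum_{n\ne0}u_n e^{\mathrm inx}/\sqrt{2\pi}$, $\|u\|_{\dot H^s}^2=\sum|n|^{2s}|u_n|^2$; $\Pi_n$ is the projector on the frequencies $\pm n$; $u^+=u$, $u^-=\bar u$, $u_n^+=u_n$, $u_n^-=\overline{u_n}$. Let $I\subset\mathbb R$ be an interval of positive length, symmetric about $0$. $C^K_*(I,\dot H^s)=\bigcap_{k\le K}C^k(I;\dot H^{s-\frac32k})$, $\|U(t)\|_{K,s}=\sum_{k\le K}\|\partial_t^kU(t)\|_{\dot H^{s-\frac32k}}$, and $B^K_s(I;r)$ is the set of $U\in C^K_*(I,\dot H^s(\mathbb T;\mathbb C^2))$ with $\sup_{t\in I}\|U(t)\|_{K,s}<r$. A matrix of operators is *real-to-real* if, for $U=(u,\bar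 u)$, its entries satisfy $M_\sigma^{\sigma'}(U)[v]=\overline{M_{-\sigma}^{-\sigma'}(U)[\bar v]}$. *Classes.* All homogeneous classes consist of translation invariant objects that are linear in $U=(U^+,U^-)$. - $\widetilde{\mathcal R}_1^{-\rho}$: bilinear operators $R(U)v$ with $\|\Pi_{n_0}R(\Pi_{n_1}U)\Pi_{n_2}v\|_{L^2}\le C\,\frac{\min(n_1,n_2)^{\rho+\mu}}{\max(n_1,n_2)^{\rho}}\|\Pi_{n_1}U\|_{L^2}\|\Pi_{n_2}v\|_{L^2}$ for some $\mu\ge0$, $C>0$. $\widetilde{\mathcal M}^m_1$: the same with the factor $C(n_0+n_1+n_2)^m$. - $\mathcal R^{-\rho}_{K,K',2}[r]$: maps $(V,t,u)\mapsto R(V;t)u$, linear in $u$, defined for $V\in B^K_{s_0}(I;r)$, $u\in \dot H^{s_0}$, such that for each $s\ge s_0$ there are $C>0$ and $0<r(s)<r$ with, for $V\in B^K_{s_0}(I;r(s))\cap C^K_*(I,\dot H^s)$, $u\in C^K_*(I,\dot H^s)$: $R(V)u\in C^{K-K'}_*(I,\dot H^{s+\rho})$ and, for $0\le k\le K-K'$,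 $t\in I$, $$\|\partial_t^k(R(V)u)\|_{\dot H^{s-\frac32k+\rho}}\le C\sum_{k'+k''=k}\big(\|u\|_{k'',s}\|V\|^2_{k'+K',s_0}+\|u\|_{k'',s_0}\|V\|_{k'+K',s_0}\|V\|_{k'+K',s}\big).$$ $\mathcal M^m_{K,K',2}[r]$: the same with $\rho$ replaced by $-m$. - $\Gamma^m_{K,K',2}[r]$: symbols $a(U;t,x,\xi)$, $2\pi$-periodic in $x$, such that for each $0\le k\le K-K'$ and $\sigma\ge s_0$ there is $0<r(\sigma)<r$ such that for $U\in B^K_{s_0}(I;r(\sigma))\cap C^{k+K'}_*(I,\dot H^\sigma)$ the derivatives of $a$ of order $\le k$ in $t$, $\le\sigma-s_0$ in $x$ and any order in $\xi$ exist, are continuous, and $|\partial_t^k\partial_x^\alpha\partial_\xi^\beta a|\le C_{k,\sigma,\alpha,\beta}\langle\xi\rangle^{m-\beta}\|U\|_{k+K',s_0}\|U\|_{k+K',\sigma}$. - $\widetilde\Gamma^m_1$: symbols $a_1(U;x,\xi)$, linear in $U$ and smooth in $\xi$, with, for some $\mu>0$, $|\partial_x^\alpha\partial_\xi^\beta a_1(\Pi_nU;x,\xi)|\le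 C_{\alpha,\beta}\,n^{\mu+\alpha}\langle\xi\rangle^{m-\beta}\|\Pi_nU\|_{L^2}$. - $\Sigma\Gamma^m_{K,K',1}[r,2]=\widetilde\Gamma^m_1+\Gamma^m_{K,K',2}[r]$, and similarly for $\Sigma\mathcal R^{-\rho}$, $\Sigma\mathcal M^m$; $\otimes\mathcal M_2(\mathbb C)$ denotes $2\times2$ matrices with entries in the class. - $Op^{\mathrm{BW}}(a)u=\frac1{\sqrt{2\pi}}\sum_{k\neq 0}\big(\sum_j(\chi\hat a)(k-j,\tfrac{k+j}2)u_j\big)\frac{e^{\mathrm ikx}}{\sqrt{2\pi}}$ is the Bony–Weyl quantization, with smooth cut-offs $\chi(\xi',\xi)$ (one for homogeneous, one for non-homogeneous symbols), even in each variable, supported in $|\xi'|\le\delta\langle\xi\rangle$ and equal to $1$ for $|\xi'|\le\delta\langle\xi\rangle/2$, $0<\delta<1$, with $|\partial_\xi^\alpha\partial_{\xi'}^\beta\chi|\lesssim_{\alpha,\beta}\langle\xi\rangle^{-\alpha-\beta}$. *Systems.* Let $m\ge0$, $1\le K'\le K$, $s_1\in\mathbb R$, $r_1>0$; below, the non-homogeneous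 classes are taken with radius $r_1$ and $s_0=s_1$, and real-to-real refers to $U\in B^K_{s_1}(I;r_1)$. Consider 1. a system $$\partial_tU=\mathrm i\big(\Omega(D)E+Op^{\mathrm{BW}}(A(U;t,x,\xi))+R(U;t)\big)U,\tag{1}$$ with $A\in\Sigma\Gamma^{3/2}_{K,1,1}[r_1,2]\otimes\mathcal M_2(\mathbb C)$, $R\in\Sigma\mathcal R^{-\rho}_{K,1,1}[r_1,2]\otimes\mathcal M_2(\mathbb C)$, and $\mathrm iOp^{\mathrm{BW}}(A)$, $\mathrm iR$ real-to-real (the gravity–capillary water waves system in complex good-unknown coordinates has this form); 2. a change of variable $$Z=U+F(U;t)[U],\qquad F\in\Sigma\mathcal M^m_{K,K',1}[r_1,2]\otimes\mathcal M_2(\mathbb C)\ \text{real-to-real};\tag{2}$$ 3. a reduced system $$\partial_tZ=\mathrm i\Omega(D)EZ+\mathtt R_1(U)[Z]+\mathrm iOp^{\mathrm{BW}}(\mathcal H_{\ge2}(U;\xi))Z+\mathtt R_{\ge2}(U)[Z],\tag{3}$$ where $\mathtt R_1\in\widetilde{\mathcal R}^{-\rho}_1\otimes\mathcal M_2(\mathbb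 C)$, $\mathtt R_{\ge2}\in\mathcal R^{-\rho}_{K,K',2}[r_1]\otimes\mathcal M_2(\mathbb C)$, $\mathcal H_{\ge2}\in\Gamma^{3/2}_{K,K',2}[r_1]\otimes\mathcal M_2(\mathbb C)$ is diagonal, independent of $x$, with $\mathrm{Im}\,\mathcal H_{\ge2}\in\Gamma^0_{K,K',2}[r_1]\otimes\mathcal M_2(\mathbb C)$ (on $U=(u,\bar u)$), and $\mathtt R_1$, $\mathrm iOp^{\mathrm{BW}}(\mathcal H_{\ge2})$, $\mathtt R_{\ge2}$ are real-to-real. *Resonant part.* Write, for $\sigma,\sigma'=\pm$, $(\mathtt R_1(U))_\sigma^{\sigma'}z^{\sigma'}=\frac1{2\pi}\sum_{\epsilon=\pm}\sum_{j,n,k\ne0,\ \epsilon n+\sigma'k=\sigma j}(\mathtt r_{1,\epsilon})^{\sigma,\sigma'}_{n,k}u_n^\epsilon z_k^{\sigma'}e^{\mathrm i\sigma jx}$. Then $\mathtt R_1^{res}$ is the operator with the same coefficients where $\sigma\Omega(j)-\sigma'\Omega(k)-\epsilon\Omega(n)=0$, and with coefficients $0$ otherwise. **Proposition (Quadratic Poincaré–Birkhoff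 normal form).** For every $m\ge0$ there is $\rho_0>0$ such that for all $\rho\ge\rho_0$, all $1\le K'\le K$ and all data as in 1–3 there is $s_0>0$ such that for every $s\ge s_0$ there is $r_0(s)>0$ such that for all $0<r\le r_0(s)$ the following holds. There are a family of linear operators $\mathfrak C^\theta(U)$, $\theta\in[0,1]$, real-to-real together with their inverses for $U\in B^K_s(I;r)$, an operator $\mathfrak R_{\ge2}\in\mathcal R^{-(\rho-\rho_0)}_{K,K',2}[r]\otimes\mathcal M_2(\mathbb C)$, real-to-real on $B^K_{s_0}(I;r)$, and a constant $C=C_{s,r,K}>0$, which may also depend on the fixed data but not on $U$ or $\theta$, such that, for any solution $U=(u,\bar u)\in B^K_s(I;r)$ of (1): - **(conjugation)** if $Z=(z,\bar z)\in C^{K-K'}_*(I,\dot H^s)$ is given by (2) and solves (3), then $Y:=\mathfrak C^1(U)[Z]$ has the form $(y,\bar y)$ and solves $$\partial_tY=\mathrm i\Omega(D)EY+\mathtt R_1^{res}(Y)[Y]+\mathcal X_{\ge3}(U,Y),\qquad \mathcal X_{\ge3}(U,Y)=\mathrm iOp^{\mathrm{BW}}(\mathcal H_{\ge2}(U;\xi))[Y]+\mathfrak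 R_{\ge2}(U)[Y],$$ where $\mathcal X_{\ge 3}(U,Y)=(\mathcal X^+_{\ge3},\overline{\mathcal X^+_{\ge3}})$, $\mathtt R_1^{res}\in\widetilde{\mathcal R}_1^{-(\rho-\rho_0)}\otimes\mathcal M_2(\mathbb C)$ is real-to-real, and $\mathcal H_{\ge2}$ is the same $x$-independent diagonal symbol as in (3), in $\Gamma^{3/2}_{K,K',2}[r]\otimes\mathcal M_2(\mathbb C)$ with $\mathrm{Im}\,\mathcal H_{\ge2}\in\Gamma^0_{K,K',2}[r]\otimes\mathcal M_2(\mathbb C)$ (on $U=(u,\bar u)$); - **(bounds)** for $\theta\in[0,1]$, $t\in I$, $\mathfrak C^\theta(U)$ is a bounded invertible linear map of $\dot H^s(\mathbb T;\mathbb C^2)$, and for $0\le k\le K-K'$ and $V\in C^{K-K'}_*(I;\dot H^s(\mathbb T;\mathbb C^2))$ each of $\|\partial_t^k\mathfrak C^\theta(U)[V]\|_{\dot H^{s-\frac32k}}$ and $\|\partial_t^k(\mathfrak C^\theta(U))^{-1}[V]\|_{\dot H^{s-\frac32k}}$ is at most $$\|V\|_{k,s}\big(1+C\|U\|_{K,s_0}\big)+C\|V\|_{k,s_0}\|U\|_{K,s},$$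 uniformly in $\theta\in[0,1]$, and both $\mathfrak C^\theta(U)[V]$ and $(\mathfrak C^\theta(U))^{-1}[V]$ belong to $C^{K-K'}_*(I;\dot H^s)$; - **(expansion)** $\mathfrak C^\theta(U)[V]=V+\theta M_1(U)[V]+M_{\ge2}(\theta;U)[V]$ for $V\in\dot H^s(\mathbb T;\mathbb C^2)$, where, for some $m'\ge 0$, $M_1\in\widetilde{\mathcal M}^{m'}_1\otimes\mathcal M_2(\mathbb C)$ and $M_{\ge2}(\theta;\cdot)\in\mathcal M^{m'}_{K,K',2}[r]\otimes\mathcal M_2(\mathbb C)$ with estimates uniform in $\theta\in[0,1]$, and $M_1,M_{\ge2}$ do not depend on the solution; - **(flow)** $\mathfrak C^\theta(U)$ is the flow $\partial_\theta\mathfrak C^\theta(U)=\mathtt G_1(U)\mathfrak C^\theta(U)$, $\mathfrak C^0(U)=\mathrm{Id}$, of a real-to-real operator $\mathtt G_1\in\widetilde{\mathcal R}_1^{-\rho}\otimes\mathcal M_2(\mathbb C)$ that solves $\mathtt G_1(\mathrm i\Omega(D)EU)+[\mathtt G_1(U),\mathrm i\Omega(D)E]+\mathtt R_1(U)=\mathtt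 R_1^{res}(U)$. -/

import Mathlib

open Filter Topology
open scoped ENNReal ContDiff

noncomputable section

namespace WaterWaves

/-! ### The dispersion relation -/

/-- `tanh (h y)` for a depth `h ∈ (0, ∞]`; it is `1` in infinite depth. -/
def tanhDepth (h : ℝ≥0∞) (y : ℝ) : ℝ :=
  if h = ⊤ then 1 else Real.tanh (h.toReal * y)

/-- `Ω(ξ) = (κ|ξ|³ + g|ξ|)^{1/2} (tanh(h|ξ|))^{1/2}`. -/
def disp (κ g : ℝ) (h : ℝ≥0∞) (ξ : ℝ) : ℝ :=
  Real.sqrt (κ * |ξ| ^ 3 + g * |ξ|) * Real.sqrt (tanhDepth h |ξ|)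

/-- The sign attached to the index of a component: `true` is `+`, `false` is `-`. -/
def sgn (σ : Bool) : ℝ := if σ then 1 else -1

/-- The Japanese bracket `⟨ξ⟩ = (1 + ξ²)^{1/2}`. -/
def jap (ξ : ℝ) : ℝ := Real.sqrt (1 + ξ ^ 2)

/-! ### Functions on the circle and Sobolev spaces

A periodic function or distribution with zero average is given by its Fourier coefficients
`u(x) = ∑_{n ≠ 0} u n e^{inx} / √(2π)`, hence `u 0 = 0`.  A pair `U = (U⁺, U⁻)` of such functions
is a `Vec`.  -/

abbrev Seq := ℤ → ℂ

abbrev Vec := Bool → Seq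

/-- `u ∈ Ḣ^s(𝕋; ℂ)`. -/
def MemH (s : ℝ) (u : Seq) : Prop :=
  u 0 = 0 ∧ Summable fun n : ℤ => |(n : ℝ)| ^ (2 * s) * ‖u n‖ ^ 2

/-- The norm of `Ḣ^s(𝕋; ℂ)`. -/
def normH (s : ℝ) (u : Seq) : ℝ :=
  Real.sqrt (∑' n : ℤ, |(n : ℝ)| ^ (2 * s) * ‖u n‖ ^ 2)

/-- `U ∈ Ḣ^s(𝕋; ℂ²)`. -/
def MemH2 (s : ℝ) (U : Vec) : Prop := ∀ σ, MemH s (U σ)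

/-- The norm of `Ḣ^s(𝕋; ℂ²)`. -/
def normH2 (s : ℝ) (U : Vec) : ℝ := Real.sqrt (∑ σ, normH s (U σ) ^ 2)

/-- Fourier coefficients of the complex conjugate function. -/
def cj (u : Seq) : Seq := fun n => starRingEnd ℂ (u (-n))

/-- `U = (u, ū)`. -/
def IsReal (U : Vec) : Prop := U false = cj (U true)

/-- The projector `Π_n` on the span of `e^{inx}`, `e^{-inx}`. -/
def proj (n : ℕ) (u : Seq) : Seq := fun j => if j.natAbs = n then u j else 0

def proj2 (n : ℕ) (U : Vec) : Vec := fun σ => proj n (U σ)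

/-! ### Curves in time -/

/-- An interval, symmetric with respect to `0`, of positive length. -/
def IsSymmInterval (I : Set ℝ) : Prop :=
  I.OrdConnected ∧ (∀ t ∈ I, -t ∈ I) ∧ ∃ t ∈ I, 0 < t

/-- `∂_t^k u (t)`, computed on each Fourier coefficient. -/
def dt (I : Set ℝ) (k : ℕ) (u : ℝ → Seq) (t : ℝ) : Seq :=
  fun n => iteratedDerivWithin k (fun τ => u τ n) I t

def dt2 (I : Set ℝ) (k : ℕ) (U : ℝ → Vec) (t : ℝ) : Vec :=
  fun σ => dt I k (fun τ => U τ σ) t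

/-- `u ∈ C^K_*(I, Ḣ^s(𝕋; ℂ)) = ⋂_{k ≤ K} C^k(I; Ḣ^{s - 3k/2})`.  By the fundamental theorem of
calculus this is the same as: the derivatives of the Fourier coefficients up to order `K` exist and
`∂_t^k u` is a continuous curve in `Ḣ^{s - 3k/2}`. -/
def CStar (I : Set ℝ) (K : ℕ) (s : ℝ) (u : ℝ → Seq) : Prop :=
  (∀ n, ContDiffOn ℝ K (fun t => u t n) I) ∧
  ∀ k ≤ K,
    (∀ t ∈ I, MemH (s - 3 / 2 * k) (dt I k u t)) ∧
    ∀ t₀ ∈ I, Tendsto (fun t => normH (s - 3 / 2 * k) (dt I k u t - dt I k u t₀))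
      (𝓝[I] t₀) (𝓝 0)

/-- `U ∈ C^K_*(I, Ḣ^s(𝕋; ℂ²))`. -/
def CStar2 (I : Set ℝ) (K : ℕ) (s : ℝ) (U : ℝ → Vec) : Prop :=
  ∀ σ, CStar I K s (fun t => U t σ)

/-- `‖u(t, ·)‖_{K,s} = ∑_{k ≤ K} ‖∂_t^k u(t, ·)‖_{Ḣ^{s - 3k/2}}`. -/
def normK (I : Set ℝ) (K : ℕ) (s : ℝ) (u : ℝ → Seq) (t : ℝ) : ℝ :=
  ∑ k ∈ Finset.range (K + 1), normH (s - 3 / 2 * k) (dt I k u t)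

def normK2 (I : Set ℝ) (K : ℕ) (s : ℝ) (U : ℝ → Vec) (t : ℝ) : ℝ :=
  ∑ k ∈ Finset.range (K + 1), normH2 (s - 3 / 2 * k) (dt2 I k U t)

/-- The ball `B^K_s(I; r)`, i.e. `U ∈ C^K_*` and `sup_{t ∈ I} ‖U(t, ·)‖_{K,s} < r`. -/
def InBall (I : Set ℝ) (K : ℕ) (s r : ℝ) (U : ℝ → Vec) : Prop :=
  CStar2 I K s U ∧ ∃ r' < r, ∀ t ∈ I, normK2 I K s U t ≤ r'

def IsRealCurve (I : Set ℝ) (U : ℝ → Vec) : Prop := ∀ t ∈ I, IsReal (U t)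

/-! ### Operators depending on `U` and matrices of operators -/

/-- Operators `(U, t, v) ↦ R(U; t) v`; here `U` is a curve and `v` a function of `x`. -/
abbrev Op := (ℝ → Vec) → ℝ → Seq → Seq

/-- `2 × 2` matrices of operators; `M σ σ'` is the entry in row `σ` and column `σ'`. -/
abbrev OpMat := Bool → Bool → Op

/-- The action `M(U; t)[V]` of a matrix of operators. -/
def act (M : OpMat) (U : ℝ → Vec) (t : ℝ) (V : Vec) : Vec :=
  fun σ => ∑ σ', M σ σ' U t (V σ')

/-- `Ω(D) E` with `E = diag(1, -1)`. -/
def dispE (κ g : ℝ) (h : ℝ≥0∞) : OpMat :=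
  fun σ σ' _ _ v n => if σ = σ' then (sgn σ * disp κ g h n : ℝ) * v n else 0

/-- `M(U)` is real-to-real for all `U = (u, ū)` in the ball `B^K_s(I; r)`, namely
`M_σ^{σ'}(U)[v]` is the conjugate of `M_{-σ}^{-σ'}(U)[v̄]`. -/
def IsRealToReal (I : Set ℝ) (K : ℕ) (s r : ℝ) (M : OpMat) : Prop :=
  ∀ U, InBall I K s r U → IsRealCurve I U → ∀ t ∈ I, ∀ v, MemH s v → ∀ σ σ',
    M σ σ' U t v = cj (M (!σ) (!σ') U t (cj v))

/-- A family `𝓕` of non-homogeneous operators which gain `γ` derivatives, vanish at degree `N` and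
are `K - K'` times differentiable in time, with estimates uniform in the family.
For `γ = -m` these are the maps `𝓜^m_{K,K',N}[r]`, for `γ = ρ ≥ 0` the smoothing operators
`𝓡^{-ρ}_{K,K',N}[r]`. -/
def IsUnifNonhomOp (I : Set ℝ) (γ : ℝ) (K K' N : ℕ) (r s₀ : ℝ) (𝓕 : Set Op) : Prop :=
  (∀ R ∈ 𝓕, ∀ V, InBall I K s₀ r V → ∀ t ∈ I, ∀ u v : Seq, MemH s₀ u → MemH s₀ v → ∀ c : ℂ,
    R V t (c • u + v) = c • R V t u + R V t v) ∧
  ∀ s ≥ s₀, ∃ C > 0, ∃ rs > 0, rs < r ∧ ∀ R ∈ 𝓕,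
    ∀ V, InBall I K s₀ rs V → CStar2 I K s V → ∀ u, CStar I K s u →
      CStar I (K - K') (s + γ) (fun t => R V t (u t)) ∧
      ∀ k ≤ K - K', ∀ t ∈ I,
        normH (s - 3 / 2 * k + γ) (dt I k (fun τ => R V τ (u τ)) t) ≤
          ∑ p ∈ Finset.HasAntidiagonal.antidiagonal k, C *
            (normK I p.2 s u t * normK2 I (p.1 + K') s₀ V t ^ N +
             normK I p.2 s₀ u t * normK2 I (p.1 + K') s₀ V t ^ (N - 1) *
              normK2 I (p.1 + K') s V t)

/-- The class `𝓜^m_{K,K',N}[r] ⊗ 𝓜₂(ℂ)` for `γ = -m`, and `𝓡^{-ρ}_{K,K',N}[r] ⊗ 𝓜₂(ℂ)` for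
`γ = ρ`. -/
def IsNonhomMat (I : Set ℝ) (γ : ℝ) (K K' N : ℕ) (r s₀ : ℝ) (M : OpMat) : Prop :=
  ∀ σ σ', IsUnifNonhomOp I γ K K' N r s₀ {M σ σ'}

/-! ### Homogeneous operators of degree one

A translation invariant bilinear operator `R(U)v` is given by coefficients `r ε a b`, where
`a` is the frequency of `U^ε` and `b` the frequency of `v`; the output has frequency `a + b`. -/

abbrev HomCoef := Bool → ℤ → ℤ → ℂ

abbrev HomMat := Bool → Bool → HomCoef

/-- `R(U)v = (2π)^{-1} ∑_{c ≠ 0} ∑_ε ∑_{a + b = c} r_{ε,a,b} U^ε_a v_b e^{icx}`. -/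
def homOp (r : HomCoef) (U : Vec) (v : Seq) : Seq := fun c =>
  if c = 0 then 0 else
    ((Real.sqrt (2 * Real.pi) : ℝ) : ℂ)⁻¹ * ∑' a : ℤ, ∑ ε, r ε a (c - a) * U ε a * v (c - a)

/-- The matrix of operators with homogeneous entries. -/
def homMat (r : HomMat) : OpMat := fun σ σ' U t v => homOp (r σ σ') (U t) v

/-- The homogeneous smoothing operators `𝓡̃_1^{-ρ}`. -/
def IsHomSmoothing (ρ : ℝ) (r : HomCoef) : Prop :=
  ∃ μ ≥ (0 : ℝ), ∃ C > 0, ∀ (U : Vec) (v : Seq) (n₀ n₁ n₂ : ℕ), 0 < n₀ → 0 < n₁ → 0 < n₂ →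
    normH 0 (proj n₀ (homOp r (proj2 n₁ U) (proj n₂ v))) ≤
      C * ((min n₁ n₂ : ℝ) ^ (ρ + μ) / (max n₁ n₂ : ℝ) ^ ρ) *
        normH2 0 (proj2 n₁ U) * normH 0 (proj n₂ v)

/-- The homogeneous maps `𝓜̃_1^m`. -/
def IsHomMap (m : ℝ) (r : HomCoef) : Prop :=
  ∃ C > 0, ∀ (U : Vec) (v : Seq) (n₀ n₁ n₂ : ℕ), 0 < n₀ → 0 < n₁ → 0 < n₂ →
    normH 0 (proj n₀ (homOp r (proj2 n₁ U) (proj n₂ v))) ≤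
      C * (n₀ + n₁ + n₂ : ℝ) ^ m * normH2 0 (proj2 n₁ U) * normH 0 (proj n₂ v)

/-- A homogeneous matrix of operators is real-to-real. -/
def IsRealHom (r : HomMat) : Prop :=
  ∀ U : Vec, (∀ s, MemH2 s U) → IsReal U → ∀ v : Seq, (∀ s, MemH s v) → ∀ σ σ',
    homOp (r σ σ') U v = cj (homOp (r (!σ) (!σ')) U (cj v))

/-- The resonant part: with `a = εn`, `b = σ'k`, `a + b = σj` only the coefficients with
`σΩ(j) - σ'Ω(k) - εΩ(n) = 0` are kept (recall that `Ω` is even). -/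
def resPart (κ g : ℝ) (h : ℝ≥0∞) (r : HomMat) : HomMat := fun σ σ' ε a b =>
  open Classical in
  if sgn σ * disp κ g h ((a + b : ℤ) : ℝ) - sgn σ' * disp κ g h b - sgn ε * disp κ g h a = 0
  then r σ σ' ε a b else 0

/-! ### Symbols and the Bony-Weyl quantization -/

/-- Non-homogeneous symbols `a(U; t, x, ξ)`. -/
abbrev ParaSymbol := (ℝ → Vec) → ℝ → ℝ → ℝ → ℂ

/-- The class `Γ^m_{K,K',p}[r]`, for symbols defined for the curves `U` with the property `P`.
The array `D j α β` is made of the derivatives `∂_t^j ∂_x^α ∂_ξ^β a(U; ·)`, which are required to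
exist and to be continuous. -/
def IsNonhomSymbolOn (P : (ℝ → Vec) → Prop) (I : Set ℝ) (m : ℝ) (K K' p : ℕ) (r s₀ : ℝ)
    (a : ParaSymbol) : Prop :=
  (∀ U, P U → InBall I K s₀ r U → ∀ t ∈ I, ∀ x ξ, a U t (x + 2 * Real.pi) ξ = a U t x ξ) ∧
  ∀ k ≤ K - K', ∀ s ≥ s₀, ∃ C : ℕ → ℕ → ℝ, ∃ rs > 0, rs < r ∧
    ∀ U, P U → InBall I K s₀ rs U → CStar2 I (k + K') s U →
      ∃ D : ℕ → ℕ → ℕ → ℝ → ℝ → ℝ → ℂ,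
        (∀ t ∈ I, ∀ x ξ, D 0 0 0 t x ξ = a U t x ξ) ∧
        (∀ j ≤ k, ∀ α : ℕ, (α : ℝ) ≤ s - s₀ → ∀ β,
          ContinuousOn (fun q : ℝ × ℝ × ℝ => D j α β q.1 q.2.1 q.2.2) (I ×ˢ Set.univ) ∧
          ∀ t ∈ I, ∀ x ξ,
            (j < k →
              HasDerivWithinAt (fun τ => D j α β τ x ξ) (D (j + 1) α β t x ξ) I t) ∧
            ((α : ℝ) + 1 ≤ s - s₀ →
              HasDerivAt (fun y => D j α β t y ξ) (D j (α + 1) β t x ξ) x) ∧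
            HasDerivAt (fun η => D j α β t x η) (D j α (β + 1) t x ξ) ξ) ∧
        ∀ α : ℕ, (α : ℝ) ≤ s - s₀ → ∀ β : ℕ, ∀ t ∈ I, ∀ x ξ,
          ‖D k α β t x ξ‖ ≤ C α β * jap ξ ^ (m - β) *
            normK2 I (k + K') s₀ U t ^ (p - 1) * normK2 I (k + K') s U t

/-- The class `Γ^m_{K,K',p}[r]`. -/
def IsNonhomSymbol (I : Set ℝ) (m : ℝ) (K K' p : ℕ) (r s₀ : ℝ) (a : ParaSymbol) : Prop :=
  IsNonhomSymbolOn (fun _ => True) I m K K' p r s₀ a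

/-- `Im a ∈ Γ^m_{K,K',p}[r]`, for `U = (u, ū)`. -/
def ImIsNonhomSymbol (I : Set ℝ) (m : ℝ) (K K' p : ℕ) (r s₀ : ℝ) (a : ParaSymbol) : Prop :=
  IsNonhomSymbolOn (IsRealCurve I) I m K K' p r s₀ (fun U t x ξ => ((a U t x ξ).im : ℂ))

/-- Homogeneous symbols of degree one that are translation invariant: they are given by coefficients
`c ε l ξ`, see `homSymbol`. -/
abbrev HomSymbolCoef := Bool → ℤ → ℝ → ℂ

/-- `a(U; x, ξ) = ∑_{l ≠ 0} ∑_ε c_{ε,l}(ξ) U^ε_l e^{ilx} / √(2π)`. -/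
def homSymbol (c : HomSymbolCoef) (U : Vec) (x ξ : ℝ) : ℂ :=
  ((Real.sqrt (2 * Real.pi) : ℝ) : ℂ)⁻¹ *
    ∑' l : ℤ, ∑ ε, c ε l ξ * U ε l * Complex.exp (Complex.I * l * x)

/-- The class `Γ̃_1^m`. -/
def IsHomSymbol (m : ℝ) (c : HomSymbolCoef) : Prop :=
  (∀ ε l, ContDiff ℝ ∞ (c ε l)) ∧
  ∃ μ > (0 : ℝ), ∀ α β : ℕ, ∃ C > 0, ∀ (U : Vec) (n : ℕ), 0 < n → ∀ x ξ : ℝ,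
    ‖iteratedDeriv α (fun y => iteratedDeriv β (fun η => homSymbol c (proj2 n U) y η) ξ) x‖ ≤
      C * (n : ℝ) ^ (μ + α) * jap ξ ^ (m - β) * normH2 0 (proj2 n U)

/-- The cut-off functions of the Bony-Weyl quantization. -/
structure IsCutoff (δ : ℝ) (χ : ℝ → ℝ → ℝ) : Prop where
  pos : 0 < δ
  small : δ < 1
  smooth : ContDiff ℝ ∞ (fun q : ℝ × ℝ => χ q.1 q.2)
  even_fst : ∀ ξ' ξ, χ (-ξ') ξ = χ ξ' ξ
  even_snd : ∀ ξ' ξ, χ ξ' (-ξ) = χ ξ' ξ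
  supp : ∀ ξ' ξ, δ * jap ξ < |ξ'| → χ ξ' ξ = 0
  eq_one : ∀ ξ' ξ, |ξ'| ≤ δ * jap ξ / 2 → χ ξ' ξ = 1
  bound : ∀ α β : ℕ, ∃ C, ∀ ξ' ξ,
    |iteratedDeriv α (fun η => iteratedDeriv β (fun y => χ y η) ξ') ξ| ≤
      C * jap ξ ^ (-(α : ℝ) - β)

/-- The Weyl quantization of the symbol whose Fourier coefficients in `x` are
`χ(l, ξ) â(l, ξ)`. -/
def opBW (χ : ℝ → ℝ → ℝ) (ahat : ℤ → ℝ → ℂ) (u : Seq) : Seq := fun k =>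
  if k = 0 then 0 else
    ((Real.sqrt (2 * Real.pi) : ℝ) : ℂ)⁻¹ *
      ∑' j : ℤ, (χ ((k - j : ℤ) : ℝ) (((k + j : ℤ) : ℝ) / 2) : ℂ) *
        ahat (k - j) (((k + j : ℤ) : ℝ) / 2) * u j

/-- The Fourier coefficient `â(l, ξ) = (2π)^{-1/2} ∫ a(x, ξ) e^{-ilx} dx`. -/
def fourierCoef (a : ℝ → ℝ → ℂ) (l : ℤ) (ξ : ℝ) : ℂ :=
  ((Real.sqrt (2 * Real.pi) : ℝ) : ℂ)⁻¹ *
    ∫ x in (0 : ℝ)..(2 * Real.pi), a x ξ * Complex.exp (-(Complex.I * l * x))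

/-- `Op^{BW}(a(U; t, ·))` for matrices of non-homogeneous symbols. -/
def paraMat (χ : ℝ → ℝ → ℝ) (a : Bool → Bool → ParaSymbol) : OpMat :=
  fun σ σ' U t v => opBW χ (fourierCoef (a σ σ' U t)) v

/-- `Op^{BW}(a(U; ·))` for matrices of homogeneous symbols of degree one.  Since `Π_n U` only
contributes to the frequencies `l = ± n` of `a(U; ·, ξ)`, the symbol
`∑_n χ₁(n, ξ) a(Π_n U; x, ξ)` has Fourier coefficients `χ₁(l, ξ) ∑_ε c_{ε,l}(ξ) U^ε_l`. -/
def paraHomMat (χ₁ : ℝ → ℝ → ℝ) (c : Bool → Bool → HomSymbolCoef) : OpMat :=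
  fun σ σ' U t v => opBW χ₁ (fun l ξ => ∑ ε, c σ σ' ε l ξ * U t ε l) v

/-- The diagonal matrix of symbols with entries `a⁺, a⁻`. -/
def diagSymbol (a : Bool → ParaSymbol) : Bool → Bool → ParaSymbol :=
  fun σ σ' => if σ = σ' then a σ else fun _ _ _ _ => 0

/-! ### The systems -/

/-- `V` solves `∂_t V = X(t)` on `I`. -/
def SolvesOn (I : Set ℝ) (V X : ℝ → Vec) : Prop :=
  ∀ t ∈ I, ∀ σ n, HasDerivWithinAt (fun τ => V τ σ n) (X t σ n) I t

/-- The coefficients of a system `D_t U = Ω(D)E U + Op^{BW}(A(U))U + B(U)U`, with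
`A = A₁ + A₂ ∈ ΣΓ^{3/2}_{K,1,1}[r,2] ⊗ 𝓜₂(ℂ)`, `B = B₁ + B₂ ∈ Σ𝓡^{-ρ}_{K,1,1}[r,2] ⊗ 𝓜₂(ℂ)`,
such that `i Op^{BW}(A)` and `i B` are real-to-real. -/
structure IsParaSystem (I : Set ℝ) (χ₁ χ : ℝ → ℝ → ℝ) (ρ : ℝ) (K : ℕ) (r s₀ : ℝ)
    (A₁ : Bool → Bool → HomSymbolCoef) (A₂ : Bool → Bool → ParaSymbol)
    (B₁ : HomMat) (B₂ : OpMat) : Prop where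
  symb_hom : ∀ σ σ', IsHomSymbol (3 / 2) (A₁ σ σ')
  symb_nonhom : ∀ σ σ', IsNonhomSymbol I (3 / 2) K 1 2 r s₀ (A₂ σ σ')
  smooth_hom : ∀ σ σ', IsHomSmoothing ρ (B₁ σ σ')
  smooth_nonhom : IsNonhomMat I ρ K 1 2 r s₀ B₂
  real_symb : IsRealToReal I K s₀ r (Complex.I • (paraHomMat χ₁ A₁ + paraMat χ A₂))
  real_smooth : IsRealToReal I K s₀ r (Complex.I • (homMat B₁ + B₂))

/-- The real-to-real maps `M₁ + M₂ ∈ Σ𝓜^m_{K,K',1}[r,2] ⊗ 𝓜₂(ℂ)`. -/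
structure IsSigmaMap (I : Set ℝ) (m : ℝ) (K K' : ℕ) (r s₀ : ℝ)
    (M₁ : HomMat) (M₂ : OpMat) : Prop where
  hom : ∀ σ σ', IsHomMap m (M₁ σ σ')
  nonhom : IsNonhomMat I (-m) K K' 2 r s₀ M₂
  real : IsRealToReal I K s₀ r (homMat M₁ + M₂)

/-- The coefficients of the reduced system
`∂_t Z = iΩ(D)E Z + R₁(U)Z + i Op^{BW}(𝓗(U; ξ))Z + R₂(U)Z`:
`R₁ ∈ 𝓡̃_1^{-ρ} ⊗ 𝓜₂(ℂ)`, `𝓗 ∈ Γ^{3/2}_{K,K',2}[r] ⊗ 𝓜₂(ℂ)` is diagonal, independent of `x` and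
`Im 𝓗 ∈ Γ^0_{K,K',2}[r] ⊗ 𝓜₂(ℂ)`, `R₂ ∈ 𝓡^{-ρ}_{K,K',2}[r] ⊗ 𝓜₂(ℂ)`, and the operators
`R₁`, `i Op^{BW}(𝓗)`, `R₂` are real-to-real. -/
structure IsReducedSystem (I : Set ℝ) (χ : ℝ → ℝ → ℝ) (ρ : ℝ) (K K' : ℕ) (r s₀ : ℝ)
    (R₁ : HomMat) (H : Bool → ParaSymbol) (R₂ : OpMat) : Prop where
  hom : ∀ σ σ', IsHomSmoothing ρ (R₁ σ σ')
  real_hom : IsRealHom R₁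
  symb : ∀ σ, IsNonhomSymbol I (3 / 2) K K' 2 r s₀ (H σ)
  symb_const : ∀ σ U, InBall I K s₀ r U → ∀ t ∈ I, ∀ x y ξ, H σ U t x ξ = H σ U t y ξ
  symb_im : ∀ σ, ImIsNonhomSymbol I 0 K K' 2 r s₀ (H σ)
  real_symb : IsRealToReal I K s₀ r (Complex.I • paraMat χ (diagSymbol H))
  nonhom : IsNonhomMat I ρ K K' 2 r s₀ R₂
  real_nonhom : IsRealToReal I K s₀ r R₂

/-- `A` and `B` are linear maps on `Ḣ^s(𝕋; ℂ²)`, bounded by `L`, and inverse to each other. -/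
structure AreBoundedInverses (s L : ℝ) (A B : Vec → Vec) : Prop where
  linear : ∀ v w, MemH2 s v → MemH2 s w → ∀ c : ℂ,
    A (c • v + w) = c • A v + A w ∧ B (c • v + w) = c • B v + B w
  mem : ∀ v, MemH2 s v → MemH2 s (A v) ∧ MemH2 s (B v)
  bound : ∀ v, MemH2 s v → normH2 s (A v) ≤ L * normH2 s v ∧ normH2 s (B v) ≤ L * normH2 s v
  inv : ∀ v, MemH2 s v → B (A v) = v ∧ A (B v) = v

/-- The tame bound
`‖∂_t^k A[V]‖_{Ḣ^{s-3k/2}} ≤ ‖V‖_{k,s}(1 + C‖U‖_{K,s₀}) + C‖V‖_{k,s₀}‖U‖_{K,s}`, `k ≤ K - K'`,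
for all `V ∈ C^{K-K'}_*(I; Ḣ^s(𝕋; ℂ²))`. -/
def TameBound (I : Set ℝ) (K K' : ℕ) (s s₀ C : ℝ) (U : ℝ → Vec) (A : ℝ → Vec → Vec) : Prop :=
  ∀ V, CStar2 I (K - K') s V →
    CStar2 I (K - K') s (fun t => A t (V t)) ∧
    ∀ k ≤ K - K', ∀ t ∈ I,
      normH2 (s - 3 / 2 * k) (dt2 I k (fun τ => A τ (V τ)) t) ≤
        normK2 I k s V t * (1 + C * normK2 I K s₀ U t) +
          C * normK2 I k s₀ V t * normK2 I K s U t

/-- The homological equation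
`G(iΩ(D)E U) + [G(U), iΩ(D)E] + R(U) = R^{res}(U)`. -/
def SolvesHomological (κ g : ℝ) (h : ℝ≥0∞) (G R : HomMat) : Prop :=
  let L : Vec → Vec := act (Complex.I • dispE κ g h) 0 0
  let ev : HomMat → Vec → Vec → Vec := fun r U V => act (homMat r) (fun _ => U) 0 V
  ∀ U V : Vec, (∀ s, MemH2 s U) → (∀ s, MemH2 s V) →
    ev G (L U) V + (ev G U (L V) - L (ev G U V)) + ev R U V = ev (resPart κ g h R) U V

end WaterWaves

end

open WaterWaves

noncomputable section

namespace WaterWaves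

/-! ### Weighted sup bounds -/

/-! The only quadratic term of the reduced system is `R₁(U)Z`. Conjugation by `exp(G(U))`, with `G`
linear in `U`, turns it at first order into `R₁(U) + G(iΩU) + [G(U), iΩ]`. On a pair of frequencies
`(a, b)` the last two terms multiply the coefficient of `G` by `-iφ`, where `φ` is the phase
`σΩ(a+b) - σ'Ω(b) - εΩ(a)`. Taking `r/(iφ)` where `φ ≠ 0`, and `0` elsewhere, leaves exactly the
resonant part (`homological_equation`).

The division loses no derivative because nonzero phases are bounded away from zero
(`exists_phase_gap`). One of `|a|`, `|b|`, `|a+b|` is the sum of the other two, so a uniform gap in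
the superadditivity of `Ω` suffices. It holds once the larger summand is at least `g/κ`
(`omega_gap`), the factor `tanh` being nondecreasing, and only finitely many frequency pairs remain.
Hence `G` is as smoothing as `R₁`, `G(U)` is a bounded operator, and the flow is an ordinary
exponential series with inverse `exp(-θG(U))`.

For the estimates, Sobolev norms are traded for weighted sup bounds on Fourier coefficients (`Bd`),
for which the tame bilinear estimate is elementary (`bil_bd`). Returning to Sobolev norms costs one
derivative, which smoothing can pay. Time derivatives are handled through jets, each derivative
costing `3/2`. A tame bound is recorded at a low and at a high level, with weights measuring `U`;
such bounds compose, with degrees adding up (`PairJ`, `TameJ.comp_pairJ`), and can be summed along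
exponential series (`tameJ_ser`, `tameJ_PhiJ`). That the formal jets are true time derivatives is a
separate, qualitative statement with merely local bounds (`CJ`). `Fam` and `HasFam` combine both,
with constants uniform in the curves and in the time.

For the conjugation, the time derivative of `G(U)^n Z` is computed by induction: by the homological
equation it is `iΩ G(U)^n Z`, plus a sum of commutators, plus `G(U)^n` of the remaining vector field
(`PtBd.derivIter_eq`). Summation against `1/n!` gives the equation of `Y` (`PtBd.tsum_derivIter`).
There `R₁` cancels, `R₁^{res}(U)Z` is replaced by `R₁^{res}(Y)Y`, which is legitimate since `Y - U`
is quadratic and `Z - Y` carries a factor `U`, and the paradifferential term is moved from `Z` to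
`Y` (`PtBd.field_eq`). What is left, `NFData.rem`, is of degree two in `U` and smoothing of order `ρ
- (m + 10)`, because every unbounded operator in it is composed with an operator gaining `ρ`
(`Hyp.exists_fam`).

Reality is a symmetry of the coefficients (`RealCoef`). It passes to `G` since the phase is odd
under the corresponding reflection, and then to all series because they commute with the conjugation
`Cc`. -/

/-- `U` has zero average and its Fourier coefficients are bounded by `B |n|^{-s}`. -/
def Bd (s : ℝ) (u : Vec) (B : ℝ) : Prop :=
  (∀ σ, u σ 0 = 0) ∧ ∀ σ (n : ℤ), n ≠ 0 → ‖u σ n‖ ≤ B * |(n : ℝ)| ^ (-s)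

lemma one_le_abs_cast {n : ℤ} (hn : n ≠ 0) : (1 : ℝ) ≤ |(n : ℝ)| := by
  exact_mod_cast Int.one_le_abs hn

lemma abs_cast_pos {n : ℤ} (hn : n ≠ 0) : (0 : ℝ) < |(n : ℝ)| :=
  lt_of_lt_of_le one_pos (one_le_abs_cast hn)

namespace Bd

variable {s s' : ℝ} {u v : Vec} {A B : ℝ}

lemma nonneg (h : Bd s u B) : 0 ≤ B := by
  have := h.2 true 1 one_ne_zero
  simp at this
  exact (norm_nonneg _).trans this

lemma mono (h : Bd s u A) (hAB : A ≤ B) : Bd s u B :=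
  ⟨h.1, fun σ n hn => (h.2 σ n hn).trans (by gcongr)⟩

lemma weaken (h : Bd s u B) (hs : s' ≤ s) : Bd s' u B :=
  ⟨h.1, fun σ n hn => (h.2 σ n hn).trans (by
    have := h.nonneg
    have := one_le_abs_cast hn
    gcongr)⟩

lemma zero : Bd s 0 0 := ⟨fun _ => rfl, fun σ n _ => by simp⟩

lemma add (hu : Bd s u A) (hv : Bd s v B) : Bd s (u + v) (A + B) :=
  ⟨fun σ => by simp [hu.1 σ, hv.1 σ], fun σ n hn => by
    have h1 := hu.2 σ n hn
    have h2 := hv.2 σ n hn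
    have := norm_add_le (u σ n) (v σ n)
    simp only [Pi.add_apply]
    linarith [add_mul A B (|(n : ℝ)| ^ (-s))]⟩

lemma smul (c : ℂ) (hu : Bd s u A) : Bd s (c • u) (‖c‖ * A) :=
  ⟨fun σ => by simp [hu.1 σ], fun σ n hn => by
    simp only [Pi.smul_apply, smul_eq_mul, norm_mul]
    have := hu.2 σ n hn
    rw [mul_assoc]
    gcongr⟩

lemma neg (hu : Bd s u A) : Bd s (-u) A := by
  simpa using hu.smul (-1)

lemma sub (hu : Bd s u A) (hv : Bd s v B) : Bd s (u - v) (A + B) := by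
  rw [sub_eq_add_neg]; exact hu.add hv.neg

lemma sum {ι : Type*} {t : Finset ι} {f : ι → Vec} {b : ι → ℝ} (h : ∀ i ∈ t, Bd s (f i) (b i)) :
    Bd s (∑ i ∈ t, f i) (∑ i ∈ t, b i) := by
  classical
  induction t using Finset.induction_on with
  | empty => simpa using Bd.zero
  | insert i t hi ih =>
    rw [Finset.sum_insert hi, Finset.sum_insert hi]
    exact (h i (by simp)).add (ih fun j hj => h j (by simp [hj]))

end Bd

/-! ### Comparison with Sobolev norms -/

/-- The constant `(∑ |n|^{-2})^{1/2}`. -/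
def sumConst : ℝ := ∑' n : ℤ, |(n : ℝ)| ^ (-2 : ℝ)

lemma summable_abs_rpow_neg_two : Summable fun n : ℤ => |(n : ℝ)| ^ (-2 : ℝ) := by
  have := Real.summable_abs_int_rpow (b := 2) (by norm_num)
  simpa using this

lemma sumConst_nonneg : 0 ≤ sumConst := tsum_nonneg fun n => by positivity

lemma normH_nonneg (s : ℝ) (u : Seq) : 0 ≤ normH s u := Real.sqrt_nonneg _

lemma normH2_nonneg (s : ℝ) (u : Vec) : 0 ≤ normH2 s u := Real.sqrt_nonneg _

lemma normH_sq (s : ℝ) (u : Seq) :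
    normH s u ^ 2 = ∑' n : ℤ, |(n : ℝ)| ^ (2 * s) * ‖u n‖ ^ 2 :=
  Real.sq_sqrt (tsum_nonneg fun n => by positivity)

lemma normH_le_normH2 (s : ℝ) (U : Vec) (σ : Bool) : normH s (U σ) ≤ normH2 s U := by
  rw [normH2, ← Real.sqrt_sq (normH_nonneg s (U σ))]
  apply Real.sqrt_le_sqrt
  exact Finset.single_le_sum (f := fun σ => normH s (U σ) ^ 2) (fun _ _ => sq_nonneg _)
    (Finset.mem_univ σ)

lemma normH2_le {s B : ℝ} {U : Vec} (hB : ∀ σ, normH s (U σ) ≤ B) : normH2 s U ≤ 2 * B := by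
  have h0 : 0 ≤ B := (normH_nonneg _ _).trans (hB true)
  rw [normH2]
  apply Real.sqrt_le_iff.2 ⟨by positivity, ?_⟩
  simp only [Fintype.sum_bool]
  have h1 := pow_le_pow_left₀ (normH_nonneg _ _) (hB true) 2
  have h2 := pow_le_pow_left₀ (normH_nonneg _ _) (hB false) 2
  nlinarith

/-- A single term of a nonnegative series is at most its sum, so this direction of the comparison
loses no derivative. -/
lemma MemH.coeff_le {s : ℝ} {u : Seq} (h : MemH s u) {n : ℤ} (hn : n ≠ 0) :
    ‖u n‖ ≤ normH s u * |(n : ℝ)| ^ (-s) := by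
  have hp := abs_cast_pos hn
  have h1 : |(n : ℝ)| ^ (2 * s) * ‖u n‖ ^ 2 ≤ normH s u ^ 2 := by
    rw [normH_sq]
    exact h.2.le_tsum n (fun m _ => by positivity)
  have h2 : (|(n : ℝ)| ^ s * ‖u n‖) ^ 2 ≤ normH s u ^ 2 := by
    rw [mul_pow, ← Real.rpow_natCast (|(n : ℝ)| ^ s), ← Real.rpow_mul hp.le]
    convert h1 using 3
    push_cast; ring
  have h3 := abs_le_of_sq_le_sq' h2 (normH_nonneg _ _)
  rw [Real.rpow_neg hp.le, ← div_eq_mul_inv, le_div_iff₀ (by positivity), mul_comm]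
  exact h3.2

lemma MemH2.bd {s : ℝ} {U : Vec} (h : MemH2 s U) : Bd s U (normH2 s U) :=
  ⟨fun σ => (h σ).1, fun σ n hn => ((h σ).coeff_le hn).trans (by
    have := normH_le_normH2 s U σ
    gcongr)⟩

/-- The extra factor `|n|^{-1}` squares to the summable `|n|^{-2}`. This loss of one derivative is
the price of sup bounds; later it is absorbed by a smoothing gain or by lowering the level. -/
lemma MemH.of_coeff_le {s B : ℝ} {u : Seq} (h0 : u 0 = 0)
    (h : ∀ n : ℤ, n ≠ 0 → ‖u n‖ ≤ B * |(n : ℝ)| ^ (-(s + 1))) :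
    MemH s u ∧ normH s u ≤ (1 + sumConst) * B := by
  have hB : 0 ≤ B := by
    have := h 1 one_ne_zero
    simp at this
    exact (norm_nonneg _).trans this
  have key : ∀ n : ℤ, |(n : ℝ)| ^ (2 * s) * ‖u n‖ ^ 2 ≤ B ^ 2 * |(n : ℝ)| ^ (-2 : ℝ) := by
    intro n
    rcases eq_or_ne n 0 with rfl | hn
    · rw [h0, norm_zero, zero_pow two_ne_zero, mul_zero]
      positivity
    have hp := abs_cast_pos hn
    calc |(n : ℝ)| ^ (2 * s) * ‖u n‖ ^ 2
        ≤ |(n : ℝ)| ^ (2 * s) * (B * |(n : ℝ)| ^ (-(s + 1))) ^ 2 := by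
          have := h n hn
          gcongr
      _ = B ^ 2 * |(n : ℝ)| ^ (-2 : ℝ) := by
          rw [mul_pow, ← Real.rpow_natCast (|(n : ℝ)| ^ (-(s + 1))), ← Real.rpow_mul hp.le,
            mul_left_comm, ← Real.rpow_add hp]
          congr 2
          push_cast; ring
  have hsum : Summable fun n : ℤ => |(n : ℝ)| ^ (2 * s) * ‖u n‖ ^ 2 :=
    Summable.of_nonneg_of_le (fun n => by positivity) key
      (summable_abs_rpow_neg_two.mul_left _)
  refine ⟨⟨h0, hsum⟩, ?_⟩
  have hs := sumConst_nonneg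
  rw [normH]
  apply Real.sqrt_le_iff.2 ⟨by positivity, ?_⟩
  calc ∑' n : ℤ, |(n : ℝ)| ^ (2 * s) * ‖u n‖ ^ 2
      ≤ ∑' n : ℤ, B ^ 2 * |(n : ℝ)| ^ (-2 : ℝ) :=
        hsum.tsum_le_tsum key (summable_abs_rpow_neg_two.mul_left _)
    _ = B ^ 2 * sumConst := tsum_mul_left
    _ ≤ ((1 + sumConst) * B) ^ 2 := by
        rw [mul_pow, mul_comm]; gcongr; nlinarith

/-- The constant in the embedding of weighted sup spaces into Sobolev spaces. -/
def embConst : ℝ := 2 * (1 + sumConst)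

lemma embConst_nonneg : 0 ≤ embConst := by
  have := sumConst_nonneg
  unfold embConst; positivity

lemma Bd.memH2 {s B : ℝ} {U : Vec} (h : Bd (s + 1) U B) : MemH2 s U :=
  fun σ => (MemH.of_coeff_le (h.1 σ) (h.2 σ)).1

lemma Bd.normH2_le {s B : ℝ} {U : Vec} (h : Bd (s + 1) U B) : normH2 s U ≤ embConst * B := by
  rw [embConst, mul_assoc]
  exact WaterWaves.normH2_le fun σ => (MemH.of_coeff_le (h.1 σ) (h.2 σ)).2

lemma MemH.mono {s s' : ℝ} {u : Seq} (h : MemH s u) (hs : s' ≤ s) :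
    MemH s' u ∧ normH s' u ≤ normH s u := by
  have key : ∀ n : ℤ, |(n : ℝ)| ^ (2 * s') * ‖u n‖ ^ 2 ≤ |(n : ℝ)| ^ (2 * s) * ‖u n‖ ^ 2 := by
    intro n
    rcases eq_or_ne n 0 with rfl | hn
    · simp [h.1]
    have := one_le_abs_cast hn
    gcongr
  have hsum := Summable.of_nonneg_of_le (fun n => by positivity) key h.2
  exact ⟨⟨h.1, hsum⟩, Real.sqrt_le_sqrt (hsum.tsum_le_tsum key h.2)⟩

lemma MemH2.normH2_mono {s s' : ℝ} {U : Vec} (h : MemH2 s U) (hs : s' ≤ s) :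
    normH2 s' U ≤ normH2 s U := by
  apply Real.sqrt_le_sqrt
  apply Finset.sum_le_sum
  intro σ _
  have := ((h σ).mono hs).2
  have := normH_nonneg s' (U σ)
  gcongr

/-- `normH2` is the `ℓ²` norm of the family of weighted coefficients. -/
lemma normH2_eq {s : ℝ} {U : Vec} (h : MemH2 s U) :
    normH2 s U = (∑' q : ℤ × Bool, (|(q.1 : ℝ)| ^ s * ‖U q.2 q.1‖) ^ (2 : ℝ)) ^ (1 / (2 : ℝ)) ∧
    Summable fun q : ℤ × Bool => (|(q.1 : ℝ)| ^ s * ‖U q.2 q.1‖) ^ (2 : ℝ) := by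
  have e : ∀ (n : ℤ) (σ : Bool), (|(n : ℝ)| ^ s * ‖U σ n‖) ^ (2 : ℝ)
      = |(n : ℝ)| ^ (2 * s) * ‖U σ n‖ ^ 2 := by
    intro n σ
    rw [Real.mul_rpow (by positivity) (by positivity), ← Real.rpow_mul (abs_nonneg _), mul_comm s]
    norm_num
  let f : Bool × ℤ → ℝ := fun q => |(q.2 : ℝ)| ^ (2 * s) * ‖U q.1 q.2‖ ^ 2
  have hf : Summable f := by
    rw [summable_prod_of_nonneg fun q => by positivity]
    exact ⟨fun σ => (h σ).2, Summable.of_finite⟩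
  have ef : (fun q : ℤ × Bool => (|(q.1 : ℝ)| ^ s * ‖U q.2 q.1‖) ^ (2 : ℝ))
      = f ∘ (Equiv.prodComm ℤ Bool) := by
    funext q; exact e q.1 q.2
  rw [ef]
  refine ⟨?_, (Equiv.prodComm ℤ Bool).summable_iff.2 hf⟩
  have h1 : ∑' q, (f ∘ (Equiv.prodComm ℤ Bool)) q = ∑' q, f q :=
    (Equiv.prodComm ℤ Bool).tsum_eq f
  have h2 : ∑' q, f q = ∑' σ, ∑' n, f (σ, n) := hf.tsum_prod' fun σ => (h σ).2
  rw [h1, h2, normH2, ← Real.sqrt_eq_rpow, tsum_fintype]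
  congr 1
  exact Finset.sum_congr rfl fun σ _ => normH_sq s (U σ)

/-- Minkowski's inequality in `ℓ²`. The constant one matters: it yields the leading coefficient `1`
in the tame bound of the flow. -/
lemma MemH2.add {s : ℝ} {U V : Vec} (hU : MemH2 s U) (hV : MemH2 s V) :
    MemH2 s (U + V) ∧ normH2 s (U + V) ≤ normH2 s U + normH2 s V := by
  obtain ⟨e1, s1⟩ := normH2_eq hU
  obtain ⟨e2, s2⟩ := normH2_eq hV
  have hm : MemH2 s (U + V) := by
    intro σ
    refine ⟨by simp [(hU σ).1, (hV σ).1], ?_⟩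
    refine Summable.of_nonneg_of_le (fun n => by positivity) (fun n => ?_)
      (((hU σ).2.add (hV σ).2).mul_left 2)
    have h1 := norm_add_le (U σ n) (V σ n)
    have h2 : ‖U σ n + V σ n‖ ^ 2 ≤ 2 * (‖U σ n‖ ^ 2 + ‖V σ n‖ ^ 2) := by
      nlinarith [sq_nonneg (‖U σ n‖ - ‖V σ n‖), norm_nonneg (U σ n + V σ n)]
    have h3 : 0 ≤ |(n : ℝ)| ^ (2 * s) := by positivity
    simp only [Pi.add_apply]
    nlinarith
  refine ⟨hm, ?_⟩
  obtain ⟨e3, s3⟩ := normH2_eq hm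
  obtain ⟨s4, h4⟩ := Real.Lp_add_le_tsum_of_nonneg (p := 2) (by norm_num)
    (f := fun q : ℤ × Bool => |(q.1 : ℝ)| ^ s * ‖U q.2 q.1‖)
    (g := fun q : ℤ × Bool => |(q.1 : ℝ)| ^ s * ‖V q.2 q.1‖)
    (fun q => by positivity) (fun q => by positivity) s1 s2
  rw [e1, e2, e3]
  refine le_trans ?_ h4
  refine Real.rpow_le_rpow (tsum_nonneg fun q => by positivity) ?_ (by norm_num)
  refine s3.tsum_le_tsum (fun q => ?_) s4
  refine Real.rpow_le_rpow (by positivity) ?_ (by norm_num)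
  rw [← mul_add]
  gcongr
  exact norm_add_le _ _

/-! ### Cauchy products of sequences of bounds -/

/-- The Cauchy product. -/
def conv (α x : ℕ → ℝ) (k : ℕ) : ℝ :=
  ∑ p ∈ Finset.HasAntidiagonal.antidiagonal k, α p.1 * x p.2

/-- Reading Cauchy products as products of power series gives associativity for free. -/
lemma conv_eq_coeff (α x : ℕ → ℝ) (k : ℕ) :
    conv α x k = PowerSeries.coeff k (PowerSeries.mk α * PowerSeries.mk x) := by
  simp [conv, PowerSeries.coeff_mul]

lemma mk_conv (α x : ℕ → ℝ) :
    PowerSeries.mk (conv α x) = PowerSeries.mk α * PowerSeries.mk x := by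
  ext k; simp [conv_eq_coeff]

lemma conv_assoc (α β x : ℕ → ℝ) (k : ℕ) : conv α (conv β x) k = conv (conv α β) x k := by
  simp [conv_eq_coeff, mk_conv, mul_assoc]

lemma conv_mono {α α' x x' : ℕ → ℝ} {k : ℕ} (h : ∀ i ≤ k, 0 ≤ α' i) (hx : ∀ i ≤ k, 0 ≤ x i)
    (hα : ∀ i ≤ k, α i ≤ α' i) (hx' : ∀ i ≤ k, x i ≤ x' i) : conv α x k ≤ conv α' x' k := by
  apply Finset.sum_le_sum
  intro p hp
  have hp := Finset.HasAntidiagonal.mem_antidiagonal.1 hp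
  exact mul_le_mul (hα _ (by omega)) (hx' _ (by omega)) (hx _ (by omega)) (h _ (by omega))

lemma conv_nonneg {α x : ℕ → ℝ} {k : ℕ} (h : ∀ i ≤ k, 0 ≤ α i) (hx : ∀ i ≤ k, 0 ≤ x i) :
    0 ≤ conv α x k := by
  apply Finset.sum_nonneg
  intro p hp
  have hp := Finset.HasAntidiagonal.mem_antidiagonal.1 hp
  exact mul_nonneg (h _ (by omega)) (hx _ (by omega))

lemma conv_add_right (α x y : ℕ → ℝ) (k : ℕ) : conv α (x + y) k = conv α x k + conv α y k := by
  simp [conv, mul_add, Finset.sum_add_distrib]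

lemma conv_smul_right (α x : ℕ → ℝ) (c : ℝ) (k : ℕ) : conv α (c • x) k = c * conv α x k := by
  simp [conv, Finset.mul_sum, mul_left_comm]

lemma conv_smul_left (α x : ℕ → ℝ) (c : ℝ) (k : ℕ) : conv (c • α) x k = c * conv α x k := by
  simp [conv, Finset.mul_sum, mul_assoc]

lemma conv_add_left (α β x : ℕ → ℝ) (k : ℕ) : conv (α + β) x k = conv α x k + conv β x k := by
  simp [conv, add_mul, Finset.sum_add_distrib]

lemma conv_le_of_mul_le {α β γ : ℕ → ℝ} {N k : ℕ} (hk : k ≤ N)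
    (h : ∀ i j, i + j ≤ N → α i * β j ≤ γ (i + j)) : conv α β k ≤ (k + 1) * γ k := by
  calc conv α β k ≤ ∑ p ∈ Finset.HasAntidiagonal.antidiagonal k, γ k := by
        apply Finset.sum_le_sum
        intro p hp
        have hp := Finset.HasAntidiagonal.mem_antidiagonal.1 hp
        have := h p.1 p.2 (by omega)
        rwa [hp] at this
    _ = (k + 1) * γ k := by simp

/-! ### Termwise differentiation of series on an interval -/

/-- The mean value inequality on a convex set bounds every difference quotient by the bound of the
derivative, and dominated convergence for series applies. Derivatives within the set are needed
since `I` may contain its endpoints. -/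
lemma hasDerivWithinAt_tsum {ι : Type*} {S : Set ℝ} (hS : Convex ℝ S) {t : ℝ} (ht : t ∈ S)
    {f f' : ι → ℝ → ℂ} {b : ι → ℝ} (hb : Summable b)
    (hd : ∀ i, ∀ τ ∈ S, HasDerivWithinAt (f i) (f' i τ) S τ)
    (hf' : ∀ i, ∀ τ ∈ S, ‖f' i τ‖ ≤ b i) (hf : ∀ τ ∈ S, Summable fun i => f i τ) :
    HasDerivWithinAt (fun τ => ∑' i, f i τ) (∑' i, f' i t) S t := by
  rw [hasDerivWithinAt_iff_tendsto_slope]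
  have h1 : Tendsto (fun τ => ∑' i, slope (f i) t τ) (𝓝[S \ {t}] t) (𝓝 (∑' i, f' i t)) := by
    refine tendsto_tsum_of_dominated_convergence hb
      (fun i => hasDerivWithinAt_iff_tendsto_slope.1 (hd i t ht)) ?_
    filter_upwards [self_mem_nhdsWithin] with τ hτ i
    have h2 := hS.norm_image_sub_le_of_norm_hasDerivWithin_le (hd i) (hf' i) ht hτ.1
    have h3 : 0 < ‖τ - t‖ := norm_pos_iff.2 (sub_ne_zero.2 hτ.2)
    rw [slope_def_module, norm_smul, norm_inv, ← div_eq_inv_mul, div_le_iff₀ h3]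
    exact h2
  refine h1.congr' ?_
  filter_upwards [self_mem_nhdsWithin] with τ hτ
  simp only [slope_def_module]
  rw [tsum_const_smul'', (hf τ hτ.1).tsum_sub (hf t ht)]

/-- Bounds are only local in time; the derivative at `t` sees only `I ∩ ball t ε`, which is still
convex. -/
lemma hasDerivWithinAt_tsum_local {ι : Type*} {I : Set ℝ} (hI : I.OrdConnected) {t : ℝ}
    (ht : t ∈ I) {ε : ℝ} (hε : 0 < ε)
    {f f' : ι → ℝ → ℂ} {b : ι → ℝ} (hb : Summable b)
    (hd : ∀ i, ∀ τ ∈ I, |τ - t| < ε → HasDerivWithinAt (f i) (f' i τ) I τ)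
    (hf' : ∀ i, ∀ τ ∈ I, |τ - t| < ε → ‖f' i τ‖ ≤ b i)
    (hf : ∀ τ ∈ I, |τ - t| < ε → Summable fun i => f i τ) :
    HasDerivWithinAt (fun τ => ∑' i, f i τ) (∑' i, f' i t) I t := by
  have hmem : ∀ τ, τ ∈ Metric.ball t ε ↔ |τ - t| < ε := fun τ => by
    rw [Metric.mem_ball, Real.dist_eq]
  have hS : Convex ℝ (I ∩ Metric.ball t ε) := hI.convex.inter (convex_ball t ε)
  rw [← hasDerivWithinAt_inter (Metric.ball_mem_nhds t hε)]
  exact hasDerivWithinAt_tsum hS ⟨ht, Metric.mem_ball_self hε⟩ hb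
    (fun i τ hτ => (hd i τ hτ.1 ((hmem τ).1 hτ.2)).mono Set.inter_subset_left)
    (fun i τ hτ => hf' i τ hτ.1 ((hmem τ).1 hτ.2)) (fun τ hτ => hf τ hτ.1 ((hmem τ).1 hτ.2))

/-! ### Bilinear operators given by coefficients -/

/-- The operator `R(U)v` of a matrix of coefficients. -/
def bil (r : HomMat) (U v : Vec) : Vec := fun σ => ∑ σ', homOp (r σ σ') U (v σ')

lemma act_homMat (r : HomMat) (U : ℝ → Vec) (t : ℝ) (v : Vec) :
    act (homMat r) U t v = bil r (U t) v := rfl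

/-- Bounds of the coefficients of an operator which gains `ρ` derivatives. -/
def CoefBd (ρ μ C : ℝ) (r : HomMat) : Prop :=
  0 ≤ C ∧ ∀ σ σ' ε (a b : ℤ), a ≠ 0 → b ≠ 0 → a + b ≠ 0 →
    ‖r σ σ' ε a b‖ ≤
      C * (min |(a : ℝ)| |(b : ℝ)|) ^ (ρ + μ) * (max |(a : ℝ)| |(b : ℝ)|) ^ (-ρ)

/-- The levels of regularity on which the operators with `CoefBd ρ μ C` act. -/
def Lv (ρ μ p : ℝ) : Prop := 2 + ρ + μ ≤ p ∧ -ρ ≤ p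

/-- The summands of `R(U)v`. -/
def bt (r : HomMat) (U v : Vec) (σ : Bool) (c a : ℤ) : ℂ :=
  ∑ σ', ∑ ε, r σ σ' ε a (c - a) * U ε a * v σ' (c - a)

/-- Here `a` is the low and `b` the high frequency. The decay `a^{-p}` absorbs `a^{ρ+μ}` and leaves
the summable `a^{-2}`. The output frequency satisfies `c ≤ 2b`, so the decay in `b`, improved by
`b^{-ρ}`, becomes decay in `c`. -/
lemma min_max_mul_le_aux {ρ μ p q e τ a b c α X : ℝ} (ha : 1 ≤ a) (hab : a ≤ b) (hc : 0 < c)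
    (hcb : c ≤ 2 * b) (hp : 2 + ρ + μ ≤ p) (he : 0 ≤ e) (heq : e - ρ ≤ q + τ)
    (hα : 0 ≤ α) (hX : 0 ≤ X) :
    a ^ (ρ + μ) * b ^ (-ρ) * ((α * a ^ (-p)) * (X * b ^ (-(q + τ)))) ≤
      2 ^ e * c ^ (-e) * (α * X * a ^ (-2 : ℝ)) := by
  have ha0 : 0 < a := by linarith
  have hb : 1 ≤ b := ha.trans hab
  have hb0 : 0 < b := by linarith
  have h1 : a ^ (ρ + μ) * a ^ (-p) ≤ a ^ (-2 : ℝ) := by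
    rw [← Real.rpow_add ha0]
    exact Real.rpow_le_rpow_of_exponent_le ha (by linarith)
  have h2 : b ^ (-ρ) * b ^ (-(q + τ)) ≤ 2 ^ e * c ^ (-e) := by
    rw [← Real.rpow_add hb0]
    calc b ^ (-ρ + -(q + τ)) ≤ b ^ (-e) := Real.rpow_le_rpow_of_exponent_le hb (by linarith)
      _ ≤ 2 ^ e * c ^ (-e) := by
        rw [Real.rpow_neg hb0.le, Real.rpow_neg hc.le, ← div_eq_mul_inv, inv_eq_one_div,
          div_le_div_iff₀ (by positivity) (by positivity), one_mul,
          ← Real.mul_rpow (by norm_num) hb0.le]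
        exact Real.rpow_le_rpow hc.le hcb he
  calc a ^ (ρ + μ) * b ^ (-ρ) * ((α * a ^ (-p)) * (X * b ^ (-(q + τ))))
      = (α * X) * ((a ^ (ρ + μ) * a ^ (-p)) * (b ^ (-ρ) * b ^ (-(q + τ)))) := by ring
    _ ≤ (α * X) * (a ^ (-2 : ℝ) * (2 ^ e * c ^ (-e))) := by gcongr
    _ = _ := by ring

/-- The larger input frequency decides which factor is measured in the high norm; this is the origin
of the two-term tame structure `αX + Ax`. -/
lemma min_max_mul_le {ρ μ p q e τ α A x X u v : ℝ} {a b : ℤ} (ha : a ≠ 0) (hb : b ≠ 0)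
    (hab : a + b ≠ 0) (hp : 2 + ρ + μ ≤ p) (hq : 2 + ρ + μ ≤ q) (he : 0 ≤ e)
    (hep : e - ρ ≤ p + τ) (heq : e - ρ ≤ q + τ)
    (hα : 0 ≤ α) (hA : 0 ≤ A) (hx : 0 ≤ x) (hX : 0 ≤ X) (hu0 : 0 ≤ u) (hv0 : 0 ≤ v)
    (hu : u ≤ α * |(a : ℝ)| ^ (-p)) (hu' : u ≤ A * |(a : ℝ)| ^ (-(p + τ)))
    (hv : v ≤ x * |(b : ℝ)| ^ (-q)) (hv' : v ≤ X * |(b : ℝ)| ^ (-(q + τ))) :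
    (min |(a : ℝ)| |(b : ℝ)|) ^ (ρ + μ) * (max |(a : ℝ)| |(b : ℝ)|) ^ (-ρ) * (u * v) ≤
      2 ^ e * |((a + b : ℤ) : ℝ)| ^ (-e) *
        (α * X * |(a : ℝ)| ^ (-2 : ℝ) + A * x * |(b : ℝ)| ^ (-2 : ℝ)) := by
  have ha1 := one_le_abs_cast ha
  have hb1 := one_le_abs_cast hb
  have hc := abs_cast_pos hab
  have hc' : |((a + b : ℤ) : ℝ)| ≤ |(a : ℝ)| + |(b : ℝ)| := by
    push_cast; exact abs_add_le _ _
  rcases le_total |(a : ℝ)| |(b : ℝ)| with h | h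
  · rw [min_eq_left h, max_eq_right h]
    have := min_max_mul_le_aux (α := α) (X := X) ha1 h hc (by linarith) hp he heq hα hX
    refine le_trans ?_ (this.trans ?_)
    · gcongr
    · gcongr
      exact le_add_of_nonneg_right (by positivity)
  · rw [min_eq_right h, max_eq_left h]
    have := min_max_mul_le_aux (α := x) (X := A) hb1 h hc (by linarith) hq he hep hx hA
    rw [mul_comm u v]
    refine le_trans ?_ (this.trans ?_)
    · gcongr
    · gcongr
      rw [mul_comm x A]
      exact le_add_of_nonneg_left (by positivity)

section bil

variable {r : HomMat} {ρ μ C p q : ℝ} {U U' v v' : Vec} {α A x X : ℝ}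

lemma norm_bt_le {e τ : ℝ} (hr : CoefBd ρ μ C r) (hp : 2 + ρ + μ ≤ p) (hq : 2 + ρ + μ ≤ q)
    (he : 0 ≤ e) (hep : e - ρ ≤ p + τ) (heq : e - ρ ≤ q + τ)
    (hU : Bd p U α) (hU' : Bd (p + τ) U A) (hv : Bd q v x) (hv' : Bd (q + τ) v X)
    (σ : Bool) {c : ℤ} (hc : c ≠ 0) (a : ℤ) :
    ‖bt r U v σ c a‖ ≤ 4 * C * (2 ^ e * |(c : ℝ)| ^ (-e)) *
      (α * X * |(a : ℝ)| ^ (-2 : ℝ) + A * x * |((c - a : ℤ) : ℝ)| ^ (-2 : ℝ)) := by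
  have hC := hr.1
  have hα := hU.nonneg
  have hA := hU'.nonneg
  have hx := hv.nonneg
  have hX := hv'.nonneg
  set M : ℝ := C * (2 ^ e * |(c : ℝ)| ^ (-e)) *
      (α * X * |(a : ℝ)| ^ (-2 : ℝ) + A * x * |((c - a : ℤ) : ℝ)| ^ (-2 : ℝ)) with hM
  have hM0 : 0 ≤ M := by positivity
  have key : ∀ σ' ε, ‖r σ σ' ε a (c - a) * U ε a * v σ' (c - a)‖ ≤ M := by
    intro σ' ε
    rcases eq_or_ne a 0 with rfl | ha
    · simpa [hU.1 ε] using hM0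
    rcases eq_or_ne (c - a) 0 with hb | hb
    · rw [hb, hv.1 σ']; simpa using hM0
    have hab : a + (c - a) = c := by ring
    have h1 := hr.2 σ σ' ε a (c - a) ha hb (by rwa [hab])
    have h2 := min_max_mul_le (ρ := ρ) (μ := μ) ha hb (by rwa [hab]) hp hq he hep heq hα hA hx hX
      (norm_nonneg (U ε a)) (norm_nonneg (v σ' (c - a))) (hU.2 ε a ha) (hU'.2 ε a ha)
      (hv.2 σ' _ hb) (hv'.2 σ' _ hb)
    rw [hab] at h2
    rw [norm_mul, norm_mul, hM]
    calc ‖r σ σ' ε a (c - a)‖ * ‖U ε a‖ * ‖v σ' (c - a)‖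
        ≤ (C * (min |(a : ℝ)| |((c - a : ℤ) : ℝ)|) ^ (ρ + μ) *
            (max |(a : ℝ)| |((c - a : ℤ) : ℝ)|) ^ (-ρ)) * ‖U ε a‖ * ‖v σ' (c - a)‖ := by gcongr
      _ = C * ((min |(a : ℝ)| |((c - a : ℤ) : ℝ)|) ^ (ρ + μ) *
            (max |(a : ℝ)| |((c - a : ℤ) : ℝ)|) ^ (-ρ) * (‖U ε a‖ * ‖v σ' (c - a)‖)) := by ring
      _ ≤ C * (2 ^ e * |(c : ℝ)| ^ (-e) *
        (α * X * |(a : ℝ)| ^ (-2 : ℝ) + A * x * |((c - a : ℤ) : ℝ)| ^ (-2 : ℝ))) := by gcongr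
      _ = _ := by ring
  -- The factor `4` counts the pairs `(σ', ε)`.
  calc ‖bt r U v σ c a‖ ≤ ∑ σ' : Bool, ∑ ε : Bool, M :=
        norm_sum_le_of_le _ fun σ' _ => norm_sum_le_of_le _ fun ε _ => key σ' ε
    _ = 4 * M := by simp; ring
    _ = _ := by rw [hM]; ring

lemma summable_abs_sub_rpow (c : ℤ) : Summable fun a : ℤ => |((c - a : ℤ) : ℝ)| ^ (-2 : ℝ) :=
  (Equiv.subLeft c).summable_iff.2 summable_abs_rpow_neg_two

lemma tsum_abs_sub_rpow (c : ℤ) : ∑' a : ℤ, |((c - a : ℤ) : ℝ)| ^ (-2 : ℝ) = sumConst :=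
  (Equiv.subLeft c).tsum_eq fun a : ℤ => |(a : ℝ)| ^ (-2 : ℝ)

lemma norm_bt_le' (hr : CoefBd ρ μ C r) (hp : Lv ρ μ p) (hq : Lv ρ μ q)
    (hU : Bd p U α) (hv : Bd q v x) (σ : Bool) {c : ℤ} (hc : c ≠ 0) (a : ℤ) :
    ‖bt r U v σ c a‖ ≤ 4 * C * (α * x) *
      (|(a : ℝ)| ^ (-2 : ℝ) + |((c - a : ℤ) : ℝ)| ^ (-2 : ℝ)) := by
  have := norm_bt_le (e := 0) (τ := 0) (A := α) (X := x) hr hp.1 hq.1 le_rfl (by linarith [hp.2])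
    (by linarith [hq.2]) hU (by simpa using hU) hv (by simpa using hv) σ hc a
  refine this.trans (le_of_eq ?_)
  simp; ring

lemma summable_bound (c : ℤ) (M : ℝ) : Summable fun a : ℤ =>
    M * (|(a : ℝ)| ^ (-2 : ℝ) + |((c - a : ℤ) : ℝ)| ^ (-2 : ℝ)) :=
  (summable_abs_rpow_neg_two.add (summable_abs_sub_rpow c)).mul_left M

lemma summable_bt (hr : CoefBd ρ μ C r) (hp : Lv ρ μ p) (hq : Lv ρ μ q)
    (hU : Bd p U α) (hv : Bd q v x) (σ : Bool) {c : ℤ} (hc : c ≠ 0) :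
    Summable (bt r U v σ c) :=
  Summable.of_norm_bounded (summable_bound c _) (norm_bt_le' hr hp hq hU hv σ hc)

/-- The normalization of the Fourier coefficients. -/
def nrm : ℂ := ((Real.sqrt (2 * Real.pi) : ℝ) : ℂ)⁻¹

lemma norm_nrm_le : ‖nrm‖ ≤ 1 := by
  have : (1 : ℝ) ≤ Real.sqrt (2 * Real.pi) := by
    rw [Real.one_le_sqrt]; linarith [Real.pi_gt_three]
  rw [nrm, norm_inv, Complex.norm_real, Real.norm_eq_abs, abs_of_nonneg (Real.sqrt_nonneg _)]
  exact inv_le_one_of_one_le₀ this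

lemma nrm_ne_zero : nrm ≠ 0 := by
  have : (0 : ℝ) < Real.sqrt (2 * Real.pi) := Real.sqrt_pos.2 (by positivity)
  simpa [nrm] using this.ne'

lemma bil_zero_mode (r : HomMat) (U v : Vec) (σ : Bool) : bil r U v σ 0 = 0 := by
  simp [bil, homOp]

lemma single_bd (s : ℝ) {v : Vec} {x : ℝ} (hv : Bd s v x) (σ₀ : Bool) :
    Bd s (fun σ => if σ = σ₀ then v σ else 0) x :=
  ⟨fun σ => by dsimp only; split_ifs <;> simp [hv.1 σ], fun σ n hn => by
    dsimp only
    split_ifs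
    · exact hv.2 σ n hn
    · have := hv.nonneg
      simp only [Pi.zero_apply, norm_zero]; positivity⟩

lemma bil_eq_tsum (hr : CoefBd ρ μ C r) (hp : Lv ρ μ p) (hq : Lv ρ μ q)
    (hU : Bd p U α) (hv : Bd q v x) (σ : Bool) {c : ℤ} (hc : c ≠ 0) :
    bil r U v σ c = nrm * ∑' a, bt r U v σ c a := by
  -- Summability of one column is that of the full sum for the vector whose only nonzero component
  -- is `v σ₀`.
  have h1 : ∀ σ₀, Summable fun a => ∑ ε, r σ σ₀ ε a (c - a) * U ε a * v σ₀ (c - a) := by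
    intro σ₀
    refine (summable_bt hr hp hq hU (single_bd q hv σ₀) σ hc).congr fun a => ?_
    simp only [bt]
    rw [Finset.sum_eq_single σ₀]
    · simp
    · intro b _ hb; simp [hb]
    · simp
  simp only [bil, Finset.sum_apply, homOp, hc, if_false, bt]
  rw [← Finset.mul_sum, Summable.tsum_finsetSum fun σ' _ => h1 σ']
  rfl

/-- In each tame term one of the frequencies `a`, `c - a` carries the power `-2`, so the sum over
`a` costs only `sumConst`. The choice `τ = 0` gives plain boundedness, `τ > 0` the estimate in high
norm; the output level `e` may exceed the input levels by `ρ`. -/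
lemma bil_bd {e τ : ℝ} (hr : CoefBd ρ μ C r) (hp : Lv ρ μ p) (hq : Lv ρ μ q)
    (he : 0 ≤ e) (hep : e - ρ ≤ p + τ) (heq : e - ρ ≤ q + τ)
    (hU : Bd p U α) (hU' : Bd (p + τ) U A) (hv : Bd q v x) (hv' : Bd (q + τ) v X) :
    Bd e (bil r U v) (4 * C * 2 ^ e * sumConst * (α * X + A * x)) := by
  refine ⟨bil_zero_mode r U v, fun σ c hc => ?_⟩
  have hS : Summable fun a : ℤ => 4 * C * (2 ^ e * |(c : ℝ)| ^ (-e)) *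
      (α * X * |(a : ℝ)| ^ (-2 : ℝ) + A * x * |((c - a : ℤ) : ℝ)| ^ (-2 : ℝ)) :=
    ((summable_abs_rpow_neg_two.mul_left _).add ((summable_abs_sub_rpow c).mul_left _)).mul_left _
  rw [bil_eq_tsum hr hp hq hU hv σ hc, norm_mul]
  have h1 := tsum_of_norm_bounded hS.hasSum (norm_bt_le hr hp.1 hq.1 he hep heq hU hU' hv hv' σ hc)
  rw [tsum_mul_left, Summable.tsum_add (summable_abs_rpow_neg_two.mul_left _)
    ((summable_abs_sub_rpow c).mul_left _), tsum_mul_left, tsum_mul_left, tsum_abs_sub_rpow] at h1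
  calc ‖nrm‖ * ‖∑' a, bt r U v σ c a‖ ≤ 1 * ‖∑' a, bt r U v σ c a‖ := by
        gcongr; exact norm_nrm_le
    _ ≤ _ := (one_mul _).le.trans h1
    _ = _ := by simp only [sumConst]; ring

lemma bil_add_left (hr : CoefBd ρ μ C r) (hp : Lv ρ μ p) (hq : Lv ρ μ q)
    (hU : Bd p U α) (hU' : Bd p U' A) (hv : Bd q v x) :
    bil r (U + U') v = bil r U v + bil r U' v := by
  funext σ c
  rcases eq_or_ne c 0 with rfl | hc
  · simp [bil_zero_mode]
  simp only [Pi.add_apply]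
  rw [bil_eq_tsum hr hp hq (hU.add hU') hv σ hc, bil_eq_tsum hr hp hq hU hv σ hc,
    bil_eq_tsum hr hp hq hU' hv σ hc, ← mul_add,
    ← (summable_bt hr hp hq hU hv σ hc).tsum_add (summable_bt hr hp hq hU' hv σ hc)]
  congr 2
  funext a
  simp only [bt, ← Finset.sum_add_distrib, Pi.add_apply]
  exact Finset.sum_congr rfl fun _ _ => Finset.sum_congr rfl fun _ _ => by ring

lemma bil_add_right (hr : CoefBd ρ μ C r) (hp : Lv ρ μ p) (hq : Lv ρ μ q)
    (hU : Bd p U α) (hv : Bd q v x) (hv' : Bd q v' X) :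
    bil r U (v + v') = bil r U v + bil r U v' := by
  funext σ c
  rcases eq_or_ne c 0 with rfl | hc
  · simp [bil_zero_mode]
  simp only [Pi.add_apply]
  rw [bil_eq_tsum hr hp hq hU (hv.add hv') σ hc, bil_eq_tsum hr hp hq hU hv σ hc,
    bil_eq_tsum hr hp hq hU hv' σ hc, ← mul_add,
    ← (summable_bt hr hp hq hU hv σ hc).tsum_add (summable_bt hr hp hq hU hv' σ hc)]
  congr 2
  funext a
  simp only [bt, ← Finset.sum_add_distrib, Pi.add_apply]
  exact Finset.sum_congr rfl fun _ _ => Finset.sum_congr rfl fun _ _ => by ring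

lemma homOp_smul_right (s : HomCoef) (U : Vec) (w : Seq) (c : ℂ) :
    homOp s U (c • w) = c • homOp s U w := by
  funext n
  simp only [homOp, Pi.smul_apply, smul_eq_mul]
  split_ifs
  · simp
  rw [mul_left_comm, ← tsum_mul_left (a := c)]
  congr 2
  funext a
  rw [Finset.mul_sum]
  exact Finset.sum_congr rfl fun _ _ => by ring

lemma bil_smul_right (r : HomMat) (U v : Vec) (c : ℂ) : bil r U (c • v) = c • bil r U v := by
  funext σ
  simp only [bil, Pi.smul_apply, homOp_smul_right, Finset.smul_sum]

lemma bil_zero_right (r : HomMat) (U : Vec) : bil r U 0 = 0 := by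
  simpa using bil_smul_right r U 0 0

lemma bil_sub_right (hr : CoefBd ρ μ C r) (hp : Lv ρ μ p) (hq : Lv ρ μ q)
    (hU : Bd p U α) (hv : Bd q v x) (hv' : Bd q v' X) :
    bil r U (v - v') = bil r U v - bil r U v' := by
  have h := bil_add_right hr hp hq hU hv hv'.neg
  have h2 := bil_smul_right r U v' (-1)
  rw [neg_one_smul, neg_one_smul] at h2
  rw [sub_eq_add_neg, h, h2, sub_eq_add_neg]

/-- Fubini: the double family is dominated by a product of two summable sequences, one in the
frequency and one in the index of the series. -/
lemma bil_tsum (hr : CoefBd ρ μ C r) (hp : Lv ρ μ p) (hq : Lv ρ μ q)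
    (hU : Bd p U α) {f : ℕ → Vec} {b : ℕ → ℝ} (hb : Summable b) (hf : ∀ i, Bd q (f i) (b i)) :
    bil r U (fun σ n => ∑' i, f i σ n) = fun σ n => ∑' i, bil r U (f i) σ n := by
  have hsum : ∀ σ n, Summable fun i => f i σ n := by
    intro σ n
    rcases eq_or_ne n 0 with rfl | hn
    · simp [(hf _).1 σ, summable_zero]
    exact Summable.of_norm_bounded (hb.mul_right _) fun i => (hf i).2 σ n hn
  have hF : Bd q (fun σ n => ∑' i, f i σ n) (∑' i, b i) := by
    refine ⟨fun σ => by simp [(hf _).1 σ], fun σ n hn => ?_⟩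
    rw [← tsum_mul_right]
    exact tsum_of_norm_bounded (hb.mul_right _).hasSum fun i => (hf i).2 σ n hn
  funext σ c
  rcases eq_or_ne c 0 with rfl | hc
  · simp [bil_zero_mode]
  rw [bil_eq_tsum hr hp hq hU hF σ hc]
  have h1 : ∀ i, bil r U (f i) σ c = nrm * ∑' a, bt r U (f i) σ c a := fun i =>
    bil_eq_tsum hr hp hq hU (hf i) σ hc
  simp only [h1]
  rw [tsum_mul_left]
  congr 1
  have h2 : ∀ a, bt r U (fun σ n => ∑' i, f i σ n) σ c a = ∑' i, bt r U (f i) σ c a := by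
    intro a
    simp only [bt]
    have h3 : ∀ σ' ε, Summable fun i => r σ σ' ε a (c - a) * U ε a * f i σ' (c - a) :=
      fun σ' ε => (hsum σ' (c - a)).mul_left _
    rw [Summable.tsum_finsetSum fun σ' _ => summable_sum fun ε _ => h3 σ' ε]
    refine Finset.sum_congr rfl fun σ' _ => ?_
    rw [Summable.tsum_finsetSum fun ε _ => h3 σ' ε]
    exact Finset.sum_congr rfl fun ε _ => tsum_mul_left.symm
  simp only [h2]
  have h4 : Summable fun q : ℤ × ℕ => bt r U (f q.2) σ c q.1 := by
    refine Summable.of_norm_bounded (g := fun q : ℤ × ℕ =>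
      (4 * C * α * (|(q.1 : ℝ)| ^ (-2 : ℝ) + |((c - q.1 : ℤ) : ℝ)| ^ (-2 : ℝ))) * b q.2) ?_ ?_
    · exact (summable_bound c _).mul_of_nonneg hb
        (fun a => by have := hr.1; have := hU.nonneg; simp only [Pi.zero_apply]; positivity)
        (fun i => (hf i).nonneg)
    · intro q
      refine (norm_bt_le' hr hp hq hU (hf q.2) σ hc q.1).trans (le_of_eq (by ring))
  exact h4.tsum_comm.symm

/-- Each summand is a product of three scalars, two of them differentiable; the local sup bounds on
the curves and their derivatives supply the summable majorant for differentiating termwise. -/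
lemma hasDerivWithinAt_bil {I : Set ℝ} (hI : I.OrdConnected) {t : ℝ}
    (ht : t ∈ I) {ε : ℝ} (hε : 0 < ε) {U U' v v' : ℝ → Vec} {B B' : ℝ}
    (hr : CoefBd ρ μ C r) (hp : Lv ρ μ p) (hq : Lv ρ μ q)
    (hdU : ∀ τ ∈ I, ∀ σ n, HasDerivWithinAt (fun τ => U τ σ n) (U' τ σ n) I τ)
    (hdv : ∀ τ ∈ I, ∀ σ n, HasDerivWithinAt (fun τ => v τ σ n) (v' τ σ n) I τ)
    (hU : ∀ τ ∈ I, |τ - t| < ε → Bd p (U τ) B) (hU' : ∀ τ ∈ I, |τ - t| < ε → Bd p (U' τ) B)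
    (hv : ∀ τ ∈ I, |τ - t| < ε → Bd q (v τ) B') (hv' : ∀ τ ∈ I, |τ - t| < ε → Bd q (v' τ) B')
    (σ : Bool) (c : ℤ) :
    HasDerivWithinAt (fun τ => bil r (U τ) (v τ) σ c)
      ((bil r (U' t) (v t) + bil r (U t) (v' t)) σ c) I t := by
  rcases eq_or_ne c 0 with rfl | hc
  · simpa [bil_zero_mode] using hasDerivWithinAt_const t I (0 : ℂ)
  have htt : |t - t| < ε := by simpa using hε
  have e1 : (bil r (U' t) (v t) + bil r (U t) (v' t)) σ c
      = nrm * ∑' a, (bt r (U' t) (v t) σ c a + bt r (U t) (v' t) σ c a) := by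
    simp only [Pi.add_apply]
    rw [bil_eq_tsum hr hp hq (hU' t ht htt) (hv t ht htt) σ hc,
      bil_eq_tsum hr hp hq (hU t ht htt) (hv' t ht htt) σ hc, ← mul_add,
      (summable_bt hr hp hq (hU' t ht htt) (hv t ht htt) σ hc).tsum_add
      (summable_bt hr hp hq (hU t ht htt) (hv' t ht htt) σ hc)]
  rw [e1]
  have hnhd : ∀ᶠ τ in 𝓝[I] t, τ ∈ I ∧ |τ - t| < ε := by
    have : Metric.ball t ε ∈ 𝓝[I] t := mem_nhdsWithin_of_mem_nhds (Metric.ball_mem_nhds t hε)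
    filter_upwards [self_mem_nhdsWithin, this] with τ h1 h2
    exact ⟨h1, by rwa [Metric.mem_ball, Real.dist_eq] at h2⟩
  have hcongr : (fun τ => bil r (U τ) (v τ) σ c)
      =ᶠ[𝓝[I] t] fun τ => nrm * ∑' a, bt r (U τ) (v τ) σ c a := by
    filter_upwards [hnhd] with τ hτ
    exact bil_eq_tsum hr hp hq (hU τ hτ.1 hτ.2) (hv τ hτ.1 hτ.2) σ hc
  refine HasDerivWithinAt.congr_of_eventuallyEq ?_ hcongr
    (bil_eq_tsum hr hp hq (hU t ht htt) (hv t ht htt) σ hc)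
  refine HasDerivWithinAt.const_mul nrm ?_
  refine hasDerivWithinAt_tsum_local hI ht hε (summable_bound c (2 * (4 * C * (B * B'))))
    (f := fun a τ => bt r (U τ) (v τ) σ c a)
    (f' := fun a τ => bt r (U' τ) (v τ) σ c a + bt r (U τ) (v' τ) σ c a) ?_ ?_ ?_
  · intro a τ hτ _
    have : ∀ σ' ε, HasDerivWithinAt (fun τ => r σ σ' ε a (c - a) * U τ ε a * v τ σ' (c - a))
        (r σ σ' ε a (c - a) * U' τ ε a * v τ σ' (c - a)
          + r σ σ' ε a (c - a) * U τ ε a * v' τ σ' (c - a)) I τ := fun σ' ε =>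
      ((hdU τ hτ ε a).const_mul _).mul (hdv τ hτ σ' (c - a))
    simp only [bt, ← Finset.sum_add_distrib]
    exact HasDerivWithinAt.fun_sum fun σ' _ => HasDerivWithinAt.fun_sum fun ε _ => this σ' ε
  · intro a τ hτ hτ'
    have h1 := norm_bt_le' hr hp hq (hU' τ hτ hτ') (hv τ hτ hτ') σ hc a
    have h2 := norm_bt_le' hr hp hq (hU τ hτ hτ') (hv' τ hτ hτ') σ hc a
    refine (norm_add_le _ _).trans ((add_le_add h1 h2).trans (le_of_eq (by ring)))
  · intro τ hτ hτ'
    exact summable_bt hr hp hq (hU τ hτ hτ') (hv τ hτ hτ') σ hc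

end bil

/-! ### Tame operators on jets

The time derivatives of a curve at a given time form a sequence of vectors, its jet. -/

/-- Bounds of a jet. -/
def JB (N : ℕ) (ℓ : ℝ) (u : ℕ → Vec) (x : ℕ → ℝ) : Prop :=
  ∀ j ≤ N, Bd (ℓ - 3 / 2 * j) (u j) (x j)

/-- Weights that measure the size of `U` in low and in high norm. -/
structure Weights (N : ℕ) (a b : ℕ → ℝ) : Prop where
  nonneg : ∀ i ≤ N, 0 ≤ a i
  le_one : ∀ i ≤ N, a i ≤ 1
  le : ∀ i ≤ N, a i ≤ b i
  mono : ∀ i j, i ≤ j → j ≤ N → a i ≤ a j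
  mono' : ∀ i j, i ≤ j → j ≤ N → b i ≤ b j

/-- The weight of a term of degree `d` with all factors in low norm. -/
def wlow (d : ℕ) (a : ℕ → ℝ) : ℕ → ℝ := fun i => a i ^ d

/-- The weight of a term of degree `d` with one factor in high norm. -/
def whigh (d : ℕ) (a b : ℕ → ℝ) : ℕ → ℝ := fun i => a i ^ (d - 1) * b i

/-- Tame operators on jets of order `N`, of degree `d` in `U`, from the level `ℓ` to the level
`ℓ'`. -/
def TameJ (N : ℕ) (τ : ℝ) (a b : ℕ → ℝ) (ℓ ℓ' : ℝ) (d : ℕ) (C : ℝ)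
    (T : (ℕ → Vec) → ℕ → Vec) : Prop :=
  0 ≤ C ∧ ∀ u x X, JB N ℓ u x → JB N (ℓ + τ) u X →
    JB N ℓ' (T u) (C • conv (wlow d a) x) ∧
    JB N (ℓ' + τ) (T u) (C • (conv (wlow d a) X + conv (whigh d a b) x))

namespace JB

variable {N : ℕ} {ℓ ℓ' : ℝ} {u v : ℕ → Vec} {x y : ℕ → ℝ}

lemma nonneg (h : JB N ℓ u x) {i : ℕ} (hi : i ≤ N) : 0 ≤ x i := (h i hi).nonneg

lemma mono (h : JB N ℓ u x) (hxy : ∀ i ≤ N, x i ≤ y i) : JB N ℓ u y :=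
  fun j hj => (h j hj).mono (hxy j hj)

lemma weaken (h : JB N ℓ u x) (hl : ℓ' ≤ ℓ) : JB N ℓ' u x :=
  fun j hj => (h j hj).weaken (by linarith)

lemma add (h : JB N ℓ u x) (h' : JB N ℓ v y) : JB N ℓ (u + v) (x + y) :=
  fun j hj => (h j hj).add (h' j hj)

lemma smul (c : ℂ) (h : JB N ℓ u x) : JB N ℓ (c • u) (‖c‖ • x) :=
  fun j hj => (h j hj).smul c

lemma tsum {f : ℕ → ℕ → Vec} {b : ℕ → ℝ} (hb : Summable b) (hf : ∀ i, JB N ℓ (f i) (b i • x)) :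
    JB N ℓ (fun k σ n => ∑' i, f i k σ n) ((∑' i, b i) • x) := by
  intro k hk
  refine ⟨fun σ => by simp [(hf _ k hk).1 σ], fun σ n hn => ?_⟩
  have := (hb.mul_right (x k * |(n : ℝ)| ^ (-(ℓ - 3 / 2 * (k : ℝ))))).hasSum
  rw [tsum_mul_right] at this
  simp only [Pi.smul_apply, smul_eq_mul]
  rw [mul_assoc]
  refine tsum_of_norm_bounded this fun i => ?_
  have := (hf i k hk).2 σ n hn
  simpa [mul_assoc] using this

end JB

/-! ### Products and convolutions of weights. -/

namespace Weights

variable {N : ℕ} {a b : ℕ → ℝ}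

lemma nonneg' (W : Weights N a b) {i : ℕ} (hi : i ≤ N) : 0 ≤ b i :=
  (W.nonneg i hi).trans (W.le i hi)

lemma wlow_nonneg (W : Weights N a b) (d : ℕ) {i : ℕ} (hi : i ≤ N) : 0 ≤ wlow d a i :=
  pow_nonneg (W.nonneg i hi) d

lemma whigh_nonneg (W : Weights N a b) (d : ℕ) {i : ℕ} (hi : i ≤ N) : 0 ≤ whigh d a b i :=
  mul_nonneg (pow_nonneg (W.nonneg i hi) _) (W.nonneg' hi)

lemma one (N : ℕ) : Weights N 1 1 := by
  constructor <;> simp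

/-- Weights are nondecreasing in the index, so both factors can be moved to the index `i + j`; being
at most one, they also allow the degree to be lowered. -/
lemma pow_mul_pow_le (W : Weights N a b) {d e f i j : ℕ} (hf : f ≤ d + e) (hij : i + j ≤ N) :
    a i ^ d * a j ^ e ≤ a (i + j) ^ f := by
  have h1 := W.nonneg i (by omega)
  have h2 := W.nonneg j (by omega)
  have h3 := W.nonneg _ hij
  calc a i ^ d * a j ^ e ≤ a (i + j) ^ d * a (i + j) ^ e := by
        gcongr
        · exact W.mono _ _ (by omega) hij
        · exact W.mono _ _ (by omega) hij
    _ = a (i + j) ^ (d + e) := (pow_add _ _ _).symm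
    _ ≤ a (i + j) ^ f := pow_le_pow_of_le_one h3 (W.le_one _ hij) hf

lemma conv_wlow (W : Weights N a b) {d e f k : ℕ} (hf : f ≤ d + e) (hk : k ≤ N) :
    conv (wlow d a) (wlow e a) k ≤ (N + 1) * wlow f a k := by
  refine (conv_le_of_mul_le (γ := wlow f a) hk fun i j hij => ?_).trans ?_
  · exact W.pow_mul_pow_le hf hij
  · have := W.wlow_nonneg f hk
    gcongr

/-- In a product only one of the two factors carries the high weight, hence two convolutions, each
with at most `N + 1` terms. -/
lemma conv_whigh (W : Weights N a b) {d e f k : ℕ} (hf : f ≤ d + e) (hk : k ≤ N) :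
    conv (wlow d a) (whigh e a b) k + conv (whigh d a b) (wlow e a) k
      ≤ 2 * (N + 1) * whigh f a b k := by
  have hb := fun {i : ℕ} hi => W.nonneg' (i := i) hi
  have h1 : conv (wlow d a) (whigh e a b) k ≤ (k + 1) * whigh f a b k := by
    refine conv_le_of_mul_le hk fun i j hij => ?_
    have h1 := W.pow_mul_pow_le (d := d) (e := e - 1) (f := f - 1) (by omega) hij
    have h2 := W.mono' j (i + j) (by omega) hij
    have h3 := W.nonneg _ hij
    have h4 := hb (i := j) (by omega)
    calc wlow d a i * whigh e a b j = (a i ^ d * a j ^ (e - 1)) * b j := by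
          simp only [wlow, whigh]; ring
      _ ≤ a (i + j) ^ (f - 1) * b (i + j) := by gcongr
  have h2 : conv (whigh d a b) (wlow e a) k ≤ (k + 1) * whigh f a b k := by
    refine conv_le_of_mul_le hk fun i j hij => ?_
    have h1 := W.pow_mul_pow_le (d := d - 1) (e := e) (f := f - 1) (by omega) hij
    have h2 := W.mono' i (i + j) (by omega) hij
    have h3 := W.nonneg _ hij
    have h4 := hb (i := i) (by omega)
    calc whigh d a b i * wlow e a j = (a i ^ (d - 1) * a j ^ e) * b i := by
          simp only [wlow, whigh]; ring
      _ ≤ a (i + j) ^ (f - 1) * b (i + j) := by gcongr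
  have h3 := W.whigh_nonneg f hk
  have h4 : (k : ℝ) ≤ N := by exact_mod_cast hk
  nlinarith

lemma conv_wlow_nonneg (W : Weights N a b) (d : ℕ) {x : ℕ → ℝ} (hx : ∀ i ≤ N, 0 ≤ x i) {k : ℕ}
    (hk : k ≤ N) : 0 ≤ conv (wlow d a) x k :=
  conv_nonneg (fun _ hi => W.wlow_nonneg d (hi.trans hk)) fun _ hi => hx _ (hi.trans hk)

lemma conv_whigh_nonneg (W : Weights N a b) (d : ℕ) {x : ℕ → ℝ} (hx : ∀ i ≤ N, 0 ≤ x i) {k : ℕ}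
    (hk : k ≤ N) : 0 ≤ conv (whigh d a b) x k :=
  conv_nonneg (fun _ hi => W.whigh_nonneg d (hi.trans hk)) fun _ hi => hx _ (hi.trans hk)

lemma conv_wlow_anti (W : Weights N a b) {d e : ℕ} (he : e ≤ d) {x : ℕ → ℝ}
    (hx : ∀ i ≤ N, 0 ≤ x i) {k : ℕ} (hk : k ≤ N) :
    conv (wlow d a) x k ≤ conv (wlow e a) x k :=
  conv_mono (fun _ hi => W.wlow_nonneg e (hi.trans hk)) (fun _ hi => hx _ (hi.trans hk))
    (fun i hi => pow_le_pow_of_le_one (W.nonneg i (hi.trans hk)) (W.le_one i (hi.trans hk)) he)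
    fun _ _ => le_rfl

lemma conv_whigh_anti (W : Weights N a b) {d e : ℕ} (he : e ≤ d) {x : ℕ → ℝ}
    (hx : ∀ i ≤ N, 0 ≤ x i) {k : ℕ} (hk : k ≤ N) :
    conv (whigh d a b) x k ≤ conv (whigh e a b) x k :=
  conv_mono (fun _ hi => W.whigh_nonneg e (hi.trans hk)) (fun _ hi => hx _ (hi.trans hk))
    (fun i hi => mul_le_mul_of_nonneg_right
      (pow_le_pow_of_le_one (W.nonneg i (hi.trans hk)) (W.le_one i (hi.trans hk)) (by omega))
      (W.nonneg' (hi.trans hk))) fun _ _ => le_rfl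

lemma conv_conv_wlow (W : Weights N a b) {d e f : ℕ} (hf : f ≤ d + e) {x : ℕ → ℝ}
    (hx : ∀ i ≤ N, 0 ≤ x i) {k : ℕ} (hk : k ≤ N) :
    conv (wlow d a) (conv (wlow e a) x) k ≤ (N + 1) * conv (wlow f a) x k := by
  rw [conv_assoc, ← conv_smul_left]
  refine conv_mono (fun i hi => ?_) (fun i hi => hx i (hi.trans hk)) (fun i hi => ?_)
    fun i _ => le_rfl
  · have := W.wlow_nonneg f (hi.trans hk)
    simp only [Pi.smul_apply, smul_eq_mul]; positivity
  · exact W.conv_wlow hf (hi.trans hk)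

lemma conv_conv_whigh (W : Weights N a b) {d e f : ℕ} (hf : f ≤ d + e) {x X : ℕ → ℝ}
    (hx : ∀ i ≤ N, 0 ≤ x i) (hX : ∀ i ≤ N, 0 ≤ X i) {k : ℕ} (hk : k ≤ N) :
    conv (wlow d a) (conv (wlow e a) X + conv (whigh e a b) x) k
      + conv (whigh d a b) (conv (wlow e a) x) k
      ≤ 2 * (N + 1) * (conv (wlow f a) X k + conv (whigh f a b) x k) := by
  have key2 : conv (conv (wlow d a) (whigh e a b)) x k
      + conv (conv (whigh d a b) (wlow e a)) x k ≤ 2 * (N + 1) * conv (whigh f a b) x k := by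
    rw [← conv_smul_left, ← conv_add_left]
    refine conv_mono (fun i hi => ?_) (fun i hi => hx i (hi.trans hk)) (fun i hi => ?_)
      fun i _ => le_rfl
    · have := W.whigh_nonneg f (hi.trans hk)
      simp only [Pi.smul_apply, smul_eq_mul]; positivity
    · exact W.conv_whigh hf (hi.trans hk)
  have key1 := W.conv_conv_wlow hf hX hk
  have h0 := W.conv_wlow_nonneg f hX hk
  have hN : (0 : ℝ) ≤ N := Nat.cast_nonneg N
  rw [conv_add_right, conv_assoc (wlow d a) (whigh e a b), conv_assoc (whigh d a b)]
  have : ((N : ℝ) + 1) * conv (wlow f a) X k ≤ 2 * (N + 1) * conv (wlow f a) X k := by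
    gcongr
    linarith
  linarith

end Weights

/-- The estimates of a jet in terms of weights and of the norms `x`, `X`. -/
def PairJ (N : ℕ) (τ : ℝ) (a b : ℕ → ℝ) (ℓ : ℝ) (d : ℕ) (C : ℝ) (x X : ℕ → ℝ) (D : ℕ → Vec) :
    Prop :=
  JB N ℓ D (C • conv (wlow d a) x) ∧
    JB N (ℓ + τ) D (C • (conv (wlow d a) X + conv (whigh d a b) x))

namespace PairJ

variable {N : ℕ} {τ : ℝ} {a b : ℕ → ℝ} {ℓ ℓ' : ℝ} {d e f : ℕ} {C C' : ℝ} {x X : ℕ → ℝ}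
  {D D' : ℕ → Vec}

lemma mono (W : Weights N a b) (hx : ∀ i ≤ N, 0 ≤ x i) (hX : ∀ i ≤ N, 0 ≤ X i) (h0 : 0 ≤ C)
    (h : PairJ N τ a b ℓ d C x X D) (hl : ℓ' ≤ ℓ) (he : e ≤ d) (hC : C ≤ C') :
    PairJ N τ a b ℓ' e C' x X D := by
  refine ⟨(h.1.mono fun k hk => ?_).weaken hl, (h.2.mono fun k hk => ?_).weaken (by linarith)⟩
  · simp only [Pi.smul_apply, smul_eq_mul]
    exact mul_le_mul hC (W.conv_wlow_anti he hx hk) (W.conv_wlow_nonneg d hx hk) (h0.trans hC)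
  · simp only [Pi.smul_apply, Pi.add_apply, smul_eq_mul]
    exact mul_le_mul hC (add_le_add (W.conv_wlow_anti he hX hk) (W.conv_whigh_anti he hx hk))
      (add_nonneg (W.conv_wlow_nonneg d hX hk) (W.conv_whigh_nonneg d hx hk)) (h0.trans hC)

lemma add (h : PairJ N τ a b ℓ d C x X D) (h' : PairJ N τ a b ℓ d C' x X D') :
    PairJ N τ a b ℓ d (C + C') x X (D + D') := by
  rw [PairJ, add_smul, add_smul]
  exact ⟨h.1.add h'.1, h.2.add h'.2⟩

lemma smul (c : ℂ) (h : PairJ N τ a b ℓ d C x X D) :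
    PairJ N τ a b ℓ d (‖c‖ * C) x X (c • D) := by
  rw [PairJ, mul_smul, mul_smul]
  exact ⟨h.1.smul c, h.2.smul c⟩

end PairJ

/-! ### Calculus of tame operators on jets. -/

namespace TameJ

variable {N : ℕ} {τ : ℝ} {a b : ℕ → ℝ} {ℓ ℓ' ℓ'' ℓ₁ ℓ₁' : ℝ} {d e f : ℕ} {C C' C'' : ℝ}
  {S T : (ℕ → Vec) → ℕ → Vec}

lemma mono (W : Weights N a b) (h : TameJ N τ a b ℓ ℓ' d C T) (hl : ℓ ≤ ℓ₁) (hl' : ℓ₁' ≤ ℓ')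
    (he : e ≤ d) (hC : C ≤ C') : TameJ N τ a b ℓ₁ ℓ₁' e C' T :=
  ⟨h.1.trans hC, fun u x X hx hX => PairJ.mono W (fun _ => hx.nonneg) (fun _ => hX.nonneg) h.1
    (h.2 u x X (hx.weaken hl) (hX.weaken (by linarith))) hl' he hC⟩

/-- By associativity of convolutions only products of weights matter, and weights of degrees `d`,
`e` multiply into a weight of any degree `f ≤ d + e`. The high estimate of the composition has one
high factor, either in the operator or in the jet. -/
lemma comp_pairJ (W : Weights N a b) (hS : TameJ N τ a b ℓ' ℓ'' d C S) {x X : ℕ → ℝ}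
    (hx : ∀ i ≤ N, 0 ≤ x i) (hX : ∀ i ≤ N, 0 ≤ X i) (hC' : 0 ≤ C') {D : ℕ → Vec}
    (hD : PairJ N τ a b ℓ' e C' x X D) (hf : f ≤ d + e) :
    PairJ N τ a b ℓ'' f (2 * (N + 1) * C * C') x X (S D) := by
  have hC := hS.1
  have hN : (0 : ℝ) ≤ N := Nat.cast_nonneg N
  obtain ⟨h3, h4⟩ := hS.2 _ _ _ hD.1 hD.2
  refine ⟨h3.mono fun k hk => ?_, h4.mono fun k hk => ?_⟩
  · simp only [Pi.smul_apply, smul_eq_mul, conv_smul_right]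
    have h1 := W.conv_conv_wlow hf hx hk
    have h2 := W.conv_wlow_nonneg f hx hk
    calc C * (C' * conv (wlow d a) (conv (wlow e a) x) k)
        ≤ C * (C' * ((N + 1) * conv (wlow f a) x k)) := by gcongr
      _ = ((N + 1) * C * C') * conv (wlow f a) x k := by ring
      _ ≤ (2 * (N + 1) * C * C') * conv (wlow f a) x k := by
          gcongr
          linarith
  · simp only [Pi.smul_apply, Pi.add_apply, smul_eq_mul, conv_smul_right]
    have h1 := W.conv_conv_whigh hf hx hX hk
    calc _ = C * C' * (conv (wlow d a) (conv (wlow e a) X + conv (whigh e a b) x) k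
          + conv (whigh d a b) (conv (wlow e a) x) k) := by ring
      _ ≤ C * C' * (2 * (N + 1) * (conv (wlow f a) X k + conv (whigh f a b) x k)) := by gcongr
      _ = _ := by ring

lemma comp (W : Weights N a b) (hS : TameJ N τ a b ℓ' ℓ'' d C S) (hT : TameJ N τ a b ℓ ℓ' e C' T)
    (hf : f ≤ d + e) : TameJ N τ a b ℓ ℓ'' f (2 * (N + 1) * C * C') (fun u => S (T u)) := by
  have hC := hS.1
  have hC' := hT.1
  exact ⟨by positivity, fun u x X hx hX => hS.comp_pairJ W (fun _ => hx.nonneg)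
    (fun _ => hX.nonneg) hC' (hT.2 u x X hx hX) hf⟩

lemma add (hS : TameJ N τ a b ℓ ℓ' d C S) (hT : TameJ N τ a b ℓ ℓ' d C' T) :
    TameJ N τ a b ℓ ℓ' d (C + C') (fun u => S u + T u) := by
  refine ⟨add_nonneg hS.1 hT.1, fun u x X hx hX => ?_⟩
  obtain ⟨h1, h2⟩ := hS.2 u x X hx hX
  obtain ⟨h3, h4⟩ := hT.2 u x X hx hX
  rw [add_smul, add_smul]
  exact ⟨h1.add h3, h2.add h4⟩

lemma smul (c : ℂ) (hS : TameJ N τ a b ℓ ℓ' d C S) :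
    TameJ N τ a b ℓ ℓ' d (‖c‖ * C) (fun u => c • S u) := by
  refine ⟨mul_nonneg (norm_nonneg c) hS.1, fun u x X hx hX => ?_⟩
  obtain ⟨h1, h2⟩ := hS.2 u x X hx hX
  rw [mul_smul, mul_smul]
  exact ⟨h1.smul c, h2.smul c⟩

lemma tsum {T : ℕ → (ℕ → Vec) → ℕ → Vec} {c : ℕ → ℝ} (hc : Summable c)
    (hT : ∀ i, TameJ N τ a b ℓ ℓ' d (c i) (T i)) :
    TameJ N τ a b ℓ ℓ' d (∑' i, c i) (fun u k σ n => ∑' i, T i u k σ n) :=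
  ⟨tsum_nonneg fun i => (hT i).1, fun u x X hx hX =>
    ⟨JB.tsum hc fun i => ((hT i).2 u x X hx hX).1, JB.tsum hc fun i => ((hT i).2 u x X hx hX).2⟩⟩

end TameJ

/-! ### Jets of bilinear operators -/

/-- The jet of `R(U)v`. -/
def gJ (r : HomMat) (V u : ℕ → Vec) : ℕ → Vec := fun k =>
  ∑ p ∈ Finset.HasAntidiagonal.antidiagonal k, (k.choose p.1 : ℂ) • bil r (V p.1) (u p.2)

lemma gJ_zero (r : HomMat) (V u : ℕ → Vec) : gJ r V u 0 = bil r (V 0) (u 0) := by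
  simp [gJ]

/-- The constant in the estimate of the jet of `R(U)v`. -/
def gConst (N : ℕ) (C E : ℝ) : ℝ := 2 ^ N * (4 * C * 2 ^ E * sumConst) * 2

lemma gConst_nonneg {N : ℕ} {C E : ℝ} (hC : 0 ≤ C) : 0 ≤ gConst N C E := by
  have := sumConst_nonneg
  unfold gConst; positivity

lemma Lv.mono {ρ μ p q : ℝ} (h : Lv ρ μ p) (hpq : p ≤ q) : Lv ρ μ q :=
  ⟨h.1.trans hpq, h.2.trans hpq⟩

/-- Leibniz' rule: the losses `3i/2` of the derivatives of `V` and `3j/2` of those of `u` add up to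
the loss `3k/2` granted to the derivative of order `k = i + j`. The condition at `ℓ - 3N/2` makes
every such pair admissible for `bil_bd`. -/
lemma tameJ_gJ {r : HomMat} {ρ μ Cr c τ ℓ ℓV : ℝ} {N d : ℕ} {a b : ℕ → ℝ} {V : ℕ → Vec}
    (hr : CoefBd ρ μ Cr r) (hτ : 0 ≤ τ) (hL : Lv ρ μ (ℓ - 3 / 2 * N)) (hℓ : ℓ ≤ ℓV)
    (hc : 0 ≤ c) (hV : JB N ℓV V (c • wlow d a)) (hV' : JB N (ℓV + τ) V (c • whigh d a b)) :
    TameJ N τ a b ℓ (ℓ + ρ) d (gConst N Cr (ℓ + τ + ρ) * c) (gJ r V) := by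
  have hCr := hr.1
  have hS := sumConst_nonneg
  refine ⟨mul_nonneg (gConst_nonneg hCr) hc, fun u x X hx hX => ?_⟩
  have choose_le : ∀ k ≤ N, ∀ i, ((k.choose i : ℕ) : ℝ) ≤ 2 ^ N := by
    intro k hk i
    have h1 : k.choose i ≤ 2 ^ k := Nat.choose_le_two_pow k i
    have h2 : (2 : ℕ) ^ k ≤ 2 ^ N := Nat.pow_le_pow_right (by norm_num) hk
    exact_mod_cast h1.trans h2
  -- A single estimate serves both levels: `θ = 0` for the low one and `θ = τ` for the high one.
  have main : ∀ (θ : ℝ) (α β y Y : ℕ → ℝ), 0 ≤ θ → θ ≤ τ → JB N ℓV V α → JB N (ℓV + θ) V β →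
      JB N ℓ u y → JB N (ℓ + θ) u Y → JB N (ℓ + ρ + θ) (gJ r V u)
        ((2 ^ N * (4 * Cr * 2 ^ (ℓ + τ + ρ) * sumConst)) • (conv α Y + conv β y)) := by
    intro θ α β y Y hθ hθτ hα hβ hy hY k hk
    have hkN : (k : ℝ) ≤ N := by exact_mod_cast hk
    have h1 : ∀ p ∈ Finset.HasAntidiagonal.antidiagonal k,
        Bd (ℓ + ρ + θ - 3 / 2 * k) ((k.choose p.1 : ℂ) • bil r (V p.1) (u p.2))
        (2 ^ N * (4 * Cr * 2 ^ (ℓ + τ + ρ) * sumConst * (α p.1 * Y p.2 + β p.1 * y p.2))) := by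
      intro p hp
      have hp := Finset.HasAntidiagonal.mem_antidiagonal.1 hp
      have hp1 : p.1 ≤ N := by omega
      have hp2 : p.2 ≤ N := by omega
      have hpk : (p.1 : ℝ) + p.2 = k := by exact_mod_cast hp
      have q1 : (0 : ℝ) ≤ p.1 := Nat.cast_nonneg _
      have q2 : (0 : ℝ) ≤ p.2 := Nat.cast_nonneg _
      have hL2 := hL.2
      have B := bil_bd (e := ℓ + ρ + θ - 3 / 2 * k) (τ := θ) hr
        (p := ℓV - 3 / 2 * p.1) (q := ℓ - 3 / 2 * p.2)
        (hL.mono (by linarith)) (hL.mono (by linarith)) (by linarith) (by linarith)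
        (by linarith) (hα _ hp1) ((hβ _ hp1).weaken (by linarith)) (hy _ hp2)
        ((hY _ hp2).weaken (by linarith))
      refine (B.smul _).mono ?_
      rw [Complex.norm_natCast]
      have n1 := (hα _ hp1).nonneg
      have n2 := (hβ _ hp1).nonneg
      have n3 := (hy _ hp2).nonneg
      have n4 := (hY _ hp2).nonneg
      gcongr
      · exact choose_le k hk _
      · norm_num
      · linarith
    refine (Bd.sum h1).mono (le_of_eq ?_)
    simp only [Pi.smul_apply, Pi.add_apply, smul_eq_mul, conv, ← Finset.mul_sum,
      Finset.sum_add_distrib, mul_assoc]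
  constructor
  -- With `θ = 0` the two tame terms coincide, which accounts for the factor `2` in `gConst`.
  · have := main 0 _ _ x x le_rfl hτ hV (by simpa using hV) hx (by simpa using hx)
    rw [add_zero] at this
    convert this using 1
    funext k
    simp only [Pi.smul_apply, Pi.add_apply, smul_eq_mul, conv_smul_left, gConst]
    ring
  · have := main τ _ _ x X hτ le_rfl hV hV' hx hX
    refine this.mono fun k hk => ?_
    have n1 : 0 ≤ conv (c • wlow d a) X k :=
      conv_nonneg (fun i hi => hV.nonneg (hi.trans hk)) fun i hi => hX.nonneg (hi.trans hk)
    have n2 : 0 ≤ conv (c • whigh d a b) x k :=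
      conv_nonneg (fun i hi => hV'.nonneg (hi.trans hk)) fun i hi => hx.nonneg (hi.trans hk)
    simp only [Pi.smul_apply, Pi.add_apply, smul_eq_mul, gConst]
    rw [mul_assoc _ c, mul_add c, ← conv_smul_left, ← conv_smul_left, mul_assoc _ (2 : ℝ)]
    have : 0 ≤ (2 : ℝ) ^ N * (4 * Cr * 2 ^ (ℓ + τ + ρ) * sumConst) := by positivity
    gcongr
    linarith

/-! ### Exponential series -/

/-- The operator `∑ cᵢ R(U)^i`. -/
def serOp (c : ℕ → ℂ) (r : HomMat) (U v : Vec) : Vec := fun σ n => ∑' i, c i * ((bil r U)^[i] v) σ n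

/-- The jet of `∑ cᵢ R(U)^i v`. -/
def serJ (c : ℕ → ℂ) (r : HomMat) (V u : ℕ → Vec) : ℕ → Vec :=
  fun k σ n => ∑' i, (c i • (gJ r V)^[i] u) k σ n

lemma gJ_iterate_zero (r : HomMat) (V u : ℕ → Vec) (i : ℕ) :
    ((gJ r V)^[i] u) 0 = (bil r (V 0))^[i] (u 0) := by
  induction i with
  | zero => rfl
  | succ i ih => rw [Function.iterate_succ_apply', Function.iterate_succ_apply', gJ_zero, ih]

lemma serJ_zero (c : ℕ → ℂ) (r : HomMat) (V u : ℕ → Vec) :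
    serJ c r V u 0 = serOp c r (V 0) (u 0) := by
  funext σ n
  simp [serJ, serOp, gJ_iterate_zero]

lemma summable_exp (Θ : ℝ) : Summable fun i : ℕ => Θ ^ i / (i.factorial : ℝ) :=
  Real.summable_pow_div_factorial Θ

section exp

variable {N : ℕ} {τ : ℝ} {a b : ℕ → ℝ} {ℓ ρ Θ CG : ℝ} {c : ℕ → ℂ} {r : HomMat} {V : ℕ → Vec}

/-- The gain `ρ` is discarded before each further application, so all powers act between the same
two levels with geometrically growing constants; the factorials of the exponential series absorb
these. -/
lemma tameJ_iterate (W : Weights N a b) (hρ : 0 ≤ ρ)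
    (hG : TameJ N τ a b ℓ (ℓ + ρ) 1 CG (gJ r V)) (hΘ : 2 * (N + 1) * CG ≤ Θ) (hΘ1 : 1 ≤ Θ)
    (i : ℕ) : TameJ N τ a b ℓ (ℓ + ρ) 1 (Θ ^ (i + 1)) ((gJ r V)^[i + 1]) := by
  have hN : (0 : ℝ) ≤ N := Nat.cast_nonneg N
  have hCG := hG.1
  induction i with
  | zero =>
    refine hG.mono W le_rfl le_rfl le_rfl ?_
    rw [zero_add, pow_one]
    nlinarith
  | succ i ih =>
    have h := hG.comp W (ih.mono W le_rfl (show ℓ ≤ ℓ + ρ by linarith) le_rfl le_rfl)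
      (show 1 ≤ 1 + 1 by norm_num)
    have e : (gJ r V)^[i + 1 + 1] = fun u => gJ r V ((gJ r V)^[i + 1] u) := by
      funext u; rw [Function.iterate_succ_apply']
    rw [e]
    refine h.mono W le_rfl le_rfl le_rfl ?_
    rw [pow_succ' Θ (i + 1)]
    gcongr

/-- From the second power on there are at least two factors `V`, hence degree two. -/
lemma tameJ_iterate' (W : Weights N a b) (hρ : 0 ≤ ρ)
    (hG : TameJ N τ a b ℓ (ℓ + ρ) 1 CG (gJ r V)) (hΘ : 2 * (N + 1) * CG ≤ Θ) (hΘ1 : 1 ≤ Θ)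
    (i : ℕ) : TameJ N τ a b ℓ (ℓ + ρ) 2 (Θ ^ (i + 2)) ((gJ r V)^[i + 2]) := by
  have h := hG.comp W ((tameJ_iterate W hρ hG hΘ hΘ1 i).mono W le_rfl
    (show ℓ ≤ ℓ + ρ by linarith) le_rfl le_rfl) (show 2 ≤ 1 + 1 by norm_num)
  have e : (gJ r V)^[i + 2] = fun u => gJ r V ((gJ r V)^[i + 1] u) := by
    funext u; rw [Function.iterate_succ_apply']
  have hN : (0 : ℝ) ≤ N := Nat.cast_nonneg N
  have hCG := hG.1
  rw [e]
  refine h.mono W le_rfl le_rfl le_rfl ?_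
  rw [pow_succ' Θ (i + 1)]
  gcongr

/-- The terms of the exponential series. -/
lemma tameJ_ser_term (W : Weights N a b) (hρ : 0 ≤ ρ)
    (hG : TameJ N τ a b ℓ (ℓ + ρ) 1 CG (gJ r V)) (hΘ : 2 * (N + 1) * CG ≤ Θ) (hΘ1 : 1 ≤ Θ)
    (hc : ∀ i, ‖c i‖ ≤ 1 / (i.factorial : ℝ)) {d : ℕ} (hd1 : 1 ≤ d) (hd2 : d ≤ 2)
    (hcd : ∀ i < d, c i = 0) (i : ℕ) :
    TameJ N τ a b ℓ (ℓ + ρ) d (Θ ^ i / (i.factorial : ℝ)) (fun u => c i • (gJ r V)^[i] u) := by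
  have hΘ0 : 0 ≤ Θ := by linarith
  by_cases hi : i < d
  · simp only [hcd i hi, zero_smul]
    refine ⟨by positivity, fun u x X hx hX => ⟨fun k hk => ?_, fun k hk => ?_⟩⟩
    · refine Bd.zero.mono ?_
      have : 0 ≤ conv (wlow d a) x k :=
        conv_nonneg (fun i hi => W.wlow_nonneg d (hi.trans hk)) fun i hi => hx.nonneg (hi.trans hk)
      simp only [Pi.smul_apply, smul_eq_mul]
      positivity
    · refine Bd.zero.mono ?_
      have : 0 ≤ conv (wlow d a) X k :=
        conv_nonneg (fun i hi => W.wlow_nonneg d (hi.trans hk)) fun i hi => hX.nonneg (hi.trans hk)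
      have : 0 ≤ conv (whigh d a b) x k :=
        conv_nonneg (fun i hi => W.whigh_nonneg d (hi.trans hk)) fun i hi => hx.nonneg (hi.trans hk)
      simp only [Pi.smul_apply, Pi.add_apply, smul_eq_mul]
      positivity
  · have h : TameJ N τ a b ℓ (ℓ + ρ) d (Θ ^ i) ((gJ r V)^[i]) := by
      obtain rfl | rfl : d = 1 ∨ d = 2 := by omega
      · obtain ⟨j, rfl⟩ : ∃ j, i = j + 1 := ⟨i - 1, by omega⟩
        exact tameJ_iterate W hρ hG hΘ hΘ1 j
      · obtain ⟨j, rfl⟩ : ∃ j, i = j + 2 := ⟨i - 2, by omega⟩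
        exact tameJ_iterate' W hρ hG hΘ hΘ1 j
    refine (h.smul (c i)).mono W le_rfl le_rfl le_rfl ?_
    rw [div_eq_mul_one_div, mul_comm]
    gcongr
    exact hc i

lemma tameJ_ser (W : Weights N a b) (hρ : 0 ≤ ρ)
    (hG : TameJ N τ a b ℓ (ℓ + ρ) 1 CG (gJ r V)) (hΘ : 2 * (N + 1) * CG ≤ Θ) (hΘ1 : 1 ≤ Θ)
    (hc : ∀ i, ‖c i‖ ≤ 1 / (i.factorial : ℝ)) {d : ℕ} (hd1 : 1 ≤ d) (hd2 : d ≤ 2)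
    (hcd : ∀ i < d, c i = 0) :
    TameJ N τ a b ℓ (ℓ + ρ) d (∑' i : ℕ, Θ ^ i / (i.factorial : ℝ)) (serJ c r V) :=
  TameJ.tsum (summable_exp Θ) (tameJ_ser_term W hρ hG hΘ hΘ1 hc hd1 hd2 hcd)

/-- The jets of the operators `∑_{i + j = n} G(U)^i Q G(U)^j`. -/
def PJ (r : HomMat) (V : ℕ → Vec) (Q : (ℕ → Vec) → ℕ → Vec) : ℕ → (ℕ → Vec) → ℕ → Vec
  | 0, u => Q u
  | n + 1, u => gJ r V (PJ r V Q n u) + Q ((gJ r V)^[n + 1] u)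

/-- The recursion adds two terms, each bounded by `Θ (2Θ)^{n+1}`, which explains the ratio `2Θ`. `PJ
r V Q 0` is `Q`, of degree one only; every later one contains both `Q` and a factor `G`, hence has
degree two. -/
lemma tameJ_PJ (W : Weights N a b) (hρ : 0 ≤ ρ)
    (hG : TameJ N τ a b ℓ (ℓ + ρ) 1 CG (gJ r V)) (hΘ : 2 * (N + 1) * CG ≤ Θ) (hΘ1 : 1 ≤ Θ)
    {Q : (ℕ → Vec) → ℕ → Vec} {CQ : ℝ} (hQ : TameJ N τ a b ℓ (ℓ + ρ) 1 CQ Q)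
    (hΘQ : 2 * (N + 1) * CQ ≤ Θ) (n : ℕ) :
    TameJ N τ a b ℓ (ℓ + ρ) 1 ((2 * Θ) ^ (n + 1)) (PJ r V Q n) ∧
    TameJ N τ a b ℓ (ℓ + ρ) 2 ((2 * Θ) ^ (n + 2)) (PJ r V Q (n + 1)) := by
  have hN : (0 : ℝ) ≤ N := Nat.cast_nonneg N
  have hCG := hG.1
  have hCQ := hQ.1
  have hl : ℓ ≤ ℓ + ρ := by linarith
  have step : ∀ n, TameJ N τ a b ℓ (ℓ + ρ) 1 ((2 * Θ) ^ (n + 1)) (PJ r V Q n) →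
      TameJ N τ a b ℓ (ℓ + ρ) 2 ((2 * Θ) ^ (n + 2)) (PJ r V Q (n + 1)) := by
    intro n ih
    have h1 := hG.comp W (ih.mono W le_rfl hl le_rfl le_rfl) (show 2 ≤ 1 + 1 by norm_num)
    have h2 := hQ.comp W ((tameJ_iterate W hρ hG hΘ hΘ1 n).mono W le_rfl hl le_rfl le_rfl)
      (show 2 ≤ 1 + 1 by norm_num)
    refine (h1.add h2).mono W le_rfl le_rfl le_rfl ?_
    have e1 : 2 * (N + 1) * CG * (2 * Θ) ^ (n + 1) ≤ Θ * (2 * Θ) ^ (n + 1) := by gcongr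
    have e2 : 2 * (N + 1) * CQ * Θ ^ (n + 1) ≤ Θ * (2 * Θ) ^ (n + 1) := by
      gcongr
      linarith
    calc _ ≤ Θ * (2 * Θ) ^ (n + 1) + Θ * (2 * Θ) ^ (n + 1) := add_le_add e1 e2
      _ = (2 * Θ) ^ (n + 2) := by ring
  have first : ∀ n, TameJ N τ a b ℓ (ℓ + ρ) 1 ((2 * Θ) ^ (n + 1)) (PJ r V Q n) := by
    intro n
    induction n with
    | zero =>
      refine hQ.mono W le_rfl le_rfl le_rfl ?_
      rw [zero_add, pow_one]
      nlinarith
    | succ n ih => exact (step n ih).mono W le_rfl le_rfl (by norm_num) le_rfl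
  exact ⟨first n, step n (first n)⟩

/-- The jets of `∑_n P_{n+1} / (n+2)!`. -/
def PhiJ (r : HomMat) (V : ℕ → Vec) (Q : (ℕ → Vec) → ℕ → Vec) (u : ℕ → Vec) : ℕ → Vec :=
  fun k σ n => ∑' i : ℕ, ((1 / ((i + 2).factorial : ℂ)) • PJ r V Q (i + 1) u) k σ n

lemma tameJ_PhiJ_term (W : Weights N a b) (hρ : 0 ≤ ρ)
    (hG : TameJ N τ a b ℓ (ℓ + ρ) 1 CG (gJ r V)) (hΘ : 2 * (N + 1) * CG ≤ Θ) (hΘ1 : 1 ≤ Θ)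
    {Q : (ℕ → Vec) → ℕ → Vec} {CQ : ℝ} (hQ : TameJ N τ a b ℓ (ℓ + ρ) 1 CQ Q)
    (hΘQ : 2 * (N + 1) * CQ ≤ Θ) (i : ℕ) :
    TameJ N τ a b ℓ (ℓ + ρ) 2 ((2 * Θ) ^ (i + 2) / ((i + 2).factorial : ℝ))
      (fun u => (1 / ((i + 2).factorial : ℂ)) • PJ r V Q (i + 1) u) := by
  refine ((tameJ_PJ W hρ hG hΘ hΘ1 hQ hΘQ i).2.smul _).mono W le_rfl le_rfl le_rfl ?_
  rw [norm_div, norm_one, Complex.norm_natCast, one_div_mul_eq_div]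

lemma tameJ_PhiJ (W : Weights N a b) (hρ : 0 ≤ ρ)
    (hG : TameJ N τ a b ℓ (ℓ + ρ) 1 CG (gJ r V)) (hΘ : 2 * (N + 1) * CG ≤ Θ) (hΘ1 : 1 ≤ Θ)
    {Q : (ℕ → Vec) → ℕ → Vec} {CQ : ℝ} (hQ : TameJ N τ a b ℓ (ℓ + ρ) 1 CQ Q)
    (hΘQ : 2 * (N + 1) * CQ ≤ Θ) :
    TameJ N τ a b ℓ (ℓ + ρ) 2 (∑' i : ℕ, (2 * Θ) ^ (i + 2) / ((i + 2).factorial : ℝ))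
      (PhiJ r V Q) :=
  TameJ.tsum ((summable_nat_add_iff 2).2 (summable_exp (2 * Θ)))
    (tameJ_PhiJ_term W hρ hG hΘ hΘ1 hQ hΘQ)

end exp

/-! ### Curves of jets -/

/-- The curve of jets of a curve: `D (k+1)` is the time derivative of `D k`, and `D k` is locally
bounded at the level `ℓ - 3k/2`. -/
structure CJ (I : Set ℝ) (N : ℕ) (ℓ : ℝ) (D : ℕ → ℝ → Vec) : Prop where
  cont : ∀ k ≤ N, ∀ t ∈ I, ∀ σ n, ContinuousWithinAt (fun τ => D k τ σ n) I t
  der : ∀ k < N, ∀ t ∈ I, ∀ σ n,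
    HasDerivWithinAt (fun τ => D k τ σ n) (D (k + 1) t σ n) I t
  loc : ∀ t ∈ I, ∃ ε > 0, ∃ B, ∀ τ ∈ I, |τ - t| < ε → JB N ℓ (fun k => D k τ) (fun _ => B)

lemma eventually_near {I : Set ℝ} {t ε : ℝ} (hε : 0 < ε) : ∀ᶠ τ in 𝓝[I] t, τ ∈ I ∧ |τ - t| < ε := by
  have : Metric.ball t ε ∈ 𝓝[I] t := mem_nhdsWithin_of_mem_nhds (Metric.ball_mem_nhds t hε)
  filter_upwards [self_mem_nhdsWithin, this] with τ h1 h2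
  exact ⟨h1, by rwa [Metric.mem_ball, Real.dist_eq] at h2⟩

/-- Pascal's rule in abstract form, shared by bilinear operators and by operators with time
dependent kernels. -/
lemma hasDerivWithinAt_leibniz {I : Set ℝ} {t : ℝ} {k : ℕ} {f : ℕ → ℕ → ℝ → ℂ}
    (h : ∀ i j, i + j = k → HasDerivWithinAt (f i j) (f (i + 1) j t + f i (j + 1) t) I t) :
    HasDerivWithinAt
      (fun τ => ∑ p ∈ Finset.HasAntidiagonal.antidiagonal k, (k.choose p.1 : ℂ) * f p.1 p.2 τ)
      (∑ p ∈ Finset.HasAntidiagonal.antidiagonal (k + 1),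
        ((k + 1).choose p.1 : ℂ) * f p.1 p.2 t) I t := by
  have e := Finset.sum_antidiagonal_choose_succ_mul (fun i j => f i j t) k
  rw [e, ← Finset.sum_add_distrib]
  refine HasDerivWithinAt.fun_sum fun p hp => ?_
  have hp := Finset.HasAntidiagonal.mem_antidiagonal.1 hp
  have hc : k.choose p.2 = k.choose p.1 := by
    rw [← hp, Nat.choose_symm_add]
  rw [hc, ← mul_add, add_comm (f p.1 (p.2 + 1) t)]
  exact (h p.1 p.2 hp).const_mul _

section bilcont

variable {r : HomMat} {ρ μ C p q : ℝ}

/-- Needed at the top order `N`, where the jets are continuous but no further derivative is at hand.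
-/
lemma continuousWithinAt_bil {I : Set ℝ} {t : ℝ} (ht : t ∈ I) {ε : ℝ} (hε : 0 < ε)
    {U v : ℝ → Vec} {B B' : ℝ}
    (hr : CoefBd ρ μ C r) (hp : Lv ρ μ p) (hq : Lv ρ μ q)
    (hcU : ∀ σ n, ContinuousWithinAt (fun τ => U τ σ n) I t)
    (hcv : ∀ σ n, ContinuousWithinAt (fun τ => v τ σ n) I t)
    (hU : ∀ τ ∈ I, |τ - t| < ε → Bd p (U τ) B)
    (hv : ∀ τ ∈ I, |τ - t| < ε → Bd q (v τ) B') (σ : Bool) (c : ℤ) :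
    ContinuousWithinAt (fun τ => bil r (U τ) (v τ) σ c) I t := by
  rcases eq_or_ne c 0 with rfl | hc
  · simpa [bil_zero_mode] using continuousWithinAt_const
  have htt : |t - t| < ε := by simpa using hε
  have hcongr : (fun τ => bil r (U τ) (v τ) σ c)
      =ᶠ[𝓝[I] t] fun τ => nrm * ∑' a, bt r (U τ) (v τ) σ c a := by
    filter_upwards [eventually_near hε] with τ hτ
    exact bil_eq_tsum hr hp hq (hU τ hτ.1 hτ.2) (hv τ hτ.1 hτ.2) σ hc
  refine ContinuousWithinAt.congr_of_eventuallyEq ?_ hcongr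
    (bil_eq_tsum hr hp hq (hU t ht htt) (hv t ht htt) σ hc)
  refine ContinuousWithinAt.const_mul ?_ nrm |>.congr (fun _ _ => rfl) rfl
  refine tendsto_tsum_of_dominated_convergence (summable_bound c (4 * C * (B * B'))) ?_ ?_
  · intro a
    have : ContinuousWithinAt (fun τ => bt r (U τ) (v τ) σ c a) I t := by
      simp only [bt]
      exact tendsto_finsetSum _ fun σ' _ => tendsto_finsetSum _ fun ε' _ =>
        (continuousWithinAt_const.mul (hcU ε' a)).mul (hcv σ' (c - a))
    exact this
  · filter_upwards [eventually_near hε] with τ hτ a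
    exact norm_bt_le' hr hp hq (hU τ hτ.1 hτ.2) (hv τ hτ.1 hτ.2) σ hc a

end bilcont

/-! ### Operations on curves of jets. -/

namespace CJ

variable {I : Set ℝ} {N M : ℕ} {ℓ ℓ' : ℝ} {D E : ℕ → ℝ → Vec}

lemma weaken (h : CJ I N ℓ D) (hl : ℓ' ≤ ℓ) : CJ I N ℓ' D :=
  ⟨h.cont, h.der, fun t ht => by
    obtain ⟨ε, hε, B, hB⟩ := h.loc t ht
    exact ⟨ε, hε, B, fun τ hτ hτ' => (hB τ hτ hτ').weaken hl⟩⟩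

lemma of_le (h : CJ I N ℓ D) (hM : M ≤ N) : CJ I M ℓ D :=
  ⟨fun k hk => h.cont k (hk.trans hM), fun k hk => h.der k (hk.trans_le hM), fun t ht => by
    obtain ⟨ε, hε, B, hB⟩ := h.loc t ht
    exact ⟨ε, hε, B, fun τ hτ hτ' j hj => hB τ hτ hτ' j (hj.trans hM)⟩⟩

lemma add (h : CJ I N ℓ D) (h' : CJ I N ℓ E) : CJ I N ℓ (fun k t => D k t + E k t) :=
  ⟨fun k hk t ht σ n => (h.cont k hk t ht σ n).add (h'.cont k hk t ht σ n),
   fun k hk t ht σ n => (h.der k hk t ht σ n).add (h'.der k hk t ht σ n), fun t ht => by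
    obtain ⟨ε, hε, B, hB⟩ := h.loc t ht
    obtain ⟨ε', hε', B', hB'⟩ := h'.loc t ht
    exact ⟨min ε ε', lt_min hε hε', B + B', fun τ hτ hτ' =>
      (hB τ hτ (hτ'.trans_le (min_le_left _ _))).add
        (hB' τ hτ (hτ'.trans_le (min_le_right _ _)))⟩⟩

lemma smul (c : ℂ) (h : CJ I N ℓ D) : CJ I N ℓ (fun k t => c • D k t) :=
  ⟨fun k hk t ht σ n => (h.cont k hk t ht σ n).const_smul c,
   fun k hk t ht σ n => (h.der k hk t ht σ n).const_smul c, fun t ht => by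
    obtain ⟨ε, hε, B, hB⟩ := h.loc t ht
    exact ⟨ε, hε, ‖c‖ * B, fun τ hτ hτ' => (hB τ hτ hτ').smul c⟩⟩

/-- With all weights equal to one and `τ = 0`, a tame estimate is mere boundedness, which is all
that the local, qualitative arguments require. -/
lemma tameJ_unit {r : HomMat} {ρ μ Cr B ℓV : ℝ} {V : ℕ → Vec}
    (hr : CoefBd ρ μ Cr r) (hL : Lv ρ μ (ℓ - 3 / 2 * N)) (hℓ : ℓ ≤ ℓV)
    (hV : JB N ℓV V (fun _ => B)) :
    TameJ N 0 1 1 ℓ (ℓ + ρ) 1 (gConst N Cr (ℓ + 0 + ρ) * B) (gJ r V) := by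
  have hB : 0 ≤ B := hV.nonneg (Nat.zero_le N)
  have h1 : (B • wlow 1 1 : ℕ → ℝ) = fun _ => B := by funext i; simp [wlow]
  have h2 : (B • whigh 1 1 1 : ℕ → ℝ) = fun _ => B := by funext i; simp [whigh]
  exact tameJ_gJ hr le_rfl hL hℓ hB (by rwa [h1]) (by rw [h2]; simpa using hV)

lemma loc_of_tame {T : ℝ → (ℕ → Vec) → ℕ → Vec} {d : ℕ} (hD : CJ I N ℓ D)
    (hT : ∀ t ∈ I, ∃ ε > 0, ∃ C, ∀ τ ∈ I, |τ - t| < ε → TameJ N 0 1 1 ℓ ℓ' d C (T τ)) :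
    ∀ t ∈ I, ∃ ε > 0, ∃ B, ∀ τ ∈ I, |τ - t| < ε →
      JB N ℓ' (T τ (fun k => D k τ)) (fun _ => B) := by
  intro t ht
  obtain ⟨ε, hε, B, hB⟩ := hD.loc t ht
  obtain ⟨ε', hε', C, hC⟩ := hT t ht
  have hB0 : 0 ≤ B := (hB t ht (by simpa using hε)).nonneg (Nat.zero_le N)
  have hC0 : 0 ≤ C := (hC t ht (by simpa using hε')).1
  refine ⟨min ε ε', lt_min hε hε', C * ((N + 1) * B), fun τ hτ hτ' => ?_⟩
  have h1 := hB τ hτ (hτ'.trans_le (min_le_left _ _))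
  have h2 := (hC τ hτ (hτ'.trans_le (min_le_right _ _))).2 _ _ _ h1 (by simpa using h1)
  refine h2.1.mono fun k hk => ?_
  have hk' : (k : ℝ) ≤ N := by exact_mod_cast hk
  simp only [Pi.smul_apply, smul_eq_mul, conv, wlow, Pi.one_apply, one_pow, one_mul,
    Finset.sum_const, Finset.Nat.card_antidiagonal, nsmul_eq_mul, Nat.cast_add, Nat.cast_one]
  gcongr

lemma gJ (hI : I.OrdConnected) {r : HomMat} {ρ μ Cr ℓV : ℝ} {V : ℕ → ℝ → Vec}
    (hr : CoefBd ρ μ Cr r) (hL : Lv ρ μ (ℓ - 3 / 2 * N)) (hℓ : ℓ ≤ ℓV)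
    (hV : CJ I N ℓV V) (hD : CJ I N ℓ D) :
    CJ I N (ℓ + ρ) (fun k t => WaterWaves.gJ r (fun j => V j t) (fun j => D j t) k) := by
  -- All derivatives up to order `N` are bounded at the common level `ℓ - 3N/2`; continuity and
  -- differentiability of coefficients need no sharper level.
  have hlev : ∀ j ≤ N, ℓ - 3 / 2 * N ≤ ℓ - 3 / 2 * (j : ℝ) := fun j hj => by
    have : (j : ℝ) ≤ N := by exact_mod_cast hj
    linarith
  have hVb : ∀ t ∈ I, ∃ ε > 0, ∃ B, ∀ τ ∈ I, |τ - t| < ε → ∀ j ≤ N, Bd (ℓ - 3 / 2 * N) (V j τ) B := by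
    intro t ht
    obtain ⟨ε, hε, B, hB⟩ := hV.loc t ht
    exact ⟨ε, hε, B, fun τ hτ hτ' j hj => (hB τ hτ hτ' j hj).weaken
      (by linarith [hlev j hj])⟩
  have hDb : ∀ t ∈ I, ∃ ε > 0, ∃ B, ∀ τ ∈ I, |τ - t| < ε → ∀ j ≤ N, Bd (ℓ - 3 / 2 * N) (D j τ) B := by
    intro t ht
    obtain ⟨ε, hε, B, hB⟩ := hD.loc t ht
    exact ⟨ε, hε, B, fun τ hτ hτ' j hj => (hB τ hτ hτ' j hj).weaken (hlev j hj)⟩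
  have hboth : ∀ t ∈ I, ∃ ε > 0, ∃ B B', ∀ τ ∈ I, |τ - t| < ε → ∀ j ≤ N,
      Bd (ℓ - 3 / 2 * N) (V j τ) B ∧ Bd (ℓ - 3 / 2 * N) (D j τ) B' := by
    intro t ht
    obtain ⟨ε, hε, B, hB⟩ := hVb t ht
    obtain ⟨ε', hε', B', hB'⟩ := hDb t ht
    exact ⟨min ε ε', lt_min hε hε', B, B', fun τ hτ hτ' j hj =>
      ⟨hB τ hτ (hτ'.trans_le (min_le_left _ _)) j hj,
       hB' τ hτ (hτ'.trans_le (min_le_right _ _)) j hj⟩⟩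
  have e : ∀ k τ σ n, WaterWaves.gJ r (fun j => V j τ) (fun j => D j τ) k σ n =
      ∑ p ∈ Finset.HasAntidiagonal.antidiagonal k,
        (k.choose p.1 : ℂ) * bil r (V p.1 τ) (D p.2 τ) σ n := by
    intro k τ σ n
    simp [WaterWaves.gJ, Finset.sum_apply]
  refine ⟨fun k hk t ht σ n => ?_, fun k hk t ht σ n => ?_, ?_⟩
  · obtain ⟨ε, hε, B, B', hB⟩ := hboth t ht
    simp only [e]
    refine tendsto_finsetSum _ fun p hp => ?_
    have hp := Finset.HasAntidiagonal.mem_antidiagonal.1 hp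
    refine (continuousWithinAt_const (b := (k.choose p.1 : ℂ))).mul ?_
    exact continuousWithinAt_bil ht hε hr hL hL (hV.cont _ (by omega) t ht)
      (hD.cont _ (by omega) t ht) (fun τ hτ hτ' => (hB τ hτ hτ' _ (by omega)).1)
      (fun τ hτ hτ' => (hB τ hτ hτ' _ (by omega)).2) σ n
  · obtain ⟨ε, hε, B, B', hB⟩ := hboth t ht
    simp only [e]
    refine hasDerivWithinAt_leibniz (f := fun i j τ => bil r (V i τ) (D j τ) σ n) fun i j hij => ?_
    exact hasDerivWithinAt_bil hI ht hε hr hL hL (hV.der i (by omega)) (hD.der j (by omega))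
      (fun τ hτ hτ' => (hB τ hτ hτ' _ (by omega)).1)
      (fun τ hτ hτ' => (hB τ hτ hτ' _ (by omega)).1)
      (fun τ hτ hτ' => (hB τ hτ hτ' _ (by omega)).2)
      (fun τ hτ hτ' => (hB τ hτ hτ' _ (by omega)).2) σ n
  · refine hD.loc_of_tame (T := fun τ => WaterWaves.gJ r (fun j => V j τ)) (d := 1)
      fun t ht => ?_
    obtain ⟨ε, hε, B, hB⟩ := hV.loc t ht
    exact ⟨ε, hε, _, fun τ hτ hτ' => tameJ_unit hr hL hℓ (hB τ hτ hτ')⟩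

/-- The summable operator constants times the local bound of the jet dominate the series of each
Fourier coefficient and of its derivatives. -/
lemma tsum (hI : I.OrdConnected) {T : ℕ → ℝ → (ℕ → Vec) → ℕ → Vec} {d : ℕ} (hD : CJ I N ℓ D)
    (hc : ∀ i, CJ I N ℓ' (fun k t => T i t (fun j => D j t) k))
    (hT : ∀ t ∈ I, ∃ ε > 0, ∃ c : ℕ → ℝ, Summable c ∧
      ∀ τ ∈ I, |τ - t| < ε → ∀ i, TameJ N 0 1 1 ℓ ℓ' d (c i) (T i τ)) :
    CJ I N ℓ' (fun k t σ n => ∑' i, T i t (fun j => D j t) k σ n) := by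
  have hbd : ∀ t ∈ I, ∃ ε > 0, ∃ b : ℕ → ℝ, Summable b ∧ ∀ τ ∈ I, |τ - t| < ε → ∀ i,
      JB N ℓ' (T i τ (fun j => D j τ)) (fun _ => b i) := by
    intro t ht
    obtain ⟨ε, hε, B, hB⟩ := hD.loc t ht
    obtain ⟨ε', hε', c, hcs, hc'⟩ := hT t ht
    have hB0 : 0 ≤ B := (hB t ht (by simpa using hε)).nonneg (Nat.zero_le N)
    refine ⟨min ε ε', lt_min hε hε', fun i => c i * ((N + 1) * B), hcs.mul_right _,
      fun τ hτ hτ' i => ?_⟩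
    have h1 := hB τ hτ (hτ'.trans_le (min_le_left _ _))
    have h3 := hc' τ hτ (hτ'.trans_le (min_le_right _ _)) i
    have h2 := h3.2 _ _ _ h1 (by simpa using h1)
    have hc0 := h3.1
    refine h2.1.mono fun k hk => ?_
    have hk' : (k : ℝ) ≤ N := by exact_mod_cast hk
    simp only [Pi.smul_apply, smul_eq_mul, conv, wlow, Pi.one_apply, one_pow, one_mul,
      Finset.sum_const, Finset.Nat.card_antidiagonal, nsmul_eq_mul, Nat.cast_add, Nat.cast_one]
    gcongr
  have zero : ∀ k ≤ N, ∀ t ∈ I, ∀ i σ, T i t (fun j => D j t) k σ 0 = 0 := by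
    intro k hk t ht i σ
    obtain ⟨ε, hε, b, -, hb⟩ := hbd t ht
    exact (hb t ht (by simpa using hε) i k hk).1 σ
  refine ⟨fun k hk t ht σ n => ?_, fun k hk t ht σ n => ?_, fun t ht => ?_⟩
  · rcases eq_or_ne n 0 with rfl | hn
    · refine (continuousWithinAt_const (b := (0 : ℂ))).congr (fun τ hτ => ?_) ?_
      · simp [zero k hk τ hτ]
      · simp [zero k hk t ht]
    obtain ⟨ε, hε, b, hbs, hb⟩ := hbd t ht
    refine tendsto_tsum_of_dominated_convergence
      (hbs.mul_right (|(n : ℝ)| ^ (-(ℓ' - 3 / 2 * (k : ℝ))))) (fun i => (hc i).cont k hk t ht σ n) ?_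
    filter_upwards [eventually_near hε] with τ hτ i
    exact (hb τ hτ.1 hτ.2 i k hk).2 σ n hn
  · rcases eq_or_ne n 0 with rfl | hn
    · have e1 : ∑' i, T i t (fun j => D j t) (k + 1) σ 0 = 0 := by simp [zero (k + 1) hk t ht]
      rw [e1]
      refine (hasDerivWithinAt_const t I (0 : ℂ)).congr (fun τ hτ => ?_) ?_
      · simp [zero k hk.le τ hτ]
      · simp [zero k hk.le t ht]
    obtain ⟨ε, hε, b, hbs, hb⟩ := hbd t ht
    refine hasDerivWithinAt_tsum_local hI ht hε
      (hbs.mul_right (|(n : ℝ)| ^ (-(ℓ' - 3 / 2 * ((k + 1 : ℕ) : ℝ)))))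
      (f := fun i τ => T i τ (fun j => D j τ) k σ n)
      (f' := fun i τ => T i τ (fun j => D j τ) (k + 1) σ n)
      (fun i τ hτ _ => (hc i).der k hk τ hτ σ n)
      (fun i τ hτ hτ' => (hb τ hτ hτ' i (k + 1) hk).2 σ n hn) fun τ hτ hτ' => ?_
    exact Summable.of_norm_bounded (hbs.mul_right _)
      fun i => (hb τ hτ hτ' i k hk.le).2 σ n hn
  · obtain ⟨ε, hε, b, hbs, hb⟩ := hbd t ht
    refine ⟨ε, hε, ∑' i, b i, fun τ hτ hτ' => ?_⟩
    have := JB.tsum (x := fun _ => 1) hbs fun i => (hb τ hτ hτ' i).mono (y := b i • fun _ => 1)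
      (by simp)
    exact this.mono (by simp)

lemma iterate (hI : I.OrdConnected) {r : HomMat} {ρ μ Cr ℓV : ℝ} {V : ℕ → ℝ → Vec} (hρ : 0 ≤ ρ)
    (hr : CoefBd ρ μ Cr r) (hL : Lv ρ μ (ℓ - 3 / 2 * N)) (hℓ : ℓ ≤ ℓV)
    (hV : CJ I N ℓV V) (hD : CJ I N ℓ D) (i : ℕ) :
    CJ I N (ℓ + ρ) (fun k t => (WaterWaves.gJ r (fun j => V j t))^[i + 1] (fun j => D j t) k) := by
  induction i with
  | zero => exact gJ hI hr hL hℓ hV hD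
  | succ i ih =>
    simp only [Function.iterate_succ_apply' _ (i + 1)]
    exact gJ hI hr hL hℓ hV (ih.weaken (by linarith))

/-- The coefficient of degree zero has to vanish: the identity gains no derivative, all positive
powers gain `ρ`. -/
lemma serJ (hI : I.OrdConnected) {r : HomMat} {ρ μ Cr ℓV : ℝ} {V : ℕ → ℝ → Vec} {c : ℕ → ℂ}
    (hρ : 0 ≤ ρ) (hr : CoefBd ρ μ Cr r) (hL : Lv ρ μ (ℓ - 3 / 2 * N)) (hℓ : ℓ ≤ ℓV)
    (hc : ∀ i, ‖c i‖ ≤ 1 / (i.factorial : ℝ)) (hc0 : c 0 = 0)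
    (hV : CJ I N ℓV V) (hD : CJ I N ℓ D) :
    CJ I N (ℓ + ρ) (fun k t => WaterWaves.serJ c r (fun j => V j t) (fun j => D j t) k) := by
  refine tsum hI (T := fun i t u => c i • (WaterWaves.gJ r (fun j => V j t))^[i] u) (d := 1) hD
    (fun i => ?_) fun t ht => ?_
  · rcases i with _ | i
    · refine ⟨fun k _ t _ σ n => ?_, fun k _ t _ σ n => ?_, fun t _ => ⟨1, one_pos, 0, ?_⟩⟩
      · simpa [hc0] using continuousWithinAt_const
      · simpa [hc0] using hasDerivWithinAt_const t I (0 : ℂ)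
      · intro τ _ _ k _
        simpa [hc0] using Bd.zero
    · exact (iterate hI hρ hr hL hℓ hV hD i).smul (c (i + 1))
  · obtain ⟨ε, hε, B, hB⟩ := hV.loc t ht
    set Θ : ℝ := max 1 (2 * (N + 1) * (gConst N Cr (ℓ + 0 + ρ) * B))
    exact ⟨ε, hε, fun i => Θ ^ i / (i.factorial : ℝ), summable_exp Θ, fun τ hτ hτ' i =>
      tameJ_ser_term (Weights.one N) hρ (tameJ_unit hr hL hℓ (hB τ hτ hτ')) (le_max_right _ _)
        (le_max_left _ _) hc le_rfl (by norm_num) (fun j hj => by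
          obtain rfl : j = 0 := by omega
          exact hc0) i⟩

lemma PhiJ (hI : I.OrdConnected) {r : HomMat} {ρ μ Cr ℓV : ℝ} {V : ℕ → ℝ → Vec}
    {Q : ℝ → (ℕ → Vec) → ℕ → Vec}
    (hρ : 0 ≤ ρ) (hr : CoefBd ρ μ Cr r) (hL : Lv ρ μ (ℓ - 3 / 2 * N)) (hℓ : ℓ ≤ ℓV)
    (hV : CJ I N ℓV V) (hD : CJ I N ℓ D)
    (hQ : ∀ E, CJ I N ℓ E → CJ I N (ℓ + ρ) (fun k t => Q t (fun j => E j t) k))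
    (hQ' : ∀ t ∈ I, ∃ ε > 0, ∃ C, ∀ τ ∈ I, |τ - t| < ε → TameJ N 0 1 1 ℓ (ℓ + ρ) 1 C (Q τ)) :
    CJ I N (ℓ + ρ) (fun k t => WaterWaves.PhiJ r (fun j => V j t) (Q t) (fun j => D j t) k) := by
  have hP : ∀ n, CJ I N (ℓ + ρ) (fun k t => PJ r (fun j => V j t) (Q t) n (fun j => D j t) k) := by
    intro n
    induction n with
    | zero => exact hQ D hD
    | succ n ih =>
      exact (gJ hI hr hL hℓ hV (ih.weaken (by linarith))).add
        (hQ _ ((iterate hI hρ hr hL hℓ hV hD n).weaken (by linarith)))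
  refine tsum hI (T := fun i t u => (1 / ((i + 2).factorial : ℂ)) •
    PJ r (fun j => V j t) (Q t) (i + 1) u) (d := 2) hD (fun i => (hP (i + 1)).smul _) fun t ht => ?_
  obtain ⟨ε, hε, B, hB⟩ := hV.loc t ht
  obtain ⟨ε', hε', C, hC⟩ := hQ' t ht
  -- One ratio dominates the constants of both `G` and `Q`.
  set Θ : ℝ := max (max 1 (2 * (N + 1) * (gConst N Cr (ℓ + 0 + ρ) * B))) (2 * (N + 1) * C)
  refine ⟨min ε ε', lt_min hε hε', fun i => (2 * Θ) ^ (i + 2) / ((i + 2).factorial : ℝ),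
    (summable_nat_add_iff 2).2 (summable_exp (2 * Θ)), fun τ hτ hτ' i => ?_⟩
  exact tameJ_PhiJ_term (Weights.one N) hρ
    (tameJ_unit hr hL hℓ (hB τ hτ (hτ'.trans_le (min_le_left _ _))))
    ((le_max_right _ _).trans (le_max_left _ _)) ((le_max_left _ _).trans (le_max_left _ _))
    (hC τ hτ (hτ'.trans_le (min_le_right _ _))) (le_max_right _ _) i

end CJ

/-! ### Curves of jets and the spaces `C^K_*` -/

lemma IsSymmInterval.uniqueDiffOn {I : Set ℝ} (hI : IsSymmInterval I) : UniqueDiffOn ℝ I := by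
  obtain ⟨h1, h2, t, ht, ht0⟩ := hI
  refine uniqueDiffOn_convex h1.convex ⟨0, ?_⟩
  refine interior_mono (h1.out (h2 t ht) ht) ?_
  rw [interior_Icc]
  constructor <;> linarith

lemma MemH.sub {s : ℝ} {u v : Seq} (hu : MemH s u) (hv : MemH s v) : MemH s (u - v) := by
  have hv' : MemH2 s (fun _ => -v) := fun _ => ⟨by simp [hv.1], by simpa using hv.2⟩
  have := (MemH2.add (U := fun _ => u) (fun _ => hu) hv').1 true
  rw [sub_eq_add_neg]
  exact this

/-- Continuity with values in the Sobolev space gives local boundedness of each derivative; finitely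
many orders and components are then treated by taking minima of radii and maxima of bounds. -/
lemma CStar2.cj {I : Set ℝ} (hI : UniqueDiffOn ℝ I) {K : ℕ} {s : ℝ} {U : ℝ → Vec}
    (h : CStar2 I K s U) : CJ I K s (fun k t => dt2 I k U t) := by
  refine ⟨fun k hk t ht σ n => ?_, fun k hk t ht σ n => ?_, fun t ht => ?_⟩
  · exact ((h σ).1 n).continuousOn_iteratedDerivWithin (by exact_mod_cast hk) hI t ht
  · have := ((h σ).1 n).differentiableOn_iteratedDerivWithin (m := k) (by exact_mod_cast hk) hI t ht
    have h2 := this.hasDerivWithinAt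
    rw [← iteratedDerivWithin_succ] at h2
    exact h2
  · have key : ∀ k ≤ K, ∀ σ, ∃ ε > 0, ∃ B, 0 ≤ B ∧ ∀ τ ∈ I, |τ - t| < ε → ∀ n : ℤ, n ≠ 0 →
        ‖dt2 I k U τ σ n‖ ≤ B * |(n : ℝ)| ^ (-(s - 3 / 2 * (k : ℝ))) := by
      intro k hk σ
      obtain ⟨hm, hc⟩ := (h σ).2 k hk
      -- Near `t` the derivative stays at distance less than one from its value at `t`.
      have h1 := (hc t ht).eventually (gt_mem_nhds one_pos)
      obtain ⟨ε, hε, hball⟩ := Metric.mem_nhdsWithin_iff.1 h1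
      refine ⟨ε, hε, 1 + normH (s - 3 / 2 * k) (dt I k (fun t => U t σ) t),
        add_nonneg zero_le_one (normH_nonneg _ _), fun τ hτ hτ' n hn => ?_⟩
      have h2 : normH (s - 3 / 2 * k) (dt I k (fun t => U t σ) τ - dt I k (fun t => U t σ) t) < 1 :=
        hball ⟨by rwa [Metric.mem_ball, Real.dist_eq], hτ⟩
      have m3 := (hm τ hτ).sub (hm t ht)
      have h3 := m3.coeff_le hn
      have h4 := (hm t ht).coeff_le hn
      have h5 : ‖dt I k (fun t => U t σ) τ n‖ ≤
          ‖(dt I k (fun t => U t σ) τ - dt I k (fun t => U t σ) t) n‖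
            + ‖dt I k (fun t => U t σ) t n‖ := by
        have := norm_add_le ((dt I k (fun t => U t σ) τ - dt I k (fun t => U t σ) t) n)
          (dt I k (fun t => U t σ) t n)
        simpa using this
      have h6 : 0 ≤ |(n : ℝ)| ^ (-(s - 3 / 2 * (k : ℝ))) := by positivity
      calc ‖dt2 I k U τ σ n‖ = ‖dt I k (fun t => U t σ) τ n‖ := rfl
        _ ≤ _ := h5
        _ ≤ _ := by nlinarith
    have key2 : ∀ M ≤ K, ∃ ε > 0, ∃ B, ∀ τ ∈ I, |τ - t| < ε → ∀ k ≤ M, ∀ σ, ∀ n : ℤ, n ≠ 0 →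
        ‖dt2 I k U τ σ n‖ ≤ B * |(n : ℝ)| ^ (-(s - 3 / 2 * (k : ℝ))) := by
      intro M
      have comb : ∀ k ≤ K, ∃ ε > 0, ∃ B, 0 ≤ B ∧ ∀ τ ∈ I, |τ - t| < ε → ∀ σ, ∀ n : ℤ, n ≠ 0 →
          ‖dt2 I k U τ σ n‖ ≤ B * |(n : ℝ)| ^ (-(s - 3 / 2 * (k : ℝ))) := by
        intro k hk
        obtain ⟨ε, hε, B, hB0, hB⟩ := key k hk true
        obtain ⟨ε', hε', B', hB0', hB'⟩ := key k hk false
        refine ⟨min ε ε', lt_min hε hε', max B B', hB0.trans (le_max_left _ _),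
          fun τ hτ hτ' σ n hn => ?_⟩
        cases σ
        · refine (hB' τ hτ (hτ'.trans_le (min_le_right _ _)) n hn).trans ?_
          gcongr; exact le_max_right _ _
        · refine (hB τ hτ (hτ'.trans_le (min_le_left _ _)) n hn).trans ?_
          gcongr; exact le_max_left _ _
      induction M with
      | zero =>
        intro h0
        obtain ⟨ε, hε, B, hB0, hB⟩ := comb 0 h0
        exact ⟨ε, hε, B, fun τ hτ hτ' k hk => by
          obtain rfl : k = 0 := by omega
          exact hB τ hτ hτ'⟩
      | succ M ih =>
        intro hM
        obtain ⟨ε, hε, B, hB⟩ := ih (by omega)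
        obtain ⟨ε', hε', B', hB0', hB'⟩ := comb (M + 1) hM
        refine ⟨min ε ε', lt_min hε hε', max B B', fun τ hτ hτ' k hk σ n hn => ?_⟩
        rcases Nat.lt_or_ge k (M + 1) with hk' | hk'
        · refine (hB τ hτ (hτ'.trans_le (min_le_left _ _)) k (by omega) σ n hn).trans ?_
          gcongr; exact le_max_left _ _
        · obtain rfl : k = M + 1 := by omega
          refine (hB' τ hτ (hτ'.trans_le (min_le_right _ _)) σ n hn).trans ?_
          gcongr; exact le_max_right _ _
    obtain ⟨ε, hε, B, hB⟩ := key2 K le_rfl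
    exact ⟨ε, hε, B, fun τ hτ hτ' k hk =>
      ⟨fun σ => (((h σ).2 k hk).1 τ hτ).1, fun σ n hn => hB τ hτ hτ' k hk σ n hn⟩⟩

lemma CJ.dt2_eq {I : Set ℝ} (hI : UniqueDiffOn ℝ I) {N : ℕ} {ℓ : ℝ} {D : ℕ → ℝ → Vec}
    (h : CJ I N ℓ D) {U : ℝ → Vec} (hU : ∀ t ∈ I, U t = D 0 t) {k : ℕ} (hk : k ≤ N) {t : ℝ}
    (ht : t ∈ I) : dt2 I k U t = D k t := by
  funext σ n
  simp only [dt2, dt]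
  induction k generalizing t with
  | zero => simp [iteratedDerivWithin_zero, hU t ht]
  | succ k ih =>
    rw [iteratedDerivWithin_succ]
    refine HasDerivWithinAt.derivWithin ?_ (hI t ht)
    exact (h.der k hk t ht σ n).congr (fun τ hτ => ih (by omega) hτ) (ih (by omega) ht)

/-- Coefficientwise continuity together with a local sup bound one derivative higher implies
continuity in the Sobolev norm, by dominated convergence. -/
lemma CJ.cstar2 {I : Set ℝ} (hI : UniqueDiffOn ℝ I) {N : ℕ} {s : ℝ} {D : ℕ → ℝ → Vec}
    (h : CJ I N (s + 1) D) {U : ℝ → Vec} (hU : ∀ t ∈ I, U t = D 0 t) : CStar2 I N s U := by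
  have e : ∀ k ≤ N, ∀ t ∈ I, ∀ σ, dt I k (fun t => U t σ) t = D k t σ := fun k hk t ht σ =>
    congrFun (h.dt2_eq hI hU hk ht) σ
  have e' : ∀ k ≤ N, ∀ t ∈ I, ∀ σ n, iteratedDerivWithin k (fun t => U t σ n) I t = D k t σ n :=
    fun k hk t ht σ n => congrFun (e k hk t ht σ) n
  intro σ
  refine ⟨fun n => ?_, fun k hk => ⟨fun t ht => ?_, fun t₀ ht₀ => ?_⟩⟩
  · rw [contDiffOn_nat_iff_continuousOn_differentiableOn_deriv hI]
    refine ⟨fun k hk => ?_, fun k hk => ?_⟩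
    · have : ContinuousOn (fun t => D k t σ n) I := fun t ht => h.cont k hk t ht σ n
      exact this.congr fun t ht => e' k hk t ht σ n
    · have : DifferentiableOn ℝ (fun t => D k t σ n) I := fun t ht =>
        (h.der k hk t ht σ n).differentiableWithinAt
      exact this.congr fun t ht => e' k hk.le t ht σ n
  · rw [e k hk t ht σ]
    obtain ⟨ε, hε, B, hB⟩ := h.loc t ht
    have := (hB t ht (by simpa using hε) k hk).weaken
      (show s - 3 / 2 * (k : ℝ) + 1 ≤ s + 1 - 3 / 2 * k by linarith)
    exact this.memH2 σ
  · obtain ⟨ε, hε, B, hB⟩ := h.loc t₀ ht₀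
    have hb : ∀ τ ∈ I, |τ - t₀| < ε → Bd (s - 3 / 2 * (k : ℝ) + 1) (D k τ) B := fun τ hτ hτ' =>
      (hB τ hτ hτ' k hk).weaken (by linarith)
    have hb0 := hb t₀ ht₀ (by simpa using hε)
    have h1 : Tendsto (fun t => ∑' n : ℤ, |(n : ℝ)| ^ (2 * (s - 3 / 2 * (k : ℝ))) *
        ‖D k t σ n - D k t₀ σ n‖ ^ 2) (𝓝[I] t₀) (𝓝 (∑' _ : ℤ, (0 : ℝ))) := by
      refine tendsto_tsum_of_dominated_convergence
        (bound := fun n : ℤ => (B + B) ^ 2 * |(n : ℝ)| ^ (-2 : ℝ))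
        (summable_abs_rpow_neg_two.mul_left _) ?_ ?_
      · intro n
        have hc := h.cont k hk t₀ ht₀ σ n
        have : Tendsto (fun t => ‖D k t σ n - D k t₀ σ n‖) (𝓝[I] t₀) (𝓝 0) :=
          tendsto_iff_norm_sub_tendsto_zero.1 hc
        simpa using (this.pow 2).const_mul (|(n : ℝ)| ^ (2 * (s - 3 / 2 * (k : ℝ))))
      · filter_upwards [eventually_near hε] with τ hτ n
        rcases eq_or_ne n 0 with rfl | hn
        · rw [(hb τ hτ.1 hτ.2).1, hb0.1, sub_zero, norm_zero, zero_pow two_ne_zero, mul_zero,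
            norm_zero]
          positivity
        have hp := abs_cast_pos hn
        have h2 := ((hb τ hτ.1 hτ.2).sub hb0).2 σ n hn
        simp only [Pi.sub_apply] at h2
        rw [Real.norm_of_nonneg (by positivity)]
        calc |(n : ℝ)| ^ (2 * (s - 3 / 2 * (k : ℝ))) * ‖D k τ σ n - D k t₀ σ n‖ ^ 2
            ≤ |(n : ℝ)| ^ (2 * (s - 3 / 2 * (k : ℝ))) *
              ((B + B) * |(n : ℝ)| ^ (-(s - 3 / 2 * (k : ℝ) + 1))) ^ 2 := by gcongr
          _ = (B + B) ^ 2 * |(n : ℝ)| ^ (-2 : ℝ) := by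
            rw [mul_pow, ← Real.rpow_natCast (|(n : ℝ)| ^ (-(s - 3 / 2 * (k : ℝ) + 1))),
              ← Real.rpow_mul hp.le, mul_left_comm, ← Real.rpow_add hp]
            congr 2
            push_cast; ring
    have h2 := (Real.continuous_sqrt.tendsto _).comp h1
    simp only [tsum_zero, Real.sqrt_zero] at h2
    refine h2.congr' ?_
    filter_upwards [self_mem_nhdsWithin] with τ hτ
    rw [e k hk τ hτ σ, e k hk t₀ ht₀ σ]
    rfl

/-! ### Monotonicity of the spaces and of the norms of curves -/

section curves

variable {I : Set ℝ} {K M : ℕ} {s s' r r' : ℝ} {U : ℝ → Vec} {t : ℝ}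

lemma CStar.mono {u : ℝ → Seq} (h : CStar I K s u) (hM : M ≤ K) (hs : s' ≤ s) :
    CStar I M s' u := by
  refine ⟨fun n => (h.1 n).of_le (by exact_mod_cast hM), fun k hk => ?_⟩
  obtain ⟨h1, h2⟩ := h.2 k (hk.trans hM)
  have hl : s' - 3 / 2 * (k : ℝ) ≤ s - 3 / 2 * k := by linarith
  refine ⟨fun t ht => ((h1 t ht).mono hl).1, fun t ht => ?_⟩
  refine squeeze_zero' (Eventually.of_forall fun _ => normH_nonneg _ _) ?_ (h2 t ht)
  filter_upwards [self_mem_nhdsWithin] with τ hτ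
  exact (((h1 τ hτ).sub (h1 t ht)).mono hl).2

lemma CStar2.mono (h : CStar2 I K s U) (hM : M ≤ K) (hs : s' ≤ s) : CStar2 I M s' U :=
  fun σ => (h σ).mono hM hs

lemma CStar2.memH2 (h : CStar2 I K s U) {k : ℕ} (hk : k ≤ K) (ht : t ∈ I) :
    MemH2 (s - 3 / 2 * k) (dt2 I k U t) := fun σ => ((h σ).2 k hk).1 t ht

lemma dt2_zero (I : Set ℝ) (U : ℝ → Vec) (t : ℝ) : dt2 I 0 U t = U t := by
  funext σ n; simp [dt2, dt]

lemma CStar2.memH2_self (h : CStar2 I K s U) (ht : t ∈ I) : MemH2 s (U t) := by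
  simpa [dt2_zero] using h.memH2 (Nat.zero_le K) ht

lemma normK2_nonneg (I : Set ℝ) (K : ℕ) (s : ℝ) (U : ℝ → Vec) (t : ℝ) : 0 ≤ normK2 I K s U t :=
  Finset.sum_nonneg fun _ _ => normH2_nonneg _ _

lemma normK2_mono_left (I : Set ℝ) (s : ℝ) (U : ℝ → Vec) (t : ℝ) (hM : M ≤ K) :
    normK2 I M s U t ≤ normK2 I K s U t :=
  Finset.sum_le_sum_of_subset_of_nonneg (Finset.range_mono (by omega))
    fun _ _ _ => normH2_nonneg _ _

lemma normH2_le_normK2 (I : Set ℝ) (s : ℝ) (U : ℝ → Vec) (t : ℝ) {k : ℕ} (hk : k ≤ K) :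
    normH2 (s - 3 / 2 * k) (dt2 I k U t) ≤ normK2 I K s U t :=
  Finset.single_le_sum (f := fun k : ℕ => normH2 (s - 3 / 2 * k) (dt2 I k U t))
    (fun _ _ => normH2_nonneg _ _) (Finset.mem_range.2 (by omega))

lemma CStar2.normK2_mono (h : CStar2 I K s U) (hM : M ≤ K) (hs : s' ≤ s) (ht : t ∈ I) :
    normK2 I M s' U t ≤ normK2 I M s U t :=
  Finset.sum_le_sum fun k hk => by
    have : k ≤ K := by have := Finset.mem_range.1 hk; omega
    exact (h.memH2 this ht).normH2_mono (by linarith)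

lemma normK_le_normK2 (I : Set ℝ) (K : ℕ) (s : ℝ) (U : ℝ → Vec) (t : ℝ) (σ : Bool) :
    normK I K s (fun τ => U τ σ) t ≤ normK2 I K s U t :=
  Finset.sum_le_sum fun _ _ => normH_le_normH2 _ (dt2 I _ U t) σ

lemma InBall.mono (h : InBall I K s r U) (hs : s' ≤ s) (hr : r ≤ r') : InBall I K s' r' U := by
  obtain ⟨h1, b, hb, h2⟩ := h
  exact ⟨h1.mono le_rfl hs, b, hb.trans_le hr, fun t ht =>
    (h1.normK2_mono le_rfl hs ht).trans (h2 t ht)⟩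

lemma InBall.lt (h : InBall I K s r U) (ht : t ∈ I) : normK2 I K s U t < r := by
  obtain ⟨h1, b, hb, h2⟩ := h
  exact (h2 t ht).trans_lt hb

lemma CStar2.jb (h : CStar2 I K s U) (ht : t ∈ I) :
    JB K s (fun k => dt2 I k U t) (fun k => normK2 I k s U t) := fun _ hk =>
  (h.memH2 hk ht).bd.mono (normH2_le_normK2 I s U t le_rfl)

end curves

lemma exists_pos_le {ι : Type*} [Finite ι] {f : ι → ℝ} (hf : ∀ i, 0 < f i) :
    ∃ r > 0, ∀ i, r ≤ f i := by
  cases isEmpty_or_nonempty ι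
  · exact ⟨1, one_pos, fun i => isEmptyElim i⟩
  · obtain ⟨i, hi⟩ := Finite.exists_min f
    exact ⟨f i, hf i, hi⟩

lemma exists_nonneg_ge {ι : Type*} [Finite ι] (f : ι → ℝ) : ∃ C ≥ 0, ∀ i, f i ≤ C := by
  obtain ⟨C, hC⟩ := (Set.finite_range f).bddAbove
  exact ⟨max C 0, le_max_right _ _, fun i => (hC ⟨i, rfl⟩).trans (le_max_left _ _)⟩

/-! ### Matrices of non-homogeneous operators -/

/-- The jet of `t ↦ M(V; t)[u(t)]`. -/
def matJ (I : Set ℝ) (M : OpMat) (V u : ℝ → Vec) : ℕ → ℝ → Vec := fun k t =>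
  dt2 I k (fun τ σ => M σ true V τ (u τ true)) t + dt2 I k (fun τ σ => M σ false V τ (u τ false)) t

lemma matJ_zero (I : Set ℝ) (M : OpMat) (V u : ℝ → Vec) (t : ℝ) :
    matJ I M V u 0 t = act M V t (u t) := by
  funext σ
  simp [matJ, dt2_zero, act]

/-- The class bounds scalar entries with constants of their own; the maximum of the constants and
the minimum of the radii serve the whole matrix. `matJ` keeps the two columns apart, so that each is
differentiated as a curve of its own. -/
lemma IsNonhomMat.tame {I : Set ℝ} (hI : UniqueDiffOn ℝ I) {γ r s₁ : ℝ} {K K' : ℕ} {M : OpMat}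
    (hM : IsNonhomMat I γ K K' 2 r s₁ M) {s : ℝ} (hs : s₁ ≤ s) :
    ∃ C ≥ (0 : ℝ), ∃ rs > 0, rs < r ∧ ∀ V, InBall I K s₁ rs V → CStar2 I K s V →
      ∀ u, CStar2 I K s u → CJ I (K - K') (s + γ) (matJ I M V u) ∧
      ∀ t ∈ I, JB (K - K') (s + γ) (fun k => matJ I M V u k t)
        (C • (conv (wlow 2 fun j => normK2 I (j + K') s₁ V t) (fun j => normK2 I j s u t)
          + conv (whigh 2 (fun j => normK2 I (j + K') s₁ V t) fun j => normK2 I (j + K') s V t)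
            (fun j => normK2 I j s₁ u t))) := by
  have h := fun q : Bool × Bool => (hM q.1 q.2).2 s hs
  choose C hC rs hrs hrr H using h
  obtain ⟨C₀, hC₀, hC₀'⟩ := exists_nonneg_ge C
  obtain ⟨r₀, hr₀, hr₀'⟩ := exists_pos_le hrs
  -- One factor `2` comes from the two components of the output, the sum from the two columns.
  refine ⟨2 * C₀ + 2 * C₀, by positivity, r₀, hr₀, (hr₀' (true, true)).trans_lt (hrr _),
    fun V hV hVs u hu => ?_⟩
  have hc : ∀ σ', CStar2 I (K - K') (s + γ) (fun τ σ => M σ σ' V τ (u τ σ')) := fun σ' σ =>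
    (H (σ, σ') (M σ σ') rfl V (hV.mono le_rfl (hr₀' _)) hVs _ (hu σ')).1
  refine ⟨((hc true).cj hI).add ((hc false).cj hI), fun t ht => ?_⟩
  set y : ℕ → ℝ := conv (wlow 2 fun j => normK2 I (j + K') s₁ V t) (fun j => normK2 I j s u t)
          + conv (whigh 2 (fun j => normK2 I (j + K') s₁ V t) fun j => normK2 I (j + K') s V t)
            (fun j => normK2 I j s₁ u t) with hy
  have key : ∀ σ', JB (K - K') (s + γ) (fun k => dt2 I k (fun τ σ => M σ σ' V τ (u τ σ')) t)
      ((2 * C₀) • y) := by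
    intro σ' k hk
    have hm : MemH2 (s + γ - 3 / 2 * k) (dt2 I k (fun τ σ => M σ σ' V τ (u τ σ')) t) :=
      (hc σ').memH2 hk ht
    refine hm.bd.mono ?_
    simp only [Pi.smul_apply, smul_eq_mul]
    rw [mul_assoc]
    refine normH2_le fun σ => ?_
    have := (H (σ, σ') (M σ σ') rfl V (hV.mono le_rfl (hr₀' _)) hVs _ (hu σ')).2 k hk t ht
    have e : s - 3 / 2 * (k : ℝ) + γ = s + γ - 3 / 2 * k := by ring
    rw [e] at this
    refine this.trans ?_
    simp only [hy, Pi.add_apply, conv, wlow, whigh, ← Finset.sum_add_distrib, Finset.mul_sum]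
    refine Finset.sum_le_sum fun p _ => ?_
    have e1 := normK_le_normK2 I p.2 s u t σ'
    have e2 := normK_le_normK2 I p.2 s₁ u t σ'
    have n1 := normK2_nonneg I (p.1 + K') s₁ V t
    have n2 := normK2_nonneg I (p.1 + K') s V t
    have n3 : 0 ≤ normK I p.2 s (fun τ => u τ σ') t :=
      Finset.sum_nonneg fun _ _ => normH_nonneg _ _
    have n4 : 0 ≤ normK I p.2 s₁ (fun τ => u τ σ') t :=
      Finset.sum_nonneg fun _ _ => normH_nonneg _ _
    have h1 := hC₀' (σ, σ')
    calc _ ≤ C₀ * (normK2 I p.2 s u t * normK2 I (p.1 + K') s₁ V t ^ 2 +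
          normK2 I p.2 s₁ u t * normK2 I (p.1 + K') s₁ V t ^ (2 - 1) *
            normK2 I (p.1 + K') s V t) := by gcongr
      _ = _ := by ring
  have := (key true).add (key false)
  rw [← add_smul] at this
  exact this

/-! ### Operators given by kernels -/

/-- Bounds of kernels that are supported where the frequencies are comparable. -/
def KB (c : ℝ) (κ : Bool → Bool → ℤ → ℤ → ℂ) : Prop :=
  ∀ σ σ' (n j : ℤ), n ≠ 0 → j ≠ 0 →
    ‖κ σ σ' n j‖ ≤ c * |(j : ℝ)| ^ (3 / 2 : ℝ) ∧ (5 * |(j : ℝ)| < |(n : ℝ)| → κ σ σ' n j = 0)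

/-- The frequencies `j ≠ 0` with `|j| ≤ 5|n|`. -/
def freq (n : ℤ) : Finset ℤ := (Finset.Icc (-(5 * |n|)) (5 * |n|)).erase 0

/-- The operator with kernel `κ`. -/
def kerOp (κ : Bool → Bool → ℤ → ℤ → ℂ) (v : Vec) : Vec := fun σ n =>
  if n = 0 then 0 else ∑ σ', ∑ j ∈ freq n, κ σ σ' n j * v σ' j

lemma mem_freq {n j : ℤ} : j ∈ freq n ↔ j ≠ 0 ∧ |j| ≤ 5 * |n| := by
  rw [freq, Finset.mem_erase, Finset.mem_Icc, abs_le]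

lemma card_freq_le (n : ℤ) : ((freq n).card : ℝ) ≤ 10 * |(n : ℝ)| := by
  have h0 : (0 : ℤ) ∈ Finset.Icc (-(5 * |n|)) (5 * |n|) := by
    rw [Finset.mem_Icc]; constructor <;> nlinarith [abs_nonneg n]
  have h1 : ((freq n).card : ℤ) = 10 * |n| := by
    rw [freq, Finset.card_erase_of_mem h0, Int.card_Icc]
    have := abs_nonneg n
    omega
  have : ((freq n).card : ℝ) = ((10 * |n| : ℤ) : ℝ) := by exact_mod_cast h1
  rw [this]; push_cast; exact le_rfl

/-- The exponent may have either sign, since Sobolev levels act as negative powers. -/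
lemma rpow_comparable {x y e : ℝ} (hx : 0 < x) (hy : 0 < y) (hxy : x ≤ 5 * y) (hyx : y ≤ 5 * x) :
    x ^ e ≤ 5 ^ |e| * y ^ e := by
  rcases le_total 0 e with he | he
  · rw [abs_of_nonneg he, ← Real.mul_rpow (by norm_num) hy.le]
    exact Real.rpow_le_rpow hx.le hxy he
  · rw [abs_of_nonpos he]
    have h1 : (5 * x) ^ e ≤ y ^ e := Real.rpow_le_rpow_of_nonpos hy hyx he
    rw [Real.mul_rpow (by norm_num) hx.le] at h1
    calc x ^ e = 5 ^ (-e) * (5 ^ e * x ^ e) := by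
          rw [← mul_assoc, ← Real.rpow_add (by norm_num)]; simp
      _ ≤ 5 ^ (-e) * y ^ e := by gcongr

/-- Of the loss `5/2`, the order of the kernel accounts for `3/2` and the at most `10|n|` input
frequencies for `1`. Comparability of `n` and `j` allows the power of `|j|` to be replaced by one of
`|n|`. -/
lemma kerOp_bd {κ : Bool → Bool → ℤ → ℤ → ℂ} {c : ℝ} (hc : 0 ≤ c) (hκ : KB c κ) {q x : ℝ}
    {v : Vec} (hv : Bd q v x) :
    Bd (q - 5 / 2) (kerOp κ v) (20 * 5 ^ |3 / 2 - q| * c * x) := by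
  have hx := hv.nonneg
  refine ⟨fun σ => by simp [kerOp], fun σ n hn => ?_⟩
  have hn0 := abs_cast_pos hn
  have hT : ∀ σ', ∀ j ∈ freq n, ‖κ σ σ' n j * v σ' j‖ ≤
      c * x * (5 ^ |3 / 2 - q| * |(n : ℝ)| ^ (3 / 2 - q)) := by
    intro σ' j hj
    obtain ⟨hj0, hj⟩ := mem_freq.1 hj
    have hjp := abs_cast_pos hj0
    obtain ⟨h1, h2⟩ := hκ σ σ' n j hn hj0
    by_cases hcase : 5 * |(j : ℝ)| < |(n : ℝ)|
    · rw [h2 hcase, zero_mul, norm_zero]; positivity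
    have hj' : |(j : ℝ)| ≤ 5 * |(n : ℝ)| := by exact_mod_cast hj
    calc ‖κ σ σ' n j * v σ' j‖ ≤ (c * |(j : ℝ)| ^ (3 / 2 : ℝ)) * (x * |(j : ℝ)| ^ (-q)) := by
          rw [norm_mul]
          exact mul_le_mul h1 (hv.2 σ' j hj0) (norm_nonneg _) (by positivity)
      _ = c * x * |(j : ℝ)| ^ (3 / 2 - q) := by
          rw [sub_eq_add_neg, Real.rpow_add hjp]; ring
      _ ≤ _ := by
          have := rpow_comparable (e := 3 / 2 - q) hjp hn0 hj' (not_lt.1 hcase)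
          gcongr
  have hP : 0 ≤ c * x * (5 ^ |3 / 2 - q| * |(n : ℝ)| ^ (3 / 2 - q)) := by positivity
  simp only [kerOp, hn, if_false]
  calc ‖∑ σ', ∑ j ∈ freq n, κ σ σ' n j * v σ' j‖
      ≤ ∑ _σ' : Bool, ∑ _j ∈ freq n, c * x * (5 ^ |3 / 2 - q| * |(n : ℝ)| ^ (3 / 2 - q)) :=
        norm_sum_le_of_le _ fun σ' _ => norm_sum_le_of_le _ fun j hj => hT σ' j hj
    _ = 2 * ((freq n).card * (c * x * (5 ^ |3 / 2 - q| * |(n : ℝ)| ^ (3 / 2 - q)))) := by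
        simp
    _ ≤ 2 * ((10 * |(n : ℝ)|) * (c * x * (5 ^ |3 / 2 - q| * |(n : ℝ)| ^ (3 / 2 - q)))) := by
        gcongr; exact card_freq_le n
    _ = 20 * 5 ^ |3 / 2 - q| * c * x * (|(n : ℝ)| ^ (1 : ℝ) * |(n : ℝ)| ^ (3 / 2 - q)) := by
        rw [Real.rpow_one]; ring
    _ = _ := by
        rw [← Real.rpow_add hn0]
        congr 2; ring

/-- The jet of an operator given by a kernel. -/
def kerJ (κ : ℕ → Bool → Bool → ℤ → ℤ → ℂ) (u : ℕ → Vec) : ℕ → Vec := fun k =>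
  ∑ p ∈ Finset.HasAntidiagonal.antidiagonal k, (k.choose p.1 : ℂ) • kerOp (κ p.1) (u p.2)

lemma kerJ_zero (κ : ℕ → Bool → Bool → ℤ → ℤ → ℂ) (u : ℕ → Vec) :
    kerJ κ u 0 = kerOp (κ 0) (u 0) := by simp [kerJ]

lemma choose_le_two_pow {N k : ℕ} (hk : k ≤ N) (i : ℕ) : ((k.choose i : ℕ) : ℝ) ≤ 2 ^ N := by
  have h1 : k.choose i ≤ 2 ^ k := Nat.choose_le_two_pow k i
  have h2 : (2 : ℕ) ^ k ≤ 2 ^ N := Nat.pow_le_pow_right (by norm_num) hk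
  exact_mod_cast h1.trans h2

/-- The constant in the estimate of operators given by kernels. -/
def kConst (N : ℕ) (ℓ : ℝ) : ℝ := 2 ^ N * (20 * 5 ^ (3 / 2 + |ℓ| + 3 / 2 * N))

lemma kConst_nonneg (N : ℕ) (ℓ : ℝ) : 0 ≤ kConst N ℓ := by unfold kConst; positivity

/-- Time derivatives of the kernel cost no regularity, so only the derivatives falling on `u`
consume part of the allowed `3k/2`. -/
lemma tameJ_kerJ {κ : ℕ → Bool → Bool → ℤ → ℤ → ℂ} {N d : ℕ} {τ c ℓ : ℝ} {a b : ℕ → ℝ}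
    (W : Weights N a b) (hc : 0 ≤ c) (hκ : ∀ j ≤ N, KB (c * wlow d a j) (κ j)) :
    TameJ N τ a b ℓ (ℓ - 5 / 2) d (max (kConst N ℓ) (kConst N (ℓ + τ)) * c) (kerJ κ) := by
  have hk1 := kConst_nonneg N ℓ
  have hk2 := kConst_nonneg N (ℓ + τ)
  have main : ∀ (ℓ : ℝ) (u : ℕ → Vec) (x : ℕ → ℝ), JB N ℓ u x →
      JB N (ℓ - 5 / 2) (kerJ κ u) ((kConst N ℓ * c) • conv (wlow d a) x) := by
    intro ℓ u x hx k hk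
    have hkN : (k : ℝ) ≤ N := by exact_mod_cast hk
    have h1 : ∀ p ∈ Finset.HasAntidiagonal.antidiagonal k,
        Bd (ℓ - 5 / 2 - 3 / 2 * k) ((k.choose p.1 : ℂ) • kerOp (κ p.1) (u p.2))
        (kConst N ℓ * c * (wlow d a p.1 * x p.2)) := by
      intro p hp
      have hp := Finset.HasAntidiagonal.mem_antidiagonal.1 hp
      have hp1 : p.1 ≤ N := by omega
      have hp2 : p.2 ≤ N := by omega
      have hpk : (p.1 : ℝ) + p.2 = k := by exact_mod_cast hp
      have q1 : (0 : ℝ) ≤ p.1 := Nat.cast_nonneg _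
      have q2 : (0 : ℝ) ≤ p.2 := Nat.cast_nonneg _
      have hw := W.wlow_nonneg d hp1
      have n3 := hx.nonneg hp2
      have B := ((kerOp_bd (mul_nonneg hc hw) (hκ _ hp1) (hx _ hp2)).weaken
        (show ℓ - 5 / 2 - 3 / 2 * k ≤ ℓ - 3 / 2 * (p.2 : ℝ) - 5 / 2 by linarith)).smul
        (k.choose p.1 : ℂ)
      refine B.mono ?_
      rw [Complex.norm_natCast, kConst]
      -- The level at which `kerOp_bd` is used varies with the order of the derivative; `kConst`
      -- takes an exponent valid for all of them.
      have e1 : |3 / 2 - (ℓ - 3 / 2 * (p.2 : ℝ))| ≤ 3 / 2 + |ℓ| + 3 / 2 * N := by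
        rw [abs_le]
        constructor <;> linarith [le_abs_self ℓ, neg_abs_le ℓ]
      calc _ ≤ 2 ^ N * (20 * 5 ^ (3 / 2 + |ℓ| + 3 / 2 * N) * (c * wlow d a p.1) * x p.2) := by
            gcongr
            · exact choose_le_two_pow hk _
            · norm_num
        _ = _ := by ring
    refine (Bd.sum h1).mono (le_of_eq ?_)
    simp only [Pi.smul_apply, smul_eq_mul, conv, Finset.mul_sum]
  refine ⟨by positivity, fun u x X hx hX => ⟨(main ℓ u x hx).mono fun k hk => ?_, ?_⟩⟩
  · have : 0 ≤ conv (wlow d a) x k :=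
      conv_nonneg (fun i hi => W.wlow_nonneg d (hi.trans hk)) fun i hi => hx.nonneg (hi.trans hk)
    simp only [Pi.smul_apply, smul_eq_mul]
    gcongr
    exact le_max_left _ _
  · have h := main (ℓ + τ) u X hX
    rw [show ℓ + τ - 5 / 2 = ℓ - 5 / 2 + τ by ring] at h
    refine h.mono fun k hk => ?_
    have n1 : 0 ≤ conv (wlow d a) X k :=
      conv_nonneg (fun i hi => W.wlow_nonneg d (hi.trans hk)) fun i hi => hX.nonneg (hi.trans hk)
    have n2 : 0 ≤ conv (whigh d a b) x k :=
      conv_nonneg (fun i hi => W.whigh_nonneg d (hi.trans hk)) fun i hi => hx.nonneg (hi.trans hk)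
    simp only [Pi.smul_apply, Pi.add_apply, smul_eq_mul]
    gcongr
    · exact le_max_right _ _
    · linarith

/-- A curve of jets of kernels, with uniform bounds. -/
structure KJ (I : Set ℝ) (N : ℕ) (c : ℝ) (κ : ℕ → ℝ → Bool → Bool → ℤ → ℤ → ℂ) : Prop where
  cont : ∀ k ≤ N, ∀ t ∈ I, ∀ σ σ' n j, ContinuousWithinAt (fun τ => κ k τ σ σ' n j) I t
  der : ∀ k < N, ∀ t ∈ I, ∀ σ σ' n j,
    HasDerivWithinAt (fun τ => κ k τ σ σ' n j) (κ (k + 1) t σ σ' n j) I t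
  bound : ∀ k ≤ N, ∀ t ∈ I, KB c (κ k t)
  nonneg : 0 ≤ c

/-- Every output coefficient is a finite sum, so continuity and differentiability are termwise
without any majorant. -/
lemma CJ.kerJ {I : Set ℝ} {N : ℕ} {c ℓ : ℝ} {κ : ℕ → ℝ → Bool → Bool → ℤ → ℤ → ℂ}
    {D : ℕ → ℝ → Vec} (hκ : KJ I N c κ) (hD : CJ I N ℓ D) :
    CJ I N (ℓ - 5 / 2) (fun k t => WaterWaves.kerJ (fun j => κ j t) (fun j => D j t) k) := by
  have e : ∀ k τ σ n, WaterWaves.kerJ (fun j => κ j τ) (fun j => D j τ) k σ n =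
      ∑ p ∈ Finset.HasAntidiagonal.antidiagonal k,
        (k.choose p.1 : ℂ) * kerOp (κ p.1 τ) (D p.2 τ) σ n := by
    intro k τ σ n
    simp [WaterWaves.kerJ, Finset.sum_apply]
  refine ⟨fun k hk t ht σ n => ?_, fun k hk t ht σ n => ?_, ?_⟩
  · simp only [e]
    refine tendsto_finsetSum _ fun p hp => ?_
    have hp := Finset.HasAntidiagonal.mem_antidiagonal.1 hp
    refine (continuousWithinAt_const (b := (k.choose p.1 : ℂ))).mul ?_
    simp only [kerOp]
    split_ifs
    · exact continuousWithinAt_const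
    · exact tendsto_finsetSum _ fun σ' _ => tendsto_finsetSum _ fun j _ =>
        (hκ.cont p.1 (by omega) t ht σ σ' n j).mul (hD.cont p.2 (by omega) t ht σ' j)
  · simp only [e]
    refine hasDerivWithinAt_leibniz (f := fun i j τ => kerOp (κ i τ) (D j τ) σ n) fun i j hij => ?_
    simp only [kerOp]
    split_ifs
    · simpa using hasDerivWithinAt_const t I (0 : ℂ)
    · simp only [← Finset.sum_add_distrib]
      exact HasDerivWithinAt.fun_sum fun σ' _ => HasDerivWithinAt.fun_sum fun l _ =>
        (hκ.der i (by omega) t ht σ σ' n l).mul (hD.der j (by omega) t ht σ' l)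
  · refine hD.loc_of_tame (T := fun τ => WaterWaves.kerJ (fun j => κ j τ)) (d := 0)
      fun t ht => ⟨1, one_pos, _, fun τ hτ _ =>
        tameJ_kerJ (Weights.one N) hκ.nonneg fun j hj => ?_⟩
    simpa [wlow] using hκ.bound j hj τ hτ

/-! ### Cut-off functions -/

lemma jap_nonneg (ξ : ℝ) : 0 ≤ jap ξ := Real.sqrt_nonneg _

lemma jap_le (ξ : ℝ) : jap ξ ≤ 1 + |ξ| := by
  rw [jap]
  refine Real.sqrt_le_iff.2 ⟨by positivity, ?_⟩
  nlinarith [sq_abs ξ, abs_nonneg ξ]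

namespace IsCutoff

variable {δ : ℝ} {χ : ℝ → ℝ → ℝ}

lemma exists_bound (h : IsCutoff δ χ) : ∃ C ≥ (0 : ℝ), ∀ ξ' ξ, |χ ξ' ξ| ≤ C := by
  obtain ⟨C, hC⟩ := h.bound 0 0
  refine ⟨max C 0, le_max_right _ _, fun ξ' ξ => ?_⟩
  have := hC ξ' ξ
  simp at this
  exact this.trans (le_max_left _ _)

/-- On the support of the cut-off the frequencies are comparable. -/
lemma comparable (h : IsCutoff δ χ) {n j : ℤ} (hn : n ≠ 0) (hj : j ≠ 0)
    (hχ : χ ((n - j : ℤ) : ℝ) (((n + j : ℤ) : ℝ) / 2) ≠ 0) :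
    |(n : ℝ)| ≤ 5 * |(j : ℝ)| ∧ |(j : ℝ)| ≤ 5 * |(n : ℝ)| ∧
    |((n - j : ℤ) : ℝ)| ≤ 4 * |(j : ℝ)| ∧ |((n - j : ℤ) : ℝ)| ≤ 4 * |(n : ℝ)| ∧
      jap (((n + j : ℤ) : ℝ) / 2) ≤ 4 * |(j : ℝ)| := by
  have h1 : |((n - j : ℤ) : ℝ)| ≤ δ * jap (((n + j : ℤ) : ℝ) / 2) := by
    by_contra hc
    exact hχ (h.supp _ _ (not_le.1 hc))
  have h2 : |((n - j : ℤ) : ℝ)| ≤ jap (((n + j : ℤ) : ℝ) / 2) := by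
    have := jap_nonneg (((n + j : ℤ) : ℝ) / 2)
    nlinarith [h.small]
  have h3 := jap_le (((n + j : ℤ) : ℝ) / 2)
  have h4 : |((n + j : ℤ) : ℝ) / 2| ≤ (|(n : ℝ)| + |(j : ℝ)|) / 2 := by
    rw [abs_div, abs_of_pos (two_pos : (0 : ℝ) < 2)]
    push_cast
    linarith [abs_add_le (n : ℝ) j]
  have h5 : |(n : ℝ)| - |(j : ℝ)| ≤ |((n - j : ℤ) : ℝ)| := by
    push_cast; exact abs_sub_abs_le_abs_sub _ _
  have h6 : |(j : ℝ)| - |(n : ℝ)| ≤ |((n - j : ℤ) : ℝ)| := by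
    push_cast; rw [abs_sub_comm]; exact abs_sub_abs_le_abs_sub _ _
  have hn1 := one_le_abs_cast hn
  have hj1 := one_le_abs_cast hj
  -- All five follow linearly from `|n - j| ≤ 1 + (|n| + |j|)/2` and `|n|, |j| ≥ 1`; for instance
  -- `|n| ≤ 2 + 3|j| ≤ 5|j|`.
  refine ⟨by linarith, by linarith, by linarith, by linarith, by linarith⟩

end IsCutoff

/-! ### Kernels of paradifferential operators -/

/-- The kernel of `Op^{BW}(a)`. -/
def paraKer (χ : ℝ → ℝ → ℝ) (a : Bool → Bool → ℝ → ℝ → ℂ) : Bool → Bool → ℤ → ℤ → ℂ :=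
  fun σ σ' n j => nrm * ((χ ((n - j : ℤ) : ℝ) (((n + j : ℤ) : ℝ) / 2) : ℂ) *
    fourierCoef (a σ σ') (n - j) (((n + j : ℤ) : ℝ) / 2))

/-- Outside `freq n` either the cut-off vanishes, by comparability of the frequencies, or `j = 0`
and the zero mode of `u` does. -/
lemma act_paraMat {δ : ℝ} {χ : ℝ → ℝ → ℝ} (h : IsCutoff δ χ) (a : Bool → Bool → ParaSymbol)
    (V : ℝ → Vec) (t : ℝ) {u : Vec} (hu : ∀ σ, u σ 0 = 0) :
    act (paraMat χ a) V t u = kerOp (paraKer χ fun σ σ' => a σ σ' V t) u := by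
  funext σ n
  simp only [act, paraMat, opBW, kerOp, Finset.sum_apply]
  by_cases hn : n = 0
  · simp [hn]
  simp only [hn, if_false]
  refine Finset.sum_congr rfl fun σ' _ => ?_
  rw [tsum_eq_sum (s := freq n), Finset.mul_sum]
  · refine Finset.sum_congr rfl fun j _ => ?_
    simp only [paraKer, nrm]; ring
  · intro j hj
    rw [mem_freq, not_and_or] at hj
    rcases hj with hj | hj
    · rw [not_not.1 hj, hu σ', mul_zero]
    by_cases hj0 : j = 0
    · rw [hj0, hu σ', mul_zero]
    by_cases hχ : χ ((n - j : ℤ) : ℝ) (((n + j : ℤ) : ℝ) / 2) = 0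
    · rw [hχ]; simp
    · exact absurd (by exact_mod_cast (h.comparable hn hj0 hχ).2.1) hj

lemma norm_exp_I_mul (l : ℤ) (x : ℝ) : ‖Complex.exp (-(Complex.I * l * x))‖ = 1 := by
  rw [Complex.norm_exp]
  simp

/-- The constant `7` is a round bound for `2π`; the normalization is at most one. -/
lemma norm_fourierCoef_le {a : ℝ → ℝ → ℂ} {ξ B : ℝ} (hB : ∀ x, ‖a x ξ‖ ≤ B) (l : ℤ) :
    ‖fourierCoef a l ξ‖ ≤ 7 * B := by
  have h0 : 0 ≤ B := (norm_nonneg _).trans (hB 0)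
  have h1 : ‖∫ x in (0 : ℝ)..(2 * Real.pi), a x ξ * Complex.exp (-(Complex.I * l * x))‖
      ≤ B * |2 * Real.pi - 0| := by
    refine intervalIntegral.norm_integral_le_of_norm_le_const fun x _ => ?_
    rw [norm_mul, norm_exp_I_mul, mul_one]
    exact hB x
  rw [fourierCoef, norm_mul]
  have h2 := norm_nrm_le
  rw [nrm] at h2
  have h3 : |2 * Real.pi - 0| ≤ 7 := by
    rw [sub_zero, abs_of_pos (by positivity)]
    linarith [Real.pi_lt_d2]
  calc _ ≤ 1 * (B * 7) := by
        gcongr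
        exact h1.trans (by gcongr)
    _ = 7 * B := by ring

section fourier

variable {I : Set ℝ} {A A' : ℝ → ℝ → ℝ → ℂ} {ξ B t : ℝ}

lemma continuous_slice (hc : ContinuousOn (fun q : ℝ × ℝ × ℝ => A q.1 q.2.1 q.2.2) (I ×ˢ Set.univ))
    (ht : t ∈ I) : Continuous fun x => A t x ξ := by
  have h1 : Continuous fun x : ℝ => (t, x, ξ) := by fun_prop
  exact hc.comp_continuous h1 fun x => ⟨ht, trivial⟩

lemma continuous_slice_time
    (hc : ContinuousOn (fun q : ℝ × ℝ × ℝ => A q.1 q.2.1 q.2.2) (I ×ˢ Set.univ))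
    (ht : t ∈ I) (x : ℝ) : ContinuousWithinAt (fun τ => A τ x ξ) I t := by
  have h1 : ContinuousOn (fun τ : ℝ => (τ, x, ξ)) I := by fun_prop
  exact (hc.comp h1 fun τ hτ => ⟨hτ, trivial⟩) t ht

lemma continuousWithinAt_fourierCoef
    (hc : ContinuousOn (fun q : ℝ × ℝ × ℝ => A q.1 q.2.1 q.2.2) (I ×ˢ Set.univ))
    (hB : ∀ τ ∈ I, ∀ x, ‖A τ x ξ‖ ≤ B) (ht : t ∈ I) (l : ℤ) :
    ContinuousWithinAt (fun τ => fourierCoef (A τ) l ξ) I t := by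
  refine (continuousWithinAt_const
    (b := ((Real.sqrt (2 * Real.pi) : ℝ) : ℂ)⁻¹)).mul ?_
  refine intervalIntegral.tendsto_integral_filter_of_dominated_convergence (fun _ => B) ?_ ?_
    intervalIntegrable_const ?_
  · filter_upwards [self_mem_nhdsWithin] with τ hτ
    have := continuous_slice (ξ := ξ) hc hτ
    exact Continuous.aestronglyMeasurable (by fun_prop)
  · filter_upwards [self_mem_nhdsWithin] with τ hτ
    refine Eventually.of_forall fun x _ => ?_
    rw [norm_mul, norm_exp_I_mul, mul_one]
    exact hB τ hτ x
  · refine Eventually.of_forall fun x _ => ?_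
    exact Tendsto.mul_const _ (continuous_slice_time hc ht x)

/-- Differentiation under the integral sign: difference quotients are bounded by the mean value
inequality on the interval `I`, which makes them dominated by a constant on a bounded domain. -/
lemma hasDerivWithinAt_fourierCoef (hI : I.OrdConnected)
    (hc : ContinuousOn (fun q : ℝ × ℝ × ℝ => A q.1 q.2.1 q.2.2) (I ×ˢ Set.univ))
    (hd : ∀ τ ∈ I, ∀ x, HasDerivWithinAt (fun τ => A τ x ξ) (A' τ x ξ) I τ)
    (hB : ∀ τ ∈ I, ∀ x, ‖A' τ x ξ‖ ≤ B) (ht : t ∈ I) (l : ℤ) :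
    HasDerivWithinAt (fun τ => fourierCoef (A τ) l ξ) (fourierCoef (A' t) l ξ) I t := by
  refine HasDerivWithinAt.const_mul _ ?_
  rw [hasDerivWithinAt_iff_tendsto_slope]
  have hint : ∀ τ ∈ I, IntervalIntegrable
      (fun x : ℝ => A τ x ξ * Complex.exp (-(Complex.I * l * x))) MeasureTheory.volume
      0 (2 * Real.pi) := fun τ hτ => by
    have := continuous_slice (ξ := ξ) hc hτ
    exact Continuous.intervalIntegrable (by fun_prop) _ _
  have h1 : Tendsto (fun τ => ∫ x in (0 : ℝ)..(2 * Real.pi),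
      slope (fun τ => A τ x ξ) t τ * Complex.exp (-(Complex.I * l * x))) (𝓝[I \ {t}] t)
      (𝓝 (∫ x in (0 : ℝ)..(2 * Real.pi), A' t x ξ * Complex.exp (-(Complex.I * l * x)))) := by
    refine intervalIntegral.tendsto_integral_filter_of_dominated_convergence (fun _ => B) ?_ ?_
      intervalIntegrable_const ?_
    · filter_upwards [self_mem_nhdsWithin] with τ hτ
      have h1 := continuous_slice (ξ := ξ) hc hτ.1
      have h2 := continuous_slice (ξ := ξ) hc ht
      simp only [slope_def_module]
      exact Continuous.aestronglyMeasurable (by fun_prop)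
    · filter_upwards [self_mem_nhdsWithin] with τ hτ
      refine Eventually.of_forall fun x _ => ?_
      rw [norm_mul, norm_exp_I_mul, mul_one]
      have h2 := hI.convex.norm_image_sub_le_of_norm_hasDerivWithin_le
        (fun τ hτ => hd τ hτ x) (fun τ hτ => hB τ hτ x) ht hτ.1
      have h3 : 0 < ‖τ - t‖ := norm_pos_iff.2 (sub_ne_zero.2 hτ.2)
      rw [slope_def_module, norm_smul, norm_inv, ← div_eq_inv_mul, div_le_iff₀ h3]
      exact h2
    · refine Eventually.of_forall fun x _ => ?_
      exact Tendsto.mul_const _ (hasDerivWithinAt_iff_tendsto_slope.1 (hd t ht x))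
  refine h1.congr' ?_
  filter_upwards [self_mem_nhdsWithin] with τ hτ
  simp only [slope_def_module]
  rw [← intervalIntegral.integral_sub (hint τ hτ.1) (hint t ht), ← intervalIntegral.integral_smul]
  congr 1
  funext x
  rw [← sub_mul, smul_mul_assoc]

end fourier

/-! ### Jets of non-homogeneous symbols -/

/-- The definition of the class supplies, for every order `k`, a separate array of derivatives of
which only the `k`-th is bounded. Uniqueness of derivatives within `I` identifies these arrays, so
that one array carries all the bounds. -/
lemma IsNonhomSymbol.jets {I : Set ℝ} (hI : UniqueDiffOn ℝ I) {m r s₁ : ℝ} {K K' : ℕ}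
    {a : ParaSymbol} (hK : K' ≤ K) (ha : IsNonhomSymbol I m K K' 2 r s₁ a) :
    ∃ C ≥ (0 : ℝ), ∃ rs > 0, rs < r ∧ ∀ V, InBall I K s₁ rs V →
      ∃ A : ℕ → ℝ → ℝ → ℝ → ℂ, (∀ t ∈ I, ∀ x ξ, A 0 t x ξ = a V t x ξ) ∧
        (∀ j ≤ K - K', ContinuousOn (fun q : ℝ × ℝ × ℝ => A j q.1 q.2.1 q.2.2) (I ×ˢ Set.univ)) ∧
        (∀ j < K - K', ∀ t ∈ I, ∀ x ξ,
          HasDerivWithinAt (fun τ => A j τ x ξ) (A (j + 1) t x ξ) I t) ∧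
        ∀ j ≤ K - K', ∀ t ∈ I, ∀ x ξ,
          ‖A j t x ξ‖ ≤ C * jap ξ ^ m * normK2 I (j + K') s₁ V t ^ 2 := by
  have h := fun k : Fin (K - K' + 1) => ha.2 k (by omega) s₁ le_rfl
  choose C rs hrs hrr H using h
  obtain ⟨C₀, hC₀, hC₀'⟩ := exists_nonneg_ge fun k => C k 0 0
  obtain ⟨r₀, hr₀, hr₀'⟩ := exists_pos_le hrs
  refine ⟨C₀, hC₀, r₀, hr₀, (hr₀' 0).trans_lt (hrr 0), fun V hV => ?_⟩
  have hCS : ∀ k : Fin (K - K' + 1), CStar2 I (k + K') s₁ V := fun k =>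
    hV.1.mono (by omega) le_rfl
  have hH := fun k => H k V trivial (hV.mono le_rfl (hr₀' k)) (hCS k)
  choose D hD0 hD hDb using hH
  have hz : ((0 : ℕ) : ℝ) ≤ s₁ - s₁ := by simp
  -- The array of maximal order contains the derivatives of all orders and is the one retained.
  set top : Fin (K - K' + 1) := ⟨K - K', by omega⟩ with htop
  have huniq : ∀ k : Fin (K - K' + 1), ∀ j ≤ (k : ℕ), ∀ t ∈ I, ∀ x ξ,
      D k j 0 0 t x ξ = D top j 0 0 t x ξ := by
    intro k j
    induction j with
    | zero => intro _ t ht x ξ; rw [hD0 k t ht, hD0 top t ht]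
    | succ j ih =>
      intro hj t ht x ξ
      have h1 := ((hD k j (by omega) 0 hz 0).2 t ht x ξ).1 hj
      have hjt : j < (top : ℕ) := by
        have := k.2
        simp only [htop]; omega
      have h2 := ((hD top j hjt.le 0 hz 0).2 t ht x ξ).1 hjt
      have h3 : HasDerivWithinAt (fun τ => D k j 0 0 τ x ξ) (D top (j + 1) 0 0 t x ξ) I t :=
        h2.congr (fun τ hτ => ih (by omega) τ hτ x ξ) (ih (by omega) t ht x ξ)
      exact (hI t ht).eq_deriv _ h1 h3
  refine ⟨fun j => D top j 0 0, hD0 top, fun j hj => (hD top j hj 0 hz 0).1,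
    fun j hj t ht x ξ => ((hD top j hj.le 0 hz 0).2 t ht x ξ).1 hj, fun j hj t ht x ξ => ?_⟩
  have h1 := hDb ⟨j, by omega⟩ 0 hz 0 t ht x ξ
  rw [huniq ⟨j, by omega⟩ j le_rfl t ht x ξ] at h1
  refine h1.trans ?_
  have h2 := hC₀' ⟨j, by omega⟩
  have n1 := normK2_nonneg I (j + K') s₁ V t
  have n2 := jap_nonneg ξ
  calc _ = C ⟨j, by omega⟩ 0 0 * (jap ξ ^ m * normK2 I (j + K') s₁ V t ^ 2) := by
        simp; ring
    _ ≤ C₀ * (jap ξ ^ m * normK2 I (j + K') s₁ V t ^ 2) := by gcongr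
    _ = _ := by ring

/-- The jets of the kernels of a matrix of paradifferential operators. -/
lemma exists_para_jets {I : Set ℝ} (hI : I.OrdConnected) (hu : UniqueDiffOn ℝ I) {r s₁ δ : ℝ}
    {K K' : ℕ} {a : Bool → Bool → ParaSymbol} {χ : ℝ → ℝ → ℝ} (hχ : IsCutoff δ χ) (hK : K' ≤ K)
    (ha : ∀ σ σ', IsNonhomSymbol I (3 / 2) K K' 2 r s₁ (a σ σ')) :
    ∃ C ≥ (0 : ℝ), ∃ rs > 0, rs < r ∧ ∀ V, InBall I K s₁ rs V →
      (∀ t ∈ I, normK2 I K s₁ V t ≤ 1) → ∃ κ, KJ I (K - K') C κ ∧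
        (∀ t ∈ I, ∀ u : Vec, (∀ σ, u σ 0 = 0) → act (paraMat χ a) V t u = kerOp (κ 0 t) u) ∧
        ∀ j ≤ K - K', ∀ t ∈ I, KB (C * normK2 I (j + K') s₁ V t ^ 2) (κ j t) := by
  have h := fun q : Bool × Bool => (ha q.1 q.2).jets hu hK
  choose C hC rs hrs hrr H using h
  obtain ⟨C₀, hC₀, hC₀'⟩ := exists_nonneg_ge C
  obtain ⟨r₀, hr₀, hr₀'⟩ := exists_pos_le hrs
  obtain ⟨X, hX, hX'⟩ := hχ.exists_bound
  -- `X` bounds the cut-off, `7` comes from the Fourier coefficient, and `8 = 4^{3/2}` from `jap ≤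
  -- 4|j|` on the support.
  refine ⟨X * (7 * (C₀ * 8)), by positivity, r₀, hr₀, (hr₀' (true, true)).trans_lt (hrr _),
    fun V hV hV1 => ?_⟩
  choose A hA0 hAc hAd hAb using fun q => H q V (hV.mono le_rfl (hr₀' q))
  have hb1 : ∀ q, ∀ j ≤ K - K', ∀ t ∈ I, ∀ x ξ,
      ‖A q j t x ξ‖ ≤ C₀ * jap ξ ^ (3 / 2 : ℝ) * normK2 I (j + K') s₁ V t ^ 2 := by
    intro q j hj t ht x ξ
    refine (hAb q j hj t ht x ξ).trans ?_
    have n2 := jap_nonneg ξ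
    have := hC₀' q
    gcongr
  have hle1 : ∀ j ≤ K - K', ∀ t ∈ I, normK2 I (j + K') s₁ V t ≤ 1 := fun j hj t ht =>
    (normK2_mono_left I s₁ V t (by omega)).trans (hV1 t ht)
  have hb2 : ∀ q, ∀ j ≤ K - K', ∀ t ∈ I, ∀ x ξ,
      ‖A q j t x ξ‖ ≤ C₀ * jap ξ ^ (3 / 2 : ℝ) := by
    intro q j hj t ht x ξ
    refine (hb1 q j hj t ht x ξ).trans (mul_le_of_le_one_right ?_ ?_)
    · have n2 := jap_nonneg ξ
      positivity
    · exact pow_le_one₀ (normK2_nonneg _ _ _ _ _) (hle1 j hj t ht)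
  have hKB : ∀ j ≤ K - K', ∀ t ∈ I, KB (X * (7 * (C₀ * 8)) * normK2 I (j + K') s₁ V t ^ 2)
      (paraKer χ fun σ σ' => A (σ, σ') j t) := by
    intro j hj t ht σ σ' n l hn hl
    by_cases hz : χ ((n - l : ℤ) : ℝ) (((n + l : ℤ) : ℝ) / 2) = 0
    · simp only [paraKer, hz]
      simp only [Complex.ofReal_zero, zero_mul, mul_zero, norm_zero, implies_true, and_true]
      positivity
    obtain ⟨c1, c2, c3, c4, c5⟩ := hχ.comparable hn hl hz
    refine ⟨?_, fun hlt => absurd c1 (not_le.2 hlt)⟩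
    have f1 := norm_fourierCoef_le (a := A (σ, σ') j t) (fun x => hb1 (σ, σ') j hj t ht x
      (((n + l : ℤ) : ℝ) / 2)) (n - l)
    have j0 := jap_nonneg (((n + l : ℤ) : ℝ) / 2)
    have j1 : jap (((n + l : ℤ) : ℝ) / 2) ^ (3 / 2 : ℝ) ≤ 8 * |(l : ℝ)| ^ (3 / 2 : ℝ) := by
      calc _ ≤ (4 * |(l : ℝ)|) ^ (3 / 2 : ℝ) := by gcongr
        _ = 8 * |(l : ℝ)| ^ (3 / 2 : ℝ) := by
          rw [Real.mul_rpow (by norm_num) (abs_nonneg _)]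
          congr 1
          rw [show (4 : ℝ) = 2 ^ (2 : ℝ) by norm_num, ← Real.rpow_mul (by norm_num)]
          norm_num
    rw [paraKer, norm_mul, norm_mul, Complex.norm_real, Real.norm_eq_abs]
    calc _ ≤ 1 * (X * (7 * (C₀ * (8 * |(l : ℝ)| ^ (3 / 2 : ℝ)) * normK2 I (j + K') s₁ V t ^ 2))) := by
          gcongr
          · exact norm_nrm_le
          · exact hX' _ _
          · exact f1.trans (by gcongr)
      _ = _ := by ring
  refine ⟨fun j t => paraKer χ fun σ σ' => A (σ, σ') j t, ⟨?_, ?_, ?_, by positivity⟩, ?_, hKB⟩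
  · intro k hk t ht σ σ' n j
    exact continuousWithinAt_const.mul (continuousWithinAt_const.mul
      (continuousWithinAt_fourierCoef (hAc (σ, σ') k hk)
        (fun τ hτ x => hb2 (σ, σ') k hk τ hτ x _) ht _))
  · intro k hk t ht σ σ' n j
    exact HasDerivWithinAt.const_mul _ (HasDerivWithinAt.const_mul _
      (hasDerivWithinAt_fourierCoef hI (hAc (σ, σ') k hk.le)
        (fun τ hτ x => hAd (σ, σ') k hk τ hτ x _)
        (fun τ hτ x => hb2 (σ, σ') (k + 1) hk τ hτ x _) ht _))
  · intro k hk t ht σ σ' n j hn hj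
    obtain ⟨h1, h2⟩ := hKB k hk t ht σ σ' n j hn hj
    refine ⟨h1.trans ?_, h2⟩
    have : normK2 I (k + K') s₁ V t ^ 2 ≤ 1 :=
      pow_le_one₀ (normK2_nonneg _ _ _ _ _) (hle1 k hk t ht)
    have h0 : 0 ≤ X * (7 * (C₀ * 8)) := by positivity
    exact mul_le_mul_of_nonneg_right (mul_le_of_le_one_right h0 this) (by positivity)
  · intro t ht u hu0
    rw [act_paraMat hχ a V t hu0]
    congr 1
    funext σ σ' n j
    simp only [paraKer]
    congr 2
    simp only [fourierCoef, hA0 (σ, σ') t ht]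

lemma isNonhomSymbol_zero {I : Set ℝ} {m r s₁ : ℝ} {K K' p : ℕ} (hr : 0 < r) :
    IsNonhomSymbol I m K K' p r s₁ (fun _ _ _ _ => 0) := by
  refine ⟨fun _ _ _ _ _ _ _ => rfl, fun k _ s _ => ⟨fun _ _ => 0, r / 2, by positivity,
    by linarith, fun U _ _ _ => ⟨fun _ _ _ _ _ _ => 0, fun _ _ _ _ => rfl, fun j _ α _ β =>
      ⟨continuousOn_const, fun t _ x ξ => ⟨fun _ => hasDerivWithinAt_const _ _ _,
        fun _ => hasDerivAt_const _ _, hasDerivAt_const _ _⟩⟩, fun α _ β t _ x ξ => by simp⟩⟩⟩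

lemma isNonhomSymbol_diagSymbol {I : Set ℝ} {m r s₁ : ℝ} {K K' p : ℕ} (hr : 0 < r)
    {H : Bool → ParaSymbol} (hH : ∀ σ, IsNonhomSymbol I m K K' p r s₁ (H σ)) (σ σ' : Bool) :
    IsNonhomSymbol I m K K' p r s₁ (diagSymbol H σ σ') := by
  unfold diagSymbol
  split_ifs
  · exact hH σ
  · exact isNonhomSymbol_zero hr

lemma IsNonhomSymbolOn.mono {P : (ℝ → Vec) → Prop} {I : Set ℝ} {m r r' s₁ s₀ : ℝ} {K K' : ℕ}
    (hK : K' ≤ K) {a : ParaSymbol} (ha : IsNonhomSymbolOn P I m K K' 2 r s₁ a) (hs : s₁ ≤ s₀)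
    (hr0 : 0 < r') (hr : r' ≤ r) : IsNonhomSymbolOn P I m K K' 2 r' s₀ a := by
  refine ⟨fun U hP hU => ha.1 U hP (hU.mono hs hr), fun k hk s hss => ?_⟩
  obtain ⟨C, rs, hrs, hrr, H⟩ := ha.2 k hk s (hs.trans hss)
  -- The constants of the class carry no sign, and enlarging the low norm requires a nonnegative
  -- one.
  refine ⟨fun α β => |C α β|, min rs (r' / 2), lt_min hrs (by positivity),
    (min_le_right _ _).trans_lt (by linarith), fun U hP hU hUs => ?_⟩
  obtain ⟨D, h0, h1, h2⟩ := H U hP (hU.mono hs (min_le_left _ _)) hUs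
  refine ⟨D, h0, fun j hj α hα β => ?_, fun α hα β t ht x ξ => ?_⟩
  · obtain ⟨g1, g2⟩ := h1 j hj α (by linarith) β
    exact ⟨g1, fun t ht x ξ => ⟨(g2 t ht x ξ).1, fun h => (g2 t ht x ξ).2.1 (by linarith),
      (g2 t ht x ξ).2.2⟩⟩
  refine (h2 α (by linarith) β t ht x ξ).trans ?_
  have n1 := normK2_nonneg I (k + K') s₁ U t
  have n2 := normK2_nonneg I (k + K') s U t
  have n3 := jap_nonneg ξ
  have n4 := hU.1.normK2_mono (M := k + K') (by omega) hs ht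
  gcongr
  exact le_abs_self _

/-! ### Small divisors -/

lemma tanh_le_tanh {x y : ℝ} (hxy : x ≤ y) : Real.tanh x ≤ Real.tanh y := by
  rw [Real.tanh_eq_sinh_div_cosh, Real.tanh_eq_sinh_div_cosh,
    div_le_div_iff₀ (Real.cosh_pos x) (Real.cosh_pos y)]
  have : Real.sinh (x - y) ≤ 0 := Real.sinh_nonpos_iff.2 (by linarith)
  rw [Real.sinh_sub] at this
  linarith

lemma tanhDepth_mono (h : ℝ≥0∞) {x y : ℝ} (hxy : x ≤ y) : tanhDepth h x ≤ tanhDepth h y := by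
  unfold tanhDepth
  split_ifs
  · exact le_rfl
  · apply tanh_le_tanh
    exact mul_le_mul_of_nonneg_left hxy ENNReal.toReal_nonneg

lemma tanhDepth_pos {h : ℝ≥0∞} (hh : 0 < h) {x : ℝ} (hx : 0 < x) : 0 < tanhDepth h x := by
  unfold tanhDepth
  split_ifs with h1
  · exact one_pos
  · rw [Real.tanh_eq_sinh_div_cosh]
    exact div_pos (Real.sinh_pos_iff.2 (mul_pos (ENNReal.toReal_pos hh.ne' h1) hx))
      (Real.cosh_pos _)

lemma tanhDepth_le_one (h : ℝ≥0∞) (x : ℝ) : tanhDepth h x ≤ 1 := by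
  unfold tanhDepth
  split_ifs
  · exact le_rfl
  · exact (Real.tanh_lt_one _).le

lemma disp_nonneg (κ g : ℝ) (h : ℝ≥0∞) (ξ : ℝ) : 0 ≤ disp κ g h ξ := by
  unfold disp; positivity

lemma disp_neg (κ g : ℝ) (h : ℝ≥0∞) (ξ : ℝ) : disp κ g h (-ξ) = disp κ g h ξ := by
  simp [disp]

lemma disp_abs (κ g : ℝ) (h : ℝ≥0∞) (ξ : ℝ) : disp κ g h |ξ| = disp κ g h ξ := by
  simp [disp]

lemma disp_le {κ g : ℝ} (hκ : 0 < κ) (hg : 0 ≤ g) (h : ℝ≥0∞) {n : ℤ} (hn : n ≠ 0) :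
    disp κ g h n ≤ Real.sqrt (κ + g) * |(n : ℝ)| ^ (3 / 2 : ℝ) := by
  have h1 := one_le_abs_cast hn
  have h2 : Real.sqrt (tanhDepth h |(n : ℝ)|) ≤ 1 := Real.sqrt_le_one.2 (tanhDepth_le_one h _)
  have h3 : Real.sqrt (|(n : ℝ)| ^ 3) = |(n : ℝ)| ^ (3 / 2 : ℝ) := by
    rw [Real.sqrt_eq_rpow, ← Real.rpow_natCast, ← Real.rpow_mul (abs_nonneg _)]
    norm_num
  calc disp κ g h n ≤ Real.sqrt (κ * |(n : ℝ)| ^ 3 + g * |(n : ℝ)|) * 1 := by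
        unfold disp; gcongr
    _ ≤ Real.sqrt ((κ + g) * |(n : ℝ)| ^ 3) := by
        rw [mul_one]
        apply Real.sqrt_le_sqrt
        have : |(n : ℝ)| ≤ |(n : ℝ)| ^ 3 := le_self_pow₀ h1 (by norm_num)
        nlinarith
    _ = _ := by rw [Real.sqrt_mul (by positivity), h3]

/-- Squaring removes the roots: `S² - (A + B)² = 3κpq(p+q) - 2AB`, and `AB ≤ κpq(p+q)` as soon as `g
≤ κp`. The difference of squares is thus at least `κpq(p+q) ≥ κ(p+q)²/2`. Division by `S + A + B ≤
2S ≤ 2√(κ+g)(p+q)²` leaves a constant independent of `p`, `q`. -/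
lemma omega_gap {κ g p q : ℝ} (hκ : 0 < κ) (hg : 0 ≤ g) (hq : 1 ≤ q) (hqp : q ≤ p)
    (hp : g ≤ κ * p) :
    κ / (4 * Real.sqrt (κ + g)) ≤ Real.sqrt (κ * (p + q) ^ 3 + g * (p + q))
      - Real.sqrt (κ * p ^ 3 + g * p) - Real.sqrt (κ * q ^ 3 + g * q) := by
  have hp1 : 1 ≤ p := hq.trans hqp
  set A := Real.sqrt (κ * p ^ 3 + g * p) with hA
  set B := Real.sqrt (κ * q ^ 3 + g * q) with hB
  set S := Real.sqrt (κ * (p + q) ^ 3 + g * (p + q)) with hS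
  have A0 : 0 ≤ A := Real.sqrt_nonneg _
  have B0 : 0 ≤ B := Real.sqrt_nonneg _
  have A2 : A ^ 2 = κ * p ^ 3 + g * p := Real.sq_sqrt (by positivity)
  have B2 : B ^ 2 = κ * q ^ 3 + g * q := Real.sq_sqrt (by positivity)
  have S2 : S ^ 2 = κ * (p + q) ^ 3 + g * (p + q) := Real.sq_sqrt (by positivity)
  have Spos : 0 < S := Real.sqrt_pos.2 (by positivity)
  have hpq : p ≤ p * q := le_mul_of_one_le_right (by linarith) hq
  have hpq0 : 0 < p * q := by positivity
  have hgpq : g ≤ κ * (p * q) := hp.trans (by gcongr)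
  -- Replacing each `g` by its bound `κpq` in `(κp² + g)(κq² + g)` produces `κ²pq(p+q)²`.
  have e1 : (A * B) ^ 2 ≤ (κ * (p * q) * (p + q)) ^ 2 := by
    rw [mul_pow, A2, B2]
    have f1 : κ * g * (p ^ 2 + q ^ 2) ≤ κ * (κ * (p * q)) * (p ^ 2 + q ^ 2) := by gcongr
    have f2 : g ^ 2 ≤ (κ * (p * q)) ^ 2 := by gcongr
    have f3 : (κ * p ^ 2 + g) * (κ * q ^ 2 + g) ≤ κ ^ 2 * (p * q) * (p + q) ^ 2 := by nlinarith
    calc _ = (p * q) * ((κ * p ^ 2 + g) * (κ * q ^ 2 + g)) := by ring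
      _ ≤ (p * q) * (κ ^ 2 * (p * q) * (p + q) ^ 2) := by gcongr
      _ = _ := by ring
  have e2 : A * B ≤ κ * (p * q) * (p + q) :=
    (abs_le_of_sq_le_sq' e1 (by positivity)).2
  have e3 : κ * (p * q) * (p + q) ≤ S ^ 2 - (A + B) ^ 2 := by
    have : S ^ 2 - (A + B) ^ 2 = 3 * (κ * (p * q) * (p + q)) - 2 * (A * B) := by
      rw [add_sq, S2, A2, B2]; ring
    linarith
  have e4 : A + B ≤ S := by
    refine (abs_le_of_sq_le_sq' ?_ Spos.le).2
    have : 0 ≤ κ * (p * q) * (p + q) := by positivity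
    linarith
  have e5 : S ≤ Real.sqrt (κ + g) * (p + q) ^ 2 := by
    rw [hS]
    refine Real.sqrt_le_iff.2 ⟨by positivity, ?_⟩
    rw [mul_pow, Real.sq_sqrt (by positivity)]
    have h1 : 1 ≤ p + q := by linarith
    have f1 : (p + q) ^ 3 ≤ ((p + q) ^ 2) ^ 2 := by
      rw [← pow_mul]; exact pow_le_pow_right₀ h1 (by norm_num)
    have f2 : p + q ≤ ((p + q) ^ 2) ^ 2 := by
      rw [← pow_mul]; exact le_self_pow₀ h1 (by norm_num)
    nlinarith
  have e6 : (p + q) ^ 2 / 2 ≤ (p * q) * (p + q) := by nlinarith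
  have hs : 0 < Real.sqrt (κ + g) := Real.sqrt_pos.2 (by positivity)
  rw [div_le_iff₀ (by positivity)]
  have e7 : κ * ((p + q) ^ 2 / 2) ≤ (S - A - B) * (2 * (Real.sqrt (κ + g) * (p + q) ^ 2)) := by
    calc κ * ((p + q) ^ 2 / 2) ≤ κ * ((p * q) * (p + q)) := by gcongr
      _ ≤ S ^ 2 - (A + B) ^ 2 := by linarith
      _ = (S - A - B) * (S + (A + B)) := by ring
      _ ≤ (S - A - B) * (2 * (Real.sqrt (κ + g) * (p + q) ^ 2)) := by
          have : 0 ≤ S - A - B := by linarith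
          gcongr
          linarith
  have hpos : 0 < (p + q) ^ 2 := by positivity
  nlinarith

/-- Since `tanh` is nondecreasing, each factor may be replaced by its value at `p + q`, the largest
frequency; this common factor is bounded below by its value at `1`, and `omega_gap` concludes. -/
lemma disp_gap {κ g : ℝ} {h : ℝ≥0∞} (hκ : 0 < κ) (hg : 0 ≤ g) (hh : 0 < h) :
    ∃ c > 0, ∀ p q : ℝ, 1 ≤ p → 1 ≤ q → g ≤ κ * max p q →
      c ≤ disp κ g h (p + q) - disp κ g h p - disp κ g h q := by
  have ht := tanhDepth_pos hh one_pos
  refine ⟨Real.sqrt (tanhDepth h 1) * (κ / (4 * Real.sqrt (κ + g))), by positivity, ?_⟩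
  have main : ∀ p q : ℝ, 1 ≤ q → q ≤ p → g ≤ κ * p →
      Real.sqrt (tanhDepth h 1) * (κ / (4 * Real.sqrt (κ + g))) ≤
        disp κ g h (p + q) - disp κ g h p - disp κ g h q := by
    intro p q hq hqp hp
    have hp1 : 1 ≤ p := hq.trans hqp
    have h1 := omega_gap hκ hg hq hqp hp
    have h2 : Real.sqrt (tanhDepth h 1) ≤ Real.sqrt (tanhDepth h (p + q)) :=
      Real.sqrt_le_sqrt (tanhDepth_mono h (by linarith))
    have h3 : Real.sqrt (tanhDepth h p) ≤ Real.sqrt (tanhDepth h (p + q)) :=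
      Real.sqrt_le_sqrt (tanhDepth_mono h (by linarith))
    have h4 : Real.sqrt (tanhDepth h q) ≤ Real.sqrt (tanhDepth h (p + q)) :=
      Real.sqrt_le_sqrt (tanhDepth_mono h (by linarith))
    simp only [disp, abs_of_nonneg (show 0 ≤ p + q by linarith),
      abs_of_nonneg (show 0 ≤ p by linarith), abs_of_nonneg (show 0 ≤ q by linarith)]
    have e1 : Real.sqrt (κ * p ^ 3 + g * p) * Real.sqrt (tanhDepth h p)
        ≤ Real.sqrt (κ * p ^ 3 + g * p) * Real.sqrt (tanhDepth h (p + q)) := by gcongr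
    have e2 : Real.sqrt (κ * q ^ 3 + g * q) * Real.sqrt (tanhDepth h q)
        ≤ Real.sqrt (κ * q ^ 3 + g * q) * Real.sqrt (tanhDepth h (p + q)) := by gcongr
    have e3 : Real.sqrt (tanhDepth h 1) * (κ / (4 * Real.sqrt (κ + g))) ≤
        Real.sqrt (tanhDepth h (p + q)) * (Real.sqrt (κ * (p + q) ^ 3 + g * (p + q))
      - Real.sqrt (κ * p ^ 3 + g * p) - Real.sqrt (κ * q ^ 3 + g * q)) := by gcongr
    linarith
  intro p q hp hq hpq
  rcases le_total q p with hqp | hqp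
  · exact main p q hq hqp (by rwa [max_eq_left hqp] at hpq)
  · have := main q p hp hqp (by rwa [max_eq_right hqp] at hpq)
    rw [add_comm q p] at this
    linarith

/-- The phase of an interaction. -/
def phase (κ g : ℝ) (h : ℝ≥0∞) (σ σ' ε : Bool) (a b : ℤ) : ℝ :=
  sgn σ * disp κ g h ((a + b : ℤ) : ℝ) - sgn σ' * disp κ g h b - sgn ε * disp κ g h a

lemma sgn_eq (σ : Bool) : sgn σ = 1 ∨ sgn σ = -1 := by cases σ <;> simp [sgn]

/-- If `x` exceeds `y + z`, no choice of signs for the three terms can produce cancellation. -/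
lemma le_abs_signed_sum {x y z c s₁ s₂ s₃ : ℝ} (hy : 0 ≤ y) (hz : 0 ≤ z)
    (hs₁ : s₁ = 1 ∨ s₁ = -1) (hs₂ : s₂ = 1 ∨ s₂ = -1) (hs₃ : s₃ = 1 ∨ s₃ = -1)
    (h : c ≤ x - y - z) : c ≤ |s₁ * x + s₂ * y + s₃ * z| := by
  rcases hs₁ with rfl | rfl <;> rcases hs₂ with rfl | rfl <;> rcases hs₃ with rfl | rfl <;>
    first
      | exact le_trans (by linarith) (le_abs_self _)
      | exact le_trans (by linarith) (neg_le_abs _)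

/-- Of `|a|`, `|b|`, `|a+b|` one is the sum of the other two. The gap of the dispersion relation is
applied to those two, and the signs in the phase are then irrelevant. -/
lemma phase_gap_of_large {κ g : ℝ} {h : ℝ≥0∞} {c : ℝ}
    (hc : ∀ p q : ℝ, 1 ≤ p → 1 ≤ q → g ≤ κ * max p q →
      c ≤ disp κ g h (p + q) - disp κ g h p - disp κ g h q)
    {P : ℝ} (hP : g ≤ κ * P) (hκ : 0 < κ) {a b : ℤ} (ha : a ≠ 0) (hb : b ≠ 0) (hab : a + b ≠ 0)
    (hlarge : 2 * P < |(a : ℝ)| ∨ 2 * P < |(b : ℝ)|) (σ σ' ε : Bool) :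
    c ≤ |phase κ g h σ σ' ε a b| := by
  have ha1 := one_le_abs_cast ha
  have hb1 := one_le_abs_cast hb
  have hab1 := one_le_abs_cast hab
  have e : ((a + b : ℤ) : ℝ) = a + b := by push_cast; ring
  have n := disp_nonneg κ g h
  have hsn : ∀ τ : Bool, -sgn τ = 1 ∨ -sgn τ = -1 := fun τ => by
    rcases sgn_eq τ with h | h <;> simp [h]
  -- A sum larger than `2P` has a summand larger than `P`.
  have hmax : ∀ x y : ℝ, 2 * P < x + y → g ≤ κ * max x y := by
    intro x y hxy
    refine hP.trans ?_
    have := le_max_left x y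
    have := le_max_right x y
    gcongr
    linarith
  have ew : ∀ z : ℤ, disp κ g h z = disp κ g h |(z : ℝ)| := fun z => (disp_abs κ g h z).symm
  rw [e] at hab1
  have cases : |(a : ℝ) + b| = |(a : ℝ)| + |(b : ℝ)| ∨ |(a : ℝ)| = |(a : ℝ) + b| + |(b : ℝ)| ∨
      |(b : ℝ)| = |(a : ℝ) + b| + |(a : ℝ)| := by
    rcases abs_cases (a : ℝ) with h1 | h1 <;> rcases abs_cases (b : ℝ) with h2 | h2 <;>
      rcases abs_cases ((a : ℝ) + b) with h3 | h3 <;>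
      first
        | (left; linarith)
        | (right; left; linarith)
        | (right; right; linarith)
  have hA := ew a
  have hB := ew b
  have hS := ew (a + b)
  rw [e] at hS
  rw [phase, e, hA, hB, hS]
  rcases cases with h1 | h1 | h1
  · have := hc _ _ ha1 hb1 (hmax _ _ (by rcases hlarge with h | h <;> linarith))
    rw [← h1] at this
    have := le_abs_signed_sum (n _) (n _) (sgn_eq σ) (hsn ε) (hsn σ') this
    convert this using 2; ring
  · have := hc _ _ hab1 hb1 (hmax _ _ (by rcases hlarge with h | h <;> linarith))
    rw [← h1] at this
    have := le_abs_signed_sum (n _) (n _) (hsn ε) (sgn_eq σ) (hsn σ') this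
    convert this using 2; ring
  · have := hc _ _ hab1 ha1 (hmax _ _ (by rcases hlarge with h | h <;> linarith))
    rw [← h1] at this
    have := le_abs_signed_sum (n _) (n _) (hsn σ') (sgn_eq σ) (hsn ε) this
    convert this using 2; ring

/-- Large frequencies are covered by `phase_gap_of_large`; for the others the minimum over a finite
set of nonzero phases is positive. -/
lemma exists_phase_gap {κ g : ℝ} {h : ℝ≥0∞} (hκ : 0 < κ) (hg : 0 ≤ g) (hh : 0 < h) :
    ∃ c > 0, ∀ (σ σ' ε : Bool) (a b : ℤ), a ≠ 0 → b ≠ 0 → a + b ≠ 0 →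
      phase κ g h σ σ' ε a b ≠ 0 → c ≤ |phase κ g h σ σ' ε a b| := by
  obtain ⟨c, hc, H⟩ := disp_gap hκ hg hh
  obtain ⟨M, hM⟩ := exists_nat_ge (2 * (g / κ))
  let J := Finset.Icc (-(M : ℤ)) M
  obtain ⟨c', hc', H'⟩ := exists_pos_le (ι := Bool × Bool × Bool × J × J)
    -- Vanishing phases are replaced by `1` so that the minimum is taken over positive numbers only.
    (f := fun q => if phase κ g h q.1 q.2.1 q.2.2.1 q.2.2.2.1 q.2.2.2.2 = 0 then 1
      else |phase κ g h q.1 q.2.1 q.2.2.1 q.2.2.2.1 q.2.2.2.2|) (fun q => by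
        split_ifs with h0
        · exact one_pos
        · exact abs_pos.2 h0)
  refine ⟨min c c', lt_min hc hc', fun σ σ' ε a b ha hb hab hne => ?_⟩
  by_cases hlarge : 2 * (g / κ) < |(a : ℝ)| ∨ 2 * (g / κ) < |(b : ℝ)|
  · exact (min_le_left _ _).trans (phase_gap_of_large H (by
      rw [mul_div_cancel₀ _ hκ.ne']) hκ ha hb hab hlarge σ σ' ε)
  · push Not at hlarge
    have hm : ∀ z : ℤ, |(z : ℝ)| ≤ 2 * (g / κ) → z ∈ J := by
      intro z hz
      have : |z| ≤ (M : ℤ) := by exact_mod_cast hz.trans hM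
      exact Finset.mem_Icc.2 (abs_le.1 this)
    have := H' (σ, σ', ε, ⟨a, hm a hlarge.1⟩, ⟨b, hm b hlarge.2⟩)
    simp only [hne, if_false] at this
    exact (min_le_right _ _).trans this

/-! ### Coefficients of homogeneous operators -/

/-- The basis vector `e^{iax}`. -/
def unitSeq (a : ℤ) : Seq := fun n => if n = a then 1 else 0

/-- The basis vector with component `ε` equal to `e^{iax}`. -/
def unitVec (ε : Bool) (a : ℤ) : Vec := fun ε' => if ε' = ε then unitSeq a else 0

lemma proj_unitSeq (a : ℤ) : proj a.natAbs (unitSeq a) = unitSeq a := by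
  funext n
  simp only [proj, unitSeq]
  by_cases hn : n = a
  · simp [hn]
  · simp [hn]

lemma proj2_unitVec (ε : Bool) (a : ℤ) : proj2 a.natAbs (unitVec ε a) = unitVec ε a := by
  funext ε'
  by_cases h : ε' = ε
  · simp [proj2, unitVec, h, proj_unitSeq]
  · funext n; simp [proj2, unitVec, h, proj]

lemma normH_unitSeq (a : ℤ) : normH 0 (unitSeq a) = 1 := by
  have : ∀ n : ℤ, |(n : ℝ)| ^ (2 * (0 : ℝ)) * ‖unitSeq a n‖ ^ 2 = if n = a then 1 else 0 := by
    intro n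
    simp only [unitSeq]
    split_ifs <;> simp
  rw [normH]
  simp only [this]
  simp

lemma normH_zero (s : ℝ) : normH s 0 = 0 := by simp [normH]

lemma normH2_unitVec (ε : Bool) (a : ℤ) : normH2 0 (unitVec ε a) = 1 := by
  have : ∀ ε', normH 0 (unitVec ε a ε') ^ 2 = if ε' = ε then 1 else 0 := by
    intro ε'
    by_cases h : ε' = ε <;> simp [unitVec, h, normH_unitSeq, normH_zero]
  rw [normH2]
  simp only [this]
  simp

lemma finite_natAbs (n : ℕ) : {j : ℤ | j.natAbs = n}.Finite := by
  refine Set.Finite.subset (Set.finite_Icc (-(n : ℤ)) n) fun j hj => ?_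
  have : j.natAbs = n := hj
  simp only [Set.mem_Icc]; omega

lemma summable_proj (s : ℝ) (n : ℕ) (u : Seq) :
    Summable fun j : ℤ => |(j : ℝ)| ^ (2 * s) * ‖proj n u j‖ ^ 2 := by
  refine summable_of_hasFiniteSupport ((finite_natAbs n).subset fun j hj => ?_)
  by_contra hne
  exact hj (by simp [proj, show ¬ j.natAbs = n from hne])

lemma norm_le_normH_proj (n : ℕ) (u : Seq) (c : ℤ) : ‖proj n u c‖ ≤ normH 0 (proj n u) := by
  have h := (summable_proj 0 n u).le_tsum c fun _ _ => by positivity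
  have h1 : ‖proj n u c‖ ^ 2 ≤ normH 0 (proj n u) ^ 2 := by
    rw [normH_sq]
    simpa using h
  exact (abs_le_of_sq_le_sq' h1 (normH_nonneg _ _)).2

lemma homOp_unit (r : HomCoef) (U : Vec) {b c : ℤ} (hc : c ≠ 0) :
    homOp r U (unitSeq b) c = nrm * ∑ ε, r ε (c - b) b * U ε (c - b) := by
  simp only [homOp, hc, if_false]
  rw [tsum_eq_single (c - b)]
  · simp [unitSeq, nrm]
  · intro a ha
    have : c - a ≠ b := fun h => ha (by rw [← h]; ring)
    simp [unitSeq, this]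

lemma norm_nrm_inv_le : ‖nrm‖⁻¹ ≤ 3 := by
  rw [nrm, norm_inv, inv_inv, Complex.norm_real, Real.norm_of_nonneg (Real.sqrt_nonneg _)]
  refine Real.sqrt_le_iff.2 ⟨by norm_num, ?_⟩
  linarith [Real.pi_lt_d2]

lemma le_three_mul_of_nrm_mul_le {z : ℂ} {B : ℝ} (h : ‖nrm * z‖ ≤ B) : ‖z‖ ≤ 3 * B := by
  have h0 : 0 < ‖nrm‖ := norm_pos_iff.2 nrm_ne_zero
  rw [norm_mul] at h
  have hB : 0 ≤ B := (mul_nonneg (norm_nonneg _) (norm_nonneg _)).trans h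
  calc ‖z‖ = ‖nrm‖⁻¹ * (‖nrm‖ * ‖z‖) := by field_simp
    _ ≤ 3 * B := by
      have := norm_nrm_inv_le
      gcongr

/-- Testing on single exponentials isolates one coefficient; the factor `3` bounds the normalization
`√(2π)`. -/
lemma coef_le_of_hom {r : HomCoef} {F : ℕ → ℕ → ℕ → ℝ}
    (h : ∀ (U : Vec) (v : Seq) (n₀ n₁ n₂ : ℕ), 0 < n₀ → 0 < n₁ → 0 < n₂ →
      normH 0 (proj n₀ (homOp r (proj2 n₁ U) (proj n₂ v))) ≤
        F n₀ n₁ n₂ * normH2 0 (proj2 n₁ U) * normH 0 (proj n₂ v))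
    (ε : Bool) {a b : ℤ} (ha : a ≠ 0) (hb : b ≠ 0) (hab : a + b ≠ 0) :
    ‖r ε a b‖ ≤ 3 * F (a + b).natAbs a.natAbs b.natAbs := by
  have h1 := h (unitVec ε a) (unitSeq b) _ _ _ (Int.natAbs_pos.2 hab) (Int.natAbs_pos.2 ha)
    (Int.natAbs_pos.2 hb)
  rw [proj2_unitVec, proj_unitSeq, normH2_unitVec, normH_unitSeq, mul_one, mul_one] at h1
  have h2 := (norm_le_normH_proj (a + b).natAbs (homOp r (unitVec ε a) (unitSeq b)) (a + b)).trans h1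
  refine le_three_mul_of_nrm_mul_le ?_
  rw [show proj (a + b).natAbs (homOp r (unitVec ε a) (unitSeq b)) (a + b)
    = homOp r (unitVec ε a) (unitSeq b) (a + b) from if_pos rfl] at h2
  have e : homOp r (unitVec ε a) (unitSeq b) (a + b) = nrm * r ε a b := by
    rw [homOp_unit _ _ hab, add_sub_cancel_right, Finset.sum_eq_single ε]
    · simp [unitVec, unitSeq]
    · intro ε' _ hne; simp [unitVec, hne]
    · simp
  rwa [e] at h2

/-- After projection only the frequencies `±n₁` and two components of `U` contribute, which gives
`4`; the two output frequencies `±n₀` cost `√2 ≤ 2`. -/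
lemma hom_le_of_coef {r : HomCoef} {n₀ n₁ n₂ : ℕ} {F : ℝ} (hF : 0 ≤ F)
    (hn₀ : 0 < n₀)
    (h : ∀ ε (a b : ℤ), a.natAbs = n₁ → b.natAbs = n₂ → a + b ≠ 0 → ‖r ε a b‖ ≤ F)
    (U : Vec) (v : Seq) :
    normH 0 (proj n₀ (homOp r (proj2 n₁ U) (proj n₂ v))) ≤
      8 * F * normH2 0 (proj2 n₁ U) * normH 0 (proj n₂ v) := by
  set X := normH2 0 (proj2 n₁ U) with hX
  set Y := normH 0 (proj n₂ v) with hY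
  have X0 : 0 ≤ X := normH2_nonneg _ _
  have Y0 : 0 ≤ Y := normH_nonneg _ _
  have hU : ∀ ε a, ‖proj2 n₁ U ε a‖ ≤ X := fun ε a =>
    (norm_le_normH_proj n₁ (U ε) a).trans (normH_le_normH2 0 (proj2 n₁ U) ε)
  have pt : ∀ c, ‖proj n₀ (homOp r (proj2 n₁ U) (proj n₂ v)) c‖ ≤ 4 * F * X * Y := by
    intro c
    by_cases hc : c.natAbs = n₀
    swap
    · simp only [proj, hc, if_false, norm_zero]; positivity
    have hc0 : c ≠ 0 := by rintro rfl; simp at hc; omega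
    simp only [proj, hc, if_true, homOp, hc0, if_false]
    rw [tsum_eq_sum (s := {(n₁ : ℤ), -(n₁ : ℤ)})]
    · rw [norm_mul]
      have hterm : ∀ (a : ℤ) ε, ‖r ε a (c - a) * proj2 n₁ U ε a * proj n₂ v (c - a)‖ ≤ F * X * Y := by
        intro a ε
        by_cases ha : a.natAbs = n₁
        swap
        · simp only [proj2, proj, ha, if_false, mul_zero, zero_mul, norm_zero]; positivity
        by_cases hb : (c - a).natAbs = n₂
        swap
        · simp only [proj, hb, if_false, mul_zero, norm_zero]; positivity
        rw [norm_mul, norm_mul]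
        have := h ε a (c - a) ha hb (by rwa [add_sub_cancel])
        have := hU ε a
        have := norm_le_normH_proj n₂ v (c - a)
        gcongr
      have h2 : ‖((Real.sqrt (2 * Real.pi) : ℝ) : ℂ)⁻¹‖ ≤ 1 := norm_nrm_le
      calc _ ≤ 1 * ∑ a ∈ ({(n₁ : ℤ), -(n₁ : ℤ)} : Finset ℤ), ∑ ε : Bool, F * X * Y := by
            gcongr
            exact norm_sum_le_of_le _ fun a _ => norm_sum_le_of_le _ fun ε _ => hterm a ε
        _ ≤ 1 * (2 * (2 * (F * X * Y))) := by
            have hcard : (({(n₁ : ℤ), -(n₁ : ℤ)} : Finset ℤ).card : ℝ) ≤ 2 := by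
              exact_mod_cast Finset.card_le_two
            rw [Finset.sum_const, nsmul_eq_mul]
            simp only [Finset.sum_const, Finset.card_univ, Fintype.card_bool, nsmul_eq_mul]
            push_cast
            gcongr
        _ = 4 * F * X * Y := by ring
    · intro a ha
      have : ¬ a.natAbs = n₁ := by
        intro h
        simp only [Finset.mem_insert, Finset.mem_singleton] at ha
        omega
      simp [proj2, proj, this]
  have hs : ∑' n : ℤ, |(n : ℝ)| ^ (2 * (0 : ℝ)) *
      ‖proj n₀ (homOp r (proj2 n₁ U) (proj n₂ v)) n‖ ^ 2
      ≤ 2 * (4 * F * X * Y) ^ 2 := by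
    rw [tsum_eq_sum (s := {(n₀ : ℤ), -(n₀ : ℤ)})]
    · calc _ ≤ ∑ a ∈ ({(n₀ : ℤ), -(n₀ : ℤ)} : Finset ℤ), (4 * F * X * Y) ^ 2 := by
            refine Finset.sum_le_sum fun a _ => ?_
            rw [mul_zero, Real.rpow_zero, one_mul]
            have := pt a
            gcongr
        _ ≤ _ := by
            have hcard : (({(n₀ : ℤ), -(n₀ : ℤ)} : Finset ℤ).card : ℝ) ≤ 2 := by
              exact_mod_cast Finset.card_le_two
            rw [Finset.sum_const, nsmul_eq_mul]
            gcongr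
    · intro a ha
      have : ¬ a.natAbs = n₀ := by
        intro h
        simp only [Finset.mem_insert, Finset.mem_singleton] at ha
        omega
      simp [proj, this]
  rw [normH]
  refine Real.sqrt_le_iff.2 ⟨by positivity, hs.trans ?_⟩
  have : 8 * F * X * Y = 2 * (4 * F * X * Y) := by ring
  rw [this, mul_pow]
  nlinarith [sq_nonneg (4 * F * X * Y)]

lemma natAbs_cast_real (a : ℤ) : ((a.natAbs : ℕ) : ℝ) = |(a : ℝ)| := by
  rw [Nat.cast_natAbs, Int.cast_abs]

lemma coefBd_of_entries {ρ : ℝ} {r : HomMat}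
    (h : ∀ σ σ', ∃ μ ≥ (0 : ℝ), ∃ C ≥ (0 : ℝ), ∀ ε (a b : ℤ), a ≠ 0 → b ≠ 0 → a + b ≠ 0 →
      ‖r σ σ' ε a b‖ ≤
        C * (min |(a : ℝ)| |(b : ℝ)|) ^ (ρ + μ) * (max |(a : ℝ)| |(b : ℝ)|) ^ (-ρ)) :
    ∃ μ ≥ (0 : ℝ), ∃ C, CoefBd ρ μ C r := by
  have h' := fun q : Bool × Bool => h q.1 q.2
  choose μ hμ C hC H using h'
  obtain ⟨μ₀, hμ₀, hμ'⟩ := exists_nonneg_ge μ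
  obtain ⟨C₀, hC₀, hC'⟩ := exists_nonneg_ge C
  refine ⟨μ₀, hμ₀, C₀, hC₀, fun σ σ' ε a b ha hb hab => (H (σ, σ') ε a b ha hb hab).trans ?_⟩
  have h1 : 1 ≤ min |(a : ℝ)| |(b : ℝ)| := le_min (one_le_abs_cast ha) (one_le_abs_cast hb)
  have h2 := hC' (σ, σ')
  have h3 := hμ' (σ, σ')
  have h4 := hC (σ, σ')
  gcongr

lemma exists_coefBd_of_smoothing {ρ : ℝ} {r : HomMat} (h : ∀ σ σ', IsHomSmoothing ρ (r σ σ')) :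
    ∃ μ ≥ (0 : ℝ), ∃ C, CoefBd ρ μ C r := by
  refine coefBd_of_entries fun σ σ' => ?_
  obtain ⟨μ, hμ, C, hC, H⟩ := h σ σ'
  refine ⟨μ, hμ, 3 * C, by positivity, fun ε a b ha hb hab => ?_⟩
  have := coef_le_of_hom (F := fun _ n₁ n₂ =>
    C * ((min n₁ n₂ : ℝ) ^ (ρ + μ) / (max n₁ n₂ : ℝ) ^ ρ)) H ε ha hb hab
  refine this.trans (le_of_eq ?_)
  have hmax : 0 < max |(a : ℝ)| |(b : ℝ)| := lt_max_of_lt_left (abs_cast_pos ha)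
  simp only [natAbs_cast_real]
  rw [Real.rpow_neg hmax.le]
  ring

/-- Since `n₀ + n₁ + n₂ ≤ 4 max(n₁, n₂)`, a map of order `m` fits the scheme with `ρ = -m`, `μ = m`:
the exponent of the minimum is then zero. -/
lemma exists_coefBd_of_homMap {m : ℝ} (hm : 0 ≤ m) {r : HomMat} (h : ∀ σ σ', IsHomMap m (r σ σ')) :
    ∃ μ ≥ (0 : ℝ), ∃ C, CoefBd (-m) μ C r := by
  refine coefBd_of_entries fun σ σ' => ?_
  obtain ⟨C, hC, H⟩ := h σ σ'
  refine ⟨m, hm, 3 * C * 4 ^ m, by positivity, fun ε a b ha hb hab => ?_⟩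
  have := coef_le_of_hom (F := fun n₀ n₁ n₂ => C * (n₀ + n₁ + n₂ : ℝ) ^ m) H ε ha hb hab
  refine this.trans ?_
  simp only [natAbs_cast_real]
  have h1 : |((a + b : ℤ) : ℝ)| ≤ |(a : ℝ)| + |(b : ℝ)| := by
    push_cast; exact abs_add_le _ _
  have h2 := le_max_left |(a : ℝ)| |(b : ℝ)|
  have h3 := le_max_right |(a : ℝ)| |(b : ℝ)|
  have h4 : 0 ≤ max |(a : ℝ)| |(b : ℝ)| := (abs_nonneg _).trans h2
  rw [neg_add_cancel, Real.rpow_zero, mul_one, neg_neg, mul_assoc (3 * C),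
    ← Real.mul_rpow (by norm_num) h4, mul_assoc]
  gcongr
  linarith

lemma CoefBd.isHomSmoothing {ρ μ C : ℝ} {r : HomMat} (h : CoefBd ρ μ C r) (hμ : 0 ≤ μ)
    (σ σ' : Bool) : IsHomSmoothing ρ (r σ σ') := by
  have hC := h.1
  refine ⟨μ, hμ, 8 * (C + 1), by positivity, fun U v n₀ n₁ n₂ h₀ h₁ h₂ => ?_⟩
  have p1 : (0 : ℝ) < n₁ := by exact_mod_cast h₁
  have p2 : (0 : ℝ) < n₂ := by exact_mod_cast h₂
  have pm : 0 < max (n₁ : ℝ) n₂ := lt_max_of_lt_left p1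
  have pmin : 0 < min (n₁ : ℝ) n₂ := lt_min p1 p2
  refine (hom_le_of_coef (F := (C + 1) * ((min n₁ n₂ : ℝ) ^ (ρ + μ) / (max n₁ n₂ : ℝ) ^ ρ))
    (by positivity) h₀ (fun ε a b ha hb hab => ?_) U v).trans (le_of_eq (by ring))
  have ha0 : a ≠ 0 := by rintro rfl; simp at ha; omega
  have hb0 : b ≠ 0 := by rintro rfl; simp at hb; omega
  have := h.2 σ σ' ε a b ha0 hb0 hab
  rw [← natAbs_cast_real, ← natAbs_cast_real, ha, hb, Real.rpow_neg pm.le, mul_assoc,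
    ← div_eq_mul_inv] at this
  refine this.trans ?_
  gcongr
  linarith

/-- The smoothing factor `(min/max)^ρ` is at most one and is dropped, leaving `min^μ`. -/
lemma CoefBd.isHomMap {ρ μ C : ℝ} {r : HomMat} (h : CoefBd ρ μ C r) (hμ : 0 ≤ μ) (hρ : 0 ≤ ρ)
    (σ σ' : Bool) : IsHomMap μ (r σ σ') := by
  have hC := h.1
  refine ⟨8 * (C + 1), by positivity, fun U v n₀ n₁ n₂ h₀ h₁ h₂ => ?_⟩
  have p0 : (0 : ℝ) < n₀ := by exact_mod_cast h₀
  have p1 : (0 : ℝ) < n₁ := by exact_mod_cast h₁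
  have p2 : (0 : ℝ) < n₂ := by exact_mod_cast h₂
  have pm : 0 < max (n₁ : ℝ) n₂ := lt_max_of_lt_left p1
  have pmin : 0 < min (n₁ : ℝ) n₂ := lt_min p1 p2
  refine (hom_le_of_coef (F := (C + 1) * (n₀ + n₁ + n₂ : ℝ) ^ μ)
    (by positivity) h₀ (fun ε a b ha hb hab => ?_) U v).trans (le_of_eq (by ring))
  have ha0 : a ≠ 0 := by rintro rfl; simp at ha; omega
  have hb0 : b ≠ 0 := by rintro rfl; simp at hb; omega
  have := h.2 σ σ' ε a b ha0 hb0 hab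
  rw [← natAbs_cast_real, ← natAbs_cast_real, ha, hb] at this
  refine this.trans ?_
  have e1 : (min (n₁ : ℝ) n₂) ^ (ρ + μ) * (max (n₁ : ℝ) n₂) ^ (-ρ) ≤ (n₀ + n₁ + n₂ : ℝ) ^ μ := by
    rw [Real.rpow_add pmin]
    have f1 : (min (n₁ : ℝ) n₂) ^ ρ * (max (n₁ : ℝ) n₂) ^ (-ρ) ≤ 1 := by
      rw [Real.rpow_neg pm.le, ← div_eq_mul_inv, div_le_one (by positivity)]
      exact Real.rpow_le_rpow pmin.le min_le_max hρ
    have f2 : (min (n₁ : ℝ) n₂) ^ μ ≤ (n₀ + n₁ + n₂ : ℝ) ^ μ := by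
      refine Real.rpow_le_rpow pmin.le ((min_le_left _ _).trans ?_) hμ
      linarith
    calc _ = ((min (n₁ : ℝ) n₂) ^ ρ * (max (n₁ : ℝ) n₂) ^ (-ρ)) * (min (n₁ : ℝ) n₂) ^ μ := by ring
      _ ≤ 1 * (n₀ + n₁ + n₂ : ℝ) ^ μ := by gcongr
      _ = _ := one_mul _
  rw [mul_assoc]
  gcongr
  linarith

/-! ### Reality -/

lemma cj_cj (u : Seq) : cj (cj u) = u := by
  funext n; simp [cj]

lemma cj_add (u v : Seq) : cj (u + v) = cj u + cj v := by
  funext n; simp [cj]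

lemma cj_zero : cj 0 = 0 := by
  funext n; simp [cj]

/-- The conjugation `(u⁺, u⁻) ↦ (conj u⁻, conj u⁺)`, whose fixed points are the real vectors. -/
def Cc (u : Vec) : Vec := fun σ => cj (u !σ)

lemma Cc_add (u v : Vec) : Cc (u + v) = Cc u + Cc v := by
  funext σ; simp [Cc, cj_add]

lemma Cc_apply (u : Vec) (σ : Bool) (n : ℤ) : Cc u σ n = starRingEnd ℂ (u (!σ) (-n)) := rfl

lemma isReal_iff {u : Vec} : IsReal u ↔ Cc u = u := by
  constructor
  · intro h
    funext σ
    cases σ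
    · exact h.symm
    · simp only [Cc, Bool.not_true]
      rw [show u false = cj (u true) from h, cj_cj]
  · intro h
    have := congrFun h false
    simpa [Cc, IsReal] using this.symm

/-- The reality condition for the coefficients. -/
def RealCoef (r : HomMat) : Prop :=
  ∀ σ σ' ε (a b : ℤ), a ≠ 0 → b ≠ 0 → a + b ≠ 0 →
    r σ σ' ε a b = starRingEnd ℂ (r (!σ) (!σ') (!ε) (-a) (-b))

lemma conj_nrm : starRingEnd ℂ nrm = nrm := by
  rw [nrm, map_inv₀, Complex.conj_ofReal]

/-- The substitutions `a ↦ -a` and `ε ↦ -ε` carry one series into the conjugate of the other. Terms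
with a zero frequency, where the symmetry of the coefficients is not assumed, vanish. -/
lemma RealCoef.homOp_cj {r : HomMat} (h : RealCoef r) {U : Vec} (hU : ∀ σ, U σ 0 = 0) {v : Seq}
    (hv : v 0 = 0) (σ σ' : Bool) :
    homOp (r σ σ') (Cc U) (cj v) = cj (homOp (r (!σ) (!σ')) U v) := by
  funext c
  rcases eq_or_ne c 0 with rfl | hc
  · simp [homOp, cj]
  have hc' : -c ≠ 0 := neg_ne_zero.2 hc
  simp only [cj, homOp, hc, hc', if_false, map_mul, Complex.conj_tsum]
  change nrm * _ = starRingEnd ℂ nrm * _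
  rw [conj_nrm]
  congr 1
  rw [← (Equiv.neg ℤ).tsum_eq]
  refine tsum_congr fun a => ?_
  simp only [Equiv.neg_apply, map_sum, map_mul, Cc_apply, neg_neg]
  rcases eq_or_ne a 0 with rfl | ha
  · simp [hU]
  rcases eq_or_ne (-c - a) 0 with hb | hb
  · simp only [show -(c - -a) = -c - a by ring, hb, hv, map_zero, mul_zero,
      Finset.sum_const_zero]
  rw [← Equiv.sum_comp Equiv.boolNot]
  refine Finset.sum_congr rfl fun ε _ => ?_
  rw [h σ σ' _ (-a) (c - -a) (neg_ne_zero.2 ha) (by omega) (by omega)]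
  simp only [Equiv.boolNot_apply, Bool.not_not, neg_neg]
  rw [show -(c - -a) = -c - a by ring]

lemma RealCoef.bil_Cc {r : HomMat} (h : RealCoef r) {U v : Vec} (hU : ∀ σ, U σ 0 = 0)
    (hv : ∀ σ, v σ 0 = 0) : bil r (Cc U) (Cc v) = Cc (bil r U v) := by
  funext σ
  have : Cc (bil r U v) σ = ∑ σ', cj (homOp (r (!σ) σ') U (v σ')) := by
    simp [Cc, bil, cj_add]
  rw [this, ← Equiv.sum_comp Equiv.boolNot]
  simp only [bil, Equiv.boolNot_apply]
  exact Finset.sum_congr rfl fun σ' _ => h.homOp_cj hU (hv _) σ σ'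

lemma RealCoef.isRealHom {r : HomMat} (h : RealCoef r) : IsRealHom r := by
  intro U hU hr v hv σ σ'
  have h1 := h.homOp_cj (U := U) (fun τ => (hU 0 τ).1) (v := cj v) (by simp [cj, (hv 0).1]) σ σ'
  rwa [isReal_iff.1 hr, cj_cj] at h1

lemma memH_of_finite {u : Seq} (h0 : u 0 = 0) (h : (Function.support u).Finite) (s : ℝ) :
    MemH s u := by
  refine ⟨h0, summable_of_hasFiniteSupport (h.subset fun n hn => ?_)⟩
  by_contra hne
  exact hn (by simp [Function.notMem_support.1 hne])

lemma memH_unitSeq {a : ℤ} (ha : a ≠ 0) (s : ℝ) : MemH s (unitSeq a) := by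
  refine memH_of_finite (by simp [unitSeq, ha.symm]) ((Set.finite_singleton a).subset fun n hn => ?_) s
  by_contra hne
  exact hn (if_neg hne)

lemma cj_unitSeq (a : ℤ) : cj (unitSeq a) = unitSeq (-a) := by
  funext n
  simp only [cj, unitSeq]
  by_cases hn : n = -a
  · simp [hn]
  · rw [if_neg hn, if_neg (by omega), map_zero]

lemma cj_smul (c : ℂ) (u : Seq) : cj (c • u) = (starRingEnd ℂ c) • cj u := by
  funext n; simp [cj]

/-- For a real `U` with `U^ε` supported at `a`, the other component is supported at `-a ≠ a`.
Applying `R(U)` to `e^{ibx}` and reading frequency `a + b` therefore singles out one coefficient. -/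
lemma IsRealHom.realCoef {r : HomMat} (h : IsRealHom r) : RealCoef r := by
  intro σ σ' ε a b ha hb hab
  -- real vectors with `U^ε = z e^{iax}`, `z = 1, i`
  have key : ∀ z : ℂ, r σ σ' ε a b * z + r σ σ' (!ε) a b * (if a = -a then starRingEnd ℂ z else 0)
      = starRingEnd ℂ (r (!σ) (!σ') (!ε) (-a) (-b)) * z +
        starRingEnd ℂ (r (!σ) (!σ') ε (-a) (-b)) * (if a = -a then starRingEnd ℂ z else 0) := by
    intro z
    let U : Vec := fun τ => if τ = ε then z • unitSeq a else (starRingEnd ℂ z) • unitSeq (-a)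
    have hUε : U ε = z • unitSeq a := if_pos rfl
    have hUε' : U (!ε) = (starRingEnd ℂ z) • unitSeq (-a) := if_neg (by cases ε <;> simp)
    have hs : ∀ (c : ℂ) {a : ℤ}, a ≠ 0 → ∀ s, MemH s (c • unitSeq a) := fun c a ha s =>
      memH_of_finite (by simp [unitSeq, ha.symm]) ((Set.finite_singleton a).subset fun n hn => by
        by_contra hne
        exact hn (by simp [unitSeq, show ¬ n = a from hne])) s
    have hU : ∀ s, MemH2 s U := fun s τ => by
      simp only [U]
      split_ifs
      · exact hs _ ha s
      · exact hs _ (neg_ne_zero.2 ha) s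
    have hreal : IsReal U := by
      cases ε
      · simp [IsReal, U, cj_smul, cj_unitSeq]
      · simp [IsReal, U, cj_smul, cj_unitSeq]
    have h1 := congrFun (h U hU hreal (unitSeq b) (memH_unitSeq hb) σ σ') (a + b)
    rw [cj_unitSeq, cj, homOp_unit _ _ hab, homOp_unit _ _ (neg_ne_zero.2 hab), map_mul,
      conj_nrm] at h1
    have h2 := mul_left_cancel₀ nrm_ne_zero h1
    rw [add_sub_cancel_right, show -(a + b) - -b = -a by ring] at h2
    have hsum : ∀ f : Bool → ℂ, ∑ τ, f τ = f ε + f (!ε) := by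
      intro f; cases ε <;> simp [add_comm]
    rw [hsum, hsum, hUε, hUε', map_add, map_mul, map_mul] at h2
    simp only [Pi.smul_apply, unitSeq, smul_eq_mul, if_true, mul_one, map_mul,
      Complex.conj_conj] at h2
    have e : ¬ (-a = a) := by omega
    have e' : ¬ (a = -a) := by omega
    simp only [e, e', if_false, mul_zero, map_zero, add_zero, zero_add] at h2 ⊢
    exact h2
  have e' : ¬ (a = -a) := by omega
  simpa [e'] using key 1

/-! ### The paradifferential operators of homogeneous symbols -/

lemma homSymbol_unit (c : HomSymbolCoef) (ε : Bool) (l : ℤ) (x ξ : ℝ) :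
    homSymbol c (unitVec ε l) x ξ = nrm * (c ε l ξ * Complex.exp (Complex.I * l * x)) := by
  rw [homSymbol, tsum_eq_single l]
  · rw [Finset.sum_eq_single ε]
    · simp [unitVec, unitSeq, nrm]
    · intro ε' _ hne; simp [unitVec, hne]
    · simp
  · intro l' hl
    refine Finset.sum_eq_zero fun ε' _ => ?_
    by_cases h : ε' = ε <;> simp [unitVec, unitSeq, h, hl]

lemma IsHomSymbol.coef_le {m : ℝ} {c : HomSymbolCoef} (h : IsHomSymbol m c) :
    ∃ μ > (0 : ℝ), ∃ C ≥ (0 : ℝ), ∀ ε (l : ℤ) ξ, l ≠ 0 → ‖c ε l ξ‖ ≤ C * |(l : ℝ)| ^ μ * jap ξ ^ m := by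
  obtain ⟨-, μ, hμ, H⟩ := h
  obtain ⟨C, hC, H⟩ := H 0 0
  refine ⟨μ, hμ, 3 * C, by positivity, fun ε l ξ hl => ?_⟩
  have h1 := H (unitVec ε l) l.natAbs (Int.natAbs_pos.2 hl) 0 ξ
  simp only [iteratedDeriv_zero, proj2_unitVec, normH2_unitVec, mul_one, homSymbol_unit,
    natAbs_cast_real, Nat.cast_zero, add_zero, sub_zero] at h1
  have h2 := le_three_mul_of_nrm_mul_le h1
  simpa [mul_assoc] using h2

/-- The coefficients of `Op^{BW}(a)` for a homogeneous symbol `a`. -/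
def paraCoef (χ₁ : ℝ → ℝ → ℝ) (c : Bool → Bool → HomSymbolCoef) : HomMat := fun σ σ' ε a b =>
  (χ₁ a (((a + 2 * b : ℤ) : ℝ) / 2) : ℂ) * c σ σ' ε a (((a + 2 * b : ℤ) : ℝ) / 2)

/-- The change of index `a = k - j` displays the paradifferential operator as a bilinear operator
with coefficients, so that all estimates for `bil` apply to it. -/
lemma act_paraHomMat (χ₁ : ℝ → ℝ → ℝ) (c : Bool → Bool → HomSymbolCoef) (U : ℝ → Vec) (t : ℝ)
    (v : Vec) : act (paraHomMat χ₁ c) U t v = bil (paraCoef χ₁ c) (U t) v := by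
  funext σ
  refine Finset.sum_congr rfl fun σ' _ => ?_
  funext k
  simp only [paraHomMat, opBW, homOp]
  split_ifs
  · rfl
  congr 1
  rw [← (Equiv.subLeft k).tsum_eq]
  refine tsum_congr fun a => ?_
  simp only [Equiv.subLeft_apply, sub_sub_cancel, paraCoef]
  rw [show k + (k - a) = a + 2 * (k - a) by ring, Finset.mul_sum, Finset.sum_mul]
  exact Finset.sum_congr rfl fun ε _ => by ring

/-- On the support of the cut-off `|a| ≤ 4 min(|a|, |b|)`, so the powers of `|a|` count as powers of
the minimum, while `jap ≤ 4 max(|a|, |b|)`. The shift by `3/2` in the second parameter makes the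
exponent of the minimum equal to `μ`. -/
lemma exists_coefBd_paraCoef {δ : ℝ} {χ₁ : ℝ → ℝ → ℝ} (hχ : IsCutoff δ χ₁)
    {c : Bool → Bool → HomSymbolCoef} (h : ∀ σ σ', IsHomSymbol (3 / 2) (c σ σ')) :
    ∃ μ ≥ (0 : ℝ), ∃ C, CoefBd (-(3 / 2)) μ C (paraCoef χ₁ c) := by
  refine coefBd_of_entries fun σ σ' => ?_
  obtain ⟨μ, hμ, C, hC, H⟩ := (h σ σ').coef_le
  obtain ⟨X, hX, HX⟩ := hχ.exists_bound
  refine ⟨μ + 3 / 2, by positivity, X * (C * (4 : ℝ) ^ μ * 4 ^ (3 / 2 : ℝ)), by positivity,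
    fun ε a b ha hb hab => ?_⟩
  have pa := abs_cast_pos ha
  have pb := abs_cast_pos hb
  have pmin : 0 < min |(a : ℝ)| |(b : ℝ)| := lt_min pa pb
  have pmax : 0 < max |(a : ℝ)| |(b : ℝ)| := lt_max_of_lt_left pa
  by_cases h0 : χ₁ a (((a + 2 * b : ℤ) : ℝ) / 2) = 0
  · rw [paraCoef, h0]
    simp only [Complex.ofReal_zero, zero_mul, norm_zero]
    positivity
  have hcomp := hχ.comparable hab hb (by
    rw [add_sub_cancel_right, show a + b + b = a + 2 * b by ring]; exact h0)
  rw [add_sub_cancel_right, show a + b + b = a + 2 * b by ring] at hcomp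
  obtain ⟨-, -, h3, -, h5⟩ := hcomp
  have h6 : |(a : ℝ)| ≤ 4 * min |(a : ℝ)| |(b : ℝ)| := by
    rw [mul_min_of_nonneg _ _ (by norm_num)]
    exact le_min (by linarith) h3
  have h7 : |(b : ℝ)| ≤ max |(a : ℝ)| |(b : ℝ)| := le_max_right _ _
  rw [paraCoef, norm_mul, Complex.norm_real, Real.norm_eq_abs, show -(3 / 2 : ℝ) + (μ + 3 / 2) = μ by ring, neg_neg,
    mul_assoc, mul_assoc X]
  refine mul_le_mul (HX _ _) ?_ (norm_nonneg _) hX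
  calc _ ≤ C * |(a : ℝ)| ^ μ * jap (((a + 2 * b : ℤ) : ℝ) / 2) ^ (3 / 2 : ℝ) := H ε a _ ha
    _ ≤ C * (4 * min |(a : ℝ)| |(b : ℝ)|) ^ μ * (4 * max |(a : ℝ)| |(b : ℝ)|) ^ (3 / 2 : ℝ) := by
        have := jap_nonneg (((a + 2 * b : ℤ) : ℝ) / 2)
        have : jap (((a + 2 * b : ℤ) : ℝ) / 2) ≤ 4 * max |(a : ℝ)| |(b : ℝ)| := by linarith
        gcongr
    _ = _ := by
        rw [Real.mul_rpow (by norm_num) pmin.le, Real.mul_rpow (by norm_num) pmax.le]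
        ring

/-! ### The homological equation -/

/-- The operator `iΩ(D)E`. -/
def dispOp (κ g : ℝ) (h : ℝ≥0∞) (w : Vec) : Vec := fun σ n =>
  Complex.I * ((sgn σ * disp κ g h n : ℝ) : ℂ) * w σ n

lemma act_dispE (κ g : ℝ) (h : ℝ≥0∞) (V : ℝ → Vec) (t : ℝ) (w : Vec) :
    act (Complex.I • dispE κ g h) V t w = dispOp κ g h w := by
  funext σ n
  simp only [act, dispE, dispOp, Finset.sum_apply, Pi.smul_apply, smul_eq_mul]
  rw [Finset.sum_eq_single σ]
  · simp [mul_assoc]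
  · intro σ' _ hne; simp [hne.symm]
  · simp

lemma Bd.dispOp {κ g : ℝ} (hκ : 0 < κ) (hg : 0 ≤ g) (h : ℝ≥0∞) {s B : ℝ} {w : Vec}
    (hw : Bd s w B) : Bd (s - 3 / 2) (dispOp κ g h w) (Real.sqrt (κ + g) * B) := by
  refine ⟨fun σ => by simp [WaterWaves.dispOp, hw.1 σ], fun σ n hn => ?_⟩
  have h1 := disp_le hκ hg h hn
  have h2 := hw.2 σ n hn
  have h3 := disp_nonneg κ g h n
  have h4 : |sgn σ| = 1 := by cases σ <;> simp [sgn]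
  have hn0 := abs_cast_pos hn
  simp only [WaterWaves.dispOp, norm_mul, Complex.norm_I, one_mul, Complex.norm_real, Real.norm_eq_abs,
    h4, abs_of_nonneg h3]
  calc _ ≤ (Real.sqrt (κ + g) * |(n : ℝ)| ^ (3 / 2 : ℝ)) * (B * |(n : ℝ)| ^ (-s)) := by gcongr
    _ = Real.sqrt (κ + g) * B * (|(n : ℝ)| ^ (3 / 2 : ℝ) * |(n : ℝ)| ^ (-s)) := by ring
    _ = _ := by rw [← Real.rpow_add hn0]; ring_nf

/-- The solution of the homological equation. -/
def genCoef (κ g : ℝ) (h : ℝ≥0∞) (r : HomMat) : HomMat := fun σ σ' ε a b =>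
  if phase κ g h σ σ' ε a b = 0 then 0
  else r σ σ' ε a b / (Complex.I * (phase κ g h σ σ' ε a b : ℝ))

lemma resPart_eq (κ g : ℝ) (h : ℝ≥0∞) (r : HomMat) (σ σ' ε : Bool) (a b : ℤ) :
    resPart κ g h r σ σ' ε a b = if phase κ g h σ σ' ε a b = 0 then r σ σ' ε a b else 0 := by
  simp only [resPart, phase]
  congr

lemma phase_neg (κ g : ℝ) (h : ℝ≥0∞) (σ σ' ε : Bool) (a b : ℤ) :
    phase κ g h (!σ) (!σ') (!ε) (-a) (-b) = -phase κ g h σ σ' ε a b := by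
  have h1 : ∀ τ, sgn (!τ) = - sgn τ := fun τ => by cases τ <;> simp [sgn]
  have e : ((-a + -b : ℤ) : ℝ) = -((a + b : ℤ) : ℝ) := by push_cast; ring
  simp only [phase, h1, e, Int.cast_neg, disp_neg]
  ring

lemma RealCoef.resPart {r : HomMat} (hr : RealCoef r) (κ g : ℝ) (h : ℝ≥0∞) :
    RealCoef (resPart κ g h r) := by
  intro σ σ' ε a b ha hb hab
  simp only [resPart_eq, phase_neg, neg_eq_zero]
  split_ifs
  · exact hr σ σ' ε a b ha hb hab
  · simp

lemma RealCoef.genCoef {r : HomMat} (hr : RealCoef r) (κ g : ℝ) (h : ℝ≥0∞) :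
    RealCoef (genCoef κ g h r) := by
  intro σ σ' ε a b ha hb hab
  simp only [WaterWaves.genCoef, phase_neg, neg_eq_zero]
  split_ifs
  · simp
  · rw [hr σ σ' ε a b ha hb hab, map_div₀, map_mul, Complex.conj_I, Complex.conj_ofReal]
    congr 1
    push_cast
    ring

lemma CoefBd.resPart {ρ μ C : ℝ} {r : HomMat} (hr : CoefBd ρ μ C r) (κ g : ℝ) (h : ℝ≥0∞) :
    CoefBd ρ μ C (resPart κ g h r) := by
  refine ⟨hr.1, fun σ σ' ε a b ha hb hab => ?_⟩
  have := hr.2 σ σ' ε a b ha hb hab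
  rw [resPart_eq]
  split_ifs
  · exact this
  · simpa using (norm_nonneg _).trans this

/-- Nonzero phases have a uniform lower bound, so the division changes the constant but neither `ρ`
nor `μ`. -/
lemma exists_coefBd_genCoef {κ g : ℝ} {h : ℝ≥0∞} (hκ : 0 < κ) (hg : 0 ≤ g) (hh : 0 < h)
    {ρ μ C : ℝ} {r : HomMat} (hr : CoefBd ρ μ C r) :
    ∃ C', CoefBd ρ μ C' (genCoef κ g h r) := by
  obtain ⟨c, hc, H⟩ := exists_phase_gap (h := h) hκ hg hh
  have hC := hr.1
  refine ⟨C / c, by positivity, fun σ σ' ε a b ha hb hab => ?_⟩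
  have h1 := hr.2 σ σ' ε a b ha hb hab
  have h2 := (norm_nonneg _).trans h1
  rw [genCoef, div_mul_eq_mul_div, div_mul_eq_mul_div]
  split_ifs with h0
  · rw [norm_zero]; positivity
  · rw [norm_div, norm_mul, Complex.norm_I, one_mul, Complex.norm_real, Real.norm_eq_abs]
    have := H σ σ' ε a b ha hb hab h0
    gcongr

/-- The discarded factor is `(min/max)^{ρ - ρ'} ≤ 1`. -/
lemma CoefBd.mono_rho {ρ ρ' μ C : ℝ} {r : HomMat} (hr : CoefBd ρ μ C r) (hρ : ρ' ≤ ρ) :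
    CoefBd ρ' μ C r := by
  refine ⟨hr.1, fun σ σ' ε a b ha hb hab => (hr.2 σ σ' ε a b ha hb hab).trans ?_⟩
  have hC := hr.1
  have pmin : 0 < min |(a : ℝ)| |(b : ℝ)| := lt_min (abs_cast_pos ha) (abs_cast_pos hb)
  have pmax : 0 < max |(a : ℝ)| |(b : ℝ)| := lt_max_of_lt_left (abs_cast_pos ha)
  have h1 : (min |(a : ℝ)| |(b : ℝ)|) ^ (ρ - ρ') * (max |(a : ℝ)| |(b : ℝ)|) ^ (-(ρ - ρ')) ≤ 1 := by
    rw [Real.rpow_neg pmax.le, ← div_eq_mul_inv, div_le_one (by positivity)]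
    exact Real.rpow_le_rpow pmin.le min_le_max (by linarith)
  have e1 : (min |(a : ℝ)| |(b : ℝ)|) ^ (ρ + μ)
      = (min |(a : ℝ)| |(b : ℝ)|) ^ (ρ' + μ) * (min |(a : ℝ)| |(b : ℝ)|) ^ (ρ - ρ') := by
    rw [← Real.rpow_add pmin]; ring_nf
  have e2 : (max |(a : ℝ)| |(b : ℝ)|) ^ (-ρ)
      = (max |(a : ℝ)| |(b : ℝ)|) ^ (-ρ') * (max |(a : ℝ)| |(b : ℝ)|) ^ (-(ρ - ρ')) := by
    rw [← Real.rpow_add pmax]; ring_nf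
  rw [e1, e2]
  calc _ = (C * (min |(a : ℝ)| |(b : ℝ)|) ^ (ρ' + μ) * (max |(a : ℝ)| |(b : ℝ)|) ^ (-ρ')) *
        ((min |(a : ℝ)| |(b : ℝ)|) ^ (ρ - ρ') * (max |(a : ℝ)| |(b : ℝ)|) ^ (-(ρ - ρ'))) := by ring
    _ ≤ (C * (min |(a : ℝ)| |(b : ℝ)|) ^ (ρ' + μ) * (max |(a : ℝ)| |(b : ℝ)|) ^ (-ρ')) * 1 := by
        gcongr
    _ = _ := mul_one _

lemma CoefBd.sub {ρ μ C C' : ℝ} {r r' : HomMat} (h : CoefBd ρ μ C r) (h' : CoefBd ρ μ C' r') :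
    CoefBd ρ μ (C + C') (r - r') := by
  refine ⟨add_nonneg h.1 h'.1, fun σ σ' ε a b ha hb hab => ?_⟩
  rw [add_mul, add_mul]
  exact (norm_sub_le _ _).trans (add_le_add (h.2 σ σ' ε a b ha hb hab)
    (h'.2 σ σ' ε a b ha hb hab))

lemma RealCoef.sub {r r' : HomMat} (h : RealCoef r) (h' : RealCoef r') : RealCoef (r - r') := by
  intro σ σ' ε a b ha hb hab
  have h1 := h σ σ' ε a b ha hb hab
  have h2 := h' σ σ' ε a b ha hb hab
  simp only [Pi.sub_apply, map_sub]
  rw [h1, h2]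

/-- On one pair of frequencies the first three terms multiply the coefficient of `G` by `i(εΩ(a) +
σ'Ω(b) - σΩ(a+b)) = -iφ`. For `φ ≠ 0` this cancels `r`; for `φ = 0` the coefficient of `G` is zero
and `r` survives. The levels are raised by `3/2` so that all series involving `Ω` converge. -/
lemma homological_equation {κ g : ℝ} {h : ℝ≥0∞} (hκ : 0 < κ) (hg : 0 ≤ g)
    {ρ μ C CG p q α x : ℝ} {r : HomMat} (hr : CoefBd ρ μ C r)
    (hG : CoefBd ρ μ CG (genCoef κ g h r)) (hp : Lv ρ μ (p - 3 / 2)) (hq : Lv ρ μ (q - 3 / 2))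
    {U v : Vec} (hU : Bd p U α) (hv : Bd q v x) :
    bil (genCoef κ g h r) (dispOp κ g h U) v + (bil (genCoef κ g h r) U (dispOp κ g h v)
      - dispOp κ g h (bil (genCoef κ g h r) U v)) + bil r U v = bil (resPart κ g h r) U v := by
  have hp' : Lv ρ μ p := hp.mono (by linarith)
  have hq' : Lv ρ μ q := hq.mono (by linarith)
  have hLU := hU.dispOp hκ hg h
  have hLv := hv.dispOp hκ hg h
  funext σ c
  rcases eq_or_ne c 0 with rfl | hc
  · simp [bil_zero_mode, dispOp]
  simp only [Pi.add_apply, Pi.sub_apply]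
  rw [show dispOp κ g h (bil (genCoef κ g h r) U v) σ c
    = Complex.I * ((sgn σ * disp κ g h c : ℝ) : ℂ) * bil (genCoef κ g h r) U v σ c from rfl]
  rw [bil_eq_tsum hG hp hq' hLU hv σ hc, bil_eq_tsum hG hp' hq hU hLv σ hc,
    bil_eq_tsum hG hp' hq' hU hv σ hc, bil_eq_tsum hr hp' hq' hU hv σ hc,
    bil_eq_tsum (hr.resPart κ g h) hp' hq' hU hv σ hc]
  have s1 := summable_bt hG hp hq' hLU hv σ hc
  have s2 := summable_bt hG hp' hq hU hLv σ hc
  have s3 := summable_bt hG hp' hq' hU hv σ hc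
  have s4 := summable_bt hr hp' hq' hU hv σ hc
  rw [mul_left_comm, ← tsum_mul_left (a := Complex.I * _), ← mul_sub,
    ← s2.tsum_sub (s3.mul_left _), ← mul_add, ← s1.tsum_add (s2.sub (s3.mul_left _)), ← mul_add,
    ← (s1.add (s2.sub (s3.mul_left _))).tsum_add s4]
  congr 1
  refine tsum_congr fun a => ?_
  simp only [bt, Finset.mul_sum, ← Finset.sum_sub_distrib, ← Finset.sum_add_distrib]
  refine Finset.sum_congr rfl fun σ' _ => Finset.sum_congr rfl fun ε _ => ?_
  simp only [dispOp, resPart_eq, genCoef]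
  set φ := phase κ g h σ σ' ε a (c - a) with hφ
  have hph : ((sgn σ * disp κ g h c : ℝ) : ℂ) = (φ : ℂ) + ((sgn σ' * disp κ g h ((c - a : ℤ) : ℝ) : ℝ) : ℂ)
      + ((sgn ε * disp κ g h a : ℝ) : ℂ) := by
    rw [hφ, phase, add_sub_cancel]
    push_cast
    ring
  rw [hph]
  split_ifs with h0
  · simp
  · have h1 : (φ : ℂ) ≠ 0 := by exact_mod_cast h0
    field_simp
    ring

lemma solvesHomological_genCoef {κ g : ℝ} {h : ℝ≥0∞} (hκ : 0 < κ) (hg : 0 ≤ g)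
    {ρ μ C CG : ℝ} {r : HomMat} (hr : CoefBd ρ μ C r) (hG : CoefBd ρ μ CG (genCoef κ g h r)) :
    SolvesHomological κ g h (genCoef κ g h r) r := by
  intro U V hU hV
  have hp : Lv ρ μ ((2 + |ρ| + |μ| + 2) - 3 / 2) :=
    ⟨by linarith [le_abs_self ρ, le_abs_self μ],
      by linarith [neg_le_abs ρ, abs_nonneg ρ, abs_nonneg μ]⟩
  have := homological_equation hκ hg hr hG hp hp (hU _).bd (hV _).bd
  simpa only [act_dispE, act_homMat] using this

/-! ### Matrices of operators defined by vector valued operators -/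

/-- The vector with component `σ` equal to `v`, the other one being zero. -/
def inj (σ : Bool) (v : Seq) : Vec := fun τ => if τ = σ then v else 0

lemma inj_add_inj (w : Vec) : inj true (w true) + inj false (w false) = w := by
  funext τ; cases τ <;> simp [inj]

lemma inj_smul_add (σ : Bool) (c : ℂ) (u v : Seq) :
    inj σ (c • u + v) = c • inj σ u + inj σ v := by
  funext τ
  by_cases h : τ = σ <;> simp [inj, h]

lemma memH_zero (s : ℝ) : MemH s 0 := ⟨rfl, by simp [summable_zero]⟩

lemma MemH.inj {s : ℝ} {v : Seq} (hv : MemH s v) (σ : Bool) : MemH2 s (inj σ v) := fun τ => by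
  by_cases h : τ = σ
  · simpa [WaterWaves.inj, h] using hv
  · simpa [WaterWaves.inj, h] using memH_zero s

lemma normH2_inj (s : ℝ) (σ : Bool) (v : Seq) : normH2 s (inj σ v) = normH s v := by
  have : ∀ τ, normH s (inj σ v τ) ^ 2 = if τ = σ then normH s v ^ 2 else 0 := fun τ => by
    by_cases h : τ = σ <;> simp [inj, h, normH_zero]
  rw [normH2]
  simp only [this]
  simp [Real.sqrt_sq (normH_nonneg s v)]

lemma Cc_inj (σ : Bool) (v : Seq) : Cc (inj (!σ) (cj v)) = inj σ v := by
  funext τ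
  by_cases h : τ = σ
  · simp [Cc, inj, h, cj_cj]
  · simp [Cc, inj, h, cj_zero]

lemma MemH.cj {s : ℝ} {v : Seq} (hv : MemH s v) : MemH s (cj v) := by
  refine ⟨by simp [WaterWaves.cj, hv.1], ((Equiv.neg ℤ).summable_iff.2 hv.2).congr fun n => ?_⟩
  simp [WaterWaves.cj]

/-- The matrix of operators associated with an operator on vectors. -/
def ofVec (𝒪 : (ℝ → Vec) → ℝ → Vec → Vec) : OpMat := fun σ σ' V t v => 𝒪 V t (inj σ' v) σ

lemma act_ofVec {𝒪 : (ℝ → Vec) → ℝ → Vec → Vec} {V : ℝ → Vec} {t : ℝ} {w : Vec}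
    (h : 𝒪 V t (inj true (w true) + inj false (w false))
      = 𝒪 V t (inj true (w true)) + 𝒪 V t (inj false (w false))) :
    act (ofVec 𝒪) V t w = 𝒪 V t w := by
  rw [inj_add_inj] at h
  rw [h]
  funext σ
  simp [act, ofVec]

lemma isRealToReal_ofVec {𝒪 : (ℝ → Vec) → ℝ → Vec → Vec} {I : Set ℝ} {K : ℕ} {s r : ℝ}
    (h : ∀ V, InBall I K s r V → IsRealCurve I V → ∀ t ∈ I, ∀ w, MemH2 s w →
      𝒪 V t (Cc w) = Cc (𝒪 V t w)) : IsRealToReal I K s r (ofVec 𝒪) := by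
  intro V hV hr t ht v hv σ σ'
  have h1 := congrFun (h V hV hr t ht _ (hv.cj.inj (!σ'))) σ
  rw [Cc_inj] at h1
  exact h1

lemma dt2_inj (I : Set ℝ) (k : ℕ) (σ : Bool) (u : ℝ → Seq) (t : ℝ) : dt2 I k (fun τ => inj σ (u τ)) t = inj σ (dt I k u t) := by
  funext τ n
  by_cases h : τ = σ
  · simp [dt2, dt, inj, h]
  · simp only [dt2, dt, inj, h, if_false, Pi.zero_apply]
    rw [iteratedDerivWithin_const]
    split_ifs <;> rfl

lemma normK2_inj (I : Set ℝ) (K : ℕ) (s : ℝ) (σ : Bool) (u : ℝ → Seq) (t : ℝ) : normK2 I K s (fun τ => inj σ (u τ)) t = normK I K s u t := by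
  simp only [normK2, normK, dt2_inj I _ σ u t, normH2_inj]

lemma cstar_zero {I : Set ℝ} (K : ℕ) (s : ℝ) : CStar I K s (fun _ => 0) := by
  have h0 : ∀ k t, dt I k (fun _ => (0 : Seq)) t = 0 := fun k t => by
    funext n
    simp only [dt, Pi.zero_apply]
    rw [iteratedDerivWithin_const]
    split_ifs <;> rfl
  refine ⟨fun n => contDiffOn_const, fun k _ => ⟨fun t _ => ?_, fun t₀ _ => ?_⟩⟩
  · rw [h0]; exact memH_zero _
  · simp [h0, normH_zero, tendsto_const_nhds]

lemma CStar.inj {I : Set ℝ} {K : ℕ} {s : ℝ} {u : ℝ → Seq} (hu : CStar I K s u) (σ : Bool) :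
    CStar2 I K s (fun t => inj σ (u t)) := fun τ => by
  by_cases h : τ = σ
  · simpa [WaterWaves.inj, h] using hu
  · simpa [WaterWaves.inj, h] using cstar_zero K s

/-- Membership in a class of non-homogeneous operators follows from bounds of the jets. -/
lemma isUnifNonhomOp_ofVec {ι : Type*} {S : Set ι} {𝒪 : ι → (ℝ → Vec) → ℝ → Vec → Vec} {I : Set ℝ}
    (hI : UniqueDiffOn ℝ I) {γ r s₀ : ℝ} {K K' : ℕ}
    (hlin : ∀ θ ∈ S, ∀ V, InBall I K s₀ r V → ∀ t ∈ I, ∀ u v, MemH2 s₀ u → MemH2 s₀ v → ∀ c : ℂ,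
      𝒪 θ V t (c • u + v) = c • 𝒪 θ V t u + 𝒪 θ V t v)
    (h : ∀ s ≥ s₀, ∃ C ≥ (0 : ℝ), ∃ rs > 0, rs < r ∧ ∀ θ ∈ S, ∀ V, InBall I K s₀ rs V →
      CStar2 I K s V → ∀ u, CStar2 I K s u → ∃ D, (∀ t ∈ I, 𝒪 θ V t (u t) = D 0 t) ∧
        CJ I (K - K') (s + γ + 1) D ∧ ∀ t ∈ I, JB (K - K') (s + γ + 1) (fun k => D k t)
        (C • (conv (wlow 2 fun j => normK2 I (j + K') s₀ V t) (fun j => normK2 I j s u t)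
          + conv (whigh 2 (fun j => normK2 I (j + K') s₀ V t) fun j => normK2 I (j + K') s V t)
            (fun j => normK2 I j s₀ u t)))) (σ σ' : Bool) :
    IsUnifNonhomOp I γ K K' 2 r s₀ ((fun θ => ofVec (𝒪 θ) σ σ') '' S) := by
  constructor
  · rintro _ ⟨θ, hθ, rfl⟩ V hV t ht u v hu hv c
    have := congrFun (hlin θ hθ V hV t ht _ _ (hu.inj σ') (hv.inj σ') c) σ
    simp only [ofVec, inj_smul_add]
    exact this
  · intro s hs
    obtain ⟨C, hC, rs, hrs, hrr, H⟩ := h s hs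
    have hE := embConst_nonneg
    -- The summand `1` only serves strict positivity of the constant; `embConst` is the cost of
    -- returning to Sobolev norms, paid by the spare derivative in the level `s + γ + 1`.
    refine ⟨embConst * C + 1, by positivity, rs, hrs, hrr, ?_⟩
    rintro _ ⟨θ, hθ, rfl⟩ V hV hVs u hu
    obtain ⟨D, hD0, hD, hDb⟩ := H θ hθ V hV hVs _ (hu.inj σ')
    refine ⟨(hD.cstar2 hI hD0) σ, fun k hk t ht => ?_⟩
    have e := hD.dt2_eq hI hD0 hk ht
    have e' : dt I k (fun τ => ofVec (𝒪 θ) σ σ' V τ (u τ)) t = D k t σ := congrFun e σ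
    rw [e']
    have hb := ((hDb t ht) k hk).weaken
      (show s - 3 / 2 * (k : ℝ) + γ + 1 ≤ s + γ + 1 - 3 / 2 * k by linarith)
    refine (normH_le_normH2 _ (D k t) σ).trans (hb.normH2_le.trans ?_)
    simp only [Pi.smul_apply, Pi.add_apply, smul_eq_mul, conv, wlow, whigh,
      ← Finset.sum_add_distrib, Finset.mul_sum, normK2_inj]
    refine Finset.sum_le_sum fun p _ => ?_
    have n1 := normK2_nonneg I (p.1 + K') s₀ V t
    have n2 := normK2_nonneg I (p.1 + K') s V t
    have n3 : 0 ≤ normK I p.2 s u t := Finset.sum_nonneg fun _ _ => normH_nonneg _ _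
    have n4 : 0 ≤ normK I p.2 s₀ u t := Finset.sum_nonneg fun _ _ => normH_nonneg _ _
    calc _ = (embConst * C) * (normK I p.2 s u t * normK2 I (p.1 + K') s₀ V t ^ 2 +
          normK I p.2 s₀ u t * normK2 I (p.1 + K') s₀ V t ^ (2 - 1) *
            normK2 I (p.1 + K') s V t) := by ring
      _ ≤ _ := by gcongr; linarith

/-! ### The exponential of `G(U)` -/

/-- The coefficients of the exponential series, starting from the term of degree `d`. -/
def expTail (d : ℕ) (θ : ℝ) (i : ℕ) : ℂ := if i < d then 0 else (θ : ℂ) ^ i / (i.factorial : ℂ)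

lemma norm_expTail_le (d : ℕ) {θ : ℝ} (hθ : |θ| ≤ 1) (i : ℕ) :
    ‖expTail d θ i‖ ≤ 1 / (i.factorial : ℝ) := by
  rw [expTail]
  split_ifs
  · rw [norm_zero]; positivity
  · rw [norm_div, norm_pow, Complex.norm_real, Complex.norm_natCast, Real.norm_eq_abs]
    gcongr
    exact pow_le_one₀ (abs_nonneg _) hθ

lemma conj_expTail (d : ℕ) (θ : ℝ) (i : ℕ) : starRingEnd ℂ (expTail d θ i) = expTail d θ i := by
  rw [expTail]
  split_ifs <;> simp

/-- The Cauchy product of two exponential series. -/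
lemma exp_cauchy {φ : ℕ → ℂ} {M Θ : ℝ} (hΘ : 0 ≤ Θ) (hφ : ∀ k, ‖φ k‖ ≤ M * Θ ^ k) {c d : ℕ → ℂ}
    (hc : ∀ i, ‖c i‖ ≤ 1 / (i.factorial : ℝ)) (hd : ∀ i, ‖d i‖ ≤ 1 / (i.factorial : ℝ)) :
    ∑' i, c i * ∑' j, d j * φ (i + j) =
      ∑' k, (∑ p ∈ Finset.HasAntidiagonal.antidiagonal k, c p.1 * d p.2) * φ k := by
  have hM : 0 ≤ M := by simpa using (norm_nonneg _).trans (hφ 0)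
  have hS : Summable fun q : ℕ × ℕ => c q.1 * (d q.2 * φ (q.1 + q.2)) := by
    refine Summable.of_norm_bounded (g := fun q : ℕ × ℕ =>
      M * ((Θ ^ q.1 / (q.1.factorial : ℝ)) * (Θ ^ q.2 / (q.2.factorial : ℝ))))
      (((summable_exp Θ).mul_of_nonneg (summable_exp Θ) (fun i => by positivity)
        fun i => by positivity).mul_left M) fun q => ?_
    rw [norm_mul, norm_mul]
    have h1 := hc q.1
    have h2 := hd q.2
    have h3 := hφ (q.1 + q.2)
    calc _ ≤ 1 / (q.1.factorial : ℝ) * (1 / (q.2.factorial : ℝ) * (M * Θ ^ (q.1 + q.2))) := by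
          gcongr
      _ = _ := by rw [pow_add]; ring
  simp only [← tsum_mul_left]
  rw [← hS.tsum_prod, ← Finset.HasAntidiagonal.sigmaAntidiagonalEquivProd.tsum_eq]
  refine (Finset.HasAntidiagonal.sigmaAntidiagonalEquivProd.summable_iff.2 hS).tsum_sigma.trans ?_
  refine tsum_congr fun k => ?_
  rw [tsum_fintype, Finset.sum_mul, ← Finset.sum_coe_sort (Finset.HasAntidiagonal.antidiagonal k)]
  refine Finset.sum_congr rfl fun p _ => ?_
  have := Finset.HasAntidiagonal.mem_antidiagonal.1 p.2
  simp only [Function.comp_apply, Finset.HasAntidiagonal.sigmaAntidiagonalEquivProd_apply, this]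
  ring

/-- This is `(θ - θ)^k / k!`, by the binomial theorem. -/
lemma sum_expTail_mul_neg (θ : ℝ) (k : ℕ) :
    ∑ p ∈ Finset.HasAntidiagonal.antidiagonal k, expTail 0 θ p.1 * expTail 0 (-θ) p.2
      = if k = 0 then 1 else 0 := by
  have h := (Commute.all (θ : ℂ) (-θ)).add_pow' k
  rw [add_neg_cancel] at h
  have h2 : ∑ p ∈ Finset.HasAntidiagonal.antidiagonal k, expTail 0 θ p.1 * expTail 0 (-θ) p.2
      = (0 : ℂ) ^ k / (k.factorial : ℂ) := by
    rw [h, Finset.sum_div]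
    refine Finset.sum_congr rfl fun p hp => ?_
    obtain rfl := Finset.HasAntidiagonal.mem_antidiagonal.1 hp
    have h3 : (p.1 + p.2).choose p.1 * p.1.factorial * p.2.factorial = (p.1 + p.2).factorial := by
      rw [Nat.choose_symm_add]
      exact Nat.add_choose_mul_factorial_mul_factorial p.1 p.2
    have h4 : (((p.1 + p.2).choose p.1 : ℕ) : ℂ) * (p.1.factorial : ℂ) * (p.2.factorial : ℂ)
        = ((p.1 + p.2).factorial : ℂ) := by exact_mod_cast h3
    have f1 : (p.1.factorial : ℂ) ≠ 0 := by exact_mod_cast p.1.factorial_ne_zero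
    have f2 : (p.2.factorial : ℂ) ≠ 0 := by exact_mod_cast p.2.factorial_ne_zero
    have f3 : (((p.1 + p.2).choose p.1 : ℕ) : ℂ) ≠ 0 := by
      exact_mod_cast (Nat.choose_pos (Nat.le_add_right _ _)).ne'
    simp only [expTail, Nat.not_lt_zero, if_false, nsmul_eq_mul, ← h4]
    push_cast
    field_simp
  rw [h2]
  rcases k with _ | k <;> simp

section exp

variable {r : HomMat} {ρ μ Cr p q α x : ℝ} {U v w : Vec} {c : ℕ → ℂ}

/-- The norm of `R(U)` on functions with `q` derivatives. -/
def itConst (Cr q α : ℝ) : ℝ := 4 * Cr * 2 ^ q * sumConst * (2 * α)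

lemma itConst_nonneg (hC : 0 ≤ Cr) (hα : 0 ≤ α) : 0 ≤ itConst Cr q α := by
  have := sumConst_nonneg
  unfold itConst; positivity

lemma bil_bd_self (hr : CoefBd ρ μ Cr r) (hρ : 0 ≤ ρ) (hq : Lv ρ μ q) (hq0 : 0 ≤ q) (hpq : q ≤ p)
    (hU : Bd p U α) (hv : Bd q v x) : Bd q (bil r U v) (itConst Cr q α * x) := by
  have hU' : Bd (q + 0) U α := by simpa using hU.weaken hpq
  refine (bil_bd (e := q) (τ := 0) hr hq hq hq0 (by linarith) (by linarith) (hU.weaken hpq) hU' hv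
    (by simpa using hv)).mono (le_of_eq ?_)
  rw [itConst]; ring

lemma bd_iterate (hr : CoefBd ρ μ Cr r) (hρ : 0 ≤ ρ) (hq : Lv ρ μ q) (hq0 : 0 ≤ q) (hpq : q ≤ p)
    (hU : Bd p U α) (hv : Bd q v x) (i : ℕ) :
    Bd q ((bil r U)^[i] v) (itConst Cr q α ^ i * x) := by
  induction i with
  | zero => simpa using hv
  | succ i ih =>
    rw [Function.iterate_succ_apply', pow_succ', mul_assoc]
    exact bil_bd_self hr hρ hq hq0 hpq hU ih

lemma bd_ser_term (hr : CoefBd ρ μ Cr r) (hρ : 0 ≤ ρ) (hq : Lv ρ μ q) (hq0 : 0 ≤ q) (hpq : q ≤ p)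
    (hU : Bd p U α) (hv : Bd q v x) (hc : ∀ i, ‖c i‖ ≤ 1 / (i.factorial : ℝ)) (i : ℕ) :
    Bd q (c i • (bil r U)^[i] v) (itConst Cr q α ^ i / (i.factorial : ℝ) * x) := by
  refine ((bd_iterate hr hρ hq hq0 hpq hU hv i).smul (c i)).mono ?_
  have h1 := itConst_nonneg (q := q) hr.1 hU.nonneg
  have h2 := hv.nonneg
  calc _ ≤ 1 / (i.factorial : ℝ) * (itConst Cr q α ^ i * x) := by gcongr; exact hc i
    _ = _ := by ring

lemma Bd.summable {f : ℕ → Vec} {b : ℕ → ℝ} (hb : Summable b) (hf : ∀ i, Bd q (f i) (b i))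
    (σ : Bool) (n : ℤ) : Summable fun i => f i σ n := by
  rcases eq_or_ne n 0 with rfl | hn
  · simp [(hf _).1 σ, summable_zero]
  · exact Summable.of_norm_bounded (hb.mul_right _) fun i => (hf i).2 σ n hn

lemma summable_ser (hr : CoefBd ρ μ Cr r) (hρ : 0 ≤ ρ) (hq : Lv ρ μ q) (hq0 : 0 ≤ q)
    (hpq : q ≤ p) (hU : Bd p U α) (hv : Bd q v x) (hc : ∀ i, ‖c i‖ ≤ 1 / (i.factorial : ℝ))
    (σ : Bool) (n : ℤ) : Summable fun i => c i * ((bil r U)^[i] v) σ n :=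
  Bd.summable ((summable_exp (itConst Cr q α)).mul_right x)
    (bd_ser_term hr hρ hq hq0 hpq hU hv hc) σ n

lemma iterate_bil_smul_add (hr : CoefBd ρ μ Cr r) (hρ : 0 ≤ ρ) (hq : Lv ρ μ q) (hq0 : 0 ≤ q)
    (hpq : q ≤ p) (hU : Bd p U α) {y : ℝ} (hv : Bd q v x) (hw : Bd q w y) (z : ℂ) (i : ℕ) :
    (bil r U)^[i] (z • v + w) = z • (bil r U)^[i] v + (bil r U)^[i] w := by
  induction i with
  | zero => rfl
  | succ i ih =>
    rw [Function.iterate_succ_apply', Function.iterate_succ_apply', Function.iterate_succ_apply',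
      ih, bil_add_right hr (hq.mono hpq) hq hU ((bd_iterate hr hρ hq hq0 hpq hU hv i).smul z)
        (bd_iterate hr hρ hq hq0 hpq hU hw i), bil_smul_right]

lemma serOp_smul_add (hr : CoefBd ρ μ Cr r) (hρ : 0 ≤ ρ) (hq : Lv ρ μ q) (hq0 : 0 ≤ q)
    (hpq : q ≤ p) (hU : Bd p U α) {y : ℝ} (hv : Bd q v x) (hw : Bd q w y)
    (hc : ∀ i, ‖c i‖ ≤ 1 / (i.factorial : ℝ)) (z : ℂ) :
    serOp c r U (z • v + w) = z • serOp c r U v + serOp c r U w := by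
  funext σ n
  simp only [serOp, iterate_bil_smul_add hr hρ hq hq0 hpq hU hv hw z, Pi.add_apply, Pi.smul_apply,
    smul_eq_mul]
  rw [← tsum_mul_left, ← ((summable_ser hr hρ hq hq0 hpq hU hv hc σ n).mul_left z).tsum_add
    (summable_ser hr hρ hq hq0 hpq hU hw hc σ n)]
  exact tsum_congr fun i => by ring

lemma iterate_bil_tsum (hr : CoefBd ρ μ Cr r) (hρ : 0 ≤ ρ) (hq : Lv ρ μ q) (hq0 : 0 ≤ q)
    (hpq : q ≤ p) (hU : Bd p U α) (i : ℕ) : ∀ {f : ℕ → Vec} {b : ℕ → ℝ}, Summable b →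
    (∀ j, Bd q (f j) (b j)) →
    (bil r U)^[i] (fun σ n => ∑' j, f j σ n) = fun σ n => ∑' j, ((bil r U)^[i] (f j)) σ n := by
  induction i with
  | zero => intros; rfl
  | succ i ih =>
    intro f b hb hf
    simp only [Function.iterate_succ_apply]
    rw [bil_tsum hr (hq.mono hpq) hq hU hb hf]
    exact ih (hb.mul_left (itConst Cr q α)) fun j => bil_bd_self hr hρ hq hq0 hpq hU (hf j)

/-- Powers of `G(U)` commute with convergent series, so composition of series becomes a double sum,
rearranged along antidiagonals by `exp_cauchy`. -/
lemma serOp_serOp (hr : CoefBd ρ μ Cr r) (hρ : 0 ≤ ρ) (hq : Lv ρ μ q) (hq0 : 0 ≤ q)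
    (hpq : q ≤ p) (hU : Bd p U α) (hv : Bd q v x) (hc : ∀ i, ‖c i‖ ≤ 1 / (i.factorial : ℝ))
    {d : ℕ → ℂ} (hd : ∀ i, ‖d i‖ ≤ 1 / (i.factorial : ℝ)) :
    serOp c r U (serOp d r U v) = serOp (fun k =>
      ∑ p ∈ Finset.HasAntidiagonal.antidiagonal k, c p.1 * d p.2) r U v := by
  have e : ∀ i, (bil r U)^[i] (serOp d r U v)
      = fun σ n => ∑' j, d j * ((bil r U)^[i + j] v) σ n := by
    intro i
    have := iterate_bil_tsum hr hρ hq hq0 hpq hU i ((summable_exp (itConst Cr q α)).mul_right x)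
      (bd_ser_term hr hρ hq hq0 hpq hU hv hd)
    refine Eq.trans this ?_
    funext σ n
    refine tsum_congr fun j => ?_
    have h0 : Bd q (0 : Vec) 0 := Bd.zero
    have h1 := iterate_bil_smul_add hr hρ hq hq0 hpq hU (bd_iterate hr hρ hq hq0 hpq hU hv j) h0
      (d j) i
    have h2 : (bil r U)^[i] 0 = 0 := Function.iterate_fixed (bil_zero_right r U) i
    rw [h2, add_zero, add_zero] at h1
    rw [h1, ← Function.iterate_add_apply]
    rfl
  funext σ n
  simp only [serOp] at e ⊢
  simp only [e]
  have h1 := itConst_nonneg (q := q) hr.1 hU.nonneg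
  rcases eq_or_ne n 0 with rfl | hn
  · have : ∀ i, ((bil r U)^[i] v) σ 0 = 0 := fun i => (bd_iterate hr hρ hq hq0 hpq hU hv i).1 σ
    simp [this]
  refine exp_cauchy (φ := fun k => ((bil r U)^[k] v) σ n) (M := x * |(n : ℝ)| ^ (-q)) h1
    (fun k => ?_) hc hd
  refine ((bd_iterate hr hρ hq hq0 hpq hU hv k).2 σ n hn).trans (le_of_eq (by ring))

lemma serOp_inv (hr : CoefBd ρ μ Cr r) (hρ : 0 ≤ ρ) (hq : Lv ρ μ q) (hq0 : 0 ≤ q)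
    (hpq : q ≤ p) (hU : Bd p U α) (hv : Bd q v x) {θ : ℝ} (hθ : |θ| ≤ 1) :
    serOp (expTail 0 θ) r U (serOp (expTail 0 (-θ)) r U v) = v := by
  rw [serOp_serOp hr hρ hq hq0 hpq hU hv (norm_expTail_le 0 hθ)
    (norm_expTail_le 0 (by rwa [abs_neg]))]
  funext σ n
  simp only [serOp, sum_expTail_mul_neg]
  rw [tsum_eq_single 0]
  · simp
  · intro i hi; simp [hi]

lemma serOp_expTail_zero (hr : CoefBd ρ μ Cr r) (hρ : 0 ≤ ρ) (hq : Lv ρ μ q) (hq0 : 0 ≤ q)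
    (hpq : q ≤ p) (hU : Bd p U α) (hv : Bd q v x) {θ : ℝ} (hθ : |θ| ≤ 1) :
    serOp (expTail 0 θ) r U v = v + serOp (expTail 1 θ) r U v := by
  funext σ n
  have s0 := summable_ser hr hρ hq hq0 hpq hU hv (norm_expTail_le 0 hθ) σ n
  have s1 := summable_ser hr hρ hq hq0 hpq hU hv (norm_expTail_le 1 hθ) σ n
  simp only [serOp, Pi.add_apply]
  rw [s0.tsum_eq_zero_add, s1.tsum_eq_zero_add]
  simp [expTail]

lemma serOp_expTail_one (hr : CoefBd ρ μ Cr r) (hρ : 0 ≤ ρ) (hq : Lv ρ μ q) (hq0 : 0 ≤ q)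
    (hpq : q ≤ p) (hU : Bd p U α) (hv : Bd q v x) {θ : ℝ} (hθ : |θ| ≤ 1) :
    serOp (expTail 1 θ) r U v = (θ : ℂ) • bil r U v + serOp (expTail 2 θ) r U v := by
  funext σ n
  have s1 := summable_ser hr hρ hq hq0 hpq hU hv (norm_expTail_le 1 hθ) σ n
  have s2 := summable_ser hr hρ hq hq0 hpq hU hv (norm_expTail_le 2 hθ) σ n
  simp only [serOp, Pi.add_apply, Pi.smul_apply, smul_eq_mul]
  rw [s1.tsum_eq_zero_add, s2.tsum_eq_zero_add, ((summable_nat_add_iff 1).2 s1).tsum_eq_zero_add,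
    ((summable_nat_add_iff 1).2 s2).tsum_eq_zero_add]
  simp [expTail]

lemma serOp_expTail_at_zero (r : HomMat) (U v : Vec) : serOp (expTail 0 0) r U v = v := by
  funext σ n
  rw [serOp, tsum_eq_single 0]
  · simp [expTail]
  · intro i hi; simp [expTail, hi]

lemma serOp_Cc (h : RealCoef r) (hU : ∀ σ, U σ 0 = 0) (hv : ∀ σ, v σ 0 = 0)
    (hc : ∀ i, starRingEnd ℂ (c i) = c i) : serOp c r (Cc U) (Cc v) = Cc (serOp c r U v) := by
  have e : ∀ i, (∀ σ, ((bil r U)^[i] v) σ 0 = 0) ∧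
      (bil r (Cc U))^[i] (Cc v) = Cc ((bil r U)^[i] v) := by
    intro i
    induction i with
    | zero => exact ⟨hv, rfl⟩
    | succ i ih =>
      rw [Function.iterate_succ_apply', Function.iterate_succ_apply']
      exact ⟨fun σ => bil_zero_mode r U _ σ, by rw [ih.2, h.bil_Cc hU ih.1]⟩
  funext σ n
  simp only [serOp, (e _).2, Cc_apply, Complex.conj_tsum, map_mul, hc]

/-- Termwise differentiation in `θ` shifts the index by one, and the extra power is one application
of `G(U)` taken out of the series. The derivatives are dominated by `i M Θ^i / i!`. -/
lemma hasDerivWithinAt_serOp (hr : CoefBd ρ μ Cr r) (hρ : 0 ≤ ρ) (hq : Lv ρ μ q) (hq0 : 0 ≤ q)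
    (hpq : q ≤ p) (hU : Bd p U α) (hv : Bd q v x) {θ : ℝ} (hθ : θ ∈ Set.Icc (0 : ℝ) 1)
    (σ : Bool) (n : ℤ) :
    HasDerivWithinAt (fun η => serOp (expTail 0 η) r U v σ n)
      (bil r U (serOp (expTail 0 θ) r U v) σ n) (Set.Icc 0 1) θ := by
  have habs : ∀ {η : ℝ}, η ∈ Set.Icc (0 : ℝ) 1 → |η| ≤ 1 := fun h => by
    rw [abs_of_nonneg h.1]; exact h.2
  rcases eq_or_ne n 0 with rfl | hn
  · have : ∀ i, ((bil r U)^[i] v) σ 0 = 0 := fun i => (bd_iterate hr hρ hq hq0 hpq hU hv i).1 σ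
    simpa [bil_zero_mode, serOp, this] using hasDerivWithinAt_const θ (Set.Icc (0 : ℝ) 1) (0 : ℂ)
  have hΘ := itConst_nonneg (q := q) hr.1 hU.nonneg
  set Θ := itConst Cr q α
  set φ : ℕ → ℂ := fun i => ((bil r U)^[i] v) σ n
  set M := x * |(n : ℝ)| ^ (-q)
  have hM : 0 ≤ M := mul_nonneg hv.nonneg (by positivity)
  have hφ : ∀ i, ‖φ i‖ ≤ M * Θ ^ i := fun i =>
    ((bd_iterate hr hρ hq hq0 hpq hU hv i).2 σ n hn).trans (le_of_eq (by ring))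
  have e1 : bil r U (serOp (expTail 0 θ) r U v) σ n = ∑' i, expTail 0 θ i * φ (i + 1) := by
    have := congrFun (congrFun (bil_tsum hr (hq.mono hpq) hq hU
      ((summable_exp Θ).mul_right x)
      (bd_ser_term hr hρ hq hq0 hpq hU hv (norm_expTail_le 0 (habs hθ)))) σ) n
    refine Eq.trans this (tsum_congr fun i => ?_)
    rw [bil_smul_right]
    simp only [φ, Function.iterate_succ_apply']
    rfl
  let f' : ℕ → ℝ → ℂ := fun i η => (i : ℂ) * (η : ℂ) ^ (i - 1) / (i.factorial : ℂ) * φ i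
  have e2 : ∑' i, expTail 0 θ i * φ (i + 1) = ∑' i, f' i θ := by
    have hfac : ∀ i : ℕ, f' (i + 1) θ = expTail 0 θ i * φ (i + 1) := by
      intro i
      have f1 : ((i + 1 : ℕ) : ℂ) ≠ 0 := by exact_mod_cast i.succ_ne_zero
      simp only [f', expTail, Nat.not_lt_zero, if_false, Nat.factorial_succ, Nat.cast_mul,
        Nat.add_sub_cancel]
      rw [mul_div_mul_left _ _ f1]
    have hs : Summable fun i => f' (i + 1) θ := by
      refine Summable.of_norm_bounded ((summable_exp Θ).mul_left (M * Θ)) fun i => ?_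
      rw [hfac, norm_mul]
      calc _ ≤ 1 / (i.factorial : ℝ) * (M * Θ ^ (i + 1)) := by
            gcongr
            · exact norm_expTail_le 0 (habs hθ) i
            · exact hφ _
        _ = _ := by rw [pow_succ]; ring
    have hs' : Summable fun i => f' i θ := (summable_nat_add_iff (f := fun i => f' i θ) 1).1 hs
    have h0 : f' 0 θ = 0 := by simp [f']
    rw [hs'.tsum_eq_zero_add, h0, zero_add]
    exact tsum_congr fun i => (hfac i).symm
  rw [e1, e2]
  have hb : Summable fun i : ℕ => (i : ℝ) / (i.factorial : ℝ) * (M * Θ ^ i) := by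
    rw [← summable_nat_add_iff 1]
    refine ((summable_exp Θ).mul_left (M * Θ)).congr fun i => ?_
    have f1 : ((i + 1 : ℕ) : ℝ) ≠ 0 := by exact_mod_cast i.succ_ne_zero
    rw [Nat.factorial_succ, Nat.cast_mul, div_mul_eq_div_div, div_self f1, pow_succ]
    ring
  refine hasDerivWithinAt_tsum (convex_Icc 0 1) hθ hb (f := fun i η => expTail 0 η i * φ i)
    (f' := f') (fun i η hη => ?_) (fun i η hη => ?_) fun η hη => ?_
  · simp only [expTail, Nat.not_lt_zero, if_false, f']
    have h1 : HasDerivWithinAt (fun η : ℝ => (η : ℂ) ^ i) ((i : ℂ) * (η : ℂ) ^ (i - 1))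
        (Set.Icc 0 1) η := by
      have := (hasDerivAt_pow i (η : ℂ)).comp_ofReal
      exact this.hasDerivWithinAt
    exact (h1.div_const _).mul_const _
  · simp only [f', norm_mul, norm_div, norm_pow, Complex.norm_natCast, Complex.norm_real,
      Real.norm_eq_abs]
    have h1 : |η| ^ (i - 1) ≤ 1 := pow_le_one₀ (abs_nonneg _) (habs hη)
    have h2 := hφ i
    calc _ ≤ (i : ℝ) * 1 / (i.factorial : ℝ) * (M * Θ ^ i) := by gcongr
      _ = _ := by rw [mul_one]
  · exact summable_ser hr hρ hq hq0 hpq hU hv (norm_expTail_le 0 (habs hη)) σ n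

/-- The terms of positive degree of the series gain `ρ` derivatives. -/
lemma exists_bd_serOp (hr : CoefBd ρ μ Cr r) (hρ : 0 ≤ ρ) (hq : Lv ρ μ q) (hpq : q ≤ p) (α : ℝ) :
    ∃ C ≥ (0 : ℝ), ∀ U, Bd p U α → ∀ c : ℕ → ℂ, (∀ i, ‖c i‖ ≤ 1 / (i.factorial : ℝ)) → c 0 = 0 →
      ∀ v x, Bd q v x → Bd (q + ρ) (serOp c r U v) (C * x) := by
  set Θ := max 1 (2 * (((0 : ℕ) : ℝ) + 1) * (gConst 0 Cr (q + 0 + ρ) * α))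
  have hΘ : 0 ≤ Θ := zero_le_one.trans (le_max_left _ _)
  refine ⟨∑' i : ℕ, Θ ^ i / (i.factorial : ℝ), tsum_nonneg fun i => by positivity,
    fun U hU c hc hc0 v x hv => ?_⟩
  -- A fixed vector is a jet of order `0`, so the estimates for jets include the pointwise one.
  have jU : JB 0 p (fun _ => U) (fun _ => α) := fun j hj => by
    obtain rfl : j = 0 := by omega
    simpa using hU
  have jv : JB 0 q (fun _ => v) (fun _ => x) := fun j hj => by
    obtain rfl : j = 0 := by omega
    simpa using hv
  have hT := tameJ_ser (Weights.one 0) hρ (CJ.tameJ_unit hr (by simpa using hq) hpq jU)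
    (le_max_right 1 _) (le_max_left _ _) hc le_rfl (by norm_num) (fun j hj => by
      obtain rfl : j = 0 := by omega
      exact hc0)
  have := (hT.2 _ _ _ jv (by simpa using jv)).1 0 le_rfl
  rw [serJ_zero] at this
  simpa [conv, wlow, Θ] using this

end exp

/-! ### Families of jets with uniform estimates -/

/-- Nonnegative and nondecreasing on `{0, …, N}`. -/
def MonoN (N : ℕ) (x : ℕ → ℝ) : Prop :=
  (∀ i ≤ N, 0 ≤ x i) ∧ ∀ i j, i ≤ j → j ≤ N → x i ≤ x j

/-- Norms of curves accumulate all lower derivatives; monotonicity allows the lower ones to be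
bounded by the last. -/
lemma conv_monoN {N : ℕ} {α x : ℕ → ℝ} (hα : ∀ i ≤ N, 0 ≤ α i) (hx : MonoN N x) :
    MonoN N (conv α x) := by
  refine ⟨fun k hk => conv_nonneg (fun i hi => hα i (hi.trans hk))
    fun i hi => hx.1 i (hi.trans hk), fun i j hij hj => ?_⟩
  rw [conv, conv, Finset.Nat.sum_antidiagonal_eq_sum_range_succ (fun p q => α p * x q),
    Finset.Nat.sum_antidiagonal_eq_sum_range_succ (fun p q => α p * x q)]
  calc _ ≤ ∑ k ∈ Finset.range (i + 1), α k * x (j - k) := by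
        refine Finset.sum_le_sum fun k hk => ?_
        have hk := Finset.mem_range.1 hk
        exact mul_le_mul_of_nonneg_left (hx.2 _ _ (by omega) (by omega)) (hα k (by omega))
    _ ≤ _ := by
        refine Finset.sum_le_sum_of_subset_of_nonneg (by simp; omega) fun k hk _ => ?_
        have hk := Finset.mem_range.1 hk
        exact mul_nonneg (hα k (by omega)) (hx.1 _ (by omega))

/-- A family of operators on jets with uniform estimates. -/
def UTame {ι : Type} (S : Set ι) (N : ℕ) (τ : ℝ) (a b : ι → ℕ → ℝ) (ℓ ℓ' : ℝ) (d : ℕ)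
    (T : ι → (ℕ → Vec) → ℕ → Vec) : Prop :=
  ∃ C ≥ (0 : ℝ), ∀ i ∈ S, TameJ N τ (a i) (b i) ℓ ℓ' d C (T i)

/-- A family of jets with uniform estimates. -/
def UPair {ι : Type} (S : Set ι) (N : ℕ) (τ : ℝ) (a b : ι → ℕ → ℝ) (ℓ : ℝ) (d : ℕ)
    (x X : ι → ℕ → ℝ) (D : ι → ℕ → Vec) : Prop :=
  ∃ C ≥ (0 : ℝ), ∀ i ∈ S, PairJ N τ (a i) (b i) ℓ d C (x i) (X i) (D i)

section uniform

variable {ι : Type} {S : Set ι} {N : ℕ} {τ : ℝ} {a b : ι → ℕ → ℝ} {ℓ ℓ' ℓ'' ℓ₁ ℓ₁' : ℝ}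
  {d e f : ℕ} {T T' : ι → (ℕ → Vec) → ℕ → Vec} {x X : ι → ℕ → ℝ} {D D' : ι → ℕ → Vec}

namespace UTame

lemma add (h : UTame S N τ a b ℓ ℓ' d T) (h' : UTame S N τ a b ℓ ℓ' d T') :
    UTame S N τ a b ℓ ℓ' d (fun i u => T i u + T' i u) :=
  let ⟨C, hC, H⟩ := h
  let ⟨C', hC', H'⟩ := h'
  ⟨C + C', by positivity, fun i hi => (H i hi).add (H' i hi)⟩

lemma pair (W : ∀ i ∈ S, Weights N (a i) (b i)) (h : UTame S N τ a b ℓ ℓ' d T)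
    (hx : ∀ i ∈ S, MonoN N (x i)) (hX : ∀ i ∈ S, MonoN N (X i)) (hD : UPair S N τ a b ℓ e x X D)
    (hf : f ≤ d + e) : UPair S N τ a b ℓ' f x X (fun i => T i (D i)) :=
  let ⟨C, hC, H⟩ := h
  let ⟨C', hC', H'⟩ := hD
  ⟨2 * (N + 1) * C * C', by positivity, fun i hi =>
    (H i hi).comp_pairJ (W i hi) (hx i hi).1 (hX i hi).1 hC' (H' i hi) hf⟩

end UTame

namespace UPair

lemma mono (W : ∀ i ∈ S, Weights N (a i) (b i)) (hx : ∀ i ∈ S, MonoN N (x i))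
    (hX : ∀ i ∈ S, MonoN N (X i)) (h : UPair S N τ a b ℓ d x X D) (hl : ℓ' ≤ ℓ) (he : e ≤ d) :
    UPair S N τ a b ℓ' e x X D :=
  let ⟨C, hC, H⟩ := h
  ⟨C, hC, fun i hi => (H i hi).mono (W i hi) (hx i hi).1 (hX i hi).1 hC hl he le_rfl⟩

lemma add (h : UPair S N τ a b ℓ d x X D) (h' : UPair S N τ a b ℓ d x X D') :
    UPair S N τ a b ℓ d x X (fun i => D i + D' i) :=
  let ⟨C, hC, H⟩ := h
  let ⟨C', hC', H'⟩ := h'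
  ⟨C + C', by positivity, fun i hi => (H i hi).add (H' i hi)⟩

lemma smul (c : ℂ) (h : UPair S N τ a b ℓ d x X D) :
    UPair S N τ a b ℓ d x X (fun i => c • D i) :=
  let ⟨C, hC, H⟩ := h
  ⟨‖c‖ * C, by positivity, fun i hi => (H i hi).smul c⟩

lemma of_jb (W : ∀ i ∈ S, Weights N (a i) (b i)) (h : ∀ i ∈ S, JB N ℓ (D i) (x i))
    (h' : ∀ i ∈ S, JB N (ℓ + τ) (D i) (X i)) : UPair S N τ a b ℓ 0 x X D := by
  have key : ∀ (y : ℕ → ℝ) (c : ℕ → ℝ) k, (∀ i ≤ k, 0 ≤ y i) → y k ≤ conv (wlow 0 c) y k := by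
    intro y c k hy
    have := Finset.single_le_sum (f := fun p : ℕ × ℕ => wlow 0 c p.1 * y p.2)
      (s := Finset.HasAntidiagonal.antidiagonal k) (fun p hp => by
        have := Finset.HasAntidiagonal.mem_antidiagonal.1 hp
        have := hy p.2 (by omega)
        simpa [wlow] using this) (a := (0, k)) (by simp)
    simpa [wlow, conv] using this
  refine ⟨1, zero_le_one, fun i hi => ⟨(h i hi).mono fun k hk => ?_, (h' i hi).mono fun k hk => ?_⟩⟩
  · simpa using key (x i) (a i) k fun j hj => (h i hi).nonneg (hj.trans hk)
  · have h1 := key (X i) (a i) k fun j hj => (h' i hi).nonneg (hj.trans hk)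
    have h2 := (W i hi).conv_whigh_nonneg 0 (fun _ => (h i hi).nonneg) hk
    simp only [Pi.smul_apply, Pi.add_apply, smul_eq_mul, one_mul]
    linarith

/-- Jets that do not depend on a further argument. -/
lemma of_weight (h : ∀ i ∈ S, JB N ℓ (D i) (wlow d (a i)))
    (h' : ∀ i ∈ S, JB N (ℓ + τ) (D i) (whigh d (a i) (b i))) :
    UPair S N τ a b ℓ d (fun _ _ => 1) (fun _ _ => 0) D := by
  have key : ∀ (y : ℕ → ℝ) k, (∀ i ≤ k, 0 ≤ y i) → y k ≤ conv y (fun _ => 1) k := by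
    intro y k hy
    have := Finset.single_le_sum (f := fun p : ℕ × ℕ => y p.1 * 1)
      (s := Finset.HasAntidiagonal.antidiagonal k) (fun p hp => by
        have := Finset.HasAntidiagonal.mem_antidiagonal.1 hp
        have := hy p.1 (by omega)
        simpa using this) (a := (k, 0)) (by simp)
    simpa [conv] using this
  refine ⟨1, zero_le_one, fun i hi => ⟨(h i hi).mono fun k hk => ?_, (h' i hi).mono fun k hk => ?_⟩⟩
  · simpa using key (wlow d (a i)) k fun j hj => (h i hi).nonneg (hj.trans hk)
  · have h1 := key (whigh d (a i) (b i)) k fun j hj => (h' i hi).nonneg (hj.trans hk)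
    simpa [conv] using h1

/-- The argument norms `x = 1`, `X = 0` encode a jet depending on the curve `V` alone; the
convolutions then reduce to the weights, up to the factor `N + 1`. -/
lemma weight (W : ∀ i ∈ S, Weights N (a i) (b i))
    (h : UPair S N τ a b ℓ d (fun _ _ => 1) (fun _ _ => 0) D) :
    ∃ c ≥ (0 : ℝ), ∀ i ∈ S, JB N ℓ (D i) (c • wlow d (a i)) ∧
      JB N (ℓ + τ) (D i) (c • whigh d (a i) (b i)) := by
  obtain ⟨C, hC, H⟩ := h
  refine ⟨C * (N + 1), by positivity, fun i hi => ⟨(H i hi).1.mono fun k hk => ?_,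
    (H i hi).2.mono fun k hk => ?_⟩⟩
  · have h1 : conv (wlow d (a i)) (fun _ => 1) k ≤ (k + 1) * wlow d (a i) k :=
      conv_le_of_mul_le (N := N) hk fun p q hpq => by
        rw [mul_one]
        exact pow_le_pow_left₀ ((W i hi).nonneg _ (by omega))
          ((W i hi).mono _ _ (by omega) hpq) d
    have h2 := (W i hi).wlow_nonneg d hk
    have hk' : (k : ℝ) ≤ N := by exact_mod_cast hk
    simp only [Pi.smul_apply, smul_eq_mul, mul_assoc]
    refine mul_le_mul_of_nonneg_left (h1.trans ?_) hC
    gcongr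
  · have h1 : conv (whigh d (a i) (b i)) (fun _ => 1) k ≤ (k + 1) * whigh d (a i) (b i) k :=
      conv_le_of_mul_le (N := N) hk fun p q hpq => by
        rw [mul_one]
        exact mul_le_mul (pow_le_pow_left₀ ((W i hi).nonneg _ (by omega))
          ((W i hi).mono _ _ (by omega) hpq) _) ((W i hi).mono' _ _ (by omega) hpq)
          ((W i hi).nonneg' (by omega)) (pow_nonneg ((W i hi).nonneg _ hpq) _)
    have h2 := (W i hi).whigh_nonneg d hk
    have hk' : (k : ℝ) ≤ N := by exact_mod_cast hk
    have h3 : conv (wlow d (a i)) (fun _ => 0) k = 0 := by simp [conv]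
    simp only [Pi.smul_apply, Pi.add_apply, smul_eq_mul, mul_assoc, h3, zero_add]
    refine mul_le_mul_of_nonneg_left (h1.trans ?_) hC
    gcongr

end UPair

lemma monoN_one (N : ℕ) : MonoN N (fun _ => 1) := ⟨fun _ _ => zero_le_one, fun _ _ _ _ => le_rfl⟩

lemma monoN_zero (N : ℕ) : MonoN N (fun _ => 0) := ⟨fun _ _ => le_rfl, fun _ _ _ _ => le_rfl⟩

namespace UTame

variable {r : HomMat} {ρ μ Cr ℓV : ℝ} {V : ι → ℕ → Vec}

lemma gJ (W : ∀ i ∈ S, Weights N (a i) (b i)) (hr : CoefBd ρ μ Cr r) (hτ : 0 ≤ τ)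
    (hL : Lv ρ μ (ℓ - 3 / 2 * N)) (hℓ : ℓ ≤ ℓV)
    (hV : UPair S N τ a b ℓV d (fun _ _ => 1) (fun _ _ => 0) V) :
    UTame S N τ a b ℓ (ℓ + ρ) d (fun i => WaterWaves.gJ r (V i)) := by
  obtain ⟨c, hc, H⟩ := hV.weight W
  exact ⟨_, mul_nonneg (gConst_nonneg hr.1) hc, fun i hi =>
    tameJ_gJ hr hτ hL hℓ hc (H i hi).1 (H i hi).2⟩

lemma serJ (W : ∀ i ∈ S, Weights N (a i) (b i)) (hr : CoefBd ρ μ Cr r) (hτ : 0 ≤ τ) (hρ : 0 ≤ ρ)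
    (hL : Lv ρ μ (ℓ - 3 / 2 * N)) (hℓ : ℓ ≤ ℓV)
    (hV : UPair S N τ a b ℓV 1 (fun _ _ => 1) (fun _ _ => 0) V) {c : ι → ℕ → ℂ}
    (hc : ∀ i ∈ S, ∀ j, ‖c i j‖ ≤ 1 / (j.factorial : ℝ)) (hd1 : 1 ≤ d) (hd2 : d ≤ 2)
    (hcd : ∀ i ∈ S, ∀ j < d, c i j = 0) :
    UTame S N τ a b ℓ (ℓ + ρ) d (fun i => WaterWaves.serJ (c i) r (V i)) := by
  obtain ⟨C, hC, H⟩ := gJ W hr hτ hL hℓ hV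
  have h0 : 0 ≤ max 1 (2 * (N + 1) * C) := zero_le_one.trans (le_max_left _ _)
  exact ⟨_, tsum_nonneg fun j => by positivity, fun i hi => tameJ_ser (W i hi) hρ (H i hi)
    (le_max_right 1 _) (le_max_left _ _) (hc i hi) hd1 hd2 (hcd i hi)⟩

lemma PhiJ (W : ∀ i ∈ S, Weights N (a i) (b i)) (hr : CoefBd ρ μ Cr r) (hτ : 0 ≤ τ) (hρ : 0 ≤ ρ)
    (hL : Lv ρ μ (ℓ - 3 / 2 * N)) (hℓ : ℓ ≤ ℓV)
    (hV : UPair S N τ a b ℓV 1 (fun _ _ => 1) (fun _ _ => 0) V)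
    (hQ : UTame S N τ a b ℓ (ℓ + ρ) 1 T) :
    UTame S N τ a b ℓ (ℓ + ρ) 2 (fun i => WaterWaves.PhiJ r (V i) (T i)) := by
  obtain ⟨C, hC, H⟩ := gJ W hr hτ hL hℓ hV
  obtain ⟨C', hC', H'⟩ := hQ
  have h0 : 0 ≤ max 1 (2 * (N + 1) * max C C') := zero_le_one.trans (le_max_left _ _)
  have h1 : 2 * ((N : ℝ) + 1) * C ≤ max 1 (2 * (N + 1) * max C C') :=
    le_max_of_le_right (by gcongr; exact le_max_left _ _)
  have h2 : 2 * ((N : ℝ) + 1) * C' ≤ max 1 (2 * (N + 1) * max C C') :=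
    le_max_of_le_right (by gcongr; exact le_max_right _ _)
  exact ⟨_, tsum_nonneg fun j => by positivity, fun i hi => tameJ_PhiJ (W i hi) hρ (H i hi)
    h1 (le_max_left _ _) (H' i hi) h2⟩

lemma kerJ (W : ∀ i ∈ S, Weights N (a i) (b i)) {κ : ι → ℕ → Bool → Bool → ℤ → ℤ → ℂ} {c : ℝ}
    (hc : 0 ≤ c) (hκ : ∀ i ∈ S, ∀ j ≤ N, KB (c * wlow d (a i) j) (κ i j)) :
    UTame S N τ a b ℓ (ℓ - 5 / 2) d (fun i => WaterWaves.kerJ (κ i)) :=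
  ⟨_, mul_nonneg (le_max_of_le_left (kConst_nonneg N ℓ)) hc, fun i hi =>
    tameJ_kerJ (W i hi) hc (hκ i hi)⟩

end UTame

end uniform

/-! ### Curves as weights -/

/-- The weights given by the norms of a curve. -/
def wt (I : Set ℝ) (K' : ℕ) (s : ℝ) (V : ℝ → Vec) (t : ℝ) : ℕ → ℝ := fun j => normK2 I (j + K') s V t

section curves

variable {I : Set ℝ} {K K' K'' : ℕ} {s s₀ s₁ r : ℝ} {V u : ℝ → Vec} {t : ℝ}

/-- The radius `1` provides `le_one`. The shift by `K'` is inherited from the classes, where the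
`j`-th derivative is controlled by `j + K'` derivatives of `V`. -/
lemma weights_wt (hK : K' ≤ K) (hV : InBall I K s₀ 1 V) (hVs : CStar2 I K s V) (hs : s₀ ≤ s)
    (ht : t ∈ I) : Weights (K - K') (wt I K' s₀ V t) (wt I K' s V t) where
  nonneg _ _ := normK2_nonneg _ _ _ _ _
  le_one i hi := (normK2_mono_left I s₀ V t (show i + K' ≤ K by omega)).trans (hV.lt ht).le
  le i hi := hVs.normK2_mono (by omega) hs ht
  mono i j hij _ := normK2_mono_left I s₀ V t (by omega)
  mono' i j hij _ := normK2_mono_left I s V t (by omega)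

lemma jb_wt (hK : K' ≤ K) (hV : CStar2 I K s₀ V) (hVs : CStar2 I K s V) (ht : t ∈ I) :
    JB (K - K') s₀ (fun k => dt2 I k V t) (wlow 1 (wt I K' s₀ V t)) ∧
    JB (K - K') s (fun k => dt2 I k V t) (whigh 1 (wt I K' s₀ V t) (wt I K' s V t)) := by
  constructor
  · intro k hk
    refine (hV.jb ht k (by omega)).mono ?_
    simp only [wlow, wt, pow_one]
    exact normK2_mono_left I s₀ V t (by omega)
  · intro k hk
    refine (hVs.jb ht k (by omega)).mono ?_
    simp only [whigh, wt, Nat.sub_self, pow_zero, one_mul]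
    exact normK2_mono_left I s V t (by omega)

lemma monoN_normK2 (I : Set ℝ) (N : ℕ) (s : ℝ) (u : ℝ → Vec) (t : ℝ) :
    MonoN N (fun j => normK2 I j s u t) :=
  ⟨fun _ _ => normK2_nonneg _ _ _ _ _, fun _ _ h _ => normK2_mono_left I s u t h⟩

/-- Each of the at most `N + 1` derivatives is embedded at the cost of one derivative in space. -/
lemma normK2_le_of_jb (hI : UniqueDiffOn ℝ I) {D : ℕ → ℝ → Vec} (hu : ∀ t ∈ I, u t = D 0 t)
    (hD : CJ I K s D) {N : ℕ} (hN : N ≤ K) (ht : t ∈ I) {x : ℕ → ℝ} (hx : MonoN N x)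
    (hJ : JB N s (fun k => D k t) x) {j : ℕ} (hj : j ≤ N) :
    normK2 I j (s - 1) u t ≤ (N + 1) * embConst * x j := by
  have hE := embConst_nonneg
  have h1 : ∀ k ∈ Finset.range (j + 1),
      normH2 (s - 1 - 3 / 2 * (k : ℝ)) (dt2 I k u t) ≤ embConst * x j := by
    intro k hk
    have hk := Finset.mem_range.1 hk
    rw [hD.dt2_eq hI hu (by omega) ht]
    refine (((hJ k (by omega)).weaken (show s - 1 - 3 / 2 * (k : ℝ) + 1 ≤ s - 3 / 2 * k by
      linarith)).normH2_le).trans ?_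
    exact mul_le_mul_of_nonneg_left (hx.2 k j (by omega) hj) hE
  have h2 := hx.1 j hj
  have hj' : (j : ℝ) ≤ N := by exact_mod_cast hj
  calc _ ≤ ∑ k ∈ Finset.range (j + 1), embConst * x j := Finset.sum_le_sum h1
    _ = (j + 1) * (embConst * x j) := by simp
    _ ≤ (N + 1) * (embConst * x j) := by gcongr
    _ = _ := by ring

lemma conv_le_conv {N : ℕ} {α α' x x' : ℕ → ℝ} (h : ∀ i ≤ N, 0 ≤ α i) (h' : ∀ i ≤ N, α i ≤ α' i)
    (hx : ∀ i ≤ N, 0 ≤ x i) (hx' : ∀ i ≤ N, x i ≤ x' i) {k : ℕ} (hk : k ≤ N) :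
    conv α x k ≤ conv α' x' k :=
  conv_mono (fun i hi => (h i (hi.trans hk)).trans (h' i (hi.trans hk)))
    (fun i hi => hx i (hi.trans hk)) (fun i hi => h' i (hi.trans hk))
    fun i hi => hx' i (hi.trans hk)

/-- The jets of `M(V)u` for a non-homogeneous operator, in terms of the jets of `u`. -/
lemma exists_nonhom_upair (hI : UniqueDiffOn ℝ I) {γ : ℝ} {M : OpMat}
    (hM : IsNonhomMat I γ K K'' 2 r s₁ M) (hK : K'' ≤ K') (hK' : K' ≤ K) (hs₀ : s₁ + 1 ≤ s₀)
    (hs : s₀ ≤ s) :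
    ∃ rs > 0, rs < r ∧
      (∀ V, InBall I K s₀ rs V → CStar2 I K s V → ∀ (u : ℝ → Vec) D, (∀ t ∈ I, u t = D 0 t) →
        CJ I K s D → CJ I (K - K') (s - 1 + γ) (matJ I M V u)) ∧
      ∀ {ι : Type} {S : Set ι} {V u : ι → ℝ → Vec} {t : ι → ℝ} {D : ι → ℕ → ℝ → Vec}
        {x X : ι → ℕ → ℝ} {d : ℕ},
        (∀ i ∈ S, InBall I K s₀ rs (V i) ∧ CStar2 I K s (V i) ∧ t i ∈ I ∧
          (∀ t ∈ I, u i t = D i 0 t) ∧ CJ I K s (D i)) →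
        (∀ i ∈ S, MonoN (K - K') (x i)) → (∀ i ∈ S, MonoN (K - K') (X i)) →
        UPair S (K - K') (s - s₀) (fun i => wt I K' s₀ (V i) (t i)) (fun i => wt I K' s (V i) (t i))
          s₀ d x X (fun i k => D i k (t i)) →
        UPair S (K - K') (s - s₀) (fun i => wt I K' s₀ (V i) (t i)) (fun i => wt I K' s (V i) (t i))
          (s₀ - 1 + γ) (2 + d) x X (fun i k => matJ I M (V i) (u i) k (t i)) := by
  -- The class is used at `s - 1` and at `s₀ - 1`: the argument is known through sup bounds, and its
  -- Sobolev norms are available one derivative lower.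
  obtain ⟨C, hC, rs, hrs, hrr, H⟩ := hM.tame hI (s := s - 1) (by linarith)
  obtain ⟨C₀, hC₀, rs₀, hrs₀, hrr₀, H₀⟩ := hM.tame hI (s := s₀ - 1) (by linarith)
  refine ⟨min (min rs rs₀) 1, by positivity, ((min_le_left _ _).trans (min_le_left _ _)).trans_lt hrr,
    fun V hV hVs u D hu hD => ?_, ?_⟩
  · exact (H V (hV.mono (by linarith) ((min_le_left _ _).trans (min_le_left _ _)))
      (hVs.mono le_rfl (by linarith)) u ((hD.weaken (by linarith)).cstar2 hI hu)).1.of_le (by omega)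
  intro ι S V u t D x X d hS hx hX hD
  obtain ⟨C', hC', hD⟩ := hD
  have hE := embConst_nonneg
  set N := K - K' with hN
  set B := ((N : ℝ) + 1) * embConst with hB
  have hB0 : 0 ≤ B := by positivity
  refine ⟨(C + 2 * C₀) * (2 * (N + 1)) * (B * C'), by positivity, fun i hi => ?_⟩
  obtain ⟨hV, hVs, ht, hu, hDi⟩ := hS i hi
  have hV1 : InBall I K s₀ rs (V i) := hV.mono le_rfl ((min_le_left _ _).trans (min_le_left _ _))
  have hV2 : InBall I K s₀ rs₀ (V i) := hV.mono le_rfl ((min_le_left _ _).trans (min_le_right _ _))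
  have hV3 : InBall I K s₀ 1 (V i) := hV.mono le_rfl (min_le_right _ _)
  have W := weights_wt (K' := K') hK' hV3 hVs hs ht
  rw [← hN] at W
  have hus : CStar2 I K (s - 1) (u i) := (hDi.weaken (by linarith)).cstar2 hI hu
  have hus₀ : CStar2 I K (s₀ - 1) (u i) := hus.mono le_rfl (by linarith)
  have hp := hD i hi
  rw [PairJ, add_sub_cancel] at hp
  have hxi := hx i hi
  have hXi := hX i hi
  set a := wt I K' s₀ (V i) (t i) with ha
  set b := wt I K' s (V i) (t i) with hb
  -- the norms of `u`
  have mlow : MonoN N (conv (wlow d a) (x i)) := conv_monoN (fun _ => W.wlow_nonneg d) hxi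
  have mlow' : MonoN N (conv (wlow d a) (X i)) := conv_monoN (fun _ => W.wlow_nonneg d) hXi
  have mhigh : MonoN N (conv (whigh d a b) (x i)) := conv_monoN (fun _ => W.whigh_nonneg d) hxi
  have nlow : ∀ j ≤ N, normK2 I j (s₀ - 1) (u i) (t i)
      ≤ ((B * C') • conv (wlow d a) (x i)) j := by
    intro j hj
    refine (normK2_le_of_jb hI hu (hDi.weaken hs) (show N ≤ K by omega) ht
      (x := C' • conv (wlow d a) (x i)) ⟨fun k hk => mul_nonneg hC' (mlow.1 k hk),
        fun k l hkl hl => mul_le_mul_of_nonneg_left (mlow.2 k l hkl hl) hC'⟩ hp.1 hj).trans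
      (le_of_eq ?_)
    simp only [Pi.smul_apply, smul_eq_mul, hB]; ring
  have nhigh : ∀ j ≤ N, normK2 I j (s - 1) (u i) (t i)
      ≤ ((B * C') • (conv (wlow d a) (X i) + conv (whigh d a b) (x i))) j := by
    intro j hj
    refine (normK2_le_of_jb hI hu hDi (show N ≤ K by omega) ht
      (x := C' • (conv (wlow d a) (X i) + conv (whigh d a b) (x i)))
      ⟨fun k hk => mul_nonneg hC' (add_nonneg (mlow'.1 k hk) (mhigh.1 k hk)),
        fun k l hkl hl => mul_le_mul_of_nonneg_left
          (add_le_add (mlow'.2 k l hkl hl) (mhigh.2 k l hkl hl)) hC'⟩ hp.2 hj).trans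
      (le_of_eq ?_)
    simp only [Pi.smul_apply, smul_eq_mul, hB]; ring
  -- the weights of `V`
  have ha₁ : ∀ j ≤ N, normK2 I (j + K'') s₁ (V i) (t i) ≤ a j := fun j hj =>
    (hV.1.normK2_mono (show j + K'' ≤ K by omega) (by linarith) ht).trans
      (normK2_mono_left I s₀ (V i) (t i) (by omega))
  have hb₁ : ∀ j ≤ N, normK2 I (j + K'') (s - 1) (V i) (t i) ≤ b j := fun j hj =>
    (hVs.normK2_mono (show j + K'' ≤ K by omega) (by linarith) ht).trans
      (normK2_mono_left I s (V i) (t i) (by omega))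
  have hb₀ : ∀ j ≤ N, normK2 I (j + K'') (s₀ - 1) (V i) (t i) ≤ a j := fun j hj =>
    (hV.1.normK2_mono (show j + K'' ≤ K by omega) (by linarith) ht).trans
      (normK2_mono_left I s₀ (V i) (t i) (by omega))
  have n0 : ∀ (M : ℕ) (σ : ℝ) (v : ℝ → Vec), 0 ≤ normK2 I M σ v (t i) :=
    fun M σ v => normK2_nonneg I M σ v (t i)
  have n1 : ∀ j ≤ N, 0 ≤ wlow 2 (fun j => normK2 I (j + K'') s₁ (V i) (t i)) j := fun j _ =>
    pow_nonneg (n0 _ _ _) _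
  have l1 : ∀ j ≤ N, wlow 2 (fun j => normK2 I (j + K'') s₁ (V i) (t i)) j ≤ wlow 2 a j :=
    fun j hj => pow_le_pow_left₀ (n0 _ _ _) (ha₁ j hj) 2
  have n2 : ∀ (σ : ℝ), ∀ j ≤ N, 0 ≤ whigh 2 (fun j => normK2 I (j + K'') s₁ (V i) (t i))
      (fun j => normK2 I (j + K'') σ (V i) (t i)) j := fun σ j _ =>
    mul_nonneg (pow_nonneg (n0 _ _ _) _) (n0 _ _ _)
  have l2 : ∀ j ≤ N, whigh 2 (fun j => normK2 I (j + K'') s₁ (V i) (t i))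
      (fun j => normK2 I (j + K'') (s - 1) (V i) (t i)) j ≤ whigh 2 a b j := fun j hj =>
    mul_le_mul (pow_le_pow_left₀ (n0 _ _ _) (ha₁ j hj) _) (hb₁ j hj) (n0 _ _ _)
      (pow_nonneg (W.nonneg j hj) _)
  -- At the level `s₀ - 1` even the high norm of `V` is at most the low weight, so the low estimate
  -- involves low weights only.
  have l3 : ∀ j ≤ N, whigh 2 (fun j => normK2 I (j + K'') s₁ (V i) (t i))
      (fun j => normK2 I (j + K'') (s₀ - 1) (V i) (t i)) j ≤ wlow 2 a j := fun j hj => by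
    have := mul_le_mul (pow_le_pow_left₀ (n0 _ _ _) (ha₁ j hj) 1) (hb₀ j hj) (n0 _ _ _)
      (pow_nonneg (W.nonneg j hj) _)
    refine this.trans (le_of_eq ?_)
    simp only [wlow]; ring
  have lx : ∀ j ≤ N, normK2 I j s₁ (u i) (t i) ≤ ((B * C') • conv (wlow d a) (x i)) j :=
    fun j hj => (hus₀.normK2_mono (by omega) (by linarith) ht).trans (nlow j hj)
  have q1 := (H (V i) (hV1.mono (by linarith) le_rfl) (hVs.mono le_rfl (by linarith)) (u i) hus).2
    (t i) ht
  have q0 := (H₀ (V i) (hV2.mono (by linarith) le_rfl) (hV.1.mono le_rfl (by linarith)) (u i)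
    hus₀).2 (t i) ht
  constructor
  · intro k hk
    refine (q0 k (by omega)).mono ?_
    simp only [Pi.smul_apply, Pi.add_apply, smul_eq_mul]
    have e1 := conv_le_conv n1 l1 (fun j _ => n0 j (s₀ - 1) (u i)) nlow hk
    have e2 := conv_le_conv (n2 (s₀ - 1)) l3 (fun j _ => n0 j s₁ (u i)) lx hk
    have e3 := W.conv_conv_wlow (le_refl (2 + d)) hxi.1 hk
    have e4 := W.conv_wlow_nonneg (2 + d) hxi.1 hk
    rw [conv_smul_right] at e1 e2
    calc _ ≤ C₀ * (B * C' * conv (wlow 2 a) (conv (wlow d a) (x i)) k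
          + B * C' * conv (wlow 2 a) (conv (wlow d a) (x i)) k) := by gcongr
      _ = 2 * C₀ * (B * C') * conv (wlow 2 a) (conv (wlow d a) (x i)) k := by ring
      _ ≤ 2 * C₀ * (B * C') * ((N + 1) * conv (wlow (2 + d) a) (x i) k) := by gcongr
      _ = 2 * C₀ * (1 * (N + 1)) * (B * C') * conv (wlow (2 + d) a) (x i) k := by ring
      _ ≤ _ := by
        gcongr
        · linarith
        · norm_num
  · intro k hk
    rw [show s₀ - 1 + γ + (s - s₀) = s - 1 + γ by ring]
    refine (q1 k (by omega)).mono ?_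
    simp only [Pi.smul_apply, Pi.add_apply, smul_eq_mul]
    have e1 := conv_le_conv n1 l1 (fun j _ => n0 j (s - 1) (u i)) nhigh hk
    have e2 := conv_le_conv (n2 (s - 1)) l2 (fun j _ => n0 j s₁ (u i)) lx hk
    have e3 := W.conv_conv_whigh (le_refl (2 + d)) hxi.1 hXi.1 hk
    have e4 := W.conv_wlow_nonneg (2 + d) hXi.1 hk
    have e5 := W.conv_whigh_nonneg (2 + d) hxi.1 hk
    rw [conv_smul_right] at e1 e2
    calc _ ≤ C * (B * C' * conv (wlow 2 a) (conv (wlow d a) (X i) + conv (whigh d a b) (x i)) k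
          + B * C' * conv (whigh 2 a b) (conv (wlow d a) (x i)) k) := by gcongr
      _ = C * (B * C') * (conv (wlow 2 a) (conv (wlow d a) (X i) + conv (whigh d a b) (x i)) k
          + conv (whigh 2 a b) (conv (wlow d a) (x i)) k) := by ring
      _ ≤ C * (B * C') * (2 * (N + 1) *
          (conv (wlow (2 + d) a) (X i) k + conv (whigh (2 + d) a b) (x i) k)) := by gcongr
      _ = C * (2 * (N + 1)) * (B * C') *
          (conv (wlow (2 + d) a) (X i) k + conv (whigh (2 + d) a b) (x i) k) := by ring
      _ ≤ _ := by
        gcongr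
        linarith

/-- The jets of paradifferential operators with non-homogeneous symbols. -/
lemma exists_para_kernels (hI : I.OrdConnected) (hu : UniqueDiffOn ℝ I) {δ : ℝ}
    {α : Bool → Bool → ParaSymbol} {χ : ℝ → ℝ → ℝ} (hχ : IsCutoff δ χ) (hK : K'' ≤ K')
    (hK' : K' ≤ K) (hs₀ : s₁ ≤ s₀)
    (ha : ∀ σ σ', IsNonhomSymbol I (3 / 2) K K'' 2 r s₁ (α σ σ')) :
    ∃ C ≥ (0 : ℝ), ∃ rs > 0, rs < r ∧
      ∃ κ : (ℝ → Vec) → ℕ → ℝ → Bool → Bool → ℤ → ℤ → ℂ, ∀ V, InBall I K s₀ rs V →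
        KJ I (K - K') C (κ V) ∧
        (∀ t ∈ I, ∀ u : Vec, (∀ σ, u σ 0 = 0) → act (paraMat χ α) V t u = kerOp (κ V 0 t) u) ∧
        ∀ j ≤ K - K', ∀ t ∈ I, KB (C * wlow 2 (wt I K' s₀ V t) j) (κ V j t) := by
  obtain ⟨C, hC, rs, hrs, hrr, H⟩ := exists_para_jets hI hu hχ (hK.trans hK') ha
  have H' : ∀ V, ∃ κ : ℕ → ℝ → Bool → Bool → ℤ → ℤ → ℂ, InBall I K s₀ (min rs 1) V →
      KJ I (K - K') C κ ∧
        (∀ t ∈ I, ∀ u : Vec, (∀ σ, u σ 0 = 0) → act (paraMat χ α) V t u = kerOp (κ 0 t) u) ∧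
        ∀ j ≤ K - K', ∀ t ∈ I, KB (C * wlow 2 (wt I K' s₀ V t) j) (κ j t) := by
    intro V
    -- Outside the ball the kernel is set to zero, so that it can be chosen as a function of all
    -- curves.
    by_cases hV : InBall I K s₀ (min rs 1) V
    swap
    · exact ⟨fun _ _ _ _ _ _ => 0, fun h => absurd h hV⟩
    obtain ⟨κ, h1, h2, h3⟩ := H V (hV.mono hs₀ (min_le_left _ _)) fun t ht =>
      ((hV.mono hs₀ (min_le_right rs 1)).lt ht).le
    refine ⟨κ, fun _ => ⟨⟨fun k hk => h1.cont k (by omega), fun k hk => h1.der k (by omega),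
      fun k hk => h1.bound k (by omega), h1.nonneg⟩, h2, fun j hj t ht σ σ' n l hn hl => ?_⟩⟩
    obtain ⟨g1, g2⟩ := h3 j (by omega) t ht σ σ' n l hn hl
    refine ⟨g1.trans ?_, g2⟩
    have e1 : normK2 I (j + K'') s₁ V t ≤ wt I K' s₀ V t j :=
      (hV.1.normK2_mono (show j + K'' ≤ K by omega) hs₀ ht).trans
        (normK2_mono_left I s₀ V t (by omega))
    have e2 := normK2_nonneg I (j + K'') s₁ V t
    simp only [wlow]
    gcongr
  choose κ hκ using H'
  exact ⟨C, hC, min rs 1, lt_min hrs one_pos, (min_le_left _ _).trans_lt hrr, κ, hκ⟩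

end curves

/-! ### Families of curves of jets -/

/-- A family of curves, given by their derivatives `D i k t`, with uniform estimates at the
times `t i`. -/
structure Fam {ι : Type} (I : Set ℝ) (S : Set ι) (t : ι → ℝ) (N : ℕ) (τ : ℝ) (a b : ι → ℕ → ℝ)
    (ℓ : ℝ) (d : ℕ) (x X : ι → ℕ → ℝ) (D : ι → ℕ → ℝ → Vec) : Prop where
  cj : ∀ i ∈ S, CJ I N (ℓ + τ) (D i)
  pair : UPair S N τ a b ℓ d x X (fun i k => D i k (t i))

namespace Fam

variable {ι : Type} {I : Set ℝ} {S : Set ι} {t : ι → ℝ} {N : ℕ} {τ : ℝ} {a b : ι → ℕ → ℝ}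
  {ℓ ℓ' ℓV ρ μ Cr : ℝ} {d e f : ℕ} {x X : ι → ℕ → ℝ} {D D' V : ι → ℕ → ℝ → Vec} {r : HomMat}

lemma mono (h : Fam I S t N τ a b ℓ d x X D) (W : ∀ i ∈ S, Weights N (a i) (b i))
    (hx : ∀ i ∈ S, MonoN N (x i)) (hX : ∀ i ∈ S, MonoN N (X i)) (hl : ℓ' ≤ ℓ) (he : e ≤ d) :
    Fam I S t N τ a b ℓ' e x X D :=
  ⟨fun i hi => (h.cj i hi).weaken (by linarith), h.pair.mono W hx hX hl he⟩

lemma add (h : Fam I S t N τ a b ℓ d x X D) (h' : Fam I S t N τ a b ℓ d x X D') :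
    Fam I S t N τ a b ℓ d x X (fun i k t => D i k t + D' i k t) :=
  ⟨fun i hi => (h.cj i hi).add (h'.cj i hi), h.pair.add h'.pair⟩

lemma smul (c : ℂ) (h : Fam I S t N τ a b ℓ d x X D) :
    Fam I S t N τ a b ℓ d x X (fun i k t => c • D i k t) :=
  ⟨fun i hi => (h.cj i hi).smul c, h.pair.smul c⟩

lemma sub (h : Fam I S t N τ a b ℓ d x X D) (h' : Fam I S t N τ a b ℓ d x X D') :
    Fam I S t N τ a b ℓ d x X (fun i k t => D i k t - D' i k t) := by
  have := h.add (h'.smul (-1))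
  simpa only [neg_one_smul, ← sub_eq_add_neg] using this

lemma gJ (W : ∀ i ∈ S, Weights N (a i) (b i)) (hI : I.OrdConnected) (hτ : 0 ≤ τ)
    (hx : ∀ i ∈ S, MonoN N (x i)) (hX : ∀ i ∈ S, MonoN N (X i))
    (hr : CoefBd ρ μ Cr r) (hL : Lv ρ μ (ℓ - 3 / 2 * N)) (hℓ : ℓ ≤ ℓV)
    (hV : Fam I S t N τ a b ℓV d (fun _ _ => 1) (fun _ _ => 0) V)
    (hD : Fam I S t N τ a b ℓ e x X D) (hf : f ≤ d + e) :
    Fam I S t N τ a b (ℓ + ρ) f x X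
      (fun i k t => WaterWaves.gJ r (fun j => V i j t) (fun j => D i j t) k) := by
  refine ⟨fun i hi => ?_, (UTame.gJ W hr hτ hL hℓ hV.pair).pair W hx hX hD.pair hf⟩
  exact (CJ.gJ hI hr (hL.mono (by linarith)) (by linarith) (hV.cj i hi) (hD.cj i hi)).weaken
    (by linarith)

lemma serJ (W : ∀ i ∈ S, Weights N (a i) (b i)) (hI : I.OrdConnected) (hτ : 0 ≤ τ) (hρ : 0 ≤ ρ)
    (hx : ∀ i ∈ S, MonoN N (x i)) (hX : ∀ i ∈ S, MonoN N (X i))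
    (hr : CoefBd ρ μ Cr r) (hL : Lv ρ μ (ℓ - 3 / 2 * N)) (hℓ : ℓ ≤ ℓV)
    (hV : Fam I S t N τ a b ℓV 1 (fun _ _ => 1) (fun _ _ => 0) V)
    (hD : Fam I S t N τ a b ℓ e x X D) {c : ι → ℕ → ℂ}
    (hc : ∀ i ∈ S, ∀ j, ‖c i j‖ ≤ 1 / (j.factorial : ℝ)) (hd1 : 1 ≤ d) (hd2 : d ≤ 2)
    (hcd : ∀ i ∈ S, ∀ j < d, c i j = 0) (hf : f ≤ d + e) :
    Fam I S t N τ a b (ℓ + ρ) f x X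
      (fun i k t => WaterWaves.serJ (c i) r (fun j => V i j t) (fun j => D i j t) k) := by
  refine ⟨fun i hi => ?_,
    (UTame.serJ W hr hτ hρ hL hℓ hV.pair hc hd1 hd2 hcd).pair W hx hX hD.pair hf⟩
  exact (CJ.serJ hI hρ hr (hL.mono (by linarith)) (by linarith) (hc i hi) (hcd i hi 0 hd1)
    (hV.cj i hi) (hD.cj i hi)).weaken (by linarith)

lemma kerJ (W : ∀ i ∈ S, Weights N (a i) (b i)) 
    (hx : ∀ i ∈ S, MonoN N (x i)) (hX : ∀ i ∈ S, MonoN N (X i))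
    {κ : ι → ℕ → ℝ → Bool → Bool → ℤ → ℤ → ℂ} {c : ℝ}
    (hκ : ∀ i ∈ S, KJ I N c (κ i)) (hc : 0 ≤ c)
    (hκ' : ∀ i ∈ S, ∀ j ≤ N, KB (c * wlow d (a i) j) (κ i j (t i)))
    (hD : Fam I S t N τ a b ℓ e x X D) (hf : f ≤ d + e) :
    Fam I S t N τ a b (ℓ - 5 / 2) f x X
      (fun i k t => WaterWaves.kerJ (fun j => κ i j t) (fun j => D i j t) k) :=
  ⟨fun i hi => (CJ.kerJ (hκ i hi) (hD.cj i hi)).weaken (by linarith),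
    (UTame.kerJ W hc hκ').pair W hx hX hD.pair hf⟩

lemma tameJ_unit_local (hV : ∀ i ∈ S, CJ I N ℓV (V i)) {i : ι} (hi : i ∈ S)
    (hr : CoefBd ρ μ Cr r) (hL : Lv ρ μ (ℓ - 3 / 2 * N)) (hℓ : ℓ ≤ ℓV) :
    ∀ t ∈ I, ∃ ε > 0, ∃ C, ∀ τ ∈ I, |τ - t| < ε →
      TameJ N 0 1 1 ℓ (ℓ + ρ) 1 C (WaterWaves.gJ r (fun j => V i j τ)) := by
  intro t ht
  obtain ⟨ε, hε, B, H⟩ := (hV i hi).loc t ht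
  exact ⟨ε, hε, _, fun τ hτ h => CJ.tameJ_unit hr hL hℓ (H τ hτ h)⟩

/-- The second order part of the conjugated vector field, where `Q` is given by
`Q u = R(V)u + G(w)u`. -/
lemma PhiJ (W : ∀ i ∈ S, Weights N (a i) (b i)) (hI : I.OrdConnected) (hτ : 0 ≤ τ) (hρ : 0 ≤ ρ)
    (hx : ∀ i ∈ S, MonoN N (x i)) (hX : ∀ i ∈ S, MonoN N (X i)) {r' : HomMat} {Cr' : ℝ}
    (hr : CoefBd ρ μ Cr r) (hr' : CoefBd ρ μ Cr' r') (hL : Lv ρ μ (ℓ - 3 / 2 * N)) (hℓ : ℓ ≤ ℓV)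
    {w : ι → ℕ → ℝ → Vec}
    (hV : Fam I S t N τ a b ℓV 1 (fun _ _ => 1) (fun _ _ => 0) V)
    (hw : Fam I S t N τ a b ℓ 1 (fun _ _ => 1) (fun _ _ => 0) w)
    (hD : Fam I S t N τ a b ℓ e x X D) (hf : f ≤ 2 + e) :
    Fam I S t N τ a b (ℓ + ρ) f x X
      (fun i k t => WaterWaves.PhiJ r (fun j => V i j t)
        (fun u => WaterWaves.gJ r' (fun j => V i j t) u + WaterWaves.gJ r (fun j => w i j t) u)
        (fun j => D i j t) k) := by
  have hL' : Lv ρ μ (ℓ + τ - 3 / 2 * N) := hL.mono (by linarith)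
  refine ⟨fun i hi => ?_, (UTame.PhiJ W hr hτ hρ hL hℓ hV.pair
    ((UTame.gJ W hr' hτ hL hℓ hV.pair).add (UTame.gJ W hr hτ hL le_rfl hw.pair))).pair
      W hx hX hD.pair hf⟩
  refine (CJ.PhiJ hI hρ hr hL' (by linarith) (hV.cj i hi) (hD.cj i hi) (fun E hE => ?_)
    fun t ht => ?_).weaken (ℓ' := ℓ + ρ + τ) (by linarith)
  · exact (CJ.gJ hI hr' hL' (by linarith) (hV.cj i hi) hE).add
      (CJ.gJ hI hr hL' le_rfl (hw.cj i hi) hE)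
  · obtain ⟨ε, hε, C, H⟩ := tameJ_unit_local hV.cj hi hr' hL' (by linarith) t ht
    obtain ⟨ε', hε', C', H'⟩ := tameJ_unit_local hw.cj hi hr hL' le_rfl t ht
    exact ⟨min ε ε', lt_min hε hε', _, fun τ hτ h =>
      (H τ hτ (h.trans_le (min_le_left _ _))).add (H' τ hτ (h.trans_le (min_le_right _ _)))⟩

end Fam

/-- The operators `P_0 = Q`, `P_{n+1} = G(U) P_n + Q G(U)^{n+1}` with `Q = R(U) + G(W)`. -/
def commOp (r r' : HomMat) (U W : Vec) : ℕ → Vec → Vec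
  | 0, v => bil r' U v + bil r W v
  | n + 1, v => bil r U (commOp r r' U W n v)
      + (bil r' U ((bil r U)^[n + 1] v) + bil r W ((bil r U)^[n + 1] v))

/-- `∑_n P_{n+1} / (n+2)!`. -/
def PhiOp (r r' : HomMat) (U W v : Vec) : Vec :=
  fun σ n => ∑' i : ℕ, ((1 / ((i + 2).factorial : ℂ)) • commOp r r' U W (i + 1) v) σ n

lemma PJ_zero (r r' : HomMat) (V w : ℕ → Vec) (n : ℕ) (u : ℕ → Vec) :
    PJ r V (fun u => gJ r' V u + gJ r w u) n u 0 = commOp r r' (V 0) (w 0) n (u 0) := by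
  induction n with
  | zero => simp [PJ, commOp, gJ_zero]
  | succ n ih =>
    rw [PJ, commOp, Pi.add_apply, Pi.add_apply, gJ_zero, gJ_zero, gJ_zero, ih, gJ_iterate_zero]

lemma PhiJ_zero (r r' : HomMat) (V w u : ℕ → Vec) :
    PhiJ r V (fun u => gJ r' V u + gJ r w u) u 0 = PhiOp r r' (V 0) (w 0) (u 0) := by
  funext σ n
  simp only [PhiJ, PhiOp]
  refine tsum_congr fun i => ?_
  rw [Pi.smul_apply, PJ_zero]

/-- Families of curves of vectors with uniform estimates on their jets. -/
def HasFam {ι : Type} (I : Set ℝ) (S : Set ι) (t : ι → ℝ) (N : ℕ) (τ : ℝ) (a b : ι → ℕ → ℝ)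
    (x X : ι → ℕ → ℝ) (ℓ : ℝ) (d : ℕ) (O : ι → ℝ → Vec) : Prop :=
  ∃ D, Fam I S t N τ a b ℓ d x X D ∧ ∀ i ∈ S, ∀ t ∈ I, O i t = D i 0 t

namespace HasFam

variable {ι : Type} {I : Set ℝ} {S : Set ι} {t : ι → ℝ} {N : ℕ} {τ : ℝ} {a b : ι → ℕ → ℝ}
  {ℓ ℓ' ℓV ρ μ Cr : ℝ} {d e f : ℕ} {x X : ι → ℕ → ℝ} {O O' V : ι → ℝ → Vec} {r : HomMat}

lemma mono (h : HasFam I S t N τ a b x X ℓ d O) (W : ∀ i ∈ S, Weights N (a i) (b i))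
    (hx : ∀ i ∈ S, MonoN N (x i)) (hX : ∀ i ∈ S, MonoN N (X i)) (hl : ℓ' ≤ ℓ) (he : e ≤ d) :
    HasFam I S t N τ a b x X ℓ' e O :=
  let ⟨D, hD, hO⟩ := h
  ⟨D, hD.mono W hx hX hl he, hO⟩

lemma add (h : HasFam I S t N τ a b x X ℓ d O) (h' : HasFam I S t N τ a b x X ℓ d O') :
    HasFam I S t N τ a b x X ℓ d (fun i t => O i t + O' i t) :=
  let ⟨_, hD, hO⟩ := h
  let ⟨_, hD', hO'⟩ := h'
  ⟨_, hD.add hD', fun i hi t ht => by beta_reduce; rw [hO i hi t ht, hO' i hi t ht]⟩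

lemma sub (h : HasFam I S t N τ a b x X ℓ d O) (h' : HasFam I S t N τ a b x X ℓ d O') :
    HasFam I S t N τ a b x X ℓ d (fun i t => O i t - O' i t) :=
  let ⟨_, hD, hO⟩ := h
  let ⟨_, hD', hO'⟩ := h'
  ⟨_, hD.sub hD', fun i hi t ht => by beta_reduce; rw [hO i hi t ht, hO' i hi t ht]⟩

lemma smul (c : ℂ) (h : HasFam I S t N τ a b x X ℓ d O) :
    HasFam I S t N τ a b x X ℓ d (fun i t => c • O i t) :=
  let ⟨_, hD, hO⟩ := h
  ⟨_, hD.smul c, fun i hi t ht => by beta_reduce; rw [hO i hi t ht]⟩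

lemma bil (W : ∀ i ∈ S, Weights N (a i) (b i)) (hI : I.OrdConnected) (hτ : 0 ≤ τ)
    (hx : ∀ i ∈ S, MonoN N (x i)) (hX : ∀ i ∈ S, MonoN N (X i))
    (hr : CoefBd ρ μ Cr r) (hL : Lv ρ μ (ℓ - 3 / 2 * N)) (hℓ : ℓ ≤ ℓV)
    (hV : HasFam I S t N τ a b (fun _ _ => 1) (fun _ _ => 0) ℓV d V)
    (hO : HasFam I S t N τ a b x X ℓ e O) (hf : f ≤ d + e) :
    HasFam I S t N τ a b x X (ℓ + ρ) f (fun i t => WaterWaves.bil r (V i t) (O i t)) :=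
  let ⟨_, hD, hO⟩ := hO
  let ⟨_, hD', hO'⟩ := hV
  ⟨_, Fam.gJ W hI hτ hx hX hr hL hℓ hD' hD hf, fun i hi t ht => by
    beta_reduce; rw [hO i hi t ht, hO' i hi t ht, gJ_zero]⟩

lemma serOp (W : ∀ i ∈ S, Weights N (a i) (b i)) (hI : I.OrdConnected) (hτ : 0 ≤ τ) (hρ : 0 ≤ ρ)
    (hx : ∀ i ∈ S, MonoN N (x i)) (hX : ∀ i ∈ S, MonoN N (X i))
    (hr : CoefBd ρ μ Cr r) (hL : Lv ρ μ (ℓ - 3 / 2 * N)) (hℓ : ℓ ≤ ℓV)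
    (hV : HasFam I S t N τ a b (fun _ _ => 1) (fun _ _ => 0) ℓV 1 V)
    (hO : HasFam I S t N τ a b x X ℓ e O) {c : ι → ℕ → ℂ}
    (hc : ∀ i ∈ S, ∀ j, ‖c i j‖ ≤ 1 / (j.factorial : ℝ)) (hd1 : 1 ≤ d) (hd2 : d ≤ 2)
    (hcd : ∀ i ∈ S, ∀ j < d, c i j = 0) (hf : f ≤ d + e) :
    HasFam I S t N τ a b x X (ℓ + ρ) f (fun i t => WaterWaves.serOp (c i) r (V i t) (O i t)) :=
  let ⟨_, hD, hO⟩ := hO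
  let ⟨_, hD', hO'⟩ := hV
  ⟨_, Fam.serJ W hI hτ hρ hx hX hr hL hℓ hD' hD hc hd1 hd2 hcd hf, fun i hi t ht => by
    beta_reduce; rw [hO i hi t ht, hO' i hi t ht, serJ_zero]⟩

lemma kerOp (W : ∀ i ∈ S, Weights N (a i) (b i))
    (hx : ∀ i ∈ S, MonoN N (x i)) (hX : ∀ i ∈ S, MonoN N (X i))
    {κ : ι → ℕ → ℝ → Bool → Bool → ℤ → ℤ → ℂ} {c : ℝ}
    (hκ : ∀ i ∈ S, KJ I N c (κ i)) (hc : 0 ≤ c)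
    (hκ' : ∀ i ∈ S, ∀ j ≤ N, KB (c * wlow d (a i) j) (κ i j (t i)))
    (hO : HasFam I S t N τ a b x X ℓ e O) (hf : f ≤ d + e) :
    HasFam I S t N τ a b x X (ℓ - 5 / 2) f (fun i t => WaterWaves.kerOp (κ i 0 t) (O i t)) :=
  let ⟨_, hD, hO⟩ := hO
  ⟨_, Fam.kerJ W hx hX hκ hc hκ' hD hf, fun i hi t ht => by
    beta_reduce; rw [hO i hi t ht, kerJ_zero]⟩

lemma PhiOp (W : ∀ i ∈ S, Weights N (a i) (b i)) (hI : I.OrdConnected) (hτ : 0 ≤ τ) (hρ : 0 ≤ ρ)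
    (hx : ∀ i ∈ S, MonoN N (x i)) (hX : ∀ i ∈ S, MonoN N (X i)) {r' : HomMat} {Cr' : ℝ}
    (hr : CoefBd ρ μ Cr r) (hr' : CoefBd ρ μ Cr' r') (hL : Lv ρ μ (ℓ - 3 / 2 * N)) (hℓ : ℓ ≤ ℓV)
    {w : ι → ℝ → Vec}
    (hV : HasFam I S t N τ a b (fun _ _ => 1) (fun _ _ => 0) ℓV 1 V)
    (hw : HasFam I S t N τ a b (fun _ _ => 1) (fun _ _ => 0) ℓ 1 w)
    (hO : HasFam I S t N τ a b x X ℓ e O) (hf : f ≤ 2 + e) :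
    HasFam I S t N τ a b x X (ℓ + ρ) f
      (fun i t => WaterWaves.PhiOp r r' (V i t) (w i t) (O i t)) :=
  let ⟨_, hD, hO⟩ := hO
  let ⟨_, hD', hO'⟩ := hV
  let ⟨_, hD'', hO''⟩ := hw
  ⟨_, Fam.PhiJ W hI hτ hρ hx hX hr hr' hL hℓ hD' hD'' hD hf, fun i hi t ht => by
    beta_reduce; rw [hO i hi t ht, hO' i hi t ht, hO'' i hi t ht, PhiJ_zero]⟩

end HasFam

/-! ### The transformed vector field -/

/-- The linear operators `M(V; t)` with kernels `κ` that are quadratic in `V` and lose at most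
finitely many derivatives. -/
def IsKerMat (I : Set ℝ) (K K' : ℕ) (s₁ : ℝ) (M : OpMat) : Prop :=
  ∀ s₀ ≥ s₁, ∃ C ≥ (0 : ℝ), ∃ rs > 0,
    ∃ κ : (ℝ → Vec) → ℕ → ℝ → Bool → Bool → ℤ → ℤ → ℂ, ∀ V, InBall I K s₀ rs V →
      KJ I (K - K') C (κ V) ∧
      (∀ t ∈ I, ∀ u : Vec, (∀ σ, u σ 0 = 0) → act M V t u = kerOp (κ V 0 t) u) ∧
      ∀ j ≤ K - K', ∀ t ∈ I, KB (C * wlow 2 (wt I K' s₀ V t) j) (κ V j t)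

/-- The operators in the three systems: the generator `G`, the resonant part `Rr` of `R₁`,
`A = A₁ + A₂` and `B = B₁ + B₂` in the first system, `F = F₁ + F₂` in the change of variable,
`R₁`, `R₂` and `H` in the reduced system. -/
structure NFData where
  G : HomMat
  R₁ : HomMat
  Rr : HomMat
  A₁ : HomMat
  B₁ : HomMat
  F₁ : HomMat
  A₂ : OpMat
  B₂ : OpMat
  F₂ : OpMat
  R₂ : OpMat
  H : OpMat

namespace NFData

variable (S : NFData)

/-- `exp(G(V)) - 1`. -/
def expSub (V v : Vec) : Vec := serOp (expTail 1 1) S.G V v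

/-- `exp(-G(V)) - 1`. -/
def expNegSub (V v : Vec) : Vec := serOp (expTail 1 (-1)) S.G V v

/-- `F(V)V`. -/
def change (V : ℝ → Vec) (t : ℝ) : Vec := bil S.F₁ (V t) (V t) + act S.F₂ V t (V t)

/-- The quadratic part of the vector field of the first system. -/
def field (V : ℝ → Vec) (t : ℝ) : Vec :=
  Complex.I • (bil S.A₁ (V t) (V t) + act S.A₂ V t (V t)) +
    Complex.I • (bil S.B₁ (V t) (V t) + act S.B₂ V t (V t))

/-- The difference between `exp(G(V))(V + F(V)V)` and `V`. -/
def shift (V : ℝ → Vec) (t : ℝ) : Vec :=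
  S.expSub (V t) (V t) + S.change V t + S.expSub (V t) (S.change V t)

/-- `exp(-G(V))y`. -/
def pull (V : ℝ → Vec) (t : ℝ) (y : Vec) : Vec := y + S.expNegSub (V t) y

/-- The vector field of the reduced system without `iΩ(D)E`. -/
def reduced (V : ℝ → Vec) (t : ℝ) (z : Vec) : Vec :=
  bil S.R₁ (V t) z + Complex.I • act S.H V t z + act S.R₂ V t z

/-- The cubic smoothing remainder. -/
def rem (V : ℝ → Vec) (t : ℝ) (y : Vec) : Vec :=
  bil S.Rr (V t) (S.expNegSub (V t) y) - bil S.Rr (S.shift V t) y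
    + bil S.G (S.field V t) (S.pull V t y)
    + PhiOp S.G (S.Rr - S.R₁) (V t) (S.field V t) (S.pull V t y)
    + act S.R₂ V t (S.pull V t y)
    + S.expSub (V t) (S.reduced V t (S.pull V t y))
    - Complex.I • act S.H V t (S.expSub (V t) (S.pull V t y))

/-- One `μ` serves all homogeneous operators. The bound on `s₀` keeps every level met below, after
the losses in space and `3/2` per time derivative, admissible for the bilinear estimates. The number
`10` in `ρ_ge` covers the fixed losses `5/2` of paradifferential operators and those of one
derivative in each change of norm. -/
structure Hyp (I : Set ℝ) (K K' : ℕ) (m ρ μ r s₁ s₀ : ℝ) : Prop where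
  symm : IsSymmInterval I
  one_le : 1 ≤ K'
  le : K' ≤ K
  m_nonneg : 0 ≤ m
  ρ_ge : m + 10 ≤ ρ
  μ_nonneg : 0 ≤ μ
  r_pos : 0 < r
  s₀_ge : |s₁| + ρ + μ + m + 2 * K + 30 ≤ s₀
  G : ∃ C, CoefBd ρ μ C S.G
  R₁ : ∃ C, CoefBd ρ μ C S.R₁
  Rr : ∃ C, CoefBd ρ μ C S.Rr
  A₁ : ∃ C, CoefBd (-(3 / 2)) μ C S.A₁
  B₁ : ∃ C, CoefBd ρ μ C S.B₁
  F₁ : ∃ C, CoefBd (-m) μ C S.F₁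
  A₂ : IsKerMat I K K' s₁ S.A₂
  B₂ : IsNonhomMat I ρ K 1 2 r s₁ S.B₂
  F₂ : IsNonhomMat I (-m) K K' 2 r s₁ S.F₂
  R₂ : IsNonhomMat I ρ K K' 2 r s₁ S.R₂
  H : IsKerMat I K K' s₁ S.H

variable {S} {I : Set ℝ} {K K' : ℕ} {m ρ μ r s₁ s₀ s : ℝ}

-- Each summand of `rem` contains an operator gaining about `ρ` and at most one block of losses:
-- `5/2` from `field`, `reduced` or `H`, or `m + 1` from `shift`. All of them thus end above `s₀ + ρ
-- - (m + 10) + 1`, the final `+ 1` being reserved for the return to Sobolev norms. The index of the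
-- family contains both curves and the time, which makes the constants uniform in them.
set_option maxHeartbeats 1600000 in
lemma Hyp.exists_fam (h : S.Hyp I K K' m ρ μ r s₁ s₀) (hs : s₀ ≤ s) :
    ∃ rs > 0, rs ≤ 1 ∧
      HasFam (ι := (ℝ → Vec) × (ℝ → Vec) × ℝ) I
        {i | InBall I K s₀ rs i.1 ∧ CStar2 I K s i.1 ∧ CStar2 I K s i.2.1 ∧ i.2.2 ∈ I}
        (fun i => i.2.2) (K - K') (s - s₀)
        (fun i => wt I K' s₀ i.1 i.2.2) (fun i => wt I K' s i.1 i.2.2)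
        (fun i j => normK2 I j s₀ i.2.1 i.2.2) (fun i j => normK2 I j s i.2.1 i.2.2)
        (s₀ + (ρ - (m + 10)) + 1) 2 (fun i t => S.rem i.1 t (i.2.1 t)) := by
  have hO := h.symm.1
  have hI := h.symm.uniqueDiffOn
  have hs₀ := h.s₀_ge
  have hρ := h.ρ_ge
  have hm := h.m_nonneg
  have hμ := h.μ_nonneg
  have hK1 := h.one_le
  have hKK := h.le
  have habs := le_abs_self s₁
  have habs' := neg_abs_le s₁
  have hK0 : (0 : ℝ) ≤ K := Nat.cast_nonneg K
  have hN : ((K - K' : ℕ) : ℝ) ≤ K := by exact_mod_cast Nat.sub_le K K'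
  obtain ⟨cG, hG⟩ := h.G
  obtain ⟨cR₁, hR₁⟩ := h.R₁
  obtain ⟨cRr, hRr⟩ := h.Rr
  obtain ⟨cA₁, hA₁⟩ := h.A₁
  obtain ⟨cB₁, hB₁⟩ := h.B₁
  obtain ⟨cF₁, hF₁⟩ := h.F₁
  obtain ⟨C1, hC1, r1, hr1, κA, HA⟩ := h.A₂ s₀ (by linarith)
  obtain ⟨C2, hC2, r2, hr2, κH, HH⟩ := h.H s₀ (by linarith)
  obtain ⟨r3, hr3, -, cB, pB⟩ := exists_nonhom_upair hI h.B₂ hK1 hKK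
    (s₀ := s₀) (s := s) (by linarith) hs
  obtain ⟨r4, hr4, -, cF, pF⟩ := exists_nonhom_upair hI h.F₂ le_rfl hKK
    (s₀ := s₀) (s := s) (by linarith) hs
  obtain ⟨r5, hr5, -, cR, pR⟩ := exists_nonhom_upair hI h.R₂ le_rfl hKK
    (s₀ := s₀) (s := s) (by linarith) hs
  obtain ⟨rs, hrs, hle⟩ := exists_pos_le (f := ![r1, r2, r3, r4, r5, 1]) (by
    intro i; fin_cases i <;> simp <;> assumption)
  have l1 : rs ≤ r1 := hle 0
  have l2 : rs ≤ r2 := hle 1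
  have l3 : rs ≤ r3 := hle 2
  have l4 : rs ≤ r4 := hle 3
  have l5 : rs ≤ r5 := hle 4
  have l6 : rs ≤ 1 := hle 5
  refine ⟨rs, hrs, l6, ?_⟩
  set N := K - K' with hNdef
  set Dm : Set ((ℝ → Vec) × (ℝ → Vec) × ℝ) :=
    {i | InBall I K s₀ rs i.1 ∧ CStar2 I K s i.1 ∧ CStar2 I K s i.2.1 ∧ i.2.2 ∈ I}
  set tt : (ℝ → Vec) × (ℝ → Vec) × ℝ → ℝ := fun i => i.2.2
  set τ := s - s₀ with hτdef
  set a : (ℝ → Vec) × (ℝ → Vec) × ℝ → ℕ → ℝ := fun i => wt I K' s₀ i.1 i.2.2 with ha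
  set b : (ℝ → Vec) × (ℝ → Vec) × ℝ → ℕ → ℝ := fun i => wt I K' s i.1 i.2.2 with hb
  set x : (ℝ → Vec) × (ℝ → Vec) × ℝ → ℕ → ℝ := fun i j => normK2 I j s₀ i.2.1 i.2.2 with hxd
  set X : (ℝ → Vec) × (ℝ → Vec) × ℝ → ℕ → ℝ := fun i j => normK2 I j s i.2.1 i.2.2 with hXd
  have hτ : 0 ≤ τ := by linarith
  have W : ∀ i ∈ Dm, Weights N (a i) (b i) := fun i hi =>
    weights_wt hKK (hi.1.mono le_rfl l6) hi.2.1 hs hi.2.2.2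
  have hx : ∀ i ∈ Dm, MonoN N (x i) := fun i _ => monoN_normK2 I N s₀ i.2.1 i.2.2
  have hX : ∀ i ∈ Dm, MonoN N (X i) := fun i _ => monoN_normK2 I N s i.2.1 i.2.2
  have h1 : ∀ i ∈ Dm, MonoN N ((fun _ _ => 1 : (ℝ → Vec) × (ℝ → Vec) × ℝ → ℕ → ℝ) i) :=
    fun _ _ => monoN_one N
  have h0 : ∀ i ∈ Dm, MonoN N ((fun _ _ => 0 : (ℝ → Vec) × (ℝ → Vec) × ℝ → ℕ → ℝ) i) :=
    fun _ _ => monoN_zero N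
  have lev : ∀ {ρ' μ' ℓ : ℝ}, 2 + ρ' + μ' + 3 / 2 * K ≤ ℓ → -ρ' + 3 / 2 * K ≤ ℓ →
      Lv ρ' μ' (ℓ - 3 / 2 * (N : ℝ)) := fun h h' => ⟨by linarith, by linarith⟩
  -- the basic curves
  have fV : Fam I Dm tt N τ a b s₀ 1 (fun _ _ => 1) (fun _ _ => 0) (fun i k t => dt2 I k i.1 t) :=
    ⟨fun i hi => ((hi.2.1.cj hI).of_le (Nat.sub_le _ _)).weaken (by linarith),
      UPair.of_weight (fun i hi => (jb_wt hKK hi.1.1 hi.2.1 hi.2.2.2).1) fun i hi => by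
        rw [hτdef, add_sub_cancel]
        exact (jb_wt hKK hi.1.1 hi.2.1 hi.2.2.2).2⟩
  have V0 : ∀ i ∈ Dm, ∀ t ∈ I, (i.1 t) = dt2 I 0 i.1 t := fun i _ t _ => (dt2_zero I i.1 t).symm
  have V1 : HasFam I Dm tt N τ a b (fun _ _ => 1) (fun _ _ => 0) s₀ 1 (fun i t => i.1 t) :=
    ⟨_, fV, V0⟩
  have fy : Fam I Dm tt N τ a b s₀ 0 x X (fun i k t => dt2 I k i.2.1 t) :=
    ⟨fun i hi => ((hi.2.2.1.cj hI).of_le (Nat.sub_le _ _)).weaken (by linarith),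
      UPair.of_jb W (fun i hi k hk => (hi.2.2.1.mono le_rfl hs).jb hi.2.2.2 k
        (hk.trans (Nat.sub_le _ _))) fun i hi => by
        rw [hτdef, add_sub_cancel]
        exact fun k hk => hi.2.2.1.jb hi.2.2.2 k (hk.trans (Nat.sub_le _ _))⟩
  have Y0 : HasFam I Dm tt N τ a b x X s₀ 0 (fun i t => i.2.1 t) :=
    ⟨_, fy, fun i _ t _ => (dt2_zero I i.2.1 t).symm⟩
  have e1 : ∀ j, ‖expTail 1 1 j‖ ≤ 1 / (j.factorial : ℝ) := norm_expTail_le 1 (by simp)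
  have e2 : ∀ j, ‖expTail 1 (-1) j‖ ≤ 1 / (j.factorial : ℝ) := norm_expTail_le 1 (by simp)
  have e0 : ∀ θ, ∀ j < 1, expTail 1 θ j = 0 := fun θ j hj => by simp [expTail, hj]
  -- `exp(-G) y`
  have E1 : HasFam I Dm tt N τ a b x X (s₀ + ρ) 1 (fun i t => S.expNegSub (i.1 t) (i.2.1 t)) :=
    HasFam.serOp W hO hτ (by linarith) hx hX hG (lev (by linarith) (by linarith)) le_rfl V1 Y0
      (c := fun _ => expTail 1 (-1)) (fun _ _ => e2) le_rfl (by norm_num) (fun _ _ => e0 _) le_rfl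
  have fz : Fam I Dm tt N τ a b s₀ 0 x X (fun i k t => dt2 I k i.2.1 t +
      serJ (expTail 1 (-1)) S.G (fun j => dt2 I j i.1 t) (fun j => dt2 I j i.2.1 t) k) :=
    fy.add ((Fam.serJ W hO hτ (by linarith) hx hX hG (lev (by linarith) (by linarith)) le_rfl fV fy
      (c := fun _ => expTail 1 (-1)) (fun _ _ => e2) le_rfl (by norm_num) (fun _ _ => e0 _)
      (f := 0) (Nat.zero_le _)).mono W hx hX (by linarith) le_rfl)
  have z0 : ∀ i ∈ Dm, ∀ t ∈ I, S.pull i.1 t (i.2.1 t) = dt2 I 0 i.2.1 t +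
      serJ (expTail 1 (-1)) S.G (fun j => dt2 I j i.1 t) (fun j => dt2 I j i.2.1 t) 0 := by
    intro i _ t _
    rw [serJ_zero, dt2_zero, dt2_zero]
    rfl
  -- `R₂` acts on curves with all `K` time derivatives, whereas the family estimates concern only `K
  -- - K'` of them; hence a longer jet of `z`.
  have zc : ∀ i ∈ Dm, CJ I K s (fun k t => dt2 I k i.2.1 t +
      serJ (expTail 1 (-1)) S.G (fun j => dt2 I j i.1 t) (fun j => dt2 I j i.2.1 t) k) := by
    intro i hi
    exact (hi.2.2.1.cj hI).add ((CJ.serJ hO (by linarith) hG ⟨by linarith, by linarith⟩ le_rfl e2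
      (e0 _ 0 (by norm_num)) (hi.2.1.cj hI) (hi.2.2.1.cj hI)).weaken (by linarith))
  have Z0 : HasFam I Dm tt N τ a b x X s₀ 0 (fun i t => S.pull i.1 t (i.2.1 t)) := ⟨_, fz, z0⟩
  -- the vector field of the first system
  have matB : HasFam I Dm tt N τ a b (fun _ _ => 1) (fun _ _ => 0) (s₀ - 1 + ρ) 3
      (fun i t => act S.B₂ i.1 t (i.1 t)) :=
    ⟨fun i => matJ I S.B₂ i.1 i.1, ⟨fun i hi => (cB i.1 (hi.1.mono le_rfl l3) hi.2.1 i.1 _ (V0 i hi)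
      (hi.2.1.cj hI)).weaken (by linarith), pB (fun i hi => ⟨hi.1.mono le_rfl l3, hi.2.1, hi.2.2.2,
        V0 i hi, hi.2.1.cj hI⟩) h1 h0 fV.pair⟩, fun i _ t _ => (matJ_zero _ _ _ _ _).symm⟩
  have matF : HasFam I Dm tt N τ a b (fun _ _ => 1) (fun _ _ => 0) (s₀ - 1 + -m) 3
      (fun i t => act S.F₂ i.1 t (i.1 t)) :=
    ⟨fun i => matJ I S.F₂ i.1 i.1, ⟨fun i hi => (cF i.1 (hi.1.mono le_rfl l4) hi.2.1 i.1 _ (V0 i hi)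
      (hi.2.1.cj hI)).weaken (by linarith), pF (fun i hi => ⟨hi.1.mono le_rfl l4, hi.2.1, hi.2.2.2,
        V0 i hi, hi.2.1.cj hI⟩) h1 h0 fV.pair⟩, fun i _ t _ => (matJ_zero _ _ _ _ _).symm⟩
  have matR : HasFam I Dm tt N τ a b x X (s₀ - 1 + ρ) 2
      (fun i t => act S.R₂ i.1 t (S.pull i.1 t (i.2.1 t))) :=
    ⟨fun i => matJ I S.R₂ i.1 (fun t => S.pull i.1 t (i.2.1 t)), ⟨fun i hi =>
      (cR i.1 (hi.1.mono le_rfl l5) hi.2.1 _ _ (z0 i hi) (zc i hi)).weaken (by linarith),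
      pR (fun i hi => ⟨hi.1.mono le_rfl l5, hi.2.1, hi.2.2.2, z0 i hi, zc i hi⟩) hx hX fz.pair⟩,
      fun i _ t _ =>
        (matJ_zero I S.R₂ i.1 (fun t => S.pull i.1 t (i.2.1 t)) t).symm⟩
  -- A paradifferential operator is represented by its kernel only on vectors without zero mode.
  have zm : ∀ {x X : (ℝ → Vec) × (ℝ → Vec) × ℝ → ℕ → ℝ} {ℓ : ℝ} {d : ℕ} {O}, 
      HasFam I Dm tt N τ a b x X ℓ d O → ∀ i ∈ Dm, ∀ t ∈ I, ∀ σ, O i t σ 0 = 0 := by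
    rintro x X ℓ d O ⟨D, hD, hO⟩ i hi t ht σ
    obtain ⟨ε, hε, B, H⟩ := (hD.cj i hi).loc t ht
    rw [hO i hi t ht]
    exact (H t ht (by simpa using hε) 0 (Nat.zero_le _)).1 σ
  have kerH : ∀ {ℓ : ℝ} {e f : ℕ} {O}, HasFam I Dm tt N τ a b x X ℓ e O → f ≤ 2 + e →
      HasFam I Dm tt N τ a b x X (ℓ - 5 / 2) f (fun i t => act S.H i.1 t (O i t)) := by
    intro ℓ e f O hO hf
    obtain ⟨D, hD, hDO⟩ := HasFam.kerOp (κ := fun i => κH i.1) W hx hX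
      (fun i hi => (HH i.1 (hi.1.mono le_rfl l2)).1) hC2
      (fun i hi j hj => (HH i.1 (hi.1.mono le_rfl l2)).2.2 j hj _ hi.2.2.2) hO hf
    exact ⟨D, hD, fun i hi t ht =>
      ((HH i.1 (hi.1.mono le_rfl l2)).2.1 t ht _ (zm hO i hi t ht)).trans (hDO i hi t ht)⟩
  have kerA : HasFam I Dm tt N τ a b (fun _ _ => 1) (fun _ _ => 0) (s₀ - 5 / 2) 3
      (fun i t => act S.A₂ i.1 t (i.1 t)) := by
    obtain ⟨D, hD, hDO⟩ := HasFam.kerOp (κ := fun i => κA i.1) W h1 h0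
      (fun i hi => (HA i.1 (hi.1.mono le_rfl l1)).1) hC1
      (fun i hi j hj => (HA i.1 (hi.1.mono le_rfl l1)).2.2 j hj _ hi.2.2.2) V1 le_rfl
    exact ⟨D, hD, fun i hi t ht =>
      ((HA i.1 (hi.1.mono le_rfl l1)).2.1 t ht _ (zm V1 i hi t ht)).trans (hDO i hi t ht)⟩
  have bA : HasFam I Dm tt N τ a b (fun _ _ => 1) (fun _ _ => 0) (s₀ + -(3 / 2)) 2
      (fun i t => bil S.A₁ (i.1 t) (i.1 t)) :=
    HasFam.bil W hO hτ h1 h0 hA₁ (lev (by linarith) (by linarith)) le_rfl V1 V1 le_rfl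
  have bB : HasFam I Dm tt N τ a b (fun _ _ => 1) (fun _ _ => 0) (s₀ + ρ) 2
      (fun i t => bil S.B₁ (i.1 t) (i.1 t)) :=
    HasFam.bil W hO hτ h1 h0 hB₁ (lev (by linarith) (by linarith)) le_rfl V1 V1 le_rfl
  have bF : HasFam I Dm tt N τ a b (fun _ _ => 1) (fun _ _ => 0) (s₀ + -m) 2
      (fun i t => bil S.F₁ (i.1 t) (i.1 t)) :=
    HasFam.bil W hO hτ h1 h0 hF₁ (lev (by linarith) (by linarith)) le_rfl V1 V1 le_rfl
  have field2 : HasFam I Dm tt N τ a b (fun _ _ => 1) (fun _ _ => 0) (s₀ - 5 / 2) 2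
      (fun i t => S.field i.1 t) :=
    (((bA.mono W h1 h0 (by linarith) le_rfl).add (kerA.mono W h1 h0 le_rfl (by norm_num))).smul
      Complex.I).add (((bB.mono W h1 h0 (by linarith) le_rfl).add
        (matB.mono W h1 h0 (by linarith) (by norm_num))).smul Complex.I)
  have change2 : HasFam I Dm tt N τ a b (fun _ _ => 1) (fun _ _ => 0) (s₀ - m - 1) 2
      (fun i t => S.change i.1 t) :=
    (bF.mono W h1 h0 (by linarith) le_rfl).add (matF.mono W h1 h0 (by linarith) (by norm_num))
  have expS : ∀ {x X : (ℝ → Vec) × (ℝ → Vec) × ℝ → ℕ → ℝ} {ℓ : ℝ} {e f : ℕ} {O},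
      (∀ i ∈ Dm, MonoN N (x i)) → (∀ i ∈ Dm, MonoN N (X i)) →
      ρ + μ + 2 + 3 / 2 * K ≤ ℓ → ℓ ≤ s₀ →
      HasFam I Dm tt N τ a b x X ℓ e O → f ≤ 1 + e →
      HasFam I Dm tt N τ a b x X (ℓ + ρ) f (fun i t => S.expSub (i.1 t) (O i t)) := by
    intro x X ℓ e f O hx hX hl hl' h hf
    exact HasFam.serOp W hO hτ (by linarith) hx hX hG (lev (by linarith) (by linarith)) hl' V1 h
      (c := fun _ => expTail 1 1) (fun _ _ => e1) le_rfl (by norm_num) (fun _ _ => e0 _) hf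
  have shift2 : HasFam I Dm tt N τ a b (fun _ _ => 1) (fun _ _ => 0) (s₀ - m - 1) 2
      (fun i t => S.shift i.1 t) :=
    (((expS h1 h0 (by linarith) le_rfl V1 le_rfl).mono W h1 h0 (by linarith) le_rfl).add
      change2).add ((expS h1 h0 (by linarith) (by linarith) change2 (f := 2) (by norm_num)).mono
        W h1 h0 (by linarith) le_rfl)
  have reduced1 : HasFam I Dm tt N τ a b x X (s₀ - 5 / 2) 1
      (fun i t => S.reduced i.1 t (S.pull i.1 t (i.2.1 t))) :=
    (((HasFam.bil W hO hτ hx hX hR₁ (lev (by linarith) (by linarith)) le_rfl V1 Z0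
      (f := 1) le_rfl).mono W hx hX (by linarith) le_rfl).add
      ((kerH Z0 (f := 1) (by norm_num)).smul Complex.I)).add
      (matR.mono W hx hX (by linarith) (by norm_num))
  -- Degree two arises as `1 + 1` in `T1` and `T6`, where a factor `exp(±G) - 1` meets an operator
  -- linear in `V`. In `T2`, `T3`, `T4` it comes from `shift`, `field` and the commutator series,
  -- and in the remaining terms from `R₂` and `H`.
  have T1 := HasFam.bil W hO hτ hx hX hRr (lev (by linarith) (by linarith)) le_rfl V1
    (E1.mono W hx hX (ℓ' := s₀) (by linarith) le_rfl) (f := 2) le_rfl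
  have T2 := HasFam.bil W hO hτ hx hX hRr (lev (by linarith) (by linarith)) le_rfl shift2
    (Y0.mono W hx hX (ℓ' := s₀ - m - 1) (by linarith) le_rfl) (f := 2) le_rfl
  have Z0' := Z0.mono W hx hX (ℓ' := s₀ - 5 / 2) (by linarith) le_rfl
  have T3 := HasFam.bil W hO hτ hx hX hG (lev (by linarith) (by linarith)) le_rfl field2 Z0'
    (f := 2) le_rfl
  have T4 := HasFam.PhiOp W hO hτ (by linarith) hx hX hG (hRr.sub hR₁)
    (lev (by linarith) (by linarith)) (by linarith) V1 (field2.mono W h1 h0 le_rfl (by norm_num)) Z0'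
    (f := 2) le_rfl
  have T6 := expS hx hX (by linarith) (by linarith) reduced1 (f := 2) le_rfl
  have T7 := (kerH (expS hx hX (by linarith) le_rfl Z0 (f := 0) (Nat.zero_le _)) (f := 2)
    le_rfl).smul Complex.I
  have hl : ∀ {ℓ O}, HasFam I Dm tt N τ a b x X ℓ 2 O → s₀ + (ρ - (m + 10)) + 1 ≤ ℓ →
      HasFam I Dm tt N τ a b x X (s₀ + (ρ - (m + 10)) + 1) 2 O := fun h h' =>
    h.mono W hx hX h' le_rfl
  exact ((((((hl T1 (by linarith)).sub (hl T2 (by linarith))).add (hl T3 (by linarith))).add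
    (hl T4 (by linarith))).add (hl matR (by linarith))).add (hl T6 (by linarith))).sub
    (hl T7 (by linarith))

end NFData

/-! ### Linear maps between spaces of weighted sequences -/

/-- `v` is bounded at the level `p`. -/
def HB (p : ℝ) (v : Vec) : Prop := ∃ B, Bd p v B

namespace HB

variable {p q : ℝ} {u v U : Vec}

lemma zero_mode (h : HB p u) (σ : Bool) : u σ 0 = 0 := h.choose_spec.1 σ

lemma add (h : HB p u) (h' : HB p v) : HB p (u + v) :=
  let ⟨_, h⟩ := h
  let ⟨_, h'⟩ := h'
  ⟨_, h.add h'⟩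

lemma smul (c : ℂ) (h : HB p u) : HB p (c • u) :=
  let ⟨_, h⟩ := h
  ⟨_, h.smul c⟩

lemma weaken (h : HB p u) (hq : q ≤ p) : HB q u :=
  let ⟨B, h⟩ := h
  ⟨B, h.weaken hq⟩

lemma memH2 (h : HB p u) (hq : q + 1 ≤ p) : MemH2 q u :=
  let ⟨_, h⟩ := h
  (h.weaken hq).memH2

lemma bil {r : HomMat} {ρ μ C e : ℝ} (hU : HB p U) (hv : HB q v) (hr : CoefBd ρ μ C r)
    (hp : Lv ρ μ p) (hq : Lv ρ μ q) (he : 0 ≤ e) (hep : e - ρ ≤ p) (heq : e - ρ ≤ q) :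
    HB e (bil r U v) :=
  let ⟨_, hU⟩ := hU
  let ⟨_, hv⟩ := hv
  ⟨_, bil_bd (τ := 0) hr hp hq he (by linarith) (by linarith) hU (by simpa using hU) hv
    (by simpa using hv)⟩

lemma serOp {r : HomMat} {ρ μ C : ℝ} {c : ℕ → ℂ} (hU : HB p U) (hv : HB q v)
    (hr : CoefBd ρ μ C r) (hρ : 0 ≤ ρ) (hq : Lv ρ μ q) (hpq : q ≤ p)
    (hc : ∀ i, ‖c i‖ ≤ 1 / (i.factorial : ℝ)) (hc0 : c 0 = 0) : HB (q + ρ) (serOp c r U v) := by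
  obtain ⟨α, hU⟩ := hU
  obtain ⟨x, hv⟩ := hv
  obtain ⟨D, -, H⟩ := exists_bd_serOp hr hρ hq hpq α
  exact ⟨_, H U hU c hc hc0 v x hv⟩

end HB

/-- Linearity on the vectors that are bounded at the level `p`. -/
def IsLin (p : ℝ) (T : Vec → Vec) : Prop :=
  ∀ (c : ℂ) u v, HB p u → HB p v → T (c • u + v) = c • T u + T v

namespace IsLin

variable {p q : ℝ} {T T' : Vec → Vec}

lemma add (h : IsLin p T) (h' : IsLin p T') : IsLin p (fun u => T u + T' u) :=
  fun c u v hu hv => by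
    beta_reduce; rw [h c u v hu hv, h' c u v hu hv, smul_add]; abel

lemma smul (z : ℂ) (h : IsLin p T) : IsLin p (fun u => z • T u) := fun c u v hu hv => by
  beta_reduce; rw [h c u v hu hv, smul_add, smul_comm z c]

lemma sub (h : IsLin p T) (h' : IsLin p T') : IsLin p (fun u => T u - T' u) :=
  fun c u v hu hv => by
    beta_reduce; rw [h c u v hu hv, h' c u v hu hv, smul_sub]; abel

lemma comp (h : IsLin q T) (h' : IsLin p T') (hm : ∀ u, HB p u → HB q (T' u)) :
    IsLin p (fun u => T (T' u)) := fun c u v hu hv => by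
  beta_reduce; rw [h' c u v hu hv, h c _ _ (hm u hu) (hm v hv)]

lemma mono (h : IsLin p T) (hpq : p ≤ q) : IsLin q T := fun c u v hu hv =>
  h c u v (hu.weaken hpq) (hv.weaken hpq)

lemma id : IsLin p (fun u => u) := fun _ _ _ _ _ => rfl

lemma bil {r : HomMat} {ρ μ C : ℝ} {U : Vec} (hU : HB p U) (hr : CoefBd ρ μ C r)
    (hp : Lv ρ μ p) (hq : Lv ρ μ q) : IsLin q (bil r U) := by
  rintro c u v ⟨x, hu⟩ ⟨y, hv⟩
  obtain ⟨α, hU⟩ := hU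
  rw [bil_add_right hr hp hq hU (hu.smul c) hv, bil_smul_right]

lemma serOp {r : HomMat} {ρ μ C : ℝ} {U : Vec} {c : ℕ → ℂ} (hU : HB p U) (hr : CoefBd ρ μ C r)
    (hρ : 0 ≤ ρ) (hq : Lv ρ μ q) (hq0 : 0 ≤ q) (hpq : q ≤ p)
    (hc : ∀ i, ‖c i‖ ≤ 1 / (i.factorial : ℝ)) : IsLin q (serOp c r U) := by
  rintro z u v ⟨x, hu⟩ ⟨y, hv⟩
  obtain ⟨α, hU⟩ := hU
  exact serOp_smul_add hr hρ hq hq0 hpq hU hu hv hc z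

lemma kerOp (κ : Bool → Bool → ℤ → ℤ → ℂ) : IsLin p (kerOp κ) := by
  intro c u v _ _
  funext σ n
  simp only [WaterWaves.kerOp, Pi.add_apply, Pi.smul_apply, smul_eq_mul]
  split_ifs
  · simp
  · rw [Finset.mul_sum, ← Finset.sum_add_distrib]
    refine Finset.sum_congr rfl fun σ' _ => ?_
    rw [Finset.mul_sum, ← Finset.sum_add_distrib]
    exact Finset.sum_congr rfl fun j _ => by ring

end IsLin

/-! ### The series of commutators -/

section comm

variable {r r' : HomMat} {U W v : Vec} {q Θ x : ℝ}

lemma bd_iterate_of_le (hG : ∀ w y, Bd q w y → Bd q (bil r U w) (Θ * y)) (hv : Bd q v x) (n : ℕ) :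
    Bd q ((bil r U)^[n] v) (Θ ^ n * x) := by
  induction n with
  | zero => simpa using hv
  | succ n ih =>
    rw [Function.iterate_succ_apply', pow_succ', mul_assoc]
    exact hG _ _ ih

lemma bd_commOp (hΘ : 1 ≤ Θ) (hG : ∀ w y, Bd q w y → Bd q (bil r U w) (Θ * y))
    (hQ : ∀ w y, Bd q w y → Bd q (bil r' U w + bil r W w) (Θ * y)) (hv : Bd q v x) (n : ℕ) :
    Bd q (commOp r r' U W n v) ((2 * Θ) ^ (n + 1) * x) := by
  have hx := hv.nonneg
  induction n with
  | zero =>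
    refine (hQ v x hv).mono ?_
    rw [zero_add, pow_one]
    nlinarith [mul_nonneg (zero_le_one.trans hΘ) hx]
  | succ n ih =>
    refine ((hG _ _ ih).add (hQ _ _ (bd_iterate_of_le hG hv (n + 1)))).mono ?_
    have h0 : 0 ≤ Θ := zero_le_one.trans hΘ
    have h1 : Θ ^ (n + 1) ≤ (2 * Θ) ^ (n + 1) := pow_le_pow_left₀ h0 (by linarith) _
    have h2 : Θ * (Θ ^ (n + 1) * x) ≤ Θ * ((2 * Θ) ^ (n + 1) * x) := by gcongr
    calc _ ≤ Θ * ((2 * Θ) ^ (n + 1) * x) + Θ * ((2 * Θ) ^ (n + 1) * x) := by linarith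
      _ = _ := by ring

lemma summable_PhiOp (Θ x : ℝ) :
    Summable fun i : ℕ => (2 * Θ) ^ (i + 2) * x / ((i + 2).factorial : ℝ) := by
  refine (((summable_nat_add_iff 2).2 (summable_exp (2 * Θ))).mul_right x).congr fun i => ?_
  ring

lemma bd_PhiOp_term (hΘ : 1 ≤ Θ) (hG : ∀ w y, Bd q w y → Bd q (bil r U w) (Θ * y))
    (hQ : ∀ w y, Bd q w y → Bd q (bil r' U w + bil r W w) (Θ * y)) (hv : Bd q v x) (i : ℕ) :
    Bd q ((1 / ((i + 2).factorial : ℂ)) • commOp r r' U W (i + 1) v)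
      ((2 * Θ) ^ (i + 2) * x / ((i + 2).factorial : ℝ)) := by
  refine ((bd_commOp hΘ hG hQ hv (i + 1)).smul _).mono (le_of_eq ?_)
  rw [norm_div, norm_one, Complex.norm_natCast]
  ring

lemma isLin_commOp (hΘ : 1 ≤ Θ) (hG : ∀ w y, Bd q w y → Bd q (bil r U w) (Θ * y))
    (hQ : ∀ w y, Bd q w y → Bd q (bil r' U w + bil r W w) (Θ * y)) (lG : IsLin q (bil r U))
    (lR : IsLin q (bil r' U)) (lW : IsLin q (bil r W)) (n : ℕ) :
    IsLin q (commOp r r' U W n) := by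
  have lQ : IsLin q (fun w => bil r' U w + bil r W w) := lR.add lW
  have it : ∀ n, IsLin q ((bil r U)^[n]) := by
    intro n
    induction n with
    | zero => exact IsLin.id
    | succ n ih =>
      simp only [Function.iterate_succ']
      exact lG.comp ih fun w ⟨y, hw⟩ => ⟨_, bd_iterate_of_le hG hw n⟩
  induction n with
  | zero => exact lQ
  | succ n ih =>
    exact (lG.comp ih fun w ⟨y, hw⟩ => ⟨_, bd_commOp hΘ hG hQ hw n⟩).add
      (lQ.comp (it (n + 1)) fun w ⟨y, hw⟩ => ⟨_, bd_iterate_of_le hG hw (n + 1)⟩)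

lemma isLin_PhiOp (hΘ : 1 ≤ Θ) (hG : ∀ w y, Bd q w y → Bd q (bil r U w) (Θ * y))
    (hQ : ∀ w y, Bd q w y → Bd q (bil r' U w + bil r W w) (Θ * y)) (lG : IsLin q (bil r U))
    (lR : IsLin q (bil r' U)) (lW : IsLin q (bil r W)) : IsLin q (PhiOp r r' U W) := by
  rintro c u v ⟨x, hu⟩ ⟨y, hv⟩
  funext σ n
  have s1 := Bd.summable (summable_PhiOp Θ x) (bd_PhiOp_term hΘ hG hQ hu) σ n
  have s2 := Bd.summable (summable_PhiOp Θ y) (bd_PhiOp_term hΘ hG hQ hv) σ n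
  simp only [PhiOp, Pi.add_apply, Pi.smul_apply, smul_eq_mul] at s1 s2 ⊢
  rw [← tsum_mul_left, ← (s1.mul_left c).tsum_add s2]
  refine tsum_congr fun i => ?_
  rw [isLin_commOp hΘ hG hQ lG lR lW (i + 1) c u v ⟨x, hu⟩ ⟨y, hv⟩]
  simp only [Pi.add_apply, Pi.smul_apply, smul_eq_mul]
  ring

end comm

/-! ### Reality -/

lemma Cc_sub (u v : Vec) : Cc (u - v) = Cc u - Cc v := by
  funext σ n; simp [Cc_apply]

lemma iterate_bil_zero_mode {r : HomMat} {U v : Vec} (hv : ∀ σ, v σ 0 = 0) (n : ℕ) (σ : Bool) :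
    ((bil r U)^[n] v) σ 0 = 0 := by
  cases n with
  | zero => exact hv σ
  | succ n => rw [Function.iterate_succ_apply']; exact bil_zero_mode _ _ _ _

lemma commOp_zero_mode (r r' : HomMat) (U W v : Vec) (n : ℕ) (σ : Bool) :
    commOp r r' U W n v σ 0 = 0 := by
  cases n <;> simp [commOp, bil_zero_mode]

lemma PhiOp_Cc {r r' : HomMat} (hr : RealCoef r) (hr' : RealCoef r') {U W v : Vec}
    (hU : ∀ σ, U σ 0 = 0) (hW : ∀ σ, W σ 0 = 0) (hv : ∀ σ, v σ 0 = 0) :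
    PhiOp r r' (Cc U) (Cc W) (Cc v) = Cc (PhiOp r r' U W v) := by
  have it : ∀ n, (bil r (Cc U))^[n] (Cc v) = Cc ((bil r U)^[n] v) := by
    intro n
    induction n with
    | zero => rfl
    | succ n ih =>
      rw [Function.iterate_succ_apply', Function.iterate_succ_apply', ih,
        hr.bil_Cc hU (iterate_bil_zero_mode hv n)]
  have hc : ∀ n, commOp r r' (Cc U) (Cc W) n (Cc v) = Cc (commOp r r' U W n v) := by
    intro n
    induction n with
    | zero => rw [commOp, commOp, hr'.bil_Cc hU hv, hr.bil_Cc hW hv, Cc_add]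
    | succ n ih =>
      rw [commOp, commOp, ih, it, hr.bil_Cc hU (commOp_zero_mode _ _ _ _ _ _),
        hr'.bil_Cc hU (iterate_bil_zero_mode hv _), hr.bil_Cc hW (iterate_bil_zero_mode hv _),
        Cc_add, Cc_add]
  funext σ n
  simp only [PhiOp, hc, Cc_apply, Complex.conj_tsum, Pi.smul_apply, smul_eq_mul, map_mul, map_div₀,
    map_one, map_natCast]

/-! ### Pointwise estimates for non-homogeneous operators -/

lemma cj_const (I : Set ℝ) (N : ℕ) {ℓ B : ℝ} {w : Vec} (hw : Bd ℓ w B) :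
    CJ I N ℓ (fun k _ => if k = 0 then w else 0) where
  cont _ _ _ _ _ _ := continuousWithinAt_const
  der k _ t _ σ n := by simpa using hasDerivWithinAt_const t I ((if k = 0 then w else 0 : Vec) σ n)
  loc _ _ := ⟨1, one_pos, B, fun _ _ _ k _ => by
    by_cases h : k = 0
    · simpa [h] using hw
    · simpa [h] using Bd.zero.mono hw.nonneg⟩

/-- The class is formulated for curves; a pointwise bound follows by freezing the argument, that is,
by applying it to the constant curve `w`. -/
lemma IsNonhomMat.exists_bd {I : Set ℝ} (hI : UniqueDiffOn ℝ I) {γ r s₀ s₁ : ℝ} {K K' : ℕ}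
    {M : OpMat} (hK : K' ≤ K) (hM : IsNonhomMat I γ K K' 2 r s₁ M) (hs₀ : s₁ + 1 ≤ s₀) :
    ∃ C ≥ (0 : ℝ), ∃ rs > 0, ∀ V, InBall I K s₀ rs V → ∀ t ∈ I, ∀ w x, Bd s₀ w x →
      Bd (s₀ - 1 + γ) (act M V t w) (C * x) := by
  obtain ⟨C, hC, rs, hrs, -, H⟩ := hM.tame hI (s := s₀ - 1) (by linarith)
  have hE := embConst_nonneg
  refine ⟨C * (2 * embConst), by positivity, min rs 1, lt_min hrs one_pos, fun V hV t ht w x hw => ?_⟩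
  have hwx := hw.nonneg
  have hc : CStar2 I K (s₀ - 1) (fun _ => w) := 
    ((cj_const I K hw).weaken (by linarith)).cstar2 hI fun _ _ => by simp
  have hV1 := hV.mono (s' := s₁) (r' := rs) (by linarith) (min_le_left _ _)
  have h := (H V hV1 (hV.1.mono le_rfl (by linarith)) _ hc).2 t ht 0 (Nat.zero_le _)
  beta_reduce at h
  rw [matJ_zero] at h
  refine (h.weaken (by simp)).mono ?_
  have e1 : ∀ σ, normK2 I 0 σ (fun _ => w) t = normH2 σ w := fun σ => by
    simp [normK2, dt2_zero]
  have e2 : normH2 (s₀ - 1) w ≤ embConst * x := 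
    (hw.weaken (show s₀ - 1 + 1 ≤ s₀ by linarith)).normH2_le
  have e3 : normH2 s₁ w ≤ embConst * x := (hw.weaken hs₀).normH2_le
  have e4 : normK2 I (0 + K') s₁ V t ≤ 1 :=
    (hV.1.normK2_mono (show 0 + K' ≤ K by omega) (by linarith) ht).trans
      ((normK2_mono_left I s₀ V t (by omega)).trans ((hV.lt ht).le.trans (min_le_right _ _)))
  have e5 : normK2 I (0 + K') (s₀ - 1) V t ≤ 1 :=
    (hV.1.normK2_mono (show 0 + K' ≤ K by omega) (by linarith) ht).trans
      ((normK2_mono_left I s₀ V t (by omega)).trans ((hV.lt ht).le.trans (min_le_right _ _)))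
  have n4 := normK2_nonneg I (0 + K') s₁ V t
  have n5 := normK2_nonneg I (0 + K') (s₀ - 1) V t
  have n2 := normH2_nonneg (s₀ - 1) w
  have n3 := normH2_nonneg s₁ w
  simp only [Pi.smul_apply, Pi.add_apply, smul_eq_mul, conv, Finset.Nat.antidiagonal_zero,
    Finset.sum_singleton, wlow, whigh, e1]
  rw [mul_assoc C]
  refine mul_le_mul_of_nonneg_left ?_ hC
  have h1 : normK2 I (0 + K') s₁ V t ^ 2 * normH2 (s₀ - 1) w ≤ 1 * (embConst * x) := by
    gcongr
    exact pow_le_one₀ n4 e4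
  have h2 : normK2 I (0 + K') s₁ V t ^ (2 - 1) * normK2 I (0 + K') (s₀ - 1) V t * normH2 s₁ w
      ≤ 1 * (embConst * x) := by
    gcongr
    simpa using mul_le_one₀ e4 n5 e5
  linarith

lemma IsKerMat.exists_bd {I : Set ℝ} {s₁ s₀ : ℝ} {K K' : ℕ} {M : OpMat}
    (hM : IsKerMat I K K' s₁ M) (hs₀ : s₁ ≤ s₀) :
    ∃ C ≥ (0 : ℝ), ∃ rs > 0, ∀ V, InBall I K s₀ rs V → ∀ t ∈ I,
      (∀ w x, Bd s₀ w x → Bd (s₀ - 5 / 2) (act M V t w) (C * x)) ∧ IsLin s₀ (act M V t) := by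
  obtain ⟨C, hC, rs, hrs, κ, H⟩ := hM s₀ hs₀
  refine ⟨20 * 5 ^ |3 / 2 - s₀| * C, by positivity, rs, hrs, fun V hV t ht => ⟨fun w x hw => ?_, ?_⟩⟩
  · rw [(H V hV).2.1 t ht w hw.1]
    exact kerOp_bd hC ((H V hV).1.bound 0 (Nat.zero_le _) t ht) hw
  · intro c u v hu hv
    rw [(H V hV).2.1 t ht _ ((hu.smul c).add hv).zero_mode, (H V hV).2.1 t ht _ hu.zero_mode,
      (H V hV).2.1 t ht _ hv.zero_mode]
    exact IsLin.kerOp _ (p := s₀) c u v hu hv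

lemma IsNonhomMat.isLin {I : Set ℝ} {γ r s₁ p : ℝ} {K K' N : ℕ} {M : OpMat}
    (hM : IsNonhomMat I γ K K' N r s₁ M) {V : ℝ → Vec} (hV : InBall I K s₁ r V) {t : ℝ} (ht : t ∈ I)
    (hp : s₁ + 1 ≤ p) : IsLin p (act M V t) := by
  intro c u v hu hv
  funext σ
  simp only [act, Pi.add_apply, Pi.smul_apply, Finset.smul_sum]
  rw [← Finset.sum_add_distrib]
  exact Finset.sum_congr rfl fun σ' _ =>
    (hM σ σ').1 _ rfl V hV t ht _ _ (hu.memH2 hp σ') (hv.memH2 hp σ') c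

lemma IsRealToReal.act_Cc {I : Set ℝ} {s r : ℝ} {K : ℕ} {M : OpMat} (hM : IsRealToReal I K s r M)
    {V : ℝ → Vec} (hV : InBall I K s r V) (hVr : IsRealCurve I V) {t : ℝ} (ht : t ∈ I) {w : Vec}
    (hw : MemH2 s w) : act M V t (Cc w) = Cc (act M V t w) := by
  funext σ
  simp only [act, Cc, Fintype.sum_bool, cj_add]
  rw [hM V hV hVr t ht _ (hw (!true)).cj σ true, hM V hV hVr t ht _ (hw (!false)).cj σ false,
    cj_cj, cj_cj]
  exact add_comm _ _

namespace NFData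

variable {S : NFData} {I : Set ℝ} {K K' : ℕ} {m ρ μ r s₁ s₀ s : ℝ} {V : ℝ → Vec} {t : ℝ}

/-- The estimates at a fixed time. -/
structure PtBd (S : NFData) (m s₀ C : ℝ) (V : ℝ → Vec) (t : ℝ) : Prop where
  hV : Bd s₀ (V t) 1
  B₂ : ∀ w x, Bd s₀ w x → Bd (s₀ - 5 / 2) (act S.B₂ V t w) (C * x)
  F₂ : ∀ w x, Bd s₀ w x → Bd (s₀ - 1 + -m) (act S.F₂ V t w) (C * x)
  R₂ : ∀ w x, Bd s₀ w x → Bd (s₀ - 5 / 2) (act S.R₂ V t w) (C * x)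
  A₂ : ∀ w x, Bd s₀ w x → Bd (s₀ - 5 / 2) (act S.A₂ V t w) (C * x)
  H : ∀ w x, Bd s₀ w x → Bd (s₀ - 5 / 2) (act S.H V t w) (C * x)
  lin_R₂ : IsLin s₀ (act S.R₂ V t)
  lin_H : IsLin s₀ (act S.H V t)

lemma Hyp.exists_ptBd (h : S.Hyp I K K' m ρ μ r s₁ s₀) :
    ∃ C ≥ (0 : ℝ), ∃ rs > 0, rs ≤ 1 ∧ rs ≤ r ∧ ∀ V, InBall I K s₀ rs V → ∀ t ∈ I,
      S.PtBd m s₀ C V t := by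
  have hI := h.symm.uniqueDiffOn
  have hs₀ := h.s₀_ge
  have hρ := h.ρ_ge
  have hm := h.m_nonneg
  have hμ := h.μ_nonneg
  have hK1 := h.one_le
  have hKK := h.le
  have habs := le_abs_self s₁
  have hK0 : (0 : ℝ) ≤ K := Nat.cast_nonneg K
  obtain ⟨C1, hC1, r1, hr1, H1⟩ := h.B₂.exists_bd hI (hK1.trans hKK) (s₀ := s₀) (by linarith)
  obtain ⟨C2, hC2, r2, hr2, H2⟩ := h.F₂.exists_bd hI hKK (s₀ := s₀) (by linarith)
  obtain ⟨C3, hC3, r3, hr3, H3⟩ := h.R₂.exists_bd hI hKK (s₀ := s₀) (by linarith)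
  obtain ⟨C4, hC4, r4, hr4, H4⟩ := h.A₂.exists_bd (s₀ := s₀) (by linarith)
  obtain ⟨C5, hC5, r5, hr5, H5⟩ := h.H.exists_bd (s₀ := s₀) (by linarith)
  obtain ⟨rs, hrs, hle⟩ := exists_pos_le (f := ![r1, r2, r3, r4, r5, 1, r]) (by
    have := h.r_pos
    intro i; fin_cases i <;> simp <;> assumption)
  have l1 : rs ≤ r1 := hle 0
  have l2 : rs ≤ r2 := hle 1
  have l3 : rs ≤ r3 := hle 2
  have l4 : rs ≤ r4 := hle 3
  have l5 : rs ≤ r5 := hle 4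
  have l6 : rs ≤ 1 := hle 5
  have l7 : rs ≤ r := hle 6
  refine ⟨C1 + C2 + C3 + C4 + C5, by positivity, rs, hrs, l6, l7, fun V hV t ht => ?_⟩
  have e4 := H4 V (hV.mono le_rfl l4) t ht
  have e5 := H5 V (hV.mono le_rfl l5) t ht
  refine ⟨?_, fun w x hw => ?_, fun w x hw => ?_, fun w x hw => ?_, fun w x hw => ?_,
    fun w x hw => ?_, h.R₂.isLin (hV.mono (show s₁ ≤ s₀ by linarith) l7) ht (by linarith), e5.2⟩
  · have := hV.1.jb ht 0 (Nat.zero_le _)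
    beta_reduce at this
    rw [dt2_zero] at this
    refine (this.weaken (by simp)).mono ((normK2_mono_left I s₀ V t (Nat.zero_le K)).trans ?_)
    exact (hV.lt ht).le.trans l6
  all_goals have hx := hw.nonneg
  · exact ((H1 V (hV.mono le_rfl l1) t ht w x hw).weaken (by linarith)).mono
      (by gcongr; linarith)
  · exact (H2 V (hV.mono le_rfl l2) t ht w x hw).mono (by gcongr; linarith)
  · exact ((H3 V (hV.mono le_rfl l3) t ht w x hw).weaken (by linarith)).mono
      (by gcongr; linarith)
  · exact (e4.1 w x hw).mono (by gcongr; linarith)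
  · exact (e5.1 w x hw).mono (by gcongr; linarith)

/-- Consequences of the choice of `s₀`. -/
structure Levels (m ρ μ s₀ : ℝ) : Prop where
  hm : 0 ≤ m
  hρ : m + 10 ≤ ρ
  hμ : 0 ≤ μ
  hs : ρ + μ + m + 30 ≤ s₀

lemma Hyp.levels (h : S.Hyp I K K' m ρ μ r s₁ s₀) : Levels m ρ μ s₀ :=
  ⟨h.m_nonneg, h.ρ_ge, h.μ_nonneg, by
    have := h.s₀_ge
    have := abs_nonneg s₁
    have hK0 : (0 : ℝ) ≤ K := Nat.cast_nonneg K
    linarith⟩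

lemma Levels.lv (L : Levels m ρ μ s₀) {ℓ : ℝ} (h : s₀ - m - 10 ≤ ℓ) : Lv ρ μ ℓ :=
  ⟨by linarith [L.hm, L.hρ, L.hμ, L.hs], by linarith [L.hm, L.hρ, L.hμ, L.hs]⟩

lemma Levels.lv_A (L : Levels m ρ μ s₀) {ℓ : ℝ} (h : s₀ - m - 10 ≤ ℓ) : Lv (-(3 / 2)) μ ℓ :=
  ⟨by linarith [L.hm, L.hρ, L.hμ, L.hs], by linarith [L.hm, L.hρ, L.hμ, L.hs]⟩

lemma Levels.lv_F (L : Levels m ρ μ s₀) {ℓ : ℝ} (h : s₀ - m - 10 ≤ ℓ) : Lv (-m) μ ℓ :=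
  ⟨by linarith [L.hm, L.hρ, L.hμ, L.hs], by linarith [L.hm, L.hρ, L.hμ, L.hs]⟩

lemma norm_exp_one (i : ℕ) : ‖expTail 1 1 i‖ ≤ 1 / (i.factorial : ℝ) := norm_expTail_le 1 (by simp) i

lemma norm_exp_neg (i : ℕ) : ‖expTail 1 (-1) i‖ ≤ 1 / (i.factorial : ℝ) :=
  norm_expTail_le 1 (by simp) i

section point

variable {C : ℝ} (h : S.Hyp I K K' m ρ μ r s₁ s₀) (p : S.PtBd m s₀ C V t)
include h p

lemma PtBd.hb_field : HB (s₀ - 5 / 2) (S.field V t) := by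
  have L := h.levels
  obtain ⟨_, hA⟩ := h.A₁
  obtain ⟨_, hB⟩ := h.B₁
  have hV : HB s₀ (V t) := ⟨_, p.hV⟩
  have := L.hm; have := L.hρ; have := L.hμ; have := L.hs
  have lA := L.lv_A (show s₀ - m - 10 ≤ s₀ by linarith)
  have lB := L.lv (show s₀ - m - 10 ≤ s₀ by linarith)
  exact ((((hV.bil hV hA lA lA (by linarith) (by linarith) (by linarith))).add
    ⟨_, p.A₂ _ _ p.hV⟩).smul _).add
    (((hV.bil hV hB lB lB (by linarith) (by linarith) (by linarith)).add ⟨_, p.B₂ _ _ p.hV⟩).smul _)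

lemma PtBd.hb_change : HB (s₀ - m - 1) (S.change V t) := by
  have L := h.levels
  obtain ⟨_, hF⟩ := h.F₁
  have hV : HB s₀ (V t) := ⟨_, p.hV⟩
  have := L.hm; have := L.hρ; have := L.hμ; have := L.hs
  have lF := L.lv_F (show s₀ - m - 10 ≤ s₀ by linarith)
  exact (hV.bil hV hF lF lF (by linarith) (by linarith) (by linarith)).add
    (HB.weaken ⟨_, p.F₂ _ _ p.hV⟩ (by linarith))

lemma PtBd.hb_expSub {ℓ : ℝ} {w : Vec} (hw : HB ℓ w) (hl : s₀ - m - 10 ≤ ℓ) (hl' : ℓ ≤ s₀) :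
    HB (ℓ + ρ) (S.expSub (V t) w) := by
  have L := h.levels
  obtain ⟨_, hG⟩ := h.G
  exact HB.serOp ⟨_, p.hV⟩ hw hG (by linarith [L.hm, L.hρ]) (L.lv hl) hl' norm_exp_one
    (by simp [expTail])

lemma PtBd.hb_expNegSub {ℓ : ℝ} {w : Vec} (hw : HB ℓ w) (hl : s₀ - m - 10 ≤ ℓ) (hl' : ℓ ≤ s₀) :
    HB (ℓ + ρ) (S.expNegSub (V t) w) := by
  have L := h.levels
  obtain ⟨_, hG⟩ := h.G
  exact HB.serOp ⟨_, p.hV⟩ hw hG (by linarith [L.hm, L.hρ]) (L.lv hl) hl' norm_exp_neg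
    (by simp [expTail])

lemma PtBd.hb_shift : HB (s₀ - m - 1) (S.shift V t) := by
  have L := h.levels
  have := L.hm; have := L.hρ; have := L.hμ; have := L.hs
  have hV : HB s₀ (V t) := ⟨_, p.hV⟩
  exact (((p.hb_expSub h hV (by linarith) le_rfl).weaken (by linarith)).add (p.hb_change h)).add
    ((p.hb_expSub h (p.hb_change h) (by linarith) (by linarith)).weaken (by linarith))

lemma PtBd.hb_pull {w : Vec} (hw : HB s₀ w) : HB s₀ (S.pull V t w) := by
  have L := h.levels
  have := L.hm; have := L.hρ; have := L.hμ; have := L.hs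
  exact hw.add ((p.hb_expNegSub h hw (by linarith) le_rfl).weaken (by linarith))

lemma PtBd.hb_reduced {w : Vec} (hw : HB s₀ w) : HB (s₀ - 5 / 2) (S.reduced V t w) := by
  have L := h.levels
  obtain ⟨_, hR⟩ := h.R₁
  have hV : HB s₀ (V t) := ⟨_, p.hV⟩
  have := L.hm; have := L.hρ; have := L.hμ; have := L.hs
  have lR := L.lv (show s₀ - m - 10 ≤ s₀ by linarith)
  obtain ⟨x, hx⟩ := hw
  exact ((hV.bil ⟨x, hx⟩ hR lR lR (by linarith) (by linarith) (by linarith)).add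
    (HB.smul _ ⟨_, p.H _ _ hx⟩)).add ⟨_, p.R₂ _ _ hx⟩

lemma PtBd.lin_expSub {ℓ : ℝ} (hl : s₀ - m - 10 ≤ ℓ) (hl' : ℓ ≤ s₀) :
    IsLin ℓ (S.expSub (V t)) := by
  have L := h.levels
  obtain ⟨_, hG⟩ := h.G
  have := L.hm; have := L.hρ; have := L.hμ; have := L.hs
  exact IsLin.serOp ⟨_, p.hV⟩ hG (by linarith) (L.lv hl) (by linarith) hl' norm_exp_one

lemma PtBd.lin_pull : IsLin s₀ (S.pull V t) := by
  have L := h.levels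
  obtain ⟨_, hG⟩ := h.G
  have := L.hm; have := L.hρ; have := L.hμ; have := L.hs
  exact IsLin.id.add (IsLin.serOp ⟨_, p.hV⟩ hG (by linarith) (L.lv (by linarith)) (by linarith) le_rfl
    norm_exp_neg)

/-- Bounds at the level `s₀ - 5/2` for the operators in the series of commutators. -/
lemma PtBd.exists_comm_bd : ∃ Θ ≥ (1 : ℝ),
    (∀ w x, Bd (s₀ - 5 / 2) w x → Bd (s₀ - 5 / 2) (bil S.G (V t) w) (Θ * x)) ∧
    ∀ w x, Bd (s₀ - 5 / 2) w x → Bd (s₀ - 5 / 2)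
      (bil (S.Rr - S.R₁) (V t) w + bil S.G (S.field V t) w) (Θ * x) := by
  have L := h.levels
  obtain ⟨cG, hG⟩ := h.G
  obtain ⟨c1, hR₁⟩ := h.R₁
  obtain ⟨c2, hRr⟩ := h.Rr
  have := L.hm; have := L.hρ; have := L.hμ; have := L.hs
  obtain ⟨α, hW⟩ := p.hb_field h
  have lq := L.lv (show s₀ - m - 10 ≤ s₀ - 5 / 2 by linarith)
  have hρ : 0 ≤ ρ := by linarith
  have hq : 0 ≤ s₀ - 5 / 2 := by linarith
  refine ⟨1 + |itConst cG (s₀ - 5 / 2) 1| + (|itConst (c2 + c1) (s₀ - 5 / 2) 1| +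
    |itConst cG (s₀ - 5 / 2) α|), by
      linarith [abs_nonneg (itConst cG (s₀ - 5 / 2) 1), abs_nonneg (itConst (c2 + c1) (s₀ - 5 / 2) 1),
        abs_nonneg (itConst cG (s₀ - 5 / 2) α)], fun w x hw => ?_, fun w x hw => ?_⟩
  all_goals have hx := hw.nonneg
  · refine (bil_bd_self hG hρ lq hq (by linarith) p.hV hw).mono (mul_le_mul_of_nonneg_right ?_ hx)
    linarith [le_abs_self (itConst cG (s₀ - 5 / 2) 1), abs_nonneg (itConst (c2 + c1) (s₀ - 5 / 2) 1),
        abs_nonneg (itConst cG (s₀ - 5 / 2) α)]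
  · refine ((bil_bd_self (hRr.sub hR₁) hρ lq hq (by linarith) p.hV hw).add
      (bil_bd_self hG hρ lq hq le_rfl hW hw)).mono ?_
    rw [← add_mul]
    refine mul_le_mul_of_nonneg_right ?_ hx
    linarith [abs_nonneg (itConst cG (s₀ - 5 / 2) 1), le_abs_self (itConst (c2 + c1) (s₀ - 5 / 2) 1),
        le_abs_self (itConst cG (s₀ - 5 / 2) α)]

lemma PtBd.lin_rem : IsLin s₀ (S.rem V t) := by
  have L := h.levels
  obtain ⟨cG, hG⟩ := h.G
  obtain ⟨c1, hR₁⟩ := h.R₁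
  obtain ⟨c2, hRr⟩ := h.Rr
  have := L.hm; have := L.hρ; have := L.hμ; have := L.hs
  have hρ : 0 ≤ ρ := by linarith
  have hV : HB s₀ (V t) := ⟨_, p.hV⟩
  have l0 := L.lv (show s₀ - m - 10 ≤ s₀ by linarith)
  have l1 := L.lv (show s₀ - m - 10 ≤ s₀ - m - 1 by linarith)
  have l2 := L.lv (show s₀ - m - 10 ≤ s₀ - 5 / 2 by linarith)
  have hp : ∀ w, HB s₀ w → HB s₀ (S.pull V t w) := fun w => p.hb_pull h
  have hp' : ∀ w, HB s₀ w → HB (s₀ - 5 / 2) (S.pull V t w) := fun w hw =>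
    (p.hb_pull h hw).weaken (by linarith)
  have lp := p.lin_pull h
  have lG : IsLin (s₀ - 5 / 2) (bil S.G (S.field V t)) := IsLin.bil (p.hb_field h) hG l2 l2
  obtain ⟨Θ, hΘ, bG, bQ⟩ := p.exists_comm_bd h
  have T1 : IsLin s₀ (fun y => bil S.Rr (V t) (S.expNegSub (V t) y)) :=
    (IsLin.bil hV hRr l0 l0).comp (IsLin.serOp hV hG hρ l0 (by linarith) le_rfl norm_exp_neg)
      fun u hu => (p.hb_expNegSub h hu (by linarith) le_rfl).weaken (by linarith)
  have T2 : IsLin s₀ (fun y => bil S.Rr (S.shift V t) y) := IsLin.bil (p.hb_shift h) hRr l1 l1 |>.mono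
    (by linarith)
  have T3 : IsLin s₀ (fun y => bil S.G (S.field V t) (S.pull V t y)) := lG.comp lp hp'
  have T4 : IsLin s₀ (fun y => PhiOp S.G (S.Rr - S.R₁) (V t) (S.field V t) (S.pull V t y)) :=
    (isLin_PhiOp hΘ bG bQ (IsLin.bil hV hG l0 l2) (IsLin.bil hV (hRr.sub hR₁) l0 l2) lG).comp lp hp'
  have T5 : IsLin s₀ (fun y => act S.R₂ V t (S.pull V t y)) := p.lin_R₂.comp lp hp
  have T6 : IsLin s₀ (fun y => S.expSub (V t) (S.reduced V t (S.pull V t y))) :=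
    (p.lin_expSub h (by linarith) (by linarith)).comp
      ((((IsLin.bil hV hR₁ l0 l0).add (p.lin_H.smul _)).add p.lin_R₂).comp lp hp)
      fun u hu => p.hb_reduced h (hp u hu)
  have T7 : IsLin s₀ (fun y => Complex.I • act S.H V t (S.expSub (V t) (S.pull V t y))) :=
    (p.lin_H.comp ((p.lin_expSub h (by linarith) le_rfl).comp lp hp) fun u hu =>
      (p.hb_expSub h (hp u hu) (by linarith) le_rfl).weaken (by linarith)).smul _
  exact (((((T1.sub T2).add T3).add T4).add T5).add T6).sub T7

end point

/-! ### Reality of the remainder -/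

/-- The operators are real-to-real. -/
structure RealHyp (S : NFData) (I : Set ℝ) (K : ℕ) (r s₁ : ℝ) : Prop where
  G : RealCoef S.G
  R₁ : RealCoef S.R₁
  Rr : RealCoef S.Rr
  A : ∀ V, InBall I K s₁ r V → IsRealCurve I V → ∀ t ∈ I, ∀ w, MemH2 s₁ w →
    Complex.I • (bil S.A₁ (V t) (Cc w) + act S.A₂ V t (Cc w)) =
      Cc (Complex.I • (bil S.A₁ (V t) w + act S.A₂ V t w))
  B : ∀ V, InBall I K s₁ r V → IsRealCurve I V → ∀ t ∈ I, ∀ w, MemH2 s₁ w →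
    Complex.I • (bil S.B₁ (V t) (Cc w) + act S.B₂ V t (Cc w)) =
      Cc (Complex.I • (bil S.B₁ (V t) w + act S.B₂ V t w))
  F : ∀ V, InBall I K s₁ r V → IsRealCurve I V → ∀ t ∈ I, ∀ w, MemH2 s₁ w →
    bil S.F₁ (V t) (Cc w) + act S.F₂ V t (Cc w) = Cc (bil S.F₁ (V t) w + act S.F₂ V t w)
  H : ∀ V, InBall I K s₁ r V → IsRealCurve I V → ∀ t ∈ I, ∀ w, MemH2 s₁ w →
    Complex.I • act S.H V t (Cc w) = Cc (Complex.I • act S.H V t w)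
  R₂ : ∀ V, InBall I K s₁ r V → IsRealCurve I V → ∀ t ∈ I, ∀ w, MemH2 s₁ w →
    act S.R₂ V t (Cc w) = Cc (act S.R₂ V t w)

/-- A real `V` is fixed by `Cc`, and so are `field`, `change` and `shift`, built from it by
real-to-real operators. Each summand is a composition of operators that commute with `Cc` when their
coefficients are fixed by it. -/
lemma rem_Cc {C : ℝ} (h : S.Hyp I K K' m ρ μ r s₁ s₀) (R : S.RealHyp I K r s₁)
    (p : S.PtBd m s₀ C V t) (hV : InBall I K s₁ r V) (hVr : IsRealCurve I V) (ht : t ∈ I)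
    {y : Vec} (hy : HB s₀ y) : S.rem V t (Cc y) = Cc (S.rem V t y) := by
  have L := h.levels
  have := L.hm; have := L.hρ; have := L.hμ; have := L.hs
  have hs₁ : s₁ + 1 ≤ s₀ := by
    have := h.s₀_ge
    have hK0 : (0 : ℝ) ≤ K := Nat.cast_nonneg K
    linarith [le_abs_self s₁]
  have hVb : HB s₀ (V t) := ⟨_, p.hV⟩
  have v := isReal_iff.1 (hVr t ht)
  have vm := hVb.memH2 hs₁
  have v0 := hVb.zero_mode
  have mexp := conj_expTail 1 1
  have mneg := conj_expTail 1 (-1)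
  have bilV : ∀ {r : HomMat}, RealCoef r → ∀ {w}, HB (s₀ - m - 10) w →
      bil r (V t) (Cc w) = Cc (bil r (V t) w) := fun hr w hw => by
    conv_lhs => rw [← v]
    exact hr.bil_Cc v0 hw.zero_mode
  have serV : ∀ {θ : ℝ} {w}, HB (s₀ - m - 10) w → serOp (expTail 1 θ) S.G (V t) (Cc w) =
      Cc (serOp (expTail 1 θ) S.G (V t) w) := fun hw => by
    conv_lhs => rw [← v]
    exact serOp_Cc R.G v0 hw.zero_mode (conj_expTail 1 _)
  have rfield : Cc (S.field V t) = S.field V t := by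
    rw [field, Cc_add, ← R.A V hV hVr t ht _ vm, ← R.B V hV hVr t ht _ vm, v]
  have rchange : Cc (S.change V t) = S.change V t := by
    rw [change, ← R.F V hV hVr t ht _ vm, v]
  have rshift : Cc (S.shift V t) = S.shift V t := by
    rw [shift, Cc_add, Cc_add, rchange, expSub, expSub, ← serV (hVb.weaken (by linarith)),
      ← serV ((p.hb_change h).weaken (by linarith)), v, rchange]
  have rpull : S.pull V t (Cc y) = Cc (S.pull V t y) := by
    rw [pull, pull, Cc_add, expNegSub, expNegSub, serV (hy.weaken (by linarith))]
  have hz := p.hb_pull h hy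
  have zm := hz.memH2 hs₁
  have e1 : S.expNegSub (V t) (Cc y) = Cc (S.expNegSub (V t) y) := serV (hy.weaken (by linarith))
  have e2 : S.reduced V t (Cc (S.pull V t y)) = Cc (S.reduced V t (S.pull V t y)) := by
    rw [reduced, reduced, Cc_add, Cc_add, bilV R.R₁ (hz.weaken (by linarith)),
      R.H V hV hVr t ht _ zm, R.R₂ V hV hVr t ht _ zm]
  have hEz := p.hb_expSub h hz (by linarith) le_rfl
  have e3 : S.expSub (V t) (Cc (S.pull V t y)) = Cc (S.expSub (V t) (S.pull V t y)) :=
    serV (hz.weaken (by linarith))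
  have t1 := bilV R.Rr ((p.hb_expNegSub h hy (by linarith) le_rfl).weaken
    (show s₀ - m - 10 ≤ s₀ + ρ by linarith))
  have t2 : bil S.Rr (S.shift V t) (Cc y) = Cc (bil S.Rr (S.shift V t) y) := by
    conv_lhs => rw [← rshift]
    exact R.Rr.bil_Cc (p.hb_shift h).zero_mode hy.zero_mode
  have t3 : bil S.G (S.field V t) (Cc (S.pull V t y)) =
      Cc (bil S.G (S.field V t) (S.pull V t y)) := by
    conv_lhs => rw [← rfield]
    exact R.G.bil_Cc (p.hb_field h).zero_mode hz.zero_mode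
  have t4 : PhiOp S.G (S.Rr - S.R₁) (V t) (S.field V t) (Cc (S.pull V t y)) =
      Cc (PhiOp S.G (S.Rr - S.R₁) (V t) (S.field V t) (S.pull V t y)) := by
    conv_lhs => rw [← rfield, ← v]
    exact PhiOp_Cc R.G (R.Rr.sub R.R₁) v0 (p.hb_field h).zero_mode hz.zero_mode
  have t6 : S.expSub (V t) (Cc (S.reduced V t (S.pull V t y))) =
      Cc (S.expSub (V t) (S.reduced V t (S.pull V t y))) :=
    serV ((p.hb_reduced h hz).weaken (by linarith))
  have t7 := R.H V hV hVr t ht _ (hEz.memH2 (show s₁ + 1 ≤ s₀ + ρ by linarith))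
  simp only [rem, rpull, e1, e2, e3, t1, t2, t3, t4, t6, t7, R.R₂ V hV hVr t ht _ zm, Cc_add,
    Cc_sub]

end NFData

/-! ### The time derivative of the flow -/

/-- The derivative of `G(U)^n z`, where `U'`, `z'` are the derivatives of `U`, `z`. -/
def derivIter (r : HomMat) (U U' z z' : Vec) : ℕ → Vec
  | 0 => z'
  | n + 1 => bil r U' ((bil r U)^[n] z) + bil r U (derivIter r U U' z z' n)

section deriv

variable {r : HomMat} {ρ μ Cr q B : ℝ}

lemma bd_derivIter {U U' z z' : Vec} (hr : CoefBd ρ μ Cr r) (hρ : 0 ≤ ρ) (hq : Lv ρ μ q) (hq0 : 0 ≤ q)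
    (hU : Bd q U B) (hU' : Bd q U' B) (hz : Bd q z B) (hz' : Bd q z' B) (n : ℕ) :
    Bd q (derivIter r U U' z z' n) ((2 * max 1 (itConst Cr q B)) ^ n * B) := by
  set Θ := max 1 (itConst Cr q B) with hΘ
  have hB := hU.nonneg
  have h1 : 1 ≤ Θ := le_max_left _ _
  have hle : itConst Cr q B ≤ Θ := le_max_right _ _
  have hG : ∀ w y, Bd q w y → Bd q (bil r U w) (Θ * y) := fun w y hw =>
    (bil_bd_self hr hρ hq hq0 le_rfl hU hw).mono (mul_le_mul_of_nonneg_right hle hw.nonneg)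
  have hG' : ∀ w y, Bd q w y → Bd q (bil r U' w) (Θ * y) := fun w y hw =>
    (bil_bd_self hr hρ hq hq0 le_rfl hU' hw).mono (mul_le_mul_of_nonneg_right hle hw.nonneg)
  induction n with
  | zero => simpa [derivIter] using hz'
  | succ n ih =>
    refine ((hG' _ _ (bd_iterate_of_le hG hz n)).add (hG _ _ ih)).mono ?_
    have h2 : Θ ^ n ≤ (2 * Θ) ^ n := pow_le_pow_left₀ (by linarith) (by linarith) _
    have h3 : Θ * (Θ ^ n * B) ≤ Θ * ((2 * Θ) ^ n * B) := by gcongr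
    calc _ ≤ Θ * ((2 * Θ) ^ n * B) + Θ * ((2 * Θ) ^ n * B) := by linarith
      _ = _ := by ring

variable {I : Set ℝ} {U U' z z' : ℝ → Vec}

/-- Local boundedness of a curve. -/
def LocBd (I : Set ℝ) (q : ℝ) (u : ℝ → Vec) : Prop :=
  ∀ t ∈ I, ∃ ε > 0, ∃ B, ∀ τ ∈ I, |τ - t| < ε → Bd q (u τ) B

lemma exists_common (hU : LocBd I q U) (hU' : LocBd I q U') (hz : LocBd I q z)
    (hz' : LocBd I q z') {t : ℝ} (ht : t ∈ I) : ∃ ε > 0, ∃ B, ∀ τ ∈ I, |τ - t| < ε →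
      Bd q (U τ) B ∧ Bd q (U' τ) B ∧ Bd q (z τ) B ∧ Bd q (z' τ) B := by
  obtain ⟨ε₁, h₁, B₁, H₁⟩ := hU t ht
  obtain ⟨ε₂, h₂, B₂, H₂⟩ := hU' t ht
  obtain ⟨ε₃, h₃, B₃, H₃⟩ := hz t ht
  obtain ⟨ε₄, h₄, B₄, H₄⟩ := hz' t ht
  refine ⟨min (min ε₁ ε₂) (min ε₃ ε₄), by positivity, max (max B₁ B₂) (max B₃ B₄), fun τ hτ h => ?_⟩
  simp only [lt_min_iff] at h
  exact ⟨(H₁ τ hτ h.1.1).mono (by simp), (H₂ τ hτ h.1.2).mono (by simp),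
    (H₃ τ hτ h.2.1).mono (by simp), (H₄ τ hτ h.2.2).mono (by simp)⟩

lemma hasDerivWithinAt_iterate (hI : I.OrdConnected) (hr : CoefBd ρ μ Cr r) (hρ : 0 ≤ ρ)
    (hq : Lv ρ μ q) (hq0 : 0 ≤ q) (hU : LocBd I q U) (hU' : LocBd I q U') (hz : LocBd I q z)
    (hz' : LocBd I q z')
    (dU : ∀ t ∈ I, ∀ σ n, HasDerivWithinAt (fun τ => U τ σ n) (U' t σ n) I t)
    (dz : ∀ t ∈ I, ∀ σ n, HasDerivWithinAt (fun τ => z τ σ n) (z' t σ n) I t) (n : ℕ) :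
    ∀ t ∈ I, ∀ σ k, HasDerivWithinAt (fun τ => ((bil r (U τ))^[n] (z τ)) σ k)
      (derivIter r (U t) (U' t) (z t) (z' t) n σ k) I t := by
  induction n with
  | zero => exact dz
  | succ n ih =>
    intro t ht σ k
    obtain ⟨ε, hε, B, H⟩ := exists_common hU hU' hz hz' ht
    simp only [Function.iterate_succ_apply']
    have hB : 0 ≤ B := (H t ht (by simpa using hε)).1.nonneg
    refine hasDerivWithinAt_bil hI ht hε (B' := (2 * max 1 (itConst Cr q B)) ^ n * B) hr hq hq dU ih
      (fun τ hτ h => (H τ hτ h).1) (fun τ hτ h => (H τ hτ h).2.1) (fun τ hτ h => ?_)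
      (fun τ hτ h => ?_) σ k
    · refine (bd_iterate hr hρ hq hq0 le_rfl (H τ hτ h).1 (H τ hτ h).2.2.1 n).mono ?_
      refine mul_le_mul_of_nonneg_right (pow_le_pow_left₀ (itConst_nonneg hr.1 hB) ?_ n) hB
      have := le_max_right 1 (itConst Cr q B)
      have := le_max_left 1 (itConst Cr q B)
      linarith
    · exact bd_derivIter hr hρ hq hq0 (H τ hτ h).1 (H τ hτ h).2.1 (H τ hτ h).2.2.1 (H τ hτ h).2.2.2 n

/-- The derivative of the `n`-th power has `n + 1` terms and grows like `(2Θ)^n`, still negligible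
against `n!`, so the exponential series is differentiated termwise. -/
lemma hasDerivWithinAt_flow (hI : I.OrdConnected) (hr : CoefBd ρ μ Cr r) (hρ : 0 ≤ ρ)
    (hq : Lv ρ μ q) (hq0 : 0 ≤ q) (hU : LocBd I q U) (hU' : LocBd I q U') (hz : LocBd I q z)
    (hz' : LocBd I q z')
    (dU : ∀ t ∈ I, ∀ σ n, HasDerivWithinAt (fun τ => U τ σ n) (U' t σ n) I t)
    (dz : ∀ t ∈ I, ∀ σ n, HasDerivWithinAt (fun τ => z τ σ n) (z' t σ n) I t) {c : ℕ → ℂ}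
    (hc : ∀ i, ‖c i‖ ≤ 1 / (i.factorial : ℝ)) {t : ℝ} (ht : t ∈ I) (σ : Bool) (k : ℤ) :
    HasDerivWithinAt (fun τ => serOp c r (U τ) (z τ) σ k)
      (∑' i, c i * derivIter r (U t) (U' t) (z t) (z' t) i σ k) I t := by
  obtain ⟨ε, hε, B, H⟩ := exists_common hU hU' hz hz' ht
  have hB : 0 ≤ B := (H t ht (by simpa using hε)).1.nonneg
  by_cases hk : k = 0
  · have h0 : ∀ τ ∈ I, |τ - t| < ε → serOp c r (U τ) (z τ) σ k = 0 := fun τ hτ h => by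
      simp [serOp, hk, iterate_bil_zero_mode (H τ hτ h).2.2.1.1]
    have h1 : (∑' i, c i * derivIter r (U t) (U' t) (z t) (z' t) i σ k) = 0 := by
      have e := H t ht (by simpa using hε)
      simp [hk, (bd_derivIter hr hρ hq hq0 e.1 e.2.1 e.2.2.1 e.2.2.2 _).1 σ]
    rw [h1]
    refine (hasDerivWithinAt_const t I (0 : ℂ)).congr_of_eventuallyEq ?_
      (h0 t ht (by simpa using hε))
    filter_upwards [eventually_near hε] with τ hτ using h0 τ hτ.1 hτ.2
  obtain ⟨Θ, hΘ⟩ : ∃ Θ, Θ = 2 * max 1 (itConst Cr q B) := ⟨_, rfl⟩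
  have hbd : ∀ i, ∀ τ ∈ I, |τ - t| < ε → Bd q (derivIter r (U τ) (U' τ) (z τ) (z' τ) i) (Θ ^ i * B) :=
    fun i τ hτ h => hΘ ▸ bd_derivIter hr hρ hq hq0 (H τ hτ h).1 (H τ hτ h).2.1 (H τ hτ h).2.2.1
      (H τ hτ h).2.2.2 i
  have hdi := hasDerivWithinAt_iterate hI hr hρ hq hq0 hU hU' hz hz' dU dz
  unfold serOp
  refine hasDerivWithinAt_tsum_local (f := fun i τ => c i * ((bil r (U τ))^[i] (z τ)) σ k)
    (f' := fun i τ => c i * derivIter r (U τ) (U' τ) (z τ) (z' τ) i σ k) hI ht hε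
    (b := fun i => Θ ^ i / (i.factorial : ℝ) * (B * |(k : ℝ)| ^ (-q)))
    ((summable_exp Θ).mul_right _) (fun i τ hτ _ => (hdi i τ hτ σ k).const_mul (c i))
    (fun i τ hτ h => ?_) fun τ hτ h =>
      summable_ser hr hρ hq hq0 le_rfl (H τ hτ h).1 (H τ hτ h).2.2.1 hc σ k
  rw [norm_mul]
  have e := (hbd i τ hτ h).2 σ k hk
  calc _ ≤ 1 / (i.factorial : ℝ) * (Θ ^ i * B * |(k : ℝ)| ^ (-q)) := by
        gcongr
        exact hc i
    _ = _ := by ring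

end deriv

lemma bil_sub_coef {r r' : HomMat} {ρ μ C C' p q α x : ℝ} {U v : Vec} (hr : CoefBd ρ μ C r)
    (hr' : CoefBd ρ μ C' r') (hp : Lv ρ μ p) (hq : Lv ρ μ q) (hU : Bd p U α) (hv : Bd q v x) :
    bil (r - r') U v = bil r U v - bil r' U v := by
  funext σ c
  by_cases hc : c = 0
  · simp [hc, bil_zero_mode]
  rw [Pi.sub_apply, Pi.sub_apply, bil_eq_tsum (hr.sub hr') hp hq hU hv σ hc,
    bil_eq_tsum hr hp hq hU hv σ hc, bil_eq_tsum hr' hp hq hU hv σ hc, ← mul_sub,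
    ← (summable_bt hr hp hq hU hv σ hc).tsum_sub (summable_bt hr' hp hq hU hv σ hc)]
  congr 1
  refine tsum_congr fun a => ?_
  simp only [bt, Pi.sub_apply, sub_mul, Finset.sum_sub_distrib]

/-! ### Derivatives of the powers of the generator along solutions. -/

namespace NFData

variable {S : NFData} {I : Set ℝ} {K K' : ℕ} {m ρ μ r s₁ s₀ s κ g : ℝ} {hd : ℝ≥0∞} {V : ℝ → Vec}
  {t : ℝ}

/-- The homological equation. -/
def SolvesHom (S : NFData) (κ g : ℝ) (hd : ℝ≥0∞) (s₀ : ℝ) : Prop :=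
  ∀ U v, HB s₀ U → HB s₀ v → bil S.G (dispOp κ g hd U) v + (bil S.G U (dispOp κ g hd v)
      - dispOp κ g hd (bil S.G U v)) + bil S.R₁ U v = bil S.Rr U v

section point

variable {C : ℝ} (h : S.Hyp I K K' m ρ μ r s₁ s₀) (p : S.PtBd m s₀ C V t)
  (hom : S.SolvesHom κ g hd s₀) (hκ : 0 < κ) (hg : 0 ≤ g)
include h p hom hκ hg

/-- The derivative of one factor `G(U)` is `G(iΩU) + G(field)`. The homological equation rewrites
`G(iΩU) + G(U) iΩ` as `iΩ G(U) + Rr - R₁`, so `iΩ` moves to the left of all powers and every step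
leaves one insertion of `Q = (Rr - R₁)(U) + G(field)`. Collecting these insertions is the recursion
of `commOp`. -/
lemma PtBd.derivIter_eq {z : Vec} (hz : HB s₀ z) (n : ℕ) :
    derivIter S.G (V t) (dispOp κ g hd (V t) + S.field V t) z
        (dispOp κ g hd z + S.reduced V t z) n =
      dispOp κ g hd ((bil S.G (V t))^[n] z)
        + (if n = 0 then 0 else commOp S.G (S.Rr - S.R₁) (V t) (S.field V t) (n - 1) z)
        + (bil S.G (V t))^[n] (S.reduced V t z) := by
  have L := h.levels
  obtain ⟨cG, hG⟩ := h.G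
  obtain ⟨c1, hR₁⟩ := h.R₁
  obtain ⟨c2, hRr⟩ := h.Rr
  have := L.hm; have := L.hρ; have := L.hμ; have := L.hs
  have hV : HB s₀ (V t) := ⟨_, p.hV⟩
  have l0 := L.lv (show s₀ - m - 10 ≤ s₀ by linarith)
  have l2 := L.lv (show s₀ - m - 10 ≤ s₀ - 5 / 2 by linarith)
  obtain ⟨Θ, hΘ, bG, bQ⟩ := p.exists_comm_bd h
  have hit : ∀ n, HB s₀ ((bil S.G (V t))^[n] z) := by
    intro n
    induction n with
    | zero => exact hz
    | succ n ih =>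
      rw [Function.iterate_succ_apply']
      exact hV.bil ih hG l0 l0 (by linarith) (by linarith) (by linarith)
  have hdisp : ∀ {w}, HB s₀ w → HB (s₀ - 5 / 2) (dispOp κ g hd w) := fun ⟨_, hw⟩ =>
    HB.weaken ⟨_, hw.dispOp hκ hg hd⟩ (by linarith)
  have hred := p.hb_reduced h hz
  have hz' : HB (s₀ - 5 / 2) z := hz.weaken (by linarith)
  induction n with
  | zero => simp [derivIter]
  | succ n ih =>
    set w := (bil S.G (V t))^[n] z with hw
    have hwb : HB s₀ w := hit n
    have hcomm : HB (s₀ - 5 / 2)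
        (if n = 0 then 0 else commOp S.G (S.Rr - S.R₁) (V t) (S.field V t) (n - 1) z) := by
      split_ifs
      · exact ⟨0, Bd.zero⟩
      · obtain ⟨_, hx⟩ := hz'
        exact ⟨_, bd_commOp hΘ bG bQ hx _⟩
    have hiter : HB (s₀ - 5 / 2) ((bil S.G (V t))^[n] (S.reduced V t z)) := by
      obtain ⟨_, hx⟩ := hred
      exact ⟨_, bd_iterate_of_le bG hx n⟩
    have hadd : ∀ {u v}, HB (s₀ - 5 / 2) u → HB (s₀ - 5 / 2) v →
        bil S.G (V t) (u + v) = bil S.G (V t) u + bil S.G (V t) v := fun ⟨_, hu⟩ ⟨_, hv⟩ =>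
      bil_add_right hG l0 l2 p.hV hu hv
    have hadd' : bil S.G (dispOp κ g hd (V t) + S.field V t) w =
        bil S.G (dispOp κ g hd (V t)) w + bil S.G (S.field V t) w := by
      obtain ⟨_, h1⟩ := hdisp hV
      obtain ⟨_, h2⟩ := p.hb_field h
      obtain ⟨_, h3⟩ := hwb
      exact bil_add_left hG l2 l0 h1 h2 h3
    have hsub : bil (S.Rr - S.R₁) (V t) w = bil S.Rr (V t) w - bil S.R₁ (V t) w := by
      obtain ⟨_, h3⟩ := hwb
      exact bil_sub_coef hRr hR₁ l0 l0 p.hV h3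
    have hh := hom (V t) w hV hwb
    have e : bil S.G (dispOp κ g hd (V t)) w = bil (S.Rr - S.R₁) (V t) w
        - bil S.G (V t) (dispOp κ g hd w) + dispOp κ g hd (bil S.G (V t) w) := by
      rw [hsub, ← hh]
      abel
    rw [derivIter, ih, hadd', hadd ((hdisp hwb).add hcomm) hiter, hadd (hdisp hwb) hcomm, e,
      Function.iterate_succ_apply', Function.iterate_succ_apply', ← hw, if_neg (Nat.succ_ne_zero n),
      Nat.add_sub_cancel]
    cases n with
    | zero =>
      rw [if_pos rfl, bil_zero_right, commOp]
      have : w = z := hw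
      rw [this]
      abel
    | succ n =>
      rw [if_neg (Nat.succ_ne_zero n), Nat.add_sub_cancel, commOp, ← hw]
      abel

end point

end NFData

/-! ### The vector field of the conjugated variable. -/

namespace NFData

variable {S : NFData} {I : Set ℝ} {K K' : ℕ} {m ρ μ r s₁ s₀ s κ g : ℝ} {hd : ℝ≥0∞} {V : ℝ → Vec}
  {t : ℝ}

section point

variable {C : ℝ} (h : S.Hyp I K K' m ρ μ r s₁ s₀) (p : S.PtBd m s₀ C V t)
include h p

lemma PtBd.exp_eq {ℓ : ℝ} {w : Vec} (hw : HB ℓ w) (hl : s₀ - m - 10 ≤ ℓ) (hl' : ℓ ≤ s₀) :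
    serOp (expTail 0 1) S.G (V t) w = w + S.expSub (V t) w := by
  have L := h.levels
  obtain ⟨cG, hG⟩ := h.G
  obtain ⟨_, hw⟩ := hw
  have := L.hm; have := L.hρ; have := L.hμ; have := L.hs
  exact serOp_expTail_zero hG (by linarith) (L.lv hl) (by linarith) hl' p.hV hw (by simp)

lemma PtBd.pull_exp {w : Vec} (hw : HB s₀ w) :
    S.pull V t (serOp (expTail 0 1) S.G (V t) w) = w := by
  have L := h.levels
  obtain ⟨cG, hG⟩ := h.G
  have := L.hm; have := L.hρ; have := L.hμ; have := L.hs
  have hE := (p.hb_expSub h hw (by linarith) le_rfl).weaken (show s₀ ≤ s₀ + ρ by linarith)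
  have hy := hw.add hE
  rw [← p.exp_eq h hw (by linarith) le_rfl] at hy
  obtain ⟨_, hw⟩ := hw
  obtain ⟨_, hy⟩ := hy
  have l0 := L.lv (show s₀ - m - 10 ≤ s₀ by linarith)
  have e := serOp_expTail_zero hG (by linarith) l0 (by linarith) le_rfl p.hV hy (θ := -1) (by simp)
  have e' := serOp_inv hG (by linarith) l0 (by linarith) le_rfl p.hV hw (θ := -1) (by simp)
  rw [neg_neg] at e'
  rw [pull, expNegSub, ← e, e']

/-- The vector field in the new variable. -/
lemma PtBd.field_eq {z y : Vec} (hz : HB s₀ z) (hZ : z = V t + S.change V t)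
    (hy : y = serOp (expTail 0 1) S.G (V t) z) :
    bil (S.Rr - S.R₁) (V t) z + bil S.G (S.field V t) z
        + PhiOp S.G (S.Rr - S.R₁) (V t) (S.field V t) z + S.reduced V t z
        + S.expSub (V t) (S.reduced V t z)
      = bil S.Rr y y + (Complex.I • act S.H V t y + S.rem V t y) := by
  have L := h.levels
  obtain ⟨c1, hR₁⟩ := h.R₁
  obtain ⟨c2, hRr⟩ := h.Rr
  have := L.hm; have := L.hρ; have := L.hμ; have := L.hs
  have hV : HB s₀ (V t) := ⟨_, p.hV⟩
  have l0 := L.lv (show s₀ - m - 10 ≤ s₀ by linarith)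
  have l1 := L.lv (show s₀ - m - 10 ≤ s₀ - m - 1 by linarith)
  have hpull : S.pull V t y = z := hy ▸ p.pull_exp h hz
  have hyz : y = z + S.expSub (V t) z := hy.trans (p.exp_eq h hz (by linarith) le_rfl)
  have hE := (p.hb_expSub h hz (by linarith) le_rfl).weaken (show s₀ ≤ s₀ + ρ by linarith)
  have hyb : HB s₀ y := hyz ▸ hz.add hE
  -- Thus `z - y` has a factor `V` and gains `ρ`, so replacing `z` by `y` under `Rr(V)` is a
  -- smoothing error of degree two.
  have hneg : S.expNegSub (V t) y = z - y := by
    rw [← hpull, pull, add_sub_cancel_left]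
  -- This allows the argument `V` of the resonant operator to be replaced by `y`, with a quadratic
  -- error.
  have hshift : y = V t + S.shift V t := by
    have := p.lin_expSub h (show s₀ - m - 10 ≤ s₀ - m - 1 by linarith) (by linarith) 1 (V t)
      (S.change V t) (hV.weaken (by linarith)) (p.hb_change h)
    rw [one_smul, one_smul, ← hZ] at this
    rw [hyz, this, shift]
    nth_rw 1 [hZ]
    abel
  have e1 : bil S.Rr (V t) (S.expNegSub (V t) y) = bil S.Rr (V t) z - bil S.Rr (V t) y := by
    obtain ⟨_, a⟩ := hz
    obtain ⟨_, b⟩ := hyb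
    rw [hneg, bil_sub_right hRr l0 l0 p.hV a b]
  have e2 : bil S.Rr y y = bil S.Rr (V t) y + bil S.Rr (S.shift V t) y := by
    obtain ⟨_, a⟩ := p.hb_shift h
    obtain ⟨_, b⟩ := hyb
    nth_rw 1 [hshift]
    exact bil_add_left hRr l1 l0 (p.hV.weaken (by linarith)) a b
  have e3 : act S.H V t y = act S.H V t z + act S.H V t (S.expSub (V t) z) := by
    have := p.lin_H 1 z _ hz hE
    rwa [one_smul, one_smul, ← hyz] at this
  have e4 : bil (S.Rr - S.R₁) (V t) z = bil S.Rr (V t) z - bil S.R₁ (V t) z := by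
    obtain ⟨_, a⟩ := hz
    exact bil_sub_coef hRr hR₁ l0 l0 p.hV a
  -- After expansion `-R₁(V)z` from `Rr - R₁` cancels `R₁(V)z` from `reduced`; only the latter's
  -- outer occurrence is unfolded, the one inside `expSub` being part of `rem`.
  rw [rem, e1, e2, e3, e4, hpull, smul_add]
  have e5 : S.reduced V t z = bil S.R₁ (V t) z + Complex.I • act S.H V t z + act S.R₂ V t z := rfl
  nth_rw 1 [e5]
  abel

variable (hom : S.SolvesHom κ g hd s₀) (hκ : 0 < κ) (hg : 0 ≤ g)
include hom hκ hg

/-- The three parts of `derivIter_eq` are summed separately. In the commutator part the index `0`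
contributes nothing, the index `1` gives `Q z`, and the indices from `2` on form `PhiOp`. -/
lemma PtBd.tsum_derivIter {z : Vec} (hz : HB s₀ z) (σ : Bool) (k : ℤ) :
    ∑' i, expTail 0 1 i * derivIter S.G (V t) (dispOp κ g hd (V t) + S.field V t) z
        (dispOp κ g hd z + S.reduced V t z) i σ k =
      (dispOp κ g hd (serOp (expTail 0 1) S.G (V t) z) + (bil (S.Rr - S.R₁) (V t) z
        + bil S.G (S.field V t) z + PhiOp S.G (S.Rr - S.R₁) (V t) (S.field V t) z
        + S.reduced V t z + S.expSub (V t) (S.reduced V t z))) σ k := by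
  have L := h.levels
  obtain ⟨cG, hG⟩ := h.G
  have := L.hm; have := L.hρ; have := L.hμ; have := L.hs
  have l0 := L.lv (show s₀ - m - 10 ≤ s₀ by linarith)
  have l2 := L.lv (show s₀ - m - 10 ≤ s₀ - 5 / 2 by linarith)
  have hc : ∀ i, ‖expTail 0 1 i‖ ≤ 1 / (i.factorial : ℝ) := norm_expTail_le 0 (by simp)
  obtain ⟨Θ, hΘ, bG, bQ⟩ := p.exists_comm_bd h
  have hred := p.hb_reduced h hz
  have hexp := p.exp_eq h hred (by linarith) (by linarith)
  obtain ⟨x, hzx⟩ := hz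
  obtain ⟨y, hy⟩ := hred
  set cm : ℕ → ℂ := fun i => expTail 0 1 i *
    (if i = 0 then 0 else commOp S.G (S.Rr - S.R₁) (V t) (S.field V t) (i - 1) z) σ k with hcm
  have hcm2 : ∀ i, cm (i + 2) = ((1 / ((i + 2).factorial : ℂ)) •
      commOp S.G (S.Rr - S.R₁) (V t) (S.field V t) (i + 1) z) σ k := fun i => by
    simp [hcm, expTail]
  have s2' : Summable fun i => cm (i + 2) := by
    simp only [hcm2]
    exact Bd.summable (summable_PhiOp Θ x)
      (bd_PhiOp_term hΘ bG bQ (hzx.weaken (by linarith))) σ k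
  have s2 : Summable cm := (summable_nat_add_iff 2).1 s2'
  have s1 := (summable_ser hG (by linarith) l0 (by linarith) le_rfl p.hV hzx hc σ k).mul_left
    (Complex.I * ((sgn σ * disp κ g hd k : ℝ) : ℂ))
  have s3 := summable_ser hG (by linarith) l2 (by linarith) (by linarith) p.hV hy hc σ k
  have e2 : ∑' i, cm i = (bil (S.Rr - S.R₁) (V t) z + bil S.G (S.field V t) z) σ k
      + PhiOp S.G (S.Rr - S.R₁) (V t) (S.field V t) z σ k := by
    rw [← s2.sum_add_tsum_nat_add 2, Finset.sum_range_succ, Finset.sum_range_one]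
    congr 1
    · simp [hcm, expTail, commOp]
    · exact tsum_congr hcm2
  have e1 : ∑' i, Complex.I * ((sgn σ * disp κ g hd k : ℝ) : ℂ) *
      (expTail 0 1 i * ((bil S.G (V t))^[i] z) σ k) =
      dispOp κ g hd (serOp (expTail 0 1) S.G (V t) z) σ k := tsum_mul_left
  have e3 : ∑' i, expTail 0 1 i * ((bil S.G (V t))^[i] (S.reduced V t z)) σ k =
      (S.reduced V t z + S.expSub (V t) (S.reduced V t z)) σ k := by
    rw [← hexp]
    rfl
  calc _ = ∑' i, (Complex.I * ((sgn σ * disp κ g hd k : ℝ) : ℂ) *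
        (expTail 0 1 i * ((bil S.G (V t))^[i] z) σ k) + cm i
        + expTail 0 1 i * ((bil S.G (V t))^[i] (S.reduced V t z)) σ k) := by
        refine tsum_congr fun i => ?_
        rw [p.derivIter_eq h hom hκ hg ⟨x, hzx⟩]
        simp only [Pi.add_apply, dispOp, hcm]
        ring
    _ = _ := by
        rw [(s1.add s2).tsum_add s3, s1.tsum_add s2, e1, e2, e3]
        simp only [Pi.add_apply]
        ring

end point

/-- The equation for `Y = exp(G(V))Z`. -/
lemma Hyp.conjugation (h : S.Hyp I K K' m ρ μ r s₁ s₀) {C : ℝ}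
    (p : ∀ t ∈ I, S.PtBd m s₀ C V t) (hom : S.SolvesHom κ g hd s₀) (hκ : 0 < κ) (hg : 0 ≤ g)
    (hV : CStar2 I K s₀ V) (dV : SolvesOn I V fun t => dispOp κ g hd (V t) + S.field V t)
    {Z : ℝ → Vec} (hZ : CStar2 I (K - K') s₀ Z) (hZV : ∀ t ∈ I, Z t = V t + S.change V t)
    (dZ : SolvesOn I Z fun t => dispOp κ g hd (Z t) + S.reduced V t (Z t)) {Y : ℝ → Vec}
    (hY : ∀ t ∈ I, Y t = serOp (expTail 0 1) S.G (V t) (Z t)) :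
    SolvesOn I Y fun t => dispOp κ g hd (Y t) + bil S.Rr (Y t) (Y t)
      + (Complex.I • act S.H V t (Y t) + S.rem V t (Y t)) := by
  have hI := h.symm.uniqueDiffOn
  have L := h.levels
  obtain ⟨cG, hG⟩ := h.G
  obtain ⟨cR, hR⟩ := h.R₁
  have := L.hm; have := L.hρ; have := L.hμ; have := L.hs
  have l0 := L.lv (show s₀ - m - 10 ≤ s₀ by linarith)
  have l2 := L.lv (show s₀ - m - 10 ≤ s₀ - 5 / 2 by linarith)
  have hK : 1 ≤ K := h.one_le.trans h.le
  have locZ : LocBd I s₀ Z := fun t ht => by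
    obtain ⟨ε, hε, B, H⟩ := (hZ.cj hI).loc t ht
    refine ⟨ε, hε, B, fun τ hτ hh => ?_⟩
    have := H τ hτ hh 0 (Nat.zero_le _)
    beta_reduce at this
    rw [dt2_zero] at this
    exact this.weaken (by simp)
  have weak : ∀ {u : ℝ → Vec} {p q : ℝ}, LocBd I p u → q ≤ p → LocBd I q u := fun hu hq t ht =>
    let ⟨ε, hε, B, H⟩ := hu t ht
    ⟨ε, hε, B, fun τ hτ hh => (H τ hτ hh).weaken hq⟩
  have locV : LocBd I s₀ V := fun t ht => ⟨1, one_pos, 1, fun τ hτ _ => (p τ hτ).hV⟩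
  have locV' : LocBd I (s₀ - 5 / 2) (fun t => dispOp κ g hd (V t) + S.field V t) := fun t ht => by
    obtain ⟨ε, hε, B, H⟩ := (hV.cj hI).loc t ht
    refine ⟨ε, hε, B, fun τ hτ hh => ?_⟩
    -- The right-hand side of the equation is the first time derivative of `V`; its local bound is
    -- therefore part of the hypothesis on `V`, which uses `1 ≤ K`.
    have e : dispOp κ g hd (V τ) + S.field V τ = dt2 I 1 V τ := by
      funext σ n
      have h1 := (hV.cj hI).der 0 (by omega) τ hτ σ n
      simp only [dt2_zero] at h1
      exact (hI τ hτ).eq_deriv _ (dV τ hτ σ n) h1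
    beta_reduce; rw [e]
    exact (H τ hτ hh 1 hK).weaken (by norm_num; linarith)
  have locZ' : LocBd I (s₀ - 5 / 2) (fun t => dispOp κ g hd (Z t) + S.reduced V t (Z t)) :=
    fun t ht => by
    obtain ⟨ε, hε, B, H⟩ := locZ t ht
    have hB : 0 ≤ B := (H t ht (by simpa using hε)).nonneg
    refine ⟨ε, hε, _, fun τ hτ hh => ((((H τ hτ hh).dispOp hκ hg hd).weaken (by linarith))).add
      ((((bil_bd_self hR (by linarith) l0 (by linarith) le_rfl (p τ hτ).hV (H τ hτ hh)).weaken
        (by linarith)).add (((p τ hτ).H _ _ (H τ hτ hh)).smul _)).add ((p τ hτ).R₂ _ _ (H τ hτ hh)))⟩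
  intro t ht σ k
  have key := hasDerivWithinAt_flow h.symm.1 hG (by linarith) l2 (by linarith)
    (weak locV (by linarith)) locV' (weak locZ (by linarith)) locZ' dV dZ
    (norm_expTail_le 0 (θ := 1) (by simp)) ht σ k
  have hz : HB s₀ (Z t) := by
    obtain ⟨ε, hε, B, H⟩ := locZ t ht
    exact ⟨B, H t ht (by simpa using hε)⟩
  rw [(p t ht).tsum_derivIter h hom hκ hg hz, (p t ht).field_eq h hz (hZV t ht) (hY t ht), ← hY t ht,
    ← add_assoc] at key
  exact key.congr (fun τ hτ => by rw [hY τ hτ]) (by rw [hY t ht])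

end NFData

/-! ### Sums of curves -/

lemma MemH.add {s : ℝ} {u v : Seq} (hu : MemH s u) (hv : MemH s v) :
    MemH s (u + v) ∧ normH s (u + v) ≤ normH s u + normH s v := by
  have h := MemH2.add (hu.inj true) (hv.inj true)
  have e : WaterWaves.inj true u + WaterWaves.inj true v = WaterWaves.inj true (u + v) := by
    simpa using (inj_smul_add true 1 u v).symm
  rw [e, normH2_inj, normH2_inj, normH2_inj] at h
  exact ⟨by simpa [WaterWaves.inj] using h.1 true, h.2⟩

lemma dt_add {I : Set ℝ} (hI : UniqueDiffOn ℝ I) {K : ℕ} {u v : ℝ → Seq}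
    (hu : ∀ n, ContDiffOn ℝ K (fun t => u t n) I) (hv : ∀ n, ContDiffOn ℝ K (fun t => v t n) I)
    {k : ℕ} (hk : k ≤ K) {t : ℝ} (ht : t ∈ I) :
    dt I k (fun t => u t + v t) t = dt I k u t + dt I k v t := by
  funext n
  exact iteratedDerivWithin_fun_add ht hI (((hu n).of_le (by exact_mod_cast hk)) t ht)
    (((hv n).of_le (by exact_mod_cast hk)) t ht)

lemma CStar.add {I : Set ℝ} (hI : UniqueDiffOn ℝ I) {K : ℕ} {s : ℝ} {u v : ℝ → Seq}
    (hu : CStar I K s u) (hv : CStar I K s v) : CStar I K s (fun t => u t + v t) := by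
  refine ⟨fun n => (hu.1 n).add (hv.1 n), fun k hk => ⟨fun t ht => ?_, fun t₀ ht₀ => ?_⟩⟩
  · rw [dt_add hI hu.1 hv.1 hk ht]
    exact (((hu.2 k hk).1 t ht).add ((hv.2 k hk).1 t ht)).1
  · have h := ((hu.2 k hk).2 t₀ ht₀).add ((hv.2 k hk).2 t₀ ht₀)
    rw [add_zero] at h
    refine squeeze_zero' (Eventually.of_forall fun _ => normH_nonneg _ _) ?_ h
    filter_upwards [self_mem_nhdsWithin] with t ht
    rw [dt_add hI hu.1 hv.1 hk ht, dt_add hI hu.1 hv.1 hk ht₀, add_sub_add_comm]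
    exact ((((hu.2 k hk).1 t ht).sub ((hu.2 k hk).1 t₀ ht₀)).add
      (((hv.2 k hk).1 t ht).sub ((hv.2 k hk).1 t₀ ht₀))).2

/-! ### The flow of the generator -/

lemma act_ofVec_of_isLin {𝒪 : (ℝ → Vec) → ℝ → Vec → Vec} {V : ℝ → Vec} {t p : ℝ}
    (h : IsLin p (𝒪 V t)) {w : Vec} (hw : HB p w) : act (ofVec 𝒪) V t w = 𝒪 V t w := by
  have hi : ∀ σ, HB p (inj σ (w σ)) := fun σ => by
    obtain ⟨B, hB⟩ := hw
    refine ⟨B, fun τ => ?_, fun τ n hn => ?_⟩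
    · by_cases hτ : τ = σ <;> simp [inj, hτ, hB.1]
    · by_cases hτ : τ = σ
      · simpa [inj, hτ] using hB.2 σ n hn
      · simpa [inj, hτ] using mul_nonneg hB.nonneg (by positivity)
  refine act_ofVec ?_
  have := h 1 _ _ (hi true) (hi false)
  rwa [one_smul, one_smul] at this

lemma InBall.bd {I : Set ℝ} {K : ℕ} {s : ℝ} {V : ℝ → Vec} (hV : InBall I K s 1 V) {t : ℝ}
    (ht : t ∈ I) : Bd s (V t) 1 := by
  have := hV.1.jb ht 0 (Nat.zero_le _)
  beta_reduce at this
  rw [dt2_zero] at this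
  exact (this.weaken (by simp)).mono
    ((normK2_mono_left I s V t (Nat.zero_le K)).trans (hV.lt ht).le)

/-- The flow `exp(θG(V))`. -/
def flowOp (r : HomMat) (θ : ℝ) (V : ℝ → Vec) (t : ℝ) (v : Vec) : Vec :=
  serOp (expTail 0 θ) r (V t) v

section flow

variable {r : HomMat} {ρ μ Cr s s₀ θ : ℝ} {I : Set ℝ} {K K' : ℕ}

lemma flowOp_isLin (hr : CoefBd ρ μ Cr r) (hρ : 0 ≤ ρ) (hL : Lv ρ μ s) (hs : 0 ≤ s)
    {V : ℝ → Vec} (hV : InBall I K s 1 V) {t : ℝ} (ht : t ∈ I) (hθ : |θ| ≤ 1) :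
    IsLin s (flowOp r θ V t) :=
  IsLin.serOp ⟨_, hV.bd ht⟩ hr hρ hL hs le_rfl (norm_expTail_le 0 hθ)

lemma act_flowOp (hr : CoefBd ρ μ Cr r) (hρ : 0 ≤ ρ) (hL : Lv ρ μ s) (hs : 0 ≤ s)
    {V : ℝ → Vec} (hV : InBall I K s 1 V) {t : ℝ} (ht : t ∈ I) (hθ : |θ| ≤ 1) {w : Vec}
    (hw : MemH2 s w) : act (ofVec (flowOp r θ)) V t w = serOp (expTail 0 θ) r (V t) w :=
  act_ofVec_of_isLin (flowOp_isLin hr hρ hL hs hV ht hθ) ⟨_, hw.bd⟩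

/-- The inverse is the flow at `-θ`. Splitting off the identity leaves a tail gaining `ρ ≥ 1`,
enough to pay for the embedding; the constant depends on the ball only through the bound `1` on `V`.
-/
lemma exists_areBoundedInverses (hr : CoefBd ρ μ Cr r) (hρ : 1 ≤ ρ) (hL : Lv ρ μ s) (hs : 0 ≤ s) :
    ∃ L, ∀ (I : Set ℝ) (K : ℕ) V, InBall I K s 1 V → ∀ t ∈ I, ∀ θ, |θ| ≤ 1 →
      AreBoundedInverses s L (act (ofVec (flowOp r θ)) V t)
        (act (ofVec (flowOp r (-θ))) V t) := by
  obtain ⟨C, hC, H⟩ := exists_bd_serOp hr (by linarith) hL le_rfl (1 : ℝ)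
  have hE := embConst_nonneg
  have hρ0 : 0 ≤ ρ := by linarith
  refine ⟨1 + embConst * C, fun I K V hV t ht θ hθ => ?_⟩
  have hb := hV.bd ht
  have ha : ∀ {θ}, |θ| ≤ 1 → ∀ v, MemH2 s v → MemH2 s (act (ofVec (flowOp r θ)) V t v) ∧
      normH2 s (act (ofVec (flowOp r θ)) V t v) ≤ (1 + embConst * C) * normH2 s v := by
    intro θ hθ v hv
    have h1 := (H (V t) hb (expTail 1 θ) (norm_expTail_le 1 hθ) (by simp [expTail]) v _
      hv.bd).weaken (show s + 1 ≤ s + ρ by linarith)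
    have h2 := hv.add h1.memH2
    rw [act_flowOp hr hρ0 hL hs hV ht hθ hv,
      serOp_expTail_zero hr hρ0 hL hs le_rfl hb hv.bd hθ]
    refine ⟨h2.1, h2.2.trans ?_⟩
    have := h1.normH2_le
    linarith
  have hθ' : |(-θ)| ≤ 1 := by rwa [abs_neg]
  refine ⟨fun v w hv hw c => ?_, fun v hv => ⟨(ha hθ v hv).1, (ha hθ' v hv).1⟩,
    fun v hv => ⟨(ha hθ v hv).2, (ha hθ' v hv).2⟩, fun v hv => ?_⟩
  · have hcv : MemH2 s (c • v + w) := fun σ => by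
      have hc : MemH s (c • v σ) := ⟨by simp [(hv σ).1], by
        have := (hv σ).2.mul_left (‖c‖ ^ 2)
        refine this.congr fun n => ?_
        simp [mul_pow]; ring⟩
      exact (hc.add (hw σ)).1
    rw [act_flowOp hr hρ0 hL hs hV ht hθ hcv, act_flowOp hr hρ0 hL hs hV ht hθ hv,
      act_flowOp hr hρ0 hL hs hV ht hθ hw, act_flowOp hr hρ0 hL hs hV ht hθ' hcv,
      act_flowOp hr hρ0 hL hs hV ht hθ' hv, act_flowOp hr hρ0 hL hs hV ht hθ' hw]
    exact ⟨flowOp_isLin hr hρ0 hL hs hV ht hθ c v w ⟨_, hv.bd⟩ ⟨_, hw.bd⟩,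
      flowOp_isLin hr hρ0 hL hs hV ht hθ' c v w ⟨_, hv.bd⟩ ⟨_, hw.bd⟩⟩
  · have m1 := (ha hθ v hv).1
    have m2 := (ha hθ' v hv).1
    rw [act_flowOp hr hρ0 hL hs hV ht hθ' m1, act_flowOp hr hρ0 hL hs hV ht hθ m2,
      act_flowOp hr hρ0 hL hs hV ht hθ hv, act_flowOp hr hρ0 hL hs hV ht hθ' hv]
    refine ⟨?_, serOp_inv hr hρ0 hL hs le_rfl hb hv.bd hθ⟩
    have := serOp_inv hr hρ0 hL hs le_rfl hb hv.bd hθ'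
    rwa [neg_neg] at this

lemma isRealToReal_flowOp (hr : RealCoef r) (θ : ℝ) :
    IsRealToReal I K s 1 (ofVec (flowOp r θ)) := by
  refine isRealToReal_ofVec fun V hV hVr t ht w hw => ?_
  have v := isReal_iff.1 (hVr t ht)
  unfold flowOp
  conv_lhs => rw [← v]
  exact serOp_Cc hr (hV.bd ht).1 hw.bd.1 (conj_expTail 0 θ)

/-- The tame bound for the flow, uniformly in `|θ| ≤ 1`. -/
lemma exists_tameBound (hI : IsSymmInterval I) (hr : CoefBd ρ μ Cr r) (hρ : 1 ≤ ρ)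
    (hL : Lv ρ μ (s₀ - 3 / 2 * ((K - K' : ℕ) : ℝ))) (hs₀ : 0 ≤ s₀) (hs : s₀ ≤ s) :
    ∃ C > 0, ∀ V, InBall I K s 1 V → ∀ θ, |θ| ≤ 1 →
      TameBound I K K' s s₀ C V (act (ofVec (flowOp r θ)) V) := by
  set N := K - K' with hN
  have hU := hI.uniqueDiffOn
  have hE := embConst_nonneg
  have hρ0 : 0 ≤ ρ := by linarith
  have hLs : Lv ρ μ s := hL.mono (by
    have : (0 : ℝ) ≤ (N : ℕ) := Nat.cast_nonneg N
    linarith)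
  set Dm : Set ((ℝ → Vec) × ℝ × ℝ) := {i | InBall I K s 1 i.1 ∧ i.2.1 ∈ I ∧ |i.2.2| ≤ 1}
  -- The tame bound is stated with the full `K` norms of `U`, so weights independent of the index
  -- are enough.
  set a : (ℝ → Vec) × ℝ × ℝ → ℕ → ℝ := fun i _ => normK2 I K s₀ i.1 i.2.1 with ha
  set b : (ℝ → Vec) × ℝ × ℝ → ℕ → ℝ := fun i _ => normK2 I K s i.1 i.2.1 with hb
  have W : ∀ i ∈ Dm, Weights N (a i) (b i) := fun i hi =>
    ⟨fun _ _ => normK2_nonneg _ _ _ _ _, fun _ _ => ((hi.1.mono hs le_rfl).lt hi.2.1).le,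
      fun _ _ => hi.1.1.normK2_mono le_rfl hs hi.2.1, fun _ _ _ _ => le_rfl, fun _ _ _ _ => le_rfl⟩
  have fV : UPair Dm N (s - s₀) a b s₀ 1 (fun _ _ => 1) (fun _ _ => 0)
      (fun i k => dt2 I k i.1 i.2.1) := by
    refine UPair.of_weight (fun i hi k hk => ?_) fun i hi k hk => ?_
    · refine ((hi.1.mono hs le_rfl).1.jb hi.2.1 k (hk.trans (Nat.sub_le _ _))).mono ?_
      simp only [wlow, ha, pow_one]
      exact normK2_mono_left I s₀ i.1 i.2.1 (hk.trans (Nat.sub_le _ _))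
    · rw [add_sub_cancel]
      refine (hi.1.1.jb hi.2.1 k (hk.trans (Nat.sub_le _ _))).mono ?_
      simp only [whigh, hb, Nat.sub_self, pow_zero, one_mul]
      exact normK2_mono_left I s i.1 i.2.1 (hk.trans (Nat.sub_le _ _))
  obtain ⟨C, hC, H⟩ := UTame.serJ (d := 1) W hr (by linarith) hρ0 hL le_rfl fV
    (c := fun i => expTail 1 i.2.2) (fun i hi => norm_expTail_le 1 hi.2.2) le_rfl (by norm_num)
    (fun i hi j hj => by simp [expTail, hj])
  refine ⟨embConst * (C * (N + 1)) + 1, by positivity, fun V hV θ hθ v hv => ?_⟩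
  have hV₀ := hV.mono hs le_rfl
  have hcj := CJ.serJ (D := fun k t => dt2 I k v t) (V := fun k t => dt2 I k V t) (ℓ := s)
    (ℓV := s) (N := N) (c := expTail 1 θ) hI.1 hρ0 hr (hL.mono (by linarith)) le_rfl
    (norm_expTail_le 1 hθ) (by simp [expTail]) ((hV.1.cj hU).of_le (Nat.sub_le _ _)) (hv.cj hU)
  set D : ℕ → ℝ → Vec := fun k t => serJ (expTail 1 θ) r (fun j => dt2 I j V t)
    (fun j => dt2 I j v t) k with hD
  have hact : ∀ t ∈ I, act (ofVec (flowOp r θ)) V t (v t) = v t + D 0 t := fun t ht => by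
    have hvt := hv.memH2_self ht
    rw [act_flowOp hr hρ0 hLs (hs₀.trans hs) hV ht hθ hvt,
      serOp_expTail_zero hr hρ0 hLs (hs₀.trans hs) le_rfl (hV.bd ht) hvt.bd hθ, hD]
    beta_reduce
    rw [serJ_zero, dt2_zero, dt2_zero]
  have hDs : CStar2 I N s (fun t => D 0 t) :=
    (hcj.weaken (show s + 1 ≤ s + ρ by linarith)).cstar2 hU fun _ _ => rfl
  have hsum : CStar2 I N s (fun t => v t + D 0 t) := fun σ => (hv σ).add hU (hDs σ)
  have hjets : ∀ k ≤ N, ∀ t ∈ I,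
      dt2 I k (fun τ => act (ofVec (flowOp r θ)) V τ (v τ)) t = dt2 I k v t + D k t := by
    intro k hk t ht
    refine (((hv.cj hU).add (hcj.weaken (show s ≤ s + ρ by linarith))).dt2_eq hU
      (fun t ht => ?_) hk ht)
    rw [hact t ht, dt2_zero]
  refine ⟨?_, fun k hk t ht => ?_⟩
  · have e : ∀ σ, CStar I N s (fun t => act (ofVec (flowOp r θ)) V t (v t) σ) := by
      intro σ
      have hc := hsum σ
      have hdt : ∀ k, ∀ t ∈ I, dt I k (fun t => act (ofVec (flowOp r θ)) V t (v t) σ) t =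
          dt I k (fun t => (v t + D 0 t) σ) t := fun k t ht => by
        funext n
        exact iteratedDerivWithin_congr
          (fun τ hτ => congrFun (congrFun (hact τ hτ) σ) n) ht
      refine ⟨fun n => (hc.1 n).congr fun t ht => congrFun (congrFun (hact t ht) σ) n, fun k hk => ⟨fun t ht => ?_,
        fun t₀ ht₀ => ?_⟩⟩
      · rw [hdt k t ht]; exact (hc.2 k hk).1 t ht
      · refine ((hc.2 k hk).2 t₀ ht₀).congr' ?_
        filter_upwards [self_mem_nhdsWithin] with t ht
        rw [hdt k t ht, hdt k t₀ ht₀]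
    exact e
  · have hN' : (k : ℝ) + 1 ≤ N + 1 := by
      have : (k : ℝ) ≤ N := by exact_mod_cast hk
      linarith
    have jb := (H (V, t, θ) ⟨hV, ht, hθ⟩).2 _ _ _
      ((hv.mono le_rfl hs).jb ht) (by rw [add_sub_cancel]; exact hv.jb ht)
    have e1 := (jb.2 k hk).weaken (show s - 3 / 2 * (k : ℝ) + 1 ≤
      s₀ + ρ + (s - s₀) - 3 / 2 * k by linarith)
    have cst : ∀ (c : ℝ) (y : ℕ → ℝ), 0 ≤ c → MonoN N y →
        conv (fun _ => c) y k ≤ c * ((N + 1) * y k) := by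
      intro c y hc hy
      rw [conv]
      calc _ ≤ ∑ p ∈ Finset.HasAntidiagonal.antidiagonal k, c * y k := by
            refine Finset.sum_le_sum fun p hp => ?_
            have := Finset.HasAntidiagonal.mem_antidiagonal.1 hp
            exact mul_le_mul_of_nonneg_left (hy.2 _ _ (by omega) hk) hc
        _ = c * ((k + 1) * y k) := by
            rw [Finset.sum_const, Finset.Nat.card_antidiagonal, nsmul_eq_mul]; push_cast; ring
        _ ≤ _ := by
            have := hy.1 k hk
            gcongr
    have nl := normK2_nonneg I K s₀ V t
    have nh := normK2_nonneg I K s V t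
    have c1 := cst (normK2 I K s₀ V t) (fun j => normK2 I j s v t) nl (monoN_normK2 I N s v t)
    have c2 := cst (normK2 I K s V t) (fun j => normK2 I j s₀ v t) nh (monoN_normK2 I N s₀ v t)
    have e2 := e1.normH2_le
    have e3 : normH2 (s - 3 / 2 * k) (D k t) ≤ embConst * (C *
        (normK2 I K s₀ V t * ((N + 1) * normK2 I k s v t) +
          normK2 I K s V t * ((N + 1) * normK2 I k s₀ v t))) := by
      refine e2.trans (mul_le_mul_of_nonneg_left ?_ hE)
      have wl : wlow 1 (a (V, t, θ)) = fun _ => normK2 I K s₀ V t := by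
        funext j; simp [wlow, ha]
      have wh : whigh 1 (a (V, t, θ)) (b (V, t, θ)) = fun _ => normK2 I K s V t := by
        funext j; simp [whigh, hb]
      rw [wl, wh]
      simp only [Pi.smul_apply, Pi.add_apply, smul_eq_mul]
      exact mul_le_mul_of_nonneg_left (add_le_add c1 c2) hC
    rw [hjets k hk t ht]
    -- The identity part is estimated directly in Sobolev norms, which keeps its coefficient equal
    -- to one.
    have e4 : normH2 (s - 3 / 2 * k) (dt2 I k v t) ≤ normK2 I k s v t :=
      normH2_le_normK2 I s v t le_rfl
    have e5 := ((hv.memH2 hk ht).add e1.memH2).2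
    have p1 := mul_nonneg nl (normK2_nonneg I k s v t)
    have p2 := mul_nonneg nh (normK2_nonneg I k s₀ v t)
    calc _ ≤ normK2 I k s v t + embConst * (C *
        (normK2 I K s₀ V t * ((N + 1) * normK2 I k s v t) +
          normK2 I K s V t * ((N + 1) * normK2 I k s₀ v t))) := e5.trans (add_le_add e4 e3)
      _ ≤ _ := by nlinarith

/-- The quadratic part of the flow. -/
lemma isUnifNonhomOp_flow (hI : IsSymmInterval I) (hr : CoefBd ρ μ Cr r) (hρ : 1 ≤ ρ)
    (hK : K' ≤ K) (hμ : 0 ≤ μ)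
    (hL : Lv ρ μ (s₀ - 3 / 2 * ((K - K' : ℕ) : ℝ))) (hs₀ : 0 ≤ s₀) {R : ℝ} (hR : 0 < R)
    (hR1 : R ≤ 1) (σ σ' : Bool) :
    IsUnifNonhomOp I (-μ) K K' 2 R s₀
      ((fun θ => ofVec (fun V t v => serOp (expTail 2 θ) r (V t) v) σ σ') '' Set.Icc (0 : ℝ) 1) := by
  have hU := hI.uniqueDiffOn
  have hρ0 : 0 ≤ ρ := by linarith
  have hN0 : (0 : ℝ) ≤ (K - K' : ℕ) := Nat.cast_nonneg _
  have habs : ∀ {θ : ℝ}, θ ∈ Set.Icc (0 : ℝ) 1 → |θ| ≤ 1 := fun h => by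
    rw [abs_of_nonneg h.1]; exact h.2
  refine isUnifNonhomOp_ofVec hU (fun θ hθ V hV t ht u v hu hv c => ?_) (fun s hs => ?_) σ σ'
  · exact IsLin.serOp ⟨_, (hV.mono le_rfl hR1).bd ht⟩ hr hρ0 (hL.mono (by linarith)) hs₀ le_rfl
      (norm_expTail_le 2 (habs hθ)) c u v ⟨_, hu.bd⟩ ⟨_, hv.bd⟩
  set N := K - K' with hN
  set Dm : Set ((ℝ → Vec) × ℝ × ℝ) :=
    {i | InBall I K s₀ 1 i.1 ∧ CStar2 I K s i.1 ∧ i.2.1 ∈ I ∧ |i.2.2| ≤ 1}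
  have W : ∀ i ∈ Dm, Weights N (wt I K' s₀ i.1 i.2.1) (wt I K' s i.1 i.2.1) := fun i hi =>
    weights_wt hK hi.1 hi.2.1 hs hi.2.2.1
  obtain ⟨C, hC, H⟩ := UTame.serJ (d := 2) (τ := s - s₀) W hr (by linarith) hρ0 hL le_rfl
    (UPair.of_weight (fun i hi => (jb_wt hK hi.1.1 hi.2.1 hi.2.2.1).1) fun i hi => by
        rw [add_sub_cancel]
        exact (jb_wt hK hi.1.1 hi.2.1 hi.2.2.1).2)
    (c := fun i => expTail 2 i.2.2) (fun i hi => norm_expTail_le 2 hi.2.2.2) (by norm_num) le_rfl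
    (fun i hi j hj => by simp [expTail, hj])
  refine ⟨C, hC, R / 2, by positivity, by linarith, fun θ hθ V hV hVs u hu => ?_⟩
  refine ⟨fun k t => serJ (expTail 2 θ) r (fun j => dt2 I j V t) (fun j => dt2 I j u t) k,
    fun t ht => ?_, ?_, fun t ht => ?_⟩
  · beta_reduce
    rw [serJ_zero, dt2_zero, dt2_zero]
  · refine (CJ.serJ (ℓ := s) hI.1 hρ0 hr (hL.mono (by linarith)) le_rfl
      (norm_expTail_le 2 (habs hθ)) (by simp [expTail]) ((hVs.cj hU).of_le (Nat.sub_le _ _))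
      ((hu.cj hU).of_le (Nat.sub_le _ _))).weaken (by linarith)
  · have jb := (H (V, t, θ) ⟨hV.mono le_rfl (by linarith), hVs, ht, habs hθ⟩).2 _ _ _
      (fun k hk => (hu.mono le_rfl hs).jb ht k (hk.trans (Nat.sub_le _ _)))
      (fun k hk => by rw [add_sub_cancel]; exact hu.jb ht k (hk.trans (Nat.sub_le _ _)))
    -- The tail gains `ρ ≥ 1`, more than the `1 - μ` required here; the order `μ` is chosen merely
    -- to agree with that of the linear term.
    exact jb.2.weaken (by linarith)

end flow

/-! ### The data of the normal form -/

lemma act_add (M M' : OpMat) (V : ℝ → Vec) (t : ℝ) (w : Vec) :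
    act (M + M') V t w = act M V t w + act M' V t w := by
  funext σ
  simp only [act, Pi.add_apply, Finset.sum_add_distrib]

lemma act_smul (c : ℂ) (M : OpMat) (V : ℝ → Vec) (t : ℝ) (w : Vec) :
    act (c • M) V t w = c • act M V t w := by
  funext σ
  simp only [act, Pi.smul_apply, Finset.smul_sum]

lemma CoefBd.mono_mu {ρ μ μ' C : ℝ} {r : HomMat} (hr : CoefBd ρ μ C r) (hμ : μ ≤ μ') :
    CoefBd ρ μ' C r := by
  refine ⟨hr.1, fun σ σ' ε a b ha hb hab => (hr.2 σ σ' ε a b ha hb hab).trans ?_⟩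
  have hC := hr.1
  have one : ∀ {c : ℤ}, c ≠ 0 → 1 ≤ |(c : ℝ)| := fun hc => by
    exact_mod_cast Int.one_le_abs hc
  have h1 : 1 ≤ min |(a : ℝ)| |(b : ℝ)| := le_min (one ha) (one hb)
  gcongr

/-- The family of jets is indexed also by the time at which it is estimated. For fixed curves all
these jets are derivatives of the same curve and hence coincide, so a single one carries the bounds
at all times. -/
lemma isNonhomMat_rem {S : NFData} {I : Set ℝ} {K K' : ℕ} {m ρ μ r s₁ s₀ R C : ℝ}
    (h : S.Hyp I K K' m ρ μ r s₁ s₀) (hR : 0 < R)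
    (p : ∀ V, InBall I K s₀ R V → ∀ t ∈ I, S.PtBd m s₀ C V t) :
    IsNonhomMat I (ρ - (m + 10)) K K' 2 R s₀ (ofVec S.rem) := by
  intro σ σ'
  have := isUnifNonhomOp_ofVec (S := {()}) (𝒪 := fun _ => S.rem) (γ := ρ - (m + 10)) (r := R)
    (s₀ := s₀) (K := K) (K' := K') h.symm.uniqueDiffOn
    (fun _ _ V hV t ht u v hu hv c => (p V hV t ht).lin_rem h c u v ⟨_, hu.bd⟩ ⟨_, hv.bd⟩)
    (fun s hs => ?_) σ σ'
  · rwa [Set.image_singleton] at this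
  obtain ⟨rs, hrs, -, D, hD, hO⟩ := h.exists_fam hs
  obtain ⟨C, hC, H⟩ := hD.pair
  refine ⟨C, hC, min rs (R / 2), lt_min hrs (by positivity),
    (min_le_right _ _).trans_lt (by linarith), fun _ _ V hV hVs u hu => ?_⟩
  have hU := h.symm.uniqueDiffOn
  have hV' := hV.mono le_rfl (min_le_left _ _)
  have hℓ : s₀ + (ρ - (m + 10)) + 1 + (s - s₀) = s + (ρ - (m + 10)) + 1 := by ring
  have hcj : ∀ τ ∈ I, CJ I (K - K') (s + (ρ - (m + 10)) + 1) (D (V, u, τ)) := fun τ hτ => by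
    rw [← hℓ]
    exact hD.cj (V, u, τ) ⟨hV', hVs, hu, hτ⟩
  have h0 : ∀ τ ∈ I, ∀ t ∈ I, S.rem V t (u t) = D (V, u, τ) 0 t := fun τ hτ t ht =>
    hO (V, u, τ) ⟨hV', hVs, hu, hτ⟩ t ht
  have hb : ∀ t ∈ I, JB (K - K') (s + (ρ - (m + 10)) + 1) (fun k => D (V, u, t) k t)
      (C • (conv (wlow 2 fun j => normK2 I (j + K') s₀ V t) (fun j => normK2 I j s u t)
        + conv (whigh 2 (fun j => normK2 I (j + K') s₀ V t) fun j => normK2 I (j + K') s V t)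
          (fun j => normK2 I j s₀ u t))) := fun t ht => by
    rw [← hℓ]
    exact (H (V, u, t) ⟨hV', hVs, hu, ht⟩).2
  clear H hD hO
  obtain ⟨t₀, ht₀, -⟩ := h.symm.2.2
  refine ⟨D (V, u, t₀), h0 t₀ ht₀, hcj t₀ ht₀, fun t ht k hk => ?_⟩
  have e : D (V, u, t) k t = D (V, u, t₀) k t :=
    ((hcj t ht).dt2_eq hU (h0 t ht) hk ht).symm.trans ((hcj t₀ ht₀).dt2_eq hU (h0 t₀ ht₀) hk ht)
  have := hb t ht k hk
  beta_reduce at this ⊢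
  rwa [e] at this

/-- The operators in the systems of the normal form procedure. -/
def normalFormData (κ g : ℝ) (h : ℝ≥0∞) (χ₁ χ : ℝ → ℝ → ℝ) (A₁ : Bool → Bool → HomSymbolCoef)
    (A₂ : Bool → Bool → ParaSymbol) (B₁ : HomMat) (B₂ : OpMat) (F₁ : HomMat) (F₂ : OpMat)
    (R₁ : HomMat) (H : Bool → ParaSymbol) (R₂ : OpMat) : NFData where
  G := genCoef κ g h R₁
  R₁ := R₁
  Rr := resPart κ g h R₁
  A₁ := paraCoef χ₁ A₁
  B₁ := B₁
  F₁ := F₁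
  A₂ := paraMat χ A₂
  B₂ := B₂
  F₂ := F₂
  R₂ := R₂
  H := paraMat χ (diagSymbol H)

section data

variable {κ g : ℝ} {h : ℝ≥0∞} {m ρ r s₁ δ : ℝ} {K K' : ℕ} {I : Set ℝ} {χ₁ χ : ℝ → ℝ → ℝ}
  {A₁ : Bool → Bool → HomSymbolCoef} {A₂ : Bool → Bool → ParaSymbol} {B₁ : HomMat} {B₂ : OpMat}
  {F₁ : HomMat} {F₂ : OpMat} {R₁ : HomMat} {H : Bool → ParaSymbol} {R₂ : OpMat}

lemma isKerMat_paraMat (hI : IsSymmInterval I) (hχ : IsCutoff δ χ) {K'' : ℕ} (hK : K'' ≤ K')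
    (hK' : K' ≤ K) {α : Bool → Bool → ParaSymbol}
    (ha : ∀ σ σ', IsNonhomSymbol I (3 / 2) K K'' 2 r s₁ (α σ σ')) :
    IsKerMat I K K' s₁ (paraMat χ α) := fun s₀ hs₀ => by
  obtain ⟨C, hC, rs, hrs, -, H⟩ := exists_para_kernels hI.1 hI.uniqueDiffOn hχ hK hK' hs₀ ha
  exact ⟨C, hC, rs, hrs, H⟩

lemma exists_hyp_normalFormData (hκ : 0 < κ) (hg : 0 ≤ g) (hh : 0 < h) (hm : 0 ≤ m)
    (hρ : m + 10 ≤ ρ) (hK1 : 1 ≤ K') (hK : K' ≤ K) (hI : IsSymmInterval I) (hr : 0 < r)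
    (hχ₁ : IsCutoff δ χ₁) (hχ : IsCutoff δ χ)
    (hA : IsParaSystem I χ₁ χ ρ K r s₁ A₁ A₂ B₁ B₂) (hF : IsSigmaMap I m K K' r s₁ F₁ F₂)
    (hR : IsReducedSystem I χ ρ K K' r s₁ R₁ H R₂) :
    ∃ μ, ∃ s₀ > 0,
      (normalFormData κ g h χ₁ χ A₁ A₂ B₁ B₂ F₁ F₂ R₁ H R₂).Hyp I K K' m ρ μ r s₁ s₀ := by
  obtain ⟨μ₁, hμ₁, C₁, h₁⟩ := exists_coefBd_of_smoothing hR.hom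
  obtain ⟨μ₂, hμ₂, C₂, h₂⟩ := exists_coefBd_of_smoothing hA.smooth_hom
  obtain ⟨μ₃, hμ₃, C₃, h₃⟩ := exists_coefBd_of_homMap hm hF.hom
  obtain ⟨μ₄, hμ₄, C₄, h₄⟩ := exists_coefBd_paraCoef hχ₁ hA.symb_hom
  set μ := μ₁ + μ₂ + μ₃ + μ₄ with hμ
  have h₁' := h₁.mono_mu (show μ₁ ≤ μ by linarith)
  have hK0 : (0 : ℝ) ≤ K := Nat.cast_nonneg K
  have := abs_nonneg s₁
  refine ⟨μ, |s₁| + ρ + μ + m + 2 * K + 30, by linarith, ?_⟩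
  exact {
    symm := hI
    one_le := hK1
    le := hK
    m_nonneg := hm
    ρ_ge := hρ
    μ_nonneg := by linarith
    r_pos := hr
    s₀_ge := le_rfl
    G := exists_coefBd_genCoef hκ hg hh h₁'
    R₁ := ⟨_, h₁'⟩
    Rr := ⟨_, h₁'.resPart κ g h⟩
    A₁ := ⟨_, h₄.mono_mu (by linarith)⟩
    B₁ := ⟨_, h₂.mono_mu (by linarith)⟩
    F₁ := ⟨_, h₃.mono_mu (by linarith)⟩
    A₂ := isKerMat_paraMat hI hχ hK1 hK hA.symb_nonhom
    B₂ := hA.smooth_nonhom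
    F₂ := hF.nonhom
    R₂ := hR.nonhom
    H := isKerMat_paraMat hI hχ le_rfl hK (isNonhomSymbol_diagSymbol hr hR.symb) }

lemma realHyp_normalFormData (hA : IsParaSystem I χ₁ χ ρ K r s₁ A₁ A₂ B₁ B₂)
    (hF : IsSigmaMap I m K K' r s₁ F₁ F₂) (hR : IsReducedSystem I χ ρ K K' r s₁ R₁ H R₂) :
    (normalFormData κ g h χ₁ χ A₁ A₂ B₁ B₂ F₁ F₂ R₁ H R₂).RealHyp I K r s₁ where
  G := hR.real_hom.realCoef.genCoef κ g h
  R₁ := hR.real_hom.realCoef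
  Rr := hR.real_hom.realCoef.resPart κ g h
  A V hV hVr t ht w hw := by
    simpa only [normalFormData, act_smul, act_add, act_paraHomMat] using hA.real_symb.act_Cc hV hVr ht hw
  B V hV hVr t ht w hw := by
    simpa only [normalFormData, act_smul, act_add, act_homMat] using hA.real_smooth.act_Cc hV hVr ht hw
  F V hV hVr t ht w hw := by
    simpa only [normalFormData, act_add, act_homMat] using hF.real.act_Cc hV hVr ht hw
  H V hV hVr t ht w hw := by
    simpa only [normalFormData, act_smul] using hR.real_symb.act_Cc hV hVr ht hw
  R₂ V hV hVr t ht w hw := hR.real_nonhom.act_Cc hV hVr ht hw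

end data

end WaterWaves

end

/-! ### The normal form proposition. -/

theorem proposition4p3
    (κ g : ℝ) (h : ℝ≥0∞) (hκ : 0 < κ) (hg : 0 ≤ g) (hh : 0 < h) (m : ℝ) (hm : 0 ≤ m) :
    ∃ ρ₀ > 0, ∀ ρ ≥ ρ₀, ∀ K K' : ℕ, 1 ≤ K' → K' ≤ K →
    ∀ I : Set ℝ, IsSymmInterval I →
    ∀ (δ : ℝ) (χ₁ χ : ℝ → ℝ → ℝ), IsCutoff δ χ₁ → IsCutoff δ χ →
    ∀ s₁ r₁ : ℝ, 0 < r₁ →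
    -- the system solved by `U`
    ∀ (A₁ : Bool → Bool → HomSymbolCoef) (A₂ : Bool → Bool → ParaSymbol) (B₁ : HomMat) (B₂ : OpMat),
      IsParaSystem I χ₁ χ ρ K r₁ s₁ A₁ A₂ B₁ B₂ →
    -- the map `U ↦ Z`
    ∀ (F₁ : HomMat) (F₂ : OpMat), IsSigmaMap I m K K' r₁ s₁ F₁ F₂ →
    -- the reduced system solved by `Z`
    ∀ (R₁ : HomMat) (H : Bool → ParaSymbol) (R₂ : OpMat),
      IsReducedSystem I χ ρ K K' r₁ s₁ R₁ H R₂ →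
    ∃ s₀ > 0, ∀ s ≥ s₀, ∃ r₀ > 0, ∀ r, 0 < r → r ≤ r₀ →
    ∃ (𝔠 𝔠inv : ℝ → OpMat) (G M₁ : HomMat) (M₂ : ℝ → OpMat) (𝔯 : OpMat) (C L : ℝ),
      0 < C ∧
      -- the resonant operator
      (∀ σ σ', IsHomSmoothing (ρ - ρ₀) (resPart κ g h R₁ σ σ')) ∧
      IsRealHom (resPart κ g h R₁) ∧
      -- the diagonal, `x`-independent symbol of the cubic remainder
      (∀ σ, IsNonhomSymbol I (3 / 2) K K' 2 r s₀ (H σ) ∧ ImIsNonhomSymbol I 0 K K' 2 r s₀ (H σ)) ∧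
      -- the cubic smoothing remainder
      IsNonhomMat I (ρ - ρ₀) K K' 2 r s₀ 𝔯 ∧
      IsRealToReal I K s₀ r 𝔯 ∧
      -- the generator of the flow
      (∀ σ σ', IsHomSmoothing ρ (G σ σ')) ∧
      IsRealHom G ∧
      SolvesHomological κ g h G R₁ ∧
      -- the maps in the expansion of the flow
      (∃ m' ≥ 0, (∀ σ σ', IsHomMap m' (M₁ σ σ')) ∧
        ∀ σ σ', IsUnifNonhomOp I (-m') K K' 2 r s₀
          ((fun θ => M₂ θ σ σ') '' Set.Icc (0 : ℝ) 1)) ∧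
      (∀ θ ∈ Set.Icc (0 : ℝ) 1, IsRealToReal I K s r (𝔠 θ) ∧ IsRealToReal I K s r (𝔠inv θ)) ∧
      ∀ U, InBall I K s r U → IsRealCurve I U →
        SolvesOn I U (fun t => act (Complex.I • (dispE κ g h
          + (paraHomMat χ₁ A₁ + paraMat χ A₂) + (homMat B₁ + B₂))) U t (U t)) →
        (∀ θ ∈ Set.Icc (0 : ℝ) 1,
          (∀ t ∈ I, AreBoundedInverses s L (act (𝔠 θ) U t) (act (𝔠inv θ) U t)) ∧
          TameBound I K K' s s₀ C U (act (𝔠 θ) U) ∧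
          TameBound I K K' s s₀ C U (act (𝔠inv θ) U) ∧
          ∀ t ∈ I, ∀ v, MemH2 s v →
            act (𝔠 θ) U t v = v + (θ : ℂ) • act (homMat M₁) U t v + act (M₂ θ) U t v ∧
            ∀ σ n, HasDerivWithinAt (fun η => act (𝔠 η) U t v σ n)
              (act (homMat G) U t (act (𝔠 θ) U t v) σ n) (Set.Icc 0 1) θ) ∧
        (∀ t ∈ I, ∀ v, MemH2 s v → act (𝔠 0) U t v = v) ∧
        ∀ Z, CStar2 I (K - K') s Z → IsRealCurve I Z →
          (∀ t ∈ I, Z t = U t + act (homMat F₁ + F₂) U t (U t)) →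
          SolvesOn I Z (fun t => act (Complex.I • dispE κ g h + homMat R₁
            + Complex.I • paraMat χ (diagSymbol H) + R₂) U t (Z t)) →
          ∀ Y : ℝ → Vec, (∀ t, Y t = act (𝔠 1) U t (Z t)) →
            IsRealCurve I Y ∧
            (∀ t ∈ I, IsReal (act (Complex.I • paraMat χ (diagSymbol H) + 𝔯) U t (Y t))) ∧
            SolvesOn I Y (fun t => act (Complex.I • dispE κ g h) U t (Y t)
              + act (homMat (resPart κ g h R₁)) Y t (Y t)
              + act (Complex.I • paraMat χ (diagSymbol H) + 𝔯) U t (Y t)) := by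
  -- `m` is the order of the change of variable, which enters through `Y - U`; `10` covers the
  -- losses of paradifferential operators and of the changes of norm.
  refine ⟨m + 10, by linarith, fun ρ hρ K K' hK1 hK I hI δ χ₁ χ hχ₁ hχ s₁ r₁ hr₁ A₁ A₂ B₁ B₂ hA
    F₁ F₂ hF R₁ H R₂ hR => ?_⟩
  obtain ⟨μ, s₀, hs₀, hyp⟩ :=
    exists_hyp_normalFormData hκ hg hh hm hρ hK1 hK hI hr₁ hχ₁ hχ hA hF hR
  have real := realHyp_normalFormData (κ := κ) (g := g) (h := h) hA hF hR
  set S := normalFormData κ g h χ₁ χ A₁ A₂ B₁ B₂ F₁ F₂ R₁ H R₂ with hS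
  obtain ⟨CG, hG⟩ := hyp.G
  obtain ⟨CR, hRc⟩ := hyp.R₁
  obtain ⟨Cr, hRr⟩ := hyp.Rr
  have lev := hyp.levels
  have hμ := hyp.μ_nonneg
  have hU := hI.uniqueDiffOn
  have hs₁' : s₁ + 1 ≤ s₀ := by
    have := hyp.s₀_ge
    have := le_abs_self s₁
    have : (0 : ℝ) ≤ K := Nat.cast_nonneg K
    linarith
  have hs₁ : s₁ ≤ s₀ := by linarith
  have hlv : Lv ρ μ (s₀ - 3 / 2 * ((K - K' : ℕ) : ℝ)) := by
    have h1 := hyp.s₀_ge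
    have h2 := abs_nonneg s₁
    have h3 : ((K - K' : ℕ) : ℝ) ≤ K := by exact_mod_cast Nat.sub_le K K'
    have h4 : (0 : ℝ) ≤ K := Nat.cast_nonneg K
    constructor <;> linarith
  have hρ1 : 1 ≤ ρ := by linarith
  have hρ0 : 0 ≤ ρ := by linarith
  have hlv₀ : Lv ρ μ s₀ := lev.lv (by linarith)
  have hhom : S.SolvesHom κ g h s₀ := fun U v ⟨_, hU⟩ ⟨_, hv⟩ =>
    homological_equation hκ hg hRc hG (lev.lv (by linarith)) (lev.lv (by linarith)) hU hv
  -- The radius comes from pointwise bounds at the level `s₀` alone and is fixed before `s`; only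
  -- the constants `C` and `L` depend on `s`.
  obtain ⟨CP, -, R, hR0, hR1, hRr₁, pt⟩ := hyp.exists_ptBd
  refine ⟨s₀, hs₀, fun s hs => ⟨R, hR0, fun r hr hrR => ?_⟩⟩
  have hs0 : 0 ≤ s := by linarith
  have hlvs : Lv ρ μ s := hlv₀.mono hs
  have hr1 : r ≤ 1 := hrR.trans hR1
  obtain ⟨L, hL⟩ := exists_areBoundedInverses hG hρ1 hlvs hs0
  obtain ⟨C, hC, tame⟩ := exists_tameBound (K := K) (K' := K') hI hG hρ1 hlv hs₀.le hs
  have habs : ∀ {θ : ℝ}, θ ∈ Set.Icc (0 : ℝ) 1 → |θ| ≤ 1 ∧ |(-θ)| ≤ 1 := fun hθ => by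
    rw [abs_neg, abs_of_nonneg hθ.1]
    exact ⟨hθ.2, hθ.2⟩
  have pr : ∀ V, InBall I K s₀ r V → ∀ t ∈ I, S.PtBd m s₀ CP V t := fun V hV =>
    pt V (hV.mono le_rfl hrR)
  have remReal : ∀ V, InBall I K s₀ r V → IsRealCurve I V → ∀ t ∈ I, ∀ w, HB s₀ w →
      S.rem V t (Cc w) = Cc (S.rem V t w) := fun V hV hVr t ht w hw =>
    NFData.rem_Cc hyp real (pr V hV t ht) (hV.mono hs₁ (hrR.trans hRr₁)) hVr ht hw
  have flowReal : ∀ θ, IsRealToReal I K s r (ofVec (flowOp S.G θ)) := fun θ V hV =>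
    isRealToReal_flowOp real.G θ V (hV.mono le_rfl hr1)
  -- The inverse is the flow at `-θ`. In the expansion of the exponential the linear term is `G`
  -- itself, so `G` also plays the role of `M₁`, and the series from degree two on that of `M_{≥2}`.
  refine ⟨fun θ => ofVec (flowOp S.G θ), fun θ => ofVec (flowOp S.G (-θ)), S.G, S.G,
    fun θ => ofVec (fun V t v => serOp (expTail 2 θ) S.G (V t) v), ofVec S.rem, C, L, hC,
    fun σ σ' => (hRr.mono_rho (by linarith)).isHomSmoothing hμ σ σ', real.Rr.isRealHom,
    fun σ => ⟨(hR.symb σ).mono hK hs₁ hr (hrR.trans hRr₁),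
      (hR.symb_im σ).mono hK hs₁ hr (hrR.trans hRr₁)⟩,
    isNonhomMat_rem hyp hr pr, isRealToReal_ofVec fun V hV hVr t ht w hw =>
      remReal V hV hVr t ht w ⟨_, hw.bd⟩,
    hG.isHomSmoothing hμ, real.G.isRealHom, solvesHomological_genCoef hκ hg hRc hG,
    ⟨μ, hμ, hG.isHomMap hμ hρ0, isUnifNonhomOp_flow hI hG hρ1 hK hμ hlv hs₀.le hr hr1⟩,
    fun θ _ => ⟨flowReal θ, flowReal (-θ)⟩, fun U hUr hUreal dU => ?_⟩
  have hU1 := hUr.mono le_rfl hr1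
  have hU₀ := hUr.mono hs le_rfl
  refine ⟨fun θ hθ => ⟨fun t ht => hL I K U hU1 t ht θ (habs hθ).1, tame U hU1 θ (habs hθ).1,
    tame U hU1 (-θ) (habs hθ).2, fun t ht v hv => ?_⟩, fun t ht v hv => ?_, ?_⟩
  · have hb := hU1.bd ht
    have e : ∀ η ∈ Set.Icc (0 : ℝ) 1,
        act (ofVec (flowOp S.G η)) U t v = serOp (expTail 0 η) S.G (U t) v := fun η hη =>
      act_flowOp hG hρ0 hlvs hs0 hU1 ht (habs hη).1 hv
    refine ⟨?_, fun σ n => ?_⟩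
    · have e2 : act (ofVec (fun V t v => serOp (expTail 2 θ) S.G (V t) v)) U t v
          = serOp (expTail 2 θ) S.G (U t) v :=
        act_ofVec_of_isLin (IsLin.serOp ⟨_, hb⟩ hG hρ0 hlvs hs0 le_rfl
          (norm_expTail_le 2 (habs hθ).1)) ⟨_, hv.bd⟩
      rw [e θ hθ, e2, act_homMat, serOp_expTail_zero hG hρ0 hlvs hs0 le_rfl hb hv.bd (habs hθ).1,
        serOp_expTail_one hG hρ0 hlvs hs0 le_rfl hb hv.bd (habs hθ).1, add_assoc]
    · rw [e θ hθ, act_homMat]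
      exact (hasDerivWithinAt_serOp hG hρ0 hlvs hs0 le_rfl hb hv.bd hθ σ n).congr
        (fun η hη => congrFun (congrFun (e η hη) σ) n) (congrFun (congrFun (e θ hθ) σ) n)
  · rw [act_flowOp hG hρ0 hlvs hs0 hU1 ht (by simp) hv, serOp_expTail_at_zero]
  intro Z hZ hZr hZU dZ Y hY
  have hY' : ∀ t ∈ I, Y t = serOp (expTail 0 1) S.G (U t) (Z t) := fun t ht => by
    rw [hY, act_flowOp hG hρ0 hlvs hs0 hU1 ht (by simp) (hZ.memH2_self ht)]
  have Zb : ∀ t ∈ I, HB s₀ (Z t) := fun t ht => ⟨_, ((hZ.memH2_self ht).bd).weaken hs⟩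
  have Ub : ∀ t ∈ I, HB s₀ (U t) := fun t ht => ⟨_, (hU1.bd ht).weaken hs⟩
  have Yr : IsRealCurve I Y := fun t ht => by
    rw [isReal_iff, hY' t ht, ← serOp_Cc real.G (Ub t ht).zero_mode (Zb t ht).zero_mode
      (conj_expTail 0 1), isReal_iff.1 (hUreal t ht), isReal_iff.1 (hZr t ht)]
  have Yb : ∀ t ∈ I, HB s₀ (Y t) := fun t ht => by
    rw [hY' t ht, ← act_flowOp hG hρ0 hlvs hs0 hU1 ht (by simp) (hZ.memH2_self ht)]
    exact ⟨_, ((((hL I K U hU1 t ht 1 (by simp)).mem _ (hZ.memH2_self ht)).1).bd).weaken hs⟩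
  have remAct : ∀ t ∈ I, act (Complex.I • paraMat χ (diagSymbol H) + ofVec S.rem) U t (Y t) =
      Complex.I • act S.H U t (Y t) + S.rem U t (Y t) := fun t ht => by
    rw [act_add, act_smul, act_ofVec_of_isLin ((pr U hU₀ t ht).lin_rem hyp) (Yb t ht)]
    rfl
  refine ⟨Yr, fun t ht => ?_, fun t ht => ?_⟩
  · have y := isReal_iff.1 (Yr t ht)
    rw [remAct t ht, isReal_iff, Cc_add, ← remReal U hU₀ hUreal t ht _ (Yb t ht),
      ← real.H U (hU₀.mono hs₁ (hrR.trans hRr₁)) hUreal t ht _ ((Yb t ht).memH2 hs₁'), y]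
  · beta_reduce
    rw [remAct t ht, act_dispE, act_homMat]
    have hdisp : ∀ V t w, Complex.I • act (dispE κ g h) V t w = dispOp κ g h w :=
      fun V t w => by rw [← act_smul, act_dispE]
    refine hyp.conjugation (pr U hU₀) hhom hκ hg hU₀.1 (fun t ht => ?_)
      (hZ.mono le_rfl hs) (fun t ht => ?_) (fun t ht => ?_) hY' t ht
    · have := dU t ht
      simp only [smul_add, act_add, act_smul, hdisp, act_paraHomMat, act_homMat] at this
      simpa only [NFData.field, hS, normalFormData, smul_add, add_assoc] using this
    · rw [hZU t ht, act_add, act_homMat]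
      rfl
    · have := dZ t ht
      simp only [act_add, act_smul, hdisp, act_homMat, add_assoc] at this
      simpa only [NFData.reduced, hS, normalFormData, add_assoc] using this
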